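/- **Setting.** All families of curves are smooth families $X\to S$ of curves over $\mathbb C$-schemes $S$; $\mathcal O,\Theta,\Omega,D$ denote functions, vertical vector fields, relative differentials and vertical differential operators. A *local $\mathcal O$-module* is a quasi-coherent $\mathcal O$-module on every such family together with compatible identifications for all morphisms of families (base changes and étale maps of curves, in particular open embeddings and isomorphisms of open parts of families). Vector fields $\xi$ act on it by $\mathrm{Lie}_\xi$, defined by the infinitesimal automorphism $1+\epsilon\xi$. Chiral algebras are unital (super) chiral algebras on curves: right $D$-modules $\mathcal A$ with a bracket $\{\cdot\}\colon j_*j^*(\mathcal A\boxtimes\mathcal A)\to\Delta_!(\mathcal A)$ that is antisymmetric and satisfies the Jacobi identity, and a unit $\Omega\to\mathcal A$, normalised so that $\frac{dz\boxtimes a}{z(x)-z(y)}\mapsto a$. A *local chiral algebra* is a chiral algebra on every family, with a structure of local $\mathcal O$-module with which all its structure is compatible. $h$ is the de Rham projection $\mathcal M\to\mathcal M/\mathcal M\cdot\Theta$. *Linear dilaton.* For $\lambda\in\mathbb C$ let $0\to\Omega\to F_\lambda\to\mathcal O\to0$ be the local $\mathcal O$-module whose sections are a function $f$ and, for each coordinate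 $z$, a form $s(z)$, with $s(w)=s(z)-\frac\lambda2 f\,d\log\frac{dw}{dz}$. For $\lambda,Q\in\mathbb C$ let $B(\lambda,Q)$ be the Lie-$*$ algebra $F_\lambda\otimes D/\ker(\Omega\otimes D\to\Omega)$ with the bracket $B\boxtimes B\to D\boxtimes D\to\Delta_!(\Omega)\subset\Delta_!(B)$, $1\boxtimes1\mapsto Q\cdot\mathbf 1'$, where $\mathbf 1'$ is the antisymmetric section of $\Delta_!(\Omega)$ with $(\mathrm{id}\boxtimes h)(\mathbf 1'\cdot(1\boxtimes g))=dg$. $\mathcal A(\lambda,Q)$ is the quotient of the chiral enveloping algebra of $B(\lambda,Q)$ in which $\Omega\subset B(\lambda,Q)$ is identified with the unit. *bc-system.* For $n\in\mathbb Z$ let $B_{bc}(n)=\Omega\oplus(\Omega^n\otimes D)\oplus(\Omega^{1-n}\otimes D)$, with $\Omega$ even and central, the other two summands odd, and the bracket of $\alpha\in\Omega^n$ and $\beta\in\Omega^{1-n}$ (in either order) equal to $\alpha\beta\in\Omega\subset\Delta_!(\Omega)$, all brackets within each of the two odd summands being zero. $\mathcal A_{bc}(n)$ is the quotient of its chiral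 enveloping algebra in which $\Omega$ is identified with the unit. *Energy–momentum tensors.* For a local chiral algebra $\mathcal A$ consider $\mathcal O$-linear maps $\widetilde T\colon\Theta\to\mathcal A/\Omega$ such that $(h\boxtimes\mathrm{id})(\{\xi'\boxtimes l\})=-\mathrm{Lie}_\xi(l)-l\cdot\xi$ for every $\xi\in\Theta$, every lift $\xi'\in\mathcal A$ of $\widetilde T(\xi)$ and every $l\in\mathcal A$. Pulling back $0\to\Omega\to\mathcal A\to\mathcal A/\Omega\to0$ along $\widetilde T$ gives an extension $0\to\Omega\to\Theta'\to\Theta\to0$ and a map $T\colon\Theta'\to\mathcal A$. For $c\in\mathbb C$ let $0\to\Omega\to\Theta'_c\to\Theta\to0$ be the local $\mathcal O$-module whose sections are a vector field $\xi$ and, for each coordinate $z$, a form $s(z)$, with $s(w)=s(z)+\frac c{12}\langle\xi,\{w,z\}dz^2\rangle$, $\{w,z\}$ being the Schwarzian derivative. *Fermion number current.* The local $\mathcal O$-module $p_{2*}\bigl(\Omega^n\boxtimes\Omega^{1-n}(\Delta)/\Omega^n\boxtimes\Omega^{1-n}(-\Delta)\bigr)$ is identified with $F_{2n-1}$ so that,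 in terms of a coordinate $z$, the class of $\bigl(\frac{f(y)}{z(x)-z(y)}+r(y)\bigr)dz(x)^n\,dz(y)^{1-n}$ corresponds to the section with function $f$ and $s(z)=r\,dz$. Put $\widetilde J(f(x,y)\,\alpha\boxtimes\beta)=(h\boxtimes\mathrm{id})(\{f(x,y)\,\alpha\boxtimes\beta\})\in\mathcal A_{bc}(n)$. **Theorem (twisted Bose–Fermi correspondence).** Let $n\in\mathbb Z$. The local chiral algebras $\mathcal A(2n-1,-1)$ and $\mathcal A_{bc}(n)$ exist, and: (a) There is a unique homomorphism of chiral algebras, compatible with the local $\mathcal O$-module structures, $J\colon\mathcal A(2n-1,-1)\to\mathcal A_{bc}(n)$ whose restriction to $F_{2n-1}$ is $\widetilde J$. (b) Each of $\mathcal A(2n-1,-1)$ and $\mathcal A_{bc}(n)$ has a unique map $\widetilde T$ as above, and it is compatible with the local structures. Let $T_{2n-1,-1}\colon\Theta'\to\mathcal A(2n-1,-1)$ and $T_{bc,n}\colon\Theta'(n)\to\mathcal A_{bc}(n)$ be the resulting energy–momentum tensors, and $c_n=-2(6n^2-6n+1)=1-3(2n-1)^2$. There are unique isomorphisms $\Theta'\simeq\Theta'_{c_n}$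 and $\Theta'(n)\simeq\Theta'_{c_n}$ of extensions of $\Theta$ by $\Omega$ in local $\mathcal O$-modules, and under these identifications $J\circ T_{2n-1,-1}=T_{bc,n}$ as maps $\Theta'_{c_n}\to\mathcal A_{bc}(n)$. -/

import Mathlib

open scoped TensorProduct RightActions

noncomputable section

namespace Chiral

open KaehlerDifferential (D)

/-- `z` is an (étale) coordinate on `Spec R` over `Spec k`: `dz` is a basis of the differentials. -/
def IsCoord (k R : Type) [CommRing k] [CommRing R] [Algebra k R] (z : R) : Prop :=
  Function.Bijective fun f : R => f • D k R z

/-- An affine family of smooth curves `Spec R → Spec k` over a base `Spec k` (`k` a `ℂ`-algebra),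
small enough to admit a coordinate. Every family of smooth curves is covered by such pieces. -/
structure Fam : Type 1 where
  k : Type
  R : Type
  [ringk : CommRing k]
  [algC : Algebra ℂ k]
  [ringR : CommRing R]
  [alg : Algebra k R]
  [smooth : Algebra.Smooth k R]
  exists_coord : ∃ z : R, IsCoord k R z

attribute [instance] Fam.ringk Fam.algC Fam.ringR Fam.alg Fam.smooth

/-- A morphism of families: a morphism of bases covered by an étale map of curves over the base
change. Étaleness of a map between smooth curves is expressed by the Jacobian criterion:
coordinates pull back to coordinates. Open embeddings, base changes and isomorphisms of families
are examples. -/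
@[ext]
structure Hom (X Y : Fam) where
  base : X.k →ₐ[ℂ] Y.k
  fn : X.R →+* Y.R
  comm : ∀ c : X.k, fn (algebraMap X.k X.R c) = algebraMap Y.k Y.R (base c)
  coord : ∀ z : X.R, IsCoord X.k X.R z → IsCoord Y.k Y.R (fn z)

def Hom.id (X : Fam) : Hom X X where
  base := AlgHom.id ℂ X.k
  fn := RingHom.id X.R
  comm _ := rfl
  coord _ h := h

def Hom.comp {X Y Z : Fam} (g : Hom Y Z) (h : Hom X Y) : Hom X Z where
  base := g.base.comp h.base
  fn := g.fn.comp h.fn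
  comm c := by simp [h.comm, g.comm]
  coord z hz := g.coord _ (h.coord z hz)

namespace Fam

variable (X : Fam)

/-- Relative differentials `Ω`. -/
abbrev Om : Type := Ω[X.R⁄X.k]

/-- The differential `d : 𝒪 → Ω`. -/
abbrev d : Derivation X.k X.R X.Om := D X.k X.R

/-- Vertical vector fields `Θ`. -/
abbrev Th : Type := Derivation X.k X.R X.R

/-- The set of coordinates. -/
abbrev Coord : Type := {z : X.R // IsCoord X.k X.R z}

/-- A complex number as a function on the curve. -/
def scal (c : ℂ) : X.R := algebraMap X.k X.R (algebraMap ℂ X.k c)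

/-- The relations between functions and vector fields in the ring of differential operators. -/
inductive DRel : FreeAlgebra X.k (X.R ⊕ X.Th) → FreeAlgebra X.k (X.R ⊕ X.Th) → Prop
  | fn_add (f g : X.R) : DRel (.ι X.k (.inl (f + g))) (.ι X.k (.inl f) + .ι X.k (.inl g))
  | fn_mul (f g : X.R) : DRel (.ι X.k (.inl (f * g))) (.ι X.k (.inl f) * .ι X.k (.inl g))
  | fn_const (c : X.k) : DRel (.ι X.k (.inl (algebraMap X.k X.R c))) (algebraMap X.k _ c)
  | vec_add (ξ η : X.Th) : DRel (.ι X.k (.inr (ξ + η))) (.ι X.k (.inr ξ) + .ι X.k (.inr η))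
  | vec_smul (f : X.R) (ξ : X.Th) :
      DRel (.ι X.k (.inr (f • ξ))) (.ι X.k (.inl f) * .ι X.k (.inr ξ))
  | leibniz (ξ : X.Th) (f : X.R) : DRel (.ι X.k (.inr ξ) * .ι X.k (.inl f))
      (.ι X.k (.inl f) * .ι X.k (.inr ξ) + .ι X.k (.inl (ξ f)))
  | lie (ξ η : X.Th) : DRel (.ι X.k (.inr ⁅ξ, η⁆))
      (.ι X.k (.inr ξ) * .ι X.k (.inr η) - .ι X.k (.inr η) * .ι X.k (.inr ξ))

/-- The ring `D` of vertical differential operators, generated by functions and vector fields. -/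
def DO : Type := RingQuot X.DRel

instance : Ring X.DO := inferInstanceAs (Ring (RingQuot X.DRel))
instance : Algebra X.k X.DO := inferInstanceAs (Algebra X.k (RingQuot X.DRel))

/-- The projection from the free algebra. -/
def mkDO : FreeAlgebra X.k (X.R ⊕ X.Th) →ₐ[X.k] X.DO := RingQuot.mkAlgHom X.k X.DRel

theorem mkDO_rel {x y} (h : X.DRel x y) : X.mkDO x = X.mkDO y :=
  RingQuot.mkAlgHom_rel X.k h

/-- Functions as differential operators of order zero. -/
def fn : X.R →ₐ[X.k] X.DO where
  toFun f := X.mkDO (.ι X.k (.inl f))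
  map_add' f g := by rw [mkDO_rel X (.fn_add f g), map_add]
  map_mul' f g := by rw [mkDO_rel X (.fn_mul f g), map_mul]
  commutes' c := by rw [mkDO_rel X (.fn_const c), AlgHom.commutes]
  map_zero' := by
    have := mkDO_rel X (.fn_const 0)
    rwa [map_zero, map_zero, map_zero] at this
  map_one' := by
    have := mkDO_rel X (.fn_const 1)
    rwa [map_one, map_one, map_one] at this

/-- Vector fields as differential operators. -/
def vec (ξ : X.Th) : X.DO := X.mkDO (.ι X.k (.inr ξ))

/-- The universal property of the ring of differential operators. -/
def liftDO {S : Type} [Ring S] [Algebra X.k S] (j : X.R →ₐ[X.k] S) (v : X.Th → S)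
    (hadd : ∀ ξ η, v (ξ + η) = v ξ + v η) (hsmul : ∀ f ξ, v (f • ξ) = j f * v ξ)
    (hleib : ∀ ξ f, v ξ * j f = j f * v ξ + j (ξ f))
    (hlie : ∀ ξ η, v ⁅ξ, η⁆ = v ξ * v η - v η * v ξ) : X.DO →ₐ[X.k] S :=
  RingQuot.liftAlgHom X.k ⟨FreeAlgebra.lift X.k (Sum.elim j v), by
    intro x y h
    cases h <;> simp [hadd, hsmul, hleib, hlie]⟩

theorem liftDO_fn {S : Type} [Ring S] [Algebra X.k S] (j : X.R →ₐ[X.k] S) (v : X.Th → S)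
    (hadd : ∀ ξ η, v (ξ + η) = v ξ + v η) (hsmul : ∀ f ξ, v (f • ξ) = j f * v ξ)
    (hleib : ∀ ξ f, v ξ * j f = j f * v ξ + j (ξ f))
    (hlie : ∀ ξ η, v ⁅ξ, η⁆ = v ξ * v η - v η * v ξ) (f : X.R) :
    X.liftDO j v hadd hsmul hleib hlie (X.fn f) = j f :=
  (RingQuot.liftAlgHom_mkAlgHom_apply _ _ _ _).trans (FreeAlgebra.lift_ι_apply _ _)

/-- Differential operators act on functions. -/
def actR : X.DO →ₐ[X.k] Module.End X.k X.R :=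
  X.liftDO (Algebra.lmul X.k X.R) (fun ξ => ξ.toLinearMap)
    (fun _ _ => rfl) (fun _ _ => rfl)
    (fun ξ f => by ext g; simp; ring)
    (fun ξ η => LinearMap.ext fun g => Derivation.commutator_apply g)

theorem smul_swap (ξ : X.Th) (g : X.R) (ω : X.Om) :
    ξ.liftKaehlerDifferential ω • X.d g = ξ g • ω := by
  obtain ⟨z, hz⟩ := X.exists_coord
  obtain ⟨h, rfl⟩ := hz.2 ω
  obtain ⟨g', hg⟩ := hz.2 (D X.k X.R g)
  have : ξ g = g' * ξ z := by
    rw [← ξ.liftKaehlerDifferential_comp_D g, ← hg]; simp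
  simp only at hg
  rw [← hg, this]
  simp [smul_smul]
  ring_nf

/-- Minus the Lie derivative along `ξ` of a relative differential on a curve:
`-L_ξ ω = -d⟨ξ, ω⟩`. -/
def negLie (ξ : X.Th) : Module.End X.k X.Om :=
  -((D X.k X.R).toLinearMap ∘ₗ ξ.liftKaehlerDifferential.restrictScalars X.k)

theorem negLie_apply (ξ : X.Th) (ω : X.Om) :
    X.negLie ξ ω = - X.d (ξ.liftKaehlerDifferential ω) := rfl

theorem lift_smul (f : X.R) (ξ : X.Th) (ω : X.Om) :
    (f • ξ).liftKaehlerDifferential ω = f * ξ.liftKaehlerDifferential ω := by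
  have : (f • ξ).liftKaehlerDifferential = f • ξ.liftKaehlerDifferential := by
    apply Derivation.liftKaehlerDifferential_unique; ext; simp
  rw [this]; rfl

theorem lift_add (ξ η : X.Th) (ω : X.Om) : (ξ + η).liftKaehlerDifferential ω =
    ξ.liftKaehlerDifferential ω + η.liftKaehlerDifferential ω := by
  have : (ξ + η).liftKaehlerDifferential =
      ξ.liftKaehlerDifferential + η.liftKaehlerDifferential := by
    apply Derivation.liftKaehlerDifferential_unique; ext; simp
  rw [this]; rfl

theorem lift_lie (ξ η : X.Th) (ω : X.Om) : ⁅ξ, η⁆.liftKaehlerDifferential ω =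
    ξ (η.liftKaehlerDifferential ω) - η (ξ.liftKaehlerDifferential ω) := by
  obtain ⟨z, hz⟩ := X.exists_coord
  obtain ⟨h, rfl⟩ := hz.2 ω
  obtain ⟨h', hh⟩ := hz.2 (D X.k X.R h)
  have e (ζ : X.Th) : ζ h = h' * ζ z := by
    rw [← ζ.liftKaehlerDifferential_comp_D h, ← hh]; simp
  simp [Derivation.commutator_apply, e]
  ring

/-- Multiplication of differentials by functions. -/
def omMul (f : X.R) : Module.End X.k X.Om := Algebra.lsmul X.k X.k X.Om f

theorem omMul_apply (f : X.R) (ω : X.Om) : X.omMul f ω = f • ω := rfl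

/-- Multiplication by functions as an algebra map to the opposite endomorphisms of `Ω`. -/
def omFn : X.R →ₐ[X.k] (Module.End X.k X.Om)ᵐᵒᵖ where
  toFun f := MulOpposite.op (X.omMul f)
  map_one' := MulOpposite.unop_injective (LinearMap.ext fun ω => one_smul _ ω)
  map_zero' := MulOpposite.unop_injective (LinearMap.ext fun ω => zero_smul _ ω)
  map_add' f g := MulOpposite.unop_injective (LinearMap.ext fun ω => add_smul f g ω)
  map_mul' f g := MulOpposite.unop_injective (LinearMap.ext fun ω => by
    change (f * g) • ω = g • f • ω
    rw [smul_smul, mul_comm])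
  commutes' c := MulOpposite.unop_injective (LinearMap.ext fun ω => algebraMap_smul X.R c ω)

/-- Differential operators act on `Ω` from the right. -/
def actOm : X.DO →ₐ[X.k] (Module.End X.k X.Om)ᵐᵒᵖ :=
  X.liftDO X.omFn (fun ξ => MulOpposite.op (X.negLie ξ))
    (fun ξ η => MulOpposite.unop_injective (LinearMap.ext fun ω => by
      change X.negLie (ξ + η) ω = X.negLie ξ ω + X.negLie η ω
      rw [negLie_apply, negLie_apply, negLie_apply, lift_add, map_add, neg_add]))
    (fun f ξ => MulOpposite.unop_injective (LinearMap.ext fun ω => by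
      change X.negLie (f • ξ) ω = X.negLie ξ (f • ω)
      rw [negLie_apply, negLie_apply, lift_smul, map_smul, smul_eq_mul]))
    (fun ξ f => MulOpposite.unop_injective (LinearMap.ext fun ω => by
      change f • X.negLie ξ ω = X.negLie ξ (f • ω) + ξ f • ω
      rw [negLie_apply, negLie_apply, map_smul, smul_eq_mul, Derivation.leibniz, smul_swap]
      simp))
    (fun ξ η => MulOpposite.unop_injective (LinearMap.ext fun ω => by
      change X.negLie ⁅ξ, η⁆ ω = X.negLie η (X.negLie ξ ω) - X.negLie ξ (X.negLie η ω)
      simp only [negLie_apply, lift_lie, map_neg, map_sub,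
        Derivation.liftKaehlerDifferential_comp_D]
      abel))

/-- `Ω` as a right `D`-module. -/
instance : Module X.DOᵐᵒᵖ X.Om :=
  Module.compHom X.Om ((RingEquiv.opOp (Module.End X.k X.Om)).symm.toRingHom.comp
    (X.actOm : X.DO →+* (Module.End X.k X.Om)ᵐᵒᵖ).op)

end Fam

namespace Fam

variable (X : Fam)

/-- Functions on the square of the curve. -/
abbrev RR : Type := X.R ⊗[X.k] X.R

/-- The equation `z(x) - z(y)` of the diagonal near the diagonal. -/
def diag (z : X.R) : X.RR := z ⊗ₜ 1 - 1 ⊗ₜ z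

/-- Functions on the square which, near the diagonal, vanish at most on the diagonal. -/
def W : Submonoid X.RR :=
  Submonoid.closure ({p | IsUnit (Algebra.TensorProduct.lmul' X.k p)} ∪
    {p | ∃ z : X.Coord, p = X.diag z})

theorem diag_mem (z : X.Coord) : X.diag z ∈ X.W :=
  Submonoid.subset_closure (Or.inr ⟨z, rfl⟩)

/-- Functions on a neighbourhood of the diagonal with poles of arbitrary order along the diagonal
only. -/
abbrev K : Type := Localization X.W

/-- The section `p / (z(x) - z(y))`. -/
def pole (z : X.Coord) (p : X.RR) : X.K := Localization.mk p ⟨X.diag z, X.diag_mem z⟩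

/-- The derivation `ξ ⊠ 1` of functions on the square. -/
def der1 (ξ : X.Th) : Derivation X.k X.RR X.RR :=
  Derivation.mk' (ξ.toLinearMap.rTensor X.R) fun a b => by
    induction a using TensorProduct.induction_on with
    | zero => simp
    | add a a' h h' => simp only [add_mul, map_add, h, h', add_smul, smul_add]; abel
    | tmul x y =>
      induction b using TensorProduct.induction_on with
      | zero => simp
      | add b b' h h' => simp only [mul_add, map_add, h, h', add_smul, smul_add]; abel
      | tmul x' y' =>
        simp [TensorProduct.add_tmul, mul_comm y']

/-- The derivation `1 ⊠ ξ` of functions on the square. -/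
def der2 (ξ : X.Th) : Derivation X.k X.RR X.RR :=
  Derivation.mk' (ξ.toLinearMap.lTensor X.R) fun a b => by
    induction a using TensorProduct.induction_on with
    | zero => simp
    | add a a' h h' => simp only [add_mul, map_add, h, h', add_smul, smul_add]; abel
    | tmul x y =>
      induction b using TensorProduct.induction_on with
      | zero => simp
      | add b b' h h' => simp only [mul_add, map_add, h, h', add_smul, smul_add]; abel
      | tmul x' y' =>
        simp [TensorProduct.tmul_add, mul_comm x']

/-- Extension of a derivation to functions with poles, by the quotient rule. -/
def extDer (δ : Derivation X.k X.RR X.RR) : Derivation X.k X.K X.K :=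
  haveI : Algebra.FormallyEtale X.RR X.K := Algebra.FormallyEtale.of_isLocalization X.W
  (((((Algebra.linearMap X.RR X.K).compDer δ).liftKaehlerDifferential.liftBaseChange X.K) ∘ₗ
    (KaehlerDifferential.tensorKaehlerEquivOfFormallyEtale X.k X.RR X.K).symm.toLinearMap).compDer
      (D X.k X.K))

theorem extDer_algebraMap (δ : Derivation X.k X.RR X.RR) (p : X.RR) :
    X.extDer δ (algebraMap X.RR X.K p) = algebraMap X.RR X.K (δ p) := by
  have : Algebra.FormallyEtale X.RR X.K := Algebra.FormallyEtale.of_isLocalization X.W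
  simp [extDer, KaehlerDifferential.tensorKaehlerEquivOfFormallyEtale_symm_D_algebraMap]

theorem der_ext {δ δ' : Derivation X.k X.K X.K}
    (h : ∀ p : X.RR, δ (algebraMap X.RR X.K p) = δ' (algebraMap X.RR X.K p)) : δ = δ' := by
  ext f
  obtain ⟨⟨p, w⟩, hw⟩ := IsLocalization.surj X.W f
  have hu := IsLocalization.map_units X.K w
  have e (ε : Derivation X.k X.K X.K) :
      algebraMap X.RR X.K w * ε f = ε (algebraMap X.RR X.K p) - f * ε (algebraMap X.RR X.K w) := by
    rw [← hw, Derivation.leibniz]; simp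
  apply hu.mul_left_cancel
  rw [e, e, h, h]

/-- A function `g(x)` of the first variable, as an element of `K`. -/
def in1 : X.R →ₐ[X.k] X.K :=
  (IsScalarTower.toAlgHom X.k X.RR X.K).comp Algebra.TensorProduct.includeLeft

/-- A function `g(y)` of the second variable, as an element of `K`. -/
def in2 : X.R →ₐ[X.k] X.K :=
  (IsScalarTower.toAlgHom X.k X.RR X.K).comp Algebra.TensorProduct.includeRight

/-- The vector field `ξ` acting in the first variable. -/
def vec1 (ξ : X.Th) : Derivation X.k X.K X.K := X.extDer (X.der1 ξ)

/-- The vector field `ξ` acting in the second variable. -/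
def vec2 (ξ : X.Th) : Derivation X.k X.K X.K := X.extDer (X.der2 ξ)

theorem vec1_apply (ξ : X.Th) (f g : X.R) :
    X.vec1 ξ (algebraMap X.RR X.K (f ⊗ₜ g)) = algebraMap X.RR X.K (ξ f ⊗ₜ g) := by
  rw [vec1, extDer_algebraMap]; rfl

theorem vec2_apply (ξ : X.Th) (f g : X.R) :
    X.vec2 ξ (algebraMap X.RR X.K (f ⊗ₜ g)) = algebraMap X.RR X.K (f ⊗ₜ ξ g) := by
  rw [vec2, extDer_algebraMap]; rfl

theorem kder_ext {δ δ' : Derivation X.k X.K X.K}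
    (h : ∀ f g : X.R, δ (algebraMap X.RR X.K (f ⊗ₜ g)) = δ' (algebraMap X.RR X.K (f ⊗ₜ g))) :
    δ = δ' := by
  apply der_ext
  intro p
  induction p using TensorProduct.induction_on with
  | zero => simp
  | add a b ha hb => rw [map_add, map_add, map_add, ha, hb]
  | tmul f g => exact h f g

/-- Differential operators acting on `K` in the first variable. -/
def act1 : X.DO →ₐ[X.k] Module.End X.k X.K :=
  X.liftDO ((Algebra.lmul X.k X.K).comp X.in1) (fun ξ => (X.vec1 ξ).toLinearMap)
    (fun ξ η => by
      rw [show X.vec1 (ξ + η) = X.vec1 ξ + X.vec1 η from kder_ext X fun f g => by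
        simp [vec1_apply, TensorProduct.add_tmul]]
      rfl)
    (fun a ξ => by
      rw [show X.vec1 (a • ξ) = X.in1 a • X.vec1 ξ from kder_ext X fun f g => by
        simp only [Derivation.smul_apply, vec1_apply, smul_eq_mul]
        rw [in1, AlgHom.comp_apply, IsScalarTower.toAlgHom_apply, ← map_mul]
        simp]
      rfl)
    (fun ξ f => LinearMap.ext fun p => by
      change X.vec1 ξ (X.in1 f * p) = X.in1 f * X.vec1 ξ p + X.in1 (ξ f) * p
      rw [Derivation.leibniz, show X.vec1 ξ (X.in1 f) = X.in1 (ξ f) from vec1_apply X ξ f 1]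
      simp [mul_comm])
    (fun ξ η => by
      rw [show X.vec1 ⁅ξ, η⁆ = ⁅X.vec1 ξ, X.vec1 η⁆ from kder_ext X fun f g => by
        simp [Derivation.commutator_apply, vec1_apply, TensorProduct.sub_tmul]]
      exact LinearMap.ext fun p => Derivation.commutator_apply p)

/-- Differential operators acting on `K` in the second variable. -/
def act2 : X.DO →ₐ[X.k] Module.End X.k X.K :=
  X.liftDO ((Algebra.lmul X.k X.K).comp X.in2) (fun ξ => (X.vec2 ξ).toLinearMap)
    (fun ξ η => by
      rw [show X.vec2 (ξ + η) = X.vec2 ξ + X.vec2 η from kder_ext X fun f g => by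
        simp [vec2_apply, TensorProduct.tmul_add]]
      rfl)
    (fun a ξ => by
      rw [show X.vec2 (a • ξ) = X.in2 a • X.vec2 ξ from kder_ext X fun f g => by
        simp only [Derivation.smul_apply, vec2_apply, smul_eq_mul]
        rw [in2, AlgHom.comp_apply, IsScalarTower.toAlgHom_apply, ← map_mul]
        simp]
      rfl)
    (fun ξ f => LinearMap.ext fun p => by
      change X.vec2 ξ (X.in2 f * p) = X.in2 f * X.vec2 ξ p + X.in2 (ξ f) * p
      rw [Derivation.leibniz, show X.vec2 ξ (X.in2 f) = X.in2 (ξ f) from vec2_apply X ξ 1 f]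
      simp [mul_comm])
    (fun ξ η => by
      rw [show X.vec2 ⁅ξ, η⁆ = ⁅X.vec2 ξ, X.vec2 η⁆ from kder_ext X fun f g => by
        simp [Derivation.commutator_apply, vec2_apply, TensorProduct.tmul_sub]]
      exact LinearMap.ext fun p => Derivation.commutator_apply p)

theorem unit_mem {p : X.RR} (h : IsUnit (Algebra.TensorProduct.lmul' X.k p)) : p ∈ X.W :=
  Submonoid.subset_closure (Or.inl h)

theorem swap_mem : X.W ≤ X.W.comap
    (Algebra.TensorProduct.comm X.k X.R X.R : X.RR →+* X.RR) := by
  rw [W, Submonoid.closure_le]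
  rintro p (hp | ⟨z, rfl⟩)
  · apply unit_mem
    have : ∀ q : X.RR, Algebra.TensorProduct.lmul' X.k (Algebra.TensorProduct.comm X.k X.R X.R q) =
        Algebra.TensorProduct.lmul' (S := X.R) X.k q := by
      intro q
      induction q using TensorProduct.induction_on with
      | zero => simp
      | add a b ha hb => rw [map_add, map_add, map_add, ha, hb]
      | tmul f g => simp [mul_comm]
    change IsUnit _
    erw [this]
    exact hp
  · have h1 : (-1 : X.RR) ∈ X.W := unit_mem X (by simp)
    have := X.W.mul_mem h1 (X.diag_mem z)
    have e : (Algebra.TensorProduct.comm X.k X.R X.R : X.RR →+* X.RR) (X.diag z) =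
        -1 * X.diag z := by
      simp [diag]
    change _ ∈ X.W
    rw [e]
    exact this

/-- The transposition of the two variables, `f(x, y) ↦ f(y, x)`. -/
def swap : X.K →+* X.K :=
  IsLocalization.map X.K (Algebra.TensorProduct.comm X.k X.R X.R : X.RR →+* X.RR) X.swap_mem

end Fam

namespace Hom

variable {X Y : Fam} (h : Hom X Y)

/-- The map induced on functions on the squares. -/
def rr : X.RR →+* Y.RR :=
  letI : Algebra X.k Y.RR := ((algebraMap Y.k Y.RR).comp h.base.toRingHom).toAlgebra
  (Algebra.TensorProduct.lift (R := X.k) (S := X.k) (A := X.R) (B := X.R) (C := Y.RR)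
    { toRingHom := (Algebra.TensorProduct.includeLeft (R := Y.k) (S := Y.k)
        (A := Y.R) (B := Y.R)).toRingHom.comp h.fn
      commutes' := fun c => by
        change h.fn (algebraMap X.k X.R c) ⊗ₜ[Y.k] (1 : Y.R) = algebraMap Y.k Y.RR (h.base c)
        rw [h.comm]; rfl }
    { toRingHom := (Algebra.TensorProduct.includeRight (R := Y.k)
        (A := Y.R) (B := Y.R)).toRingHom.comp h.fn
      commutes' := fun c => by
        change (1 : Y.R) ⊗ₜ[Y.k] h.fn (algebraMap X.k X.R c) = algebraMap Y.k Y.RR (h.base c)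
        rw [h.comm, Algebra.TensorProduct.algebraMap_apply, Algebra.algebraMap_eq_smul_one]
        exact (TensorProduct.smul_tmul _ _ _).symm }
    (fun _ _ => Commute.all _ _)).toRingHom

theorem rr_tmul (f g : X.R) : h.rr (f ⊗ₜ g) = h.fn f ⊗ₜ h.fn g := by
  change (h.fn f ⊗ₜ[Y.k] (1 : Y.R)) * ((1 : Y.R) ⊗ₜ[Y.k] h.fn g) = _
  simp

theorem rr_mem : X.W ≤ Y.W.comap h.rr := by
  rw [Fam.W, Submonoid.closure_le]
  rintro p (hp | ⟨z, rfl⟩)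
  · apply Fam.unit_mem
    have : ∀ q : X.RR, Algebra.TensorProduct.lmul' Y.k (h.rr q) =
        h.fn (Algebra.TensorProduct.lmul' X.k q) := by
      intro q
      induction q using TensorProduct.induction_on with
      | zero => simp
      | add a b ha hb => rw [map_add, map_add, map_add, map_add, ha, hb]
      | tmul f g => simp [rr_tmul]
    rw [this]
    exact RingHom.isUnit_map h.fn hp
  · have : h.rr (X.diag z) = Y.diag (h.fn z) := by
      simp [Fam.diag, rr_tmul]
    change h.rr _ ∈ Y.W
    rw [this]
    exact Y.diag_mem ⟨_, h.coord z z.2⟩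

/-- The map induced on functions with poles along the diagonals. -/
def kk : X.K →+* Y.K := IsLocalization.map Y.K h.rr h.rr_mem

end Hom

section Coord

variable {k R R' : Type} [CommRing k] [CommRing R] [Algebra k R] [CommRing R'] [Algebra k R']

/-- The map on differentials induced by a map of algebras. -/
def omMap (φ : R →ₐ[k] R') : Ω[R⁄k] →ₛₗ[(φ : R →+* R')] Ω[R'⁄k] :=
  letI : Algebra R R' := (φ : R →+* R').toAlgebra
  haveI : IsScalarTower k R R' := .of_algebraMap_eq fun c => (φ.commutes c).symm
  { toFun := KaehlerDifferential.map k k R R'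
    map_add' := map_add _
    map_smul' := fun f ω => by
      rw [map_smul, algebra_compatible_smul R' f]; rfl }

theorem omMap_D (φ : R →ₐ[k] R') (f : R) : omMap φ (D k R f) = D k R' (φ f) := by
  let : Algebra R R' := (φ : R →+* R').toAlgebra
  have : IsScalarTower k R R' := .of_algebraMap_eq fun c => (φ.commutes c).symm
  exact KaehlerDifferential.map_D k k R R' f

theorem omMap_comp_cancel (φ : R →ₐ[k] R') (χ : R' →ₐ[k] R) (h : ∀ f, χ (φ f) = f)
    (ω : Ω[R⁄k]) : omMap χ (omMap φ ω) = ω := by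
  have hω : ω ∈ Submodule.span R (Set.range (D k R)) := by
    rw [KaehlerDifferential.span_range_derivation]; trivial
  induction hω using Submodule.span_induction with
  | mem x hx => obtain ⟨f, rfl⟩ := hx; rw [omMap_D, omMap_D, h]
  | zero => simp
  | add x y _ _ hx hy => rw [map_add, map_add, hx, hy]
  | smul a x _ hx => rw [map_smulₛₗ, map_smulₛₗ, hx]; congr 1; exact h a

theorem IsCoord.of_inverse (φ : R →ₐ[k] R') (χ : R' →ₐ[k] R) (h : ∀ f, χ (φ f) = f)
    (h' : ∀ f, φ (χ f) = f) {z : R} (hz : IsCoord k R z) : IsCoord k R' (φ z) := by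
  constructor
  · intro f g hfg
    have := congrArg (omMap χ) hfg
    simp only [map_smulₛₗ, omMap_D, h] at this
    have := congrArg φ (hz.1 this)
    simpa [h'] using this
  · intro ω
    obtain ⟨f, hf⟩ := hz.2 (omMap χ ω)
    refine ⟨φ f, ?_⟩
    have := congrArg (omMap φ) hf
    simp only [map_smulₛₗ, omMap_D] at this
    rw [omMap_comp_cancel χ φ h'] at this
    exact this

attribute [local instance] Algebra.TensorProduct.rightAlgebra in
theorem IsCoord.baseChange (S : Type) [CommRing S] [Algebra k S] {z : R} (hz : IsCoord k R z) :
    IsCoord S (S ⊗[k] R) (1 ⊗ₜ z) := by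
  let u : R ≃ₗ[R] Ω[R⁄k] := LinearEquiv.ofBijective
    (LinearMap.toSpanSingleton R Ω[R⁄k] (D k R z)) hz
  let e := (TensorProduct.AlgebraTensorModule.rid R (S ⊗[k] R) (S ⊗[k] R)).symm ≪≫ₗ
    TensorProduct.AlgebraTensorModule.congr (.refl (S ⊗[k] R) (S ⊗[k] R)) u ≪≫ₗ
    KaehlerDifferential.tensorKaehlerEquiv k S R (S ⊗[k] R)
  have : (fun f : S ⊗[k] R => f • D S (S ⊗[k] R) (1 ⊗ₜ z)) = e := by
    funext f
    have hu : u 1 = D k R z := by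
      change (1 : R) • D k R z = D k R z
      rw [one_smul]
    simp [e, hu]
    rfl
  rw [IsCoord, this]
  exact e.bijective

variable {S : Type} [CommRing S] [Algebra k S]

/-- The algebra map `f ↦ f + ε ξ(f)`, where `ε ^ 2 = 0`. -/
def flowFn (ε : S) (hε : ε * ε = 0) (ξ : Derivation k R R) : R →ₐ[k] S ⊗[k] R :=
  AlgHom.ofLinearMap
    (TensorProduct.mk k S R 1 + TensorProduct.mk k S R ε ∘ₗ ξ.toLinearMap)
    (by simp [Algebra.TensorProduct.one_def])
    (fun f g => by
      simp only [LinearMap.add_apply, LinearMap.comp_apply, TensorProduct.mk_apply,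
        Derivation.coeFn_coe, Derivation.leibniz, smul_eq_mul, TensorProduct.tmul_add, mul_add,
        add_mul, Algebra.TensorProduct.tmul_mul_tmul, hε, TensorProduct.zero_tmul, mul_one, one_mul,
        mul_comm g]
      abel)

/-- The infinitesimal automorphism `1 + ε ξ` over `S`. -/
def flowAlg (ε : S) (hε : ε * ε = 0) (ξ : Derivation k R R) : S ⊗[k] R →ₐ[S] S ⊗[k] R :=
  Algebra.TensorProduct.lift (Algebra.ofId S (S ⊗[k] R)) (flowFn ε hε ξ) (fun _ _ => Commute.all _ _)

theorem flowAlg_tmul (ε : S) (hε : ε * ε = 0) (ξ : Derivation k R R) (c : S) (f : R) :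
    flowAlg ε hε ξ (c ⊗ₜ f) = c ⊗ₜ f + (c * ε) ⊗ₜ ξ f := by
  simp [flowAlg, flowFn, Algebra.ofId_apply, mul_add]

theorem flowAlg_neg (ε : S) (hε : ε * ε = 0) (ξ : Derivation k R R) (f : S ⊗[k] R) :
    flowAlg ε hε (-ξ) (flowAlg ε hε ξ f) = f := by
  induction f using TensorProduct.induction_on with
  | zero => simp
  | add a b ha hb => rw [map_add, map_add, ha, hb]
  | tmul c f =>
    rw [flowAlg_tmul, map_add, flowAlg_tmul, flowAlg_tmul, mul_assoc, hε]
    simp [TensorProduct.tmul_neg]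

end Coord

namespace Fam

variable (X : Fam)

/-- The constant family over the dual numbers `k[ε]`. -/
def eps : Fam where
  k := DualNumber X.k
  R := DualNumber X.k ⊗[X.k] X.R
  exists_coord := by
    obtain ⟨z, hz⟩ := X.exists_coord
    exact ⟨_, hz.baseChange (DualNumber X.k)⟩

/-- The function `ε` on the constant family over the dual numbers. -/
def epsFn : X.eps.R := (DualNumber.eps : DualNumber X.k) ⊗ₜ[X.k] (1 : X.R)

/-- The projection of the constant family over the dual numbers to the original one. -/
def toEps : Hom X X.eps where
  base := (TrivSqZeroExt.inlAlgHom ℂ X.k X.k)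
  fn := (Algebra.TensorProduct.includeRight : X.R →ₐ[X.k] DualNumber X.k ⊗[X.k] X.R).toRingHom
  comm c := by
    change (1 : DualNumber X.k) ⊗ₜ[X.k] algebraMap X.k X.R c =
      (TrivSqZeroExt.inl c : DualNumber X.k) ⊗ₜ[X.k] (1 : X.R)
    rw [Algebra.algebraMap_eq_smul_one, ← TensorProduct.smul_tmul]
    congr 1
    ext <;> simp
  coord z hz := hz.baseChange (DualNumber X.k)

/-- The infinitesimal automorphism `1 + ε ξ`, as a morphism of families. -/
def flow (ξ : X.Th) : Hom X.eps X.eps where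
  base := AlgHom.id ℂ _
  fn := (flowAlg (DualNumber.eps : DualNumber X.k) DualNumber.eps_mul_eps ξ).toRingHom
  comm c := (flowAlg (DualNumber.eps : DualNumber X.k) DualNumber.eps_mul_eps ξ).commutes c
  coord _ hz := hz.of_inverse (flowAlg (DualNumber.eps : DualNumber X.k) DualNumber.eps_mul_eps ξ)
    (flowAlg (DualNumber.eps : DualNumber X.k) DualNumber.eps_mul_eps (-ξ)) (flowAlg_neg _ _ ξ)
    (fun f => by simpa using flowAlg_neg (DualNumber.eps : DualNumber X.k) _ (-ξ) f)

end Fam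

/-- The map on relative differentials induced by a morphism of families. -/
def Hom.om {X Y : Fam} (h : Hom X Y) : X.Om →ₛₗ[h.fn] Y.Om :=
  letI : Algebra X.R Y.R := h.fn.toAlgebra
  letI : Algebra X.k Y.k := h.base.toRingHom.toAlgebra
  letI : Algebra X.k Y.R := ((algebraMap Y.k Y.R).comp h.base.toRingHom).toAlgebra
  haveI : IsScalarTower X.k X.R Y.R := .of_algebraMap_eq fun c => (h.comm c).symm
  haveI : IsScalarTower X.k Y.k Y.R := .of_algebraMap_eq fun _ => rfl
  { toFun := KaehlerDifferential.map X.k Y.k X.R Y.R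
    map_add' := map_add _
    map_smul' := fun f ω => by
      rw [map_smul, algebra_compatible_smul Y.R f]; rfl }

/-- A coordinate, transported along a morphism of families. -/
def Hom.crd {X Y : Fam} (h : Hom X Y) (z : X.Coord) : Y.Coord := ⟨h.fn z, h.coord z z.2⟩

/-- `ξ'` is the transport of the vector field `ξ` along a morphism of families. -/
def Hom.RelVec {X Y : Fam} (h : Hom X Y) (ξ : X.Th) (ξ' : Y.Th) : Prop :=
  ∀ g : X.R, ξ' (h.fn g) = h.fn (ξ g)

theorem Fam.om_fn (X : Fam) (f : X.R) (ω : X.Om) : ω <• X.fn f = f • ω := by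
  change MulOpposite.unop (X.actOm (X.fn f)) ω = f • ω
  have : X.actOm (X.fn f) = X.omFn f :=
    X.liftDO_fn _ _ _ _ _ _ f
  rw [this]; rfl

/-! ### Chiral algebras -/

/-- For a right `D`-module `A`, the direct image `Δ_!(A)` under the diagonal is `A ⊗_𝒪 D`, with `D`
acting in the first variable. An element `u = ∑ aᵢ ⊗ Pᵢ` is recorded through the differential
operator `g ↦ (h ⊠ id)(u · (g ⊠ 1)) = ∑ Pᵢ(g) aᵢ` from `𝒪` to `A`, which determines it. -/
def expand (X : Fam) {A : Type} [AddCommGroup A] [Module X.R A] (l : List (X.DO × A)) (g : X.R) :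
    A :=
  (l.map fun t => X.actR t.1 g • t.2).sum

/-- The differential operator `g ↦ (id ⊠ h)(u · (1 ⊠ g)) = ∑ (g aᵢ) · Pᵢ` that records the
transpose `σ₁₂(u)` of the element `u = ∑ aᵢ ⊗ Pᵢ` of `Δ_!(A)`. -/
def expandSwap (X : Fam) {A : Type} [AddCommGroup A] [Module X.R A] [Module X.DOᵐᵒᵖ A]
    (l : List (X.DO × A)) (g : X.R) : A :=
  (l.map fun t => (g • t.2) <• t.1).sum

/-- The sign `(-1)^{ij}`. -/
def sgn (i j : ZMod 2) : ℤ := (-1) ^ (i.val * j.val)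

/-- A unital (super) chiral algebra on the family of curves `X`.

`br f a b : 𝒪 → A` is the element `{f(x,y) · a ⊠ b}` of `Δ_!(A)`, recorded as the differential
operator `g ↦ (h ⊠ id)({f(x,y) · a ⊠ b} · (g ⊠ 1))`. Since `Δ_!(A)` is supported on the diagonal,
sections of `j_*j^*(A ⊠ A)` are only needed near the diagonal. -/
structure ChirAlg (X : Fam) : Type 1 where
  carrier : Type
  [grp : AddCommGroup carrier]
  [modR : Module X.R carrier]
  [modD : Module X.DOᵐᵒᵖ carrier]
  fn_act : ∀ (f : X.R) (a : carrier), a <• X.fn f = f • a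
  /-- the parity decomposition -/
  par : ZMod 2 → Submodule X.DOᵐᵒᵖ carrier
  par_internal : DirectSum.IsInternal par
  /-- the chiral bracket -/
  br : X.K → carrier → carrier → X.R → carrier
  br_delta : ∀ f a b, ∃ l : List (X.DO × carrier), ∀ g, br f a b g = expand X l g
  br_add : ∀ f f' a b g, br (f + f') a b g = br f a b g + br f' a b g
  br_add_left : ∀ f a a' b g, br f (a + a') b g = br f a b g + br f a' b g
  br_add_right : ∀ f a b b' g, br f a (b + b') g = br f a b g + br f a b' g
  br_par : ∀ i j, ∀ a ∈ par i, ∀ b ∈ par j, ∀ f g, br f a b g ∈ par (i + j)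
  -- `f(x,y) · (r a) ⊠ (s b) = f(x,y) r(x) s(y) · a ⊠ b`
  br_left : ∀ f r a b g, br f (r • a) b g = br (f * X.in1 r) a b g
  br_right : ∀ f s a b g, br f a (s • b) g = br (f * X.in2 s) a b g
  -- the bracket commutes with the right actions of functions of `x` and of `y`
  br_fn1 : ∀ f r a b g, br (f * X.in1 r) a b g = br f a b (r * g)
  br_fn2 : ∀ f s a b g, br (f * X.in2 s) a b g = s • br f a b g
  -- the bracket commutes with the right actions of vector fields in `x` and in `y`
  br_vec1 : ∀ f (ξ : X.Th) a b g,
    br f (a <• X.vec ξ) b g - br (X.vec1 ξ f) a b g = br f a b (ξ g)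
  br_vec2 : ∀ f (ξ : X.Th) a b g,
    br f a (b <• X.vec ξ) g - br (X.vec2 ξ f) a b g = br f a b g <• X.vec ξ
  -- `{f(x,y) · a ⊠ b} = -(-1)^{|a||b|} σ₁₂ {f(y,x) · b ⊠ a}`
  antisymm : ∀ i j, ∀ a ∈ par i, ∀ b ∈ par j, ∀ f (l : List (X.DO × carrier)),
    (∀ g, br (X.swap f) b a g = expand X l g) →
      ∀ g, br f a b g = -(sgn i j • expandSwap X l g)
  -- `{{F · a ⊠ b} ⊠ c} = {a ⊠ {F · b ⊠ c}} - (-1)^{|a||b|} σ₁₂ {b ⊠ {F · a ⊠ c}}` for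
  -- `F = f₁₂(x,y) f₁₃(x,z) f₂₃(y,z)`, after applying `h ⊠ h ⊠ id`; such `F` span the functions with
  -- poles along the diagonals, and the equality for all `F` is the equality in `Δ_!`
  jacobi : ∀ i j, ∀ a ∈ par i, ∀ b ∈ par j, ∀ c f₁₂ f₁₃ f₂₃ (l₁ l₂ l₃ : List (X.DO × carrier)),
    (∀ g, br f₁₂ a b g = expand X l₁ g) →
    (∀ g, br f₂₃ b c g = expand X l₂ g) →
    (∀ g, br f₁₃ a c g = expand X l₃ g) →
      (l₁.map fun t => br (f₂₃ * X.act1 t.1 f₁₃) t.2 c 1).sum =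
        (l₂.map fun t => br (f₁₃ * X.act2 t.1 f₁₂) a t.2 1).sum -
          sgn i j • (l₃.map fun t => br (f₂₃ * X.swap (X.act1 t.1 f₁₂)) b t.2 1).sum
  /-- the unit -/
  unit : X.Om →ₗ[X.R] carrier
  unit_act : ∀ (ω : X.Om) (P : X.DO), unit (ω <• P) = unit ω <• P
  unit_even : ∀ ω, unit ω ∈ par 0
  -- the bracket with the unit is the canonical map
  -- `j_*j^*(Ω ⊠ A) → j_*j^*(Ω ⊠ A) / Ω ⊠ A = Δ_!(A)`: it kills `Ω ⊠ A` and sends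
  -- `dz ⊠ a / (z(x) - z(y))` to `a ∈ A ⊂ Δ_!(A)`
  br_unit_reg : ∀ (p : X.RR) ω a g, br (algebraMap X.RR X.K p) (unit ω) a g = 0
  br_unit_pole : ∀ (z : X.Coord) a g, br (X.pole z 1) (unit (X.d z)) a g = g • a

attribute [instance] ChirAlg.grp ChirAlg.modR ChirAlg.modD

/-- A homomorphism of unital chiral algebras. -/
structure ChirHom {X : Fam} (A B : ChirAlg X) where
  toFun : A.carrier →ₗ[X.DOᵐᵒᵖ] B.carrier
  map_par : ∀ i, ∀ a ∈ A.par i, toFun a ∈ B.par i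
  map_br : ∀ f a b g, B.br f (toFun a) (toFun b) g = toFun (A.br f a b g)
  map_unit : ∀ ω, toFun (A.unit ω) = B.unit ω

/-- A semilinear map `M → M'` over `R → R'` exhibiting `M'` as the base change `R' ⊗ M`. -/
def IsBC {R R' M M' : Type} [CommRing R] [CommRing R'] [AddCommGroup M] [AddCommGroup M']
    [Module R M] [Module R' M'] (φ : R →+* R') (u : M →ₛₗ[φ] M') : Prop :=
  letI : Algebra R R' := φ.toAlgebra
  letI : Module R M' := Module.compHom M' φ
  haveI : IsScalarTower R R' M' := ⟨fun a b m => mul_smul (φ a) b m⟩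
  IsBaseChange R' ({ toFun := u, map_add' := map_add u, map_smul' := map_smulₛₗ u } : M →ₗ[R] M')

/-- A chiral algebra on the universal curve with a compatible structure of local `𝒪`-module: a
chiral algebra on every family of curves, with identifications for all morphisms of families
(restrictions to open subsets, base changes, isomorphisms of open parts of two families). All the
structure is compatible with these identifications. -/
structure LocalChirAlg : Type 1 where
  obj : ∀ X : Fam, ChirAlg X
  map : ∀ {X Y : Fam} (h : Hom X Y), (obj X).carrier →ₛₗ[h.fn] (obj Y).carrier
  map_id : ∀ X a, map (Hom.id X) a = a
  map_comp : ∀ {X Y Z : Fam} (g : Hom Y Z) (h : Hom X Y) a, map (g.comp h) a = map g (map h a)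
  isBC : ∀ {X Y : Fam} (h : Hom X Y), IsBC h.fn (map h)
  map_vec : ∀ {X Y : Fam} (h : Hom X Y) (ξ : X.Th) (ξ' : Y.Th), h.RelVec ξ ξ' →
    ∀ a, map h (a <• X.vec ξ) = map h a <• Y.vec ξ'
  map_par : ∀ {X Y : Fam} (h : Hom X Y) i, ∀ a ∈ (obj X).par i, map h a ∈ (obj Y).par i
  map_br : ∀ {X Y : Fam} (h : Hom X Y) f a b g,
    map h ((obj X).br f a b g) = (obj Y).br (h.kk f) (map h a) (map h b) (h.fn g)
  map_unit : ∀ {X Y : Fam} (h : Hom X Y) ω, map h ((obj X).unit ω) = (obj Y).unit (h.om ω)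

/-- `Lie_ξ(l) = l'` for the action of vector fields by Lie derivations that comes from the local
structure: the infinitesimal automorphism `1 + ε ξ` sends `l` to `l + ε l'`. -/
def LocalChirAlg.IsLie (A : LocalChirAlg) {X : Fam} (ξ : X.Th) (l l' : (A.obj X).carrier) : Prop :=
  A.map (X.flow ξ) (A.map X.toEps l) = A.map X.toEps l + X.epsFn • A.map X.toEps l'

/-- A map of chiral algebras on the universal curve compatible with the local structures. -/
structure LocalChirHom (A B : LocalChirAlg) where
  app : ∀ X, ChirHom (A.obj X) (B.obj X)
  natural : ∀ {X Y : Fam} (h : Hom X Y) a,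
    (app Y).toFun (A.map h a) = B.map h ((app X).toFun a)

/-! ### Enveloping chiral algebras -/

/-- A right `D`-module with a (super) Lie-* bracket and a central copy of `Ω`.
`br a b g = (h ⊠ id)({a ⊠ b} · (g ⊠ 1))`. -/
structure StarAlg (X : Fam) : Type 1 where
  carrier : Type
  [grp : AddCommGroup carrier]
  [modD : Module X.DOᵐᵒᵖ carrier]
  par : ZMod 2 → Submodule X.DOᵐᵒᵖ carrier
  br : carrier → carrier → X.R → carrier
  cent : X.Om → carrier

attribute [instance] StarAlg.grp StarAlg.modD

/-- A homomorphism of Lie-* algebras from `B` to the Lie-* algebra underlying the chiral algebra `A`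
which identifies the central `Ω ⊂ B` with the unit of `A`. -/
structure IsStarMap {X : Fam} (B : StarAlg X) (A : ChirAlg X)
    (φ : B.carrier →ₗ[X.DOᵐᵒᵖ] A.carrier) : Prop where
  map_par : ∀ i, ∀ b ∈ B.par i, φ b ∈ A.par i
  map_br : ∀ b b' g, A.br 1 (φ b) (φ b') g = φ (B.br b b' g)
  map_cent : ∀ ω, φ (B.cent ω) = A.unit ω

/-- `A` is the quotient of the chiral universal enveloping algebra of `B` by the relation that
identifies the central `Ω ⊂ B` with the unit. -/
structure IsEnvelope {X : Fam} (B : StarAlg X) (A : ChirAlg X)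
    (φ : B.carrier →ₗ[X.DOᵐᵒᵖ] A.carrier) : Prop where
  isStarMap : IsStarMap B A φ
  universal : ∀ (A' : ChirAlg X) (φ' : B.carrier →ₗ[X.DOᵐᵒᵖ] A'.carrier), IsStarMap B A' φ' →
    ∃! Φ : ChirHom A A', ∀ b, Φ.toFun (φ b) = φ' b

/-! ### Induced `D`-modules -/

namespace Fam

variable (X : Fam)

/-- `D` as a left `𝒪`-module. -/
instance : Module X.R X.DO := Module.compHom X.DO (X.fn : X.R →+* X.DO)

theorem smul_DO (f : X.R) (P : X.DO) : f • P = X.fn f * P := rfl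

instance : SMulCommClass X.R X.DOᵐᵒᵖ X.DO where
  smul_comm f P Q := by
    induction P using MulOpposite.rec' with
    | _ P => simp [smul_DO, mul_assoc]

/-- The right `D`-module `L ⊗_𝒪 D` induced from an `𝒪`-module `L`; `P ⊗ₜ s` stands for `s ⊗ P`. -/
abbrev Ind (L : Type) [AddCommGroup L] [Module X.R L] : Type := X.DO ⊗[X.R] L

/-- The section `s ⊗ 1` of `L ⊗ D`. -/
def gen {L : Type} [AddCommGroup L] [Module X.R L] (s : L) : X.Ind L := 1 ⊗ₜ s

/-! ### The linear dilaton -/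

/-- The extension `0 → Ω → F_λ → 𝒪 → 0`. A section is a function `f` together with a form
`s(z)` for every coordinate `z`, such that `s(w) = s(z) - (λ/2) f d log (dw/dz)`. -/
def F (lam : ℂ) : Submodule X.R (X.R × (X.Coord → X.Om)) where
  carrier := {s | ∀ (z w : X.Coord) (u : X.Rˣ), X.d w = (u : X.R) • X.d z →
    s.2 w = s.2 z - (X.scal (lam / 2) * s.1 * ((u⁻¹ : X.Rˣ) : X.R)) • X.d u}
  add_mem' {s t} hs ht z w u h := by
    simp only [Prod.snd_add, Prod.fst_add, Pi.add_apply, hs z w u h, ht z w u h, mul_add, add_mul,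
      add_smul]
    abel
  zero_mem' z w u h := by simp
  smul_mem' r s hs z w u h := by
    simp only [Prod.smul_snd, Prod.smul_fst, Pi.smul_apply, hs z w u h, smul_sub, smul_smul,
      smul_eq_mul]
    congr 2
    ring

/-- The embedding `Ω → F_λ`. -/
def inclF (lam : ℂ) (ω : X.Om) : X.F lam := ⟨(0, fun _ => ω), fun _ _ _ _ => by simp⟩

/-- The kernel of `Ω ⊗ D → Ω`, inside `F_λ ⊗ D`. -/
def relF (lam : ℂ) : Submodule X.DOᵐᵒᵖ (X.Ind (X.F lam)) :=
  Submodule.span _ {x | ∃ (P : X.DO) (ω : X.Om),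
    x = P ⊗ₜ X.inclF lam ω - X.gen (X.inclF lam (ω <• P))}

/-- The `D`-module `B(λ, Q) = F_λ ⊗ D / ker(Ω ⊗ D → Ω)`. -/
abbrev BDilMod (lam : ℂ) : Type := X.Ind (X.F lam) ⧸ X.relF lam

/-- The projection `F_λ ⊗ D → D`. -/
def projF (lam : ℂ) : X.Ind (X.F lam) →ₗ[X.DOᵐᵒᵖ] X.DO :=
  let p : X.Ind (X.F lam) →ₗ[X.R] X.DO := TensorProduct.lift
    (LinearMap.mk₂ X.R (fun P (s : X.F lam) => s.1.1 • P)
      (fun P P' s => smul_add _ P P')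
      (fun r P s => smul_comm _ r P)
      (fun P s s' => add_smul s.1.1 s'.1.1 P)
      (fun r P s => mul_smul r s.1.1 P))
  { toFun := p
    map_add' := map_add p
    map_smul' := fun P x => by
      induction x using TensorProduct.induction_on with
      | zero => simp
      | add a b ha hb => rw [smul_add, map_add, map_add, ha, hb, smul_add]
      | tmul Q s => exact smul_comm s.1.1 P Q }

theorem projF_tmul (lam : ℂ) (P : X.DO) (s : X.F lam) : X.projF lam (P ⊗ₜ s) = s.1.1 • P := rfl

/-- The projection `B(λ, Q) → D`. -/
def projB (lam : ℂ) : X.BDilMod lam →ₗ[X.DOᵐᵒᵖ] X.DO :=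
  (X.relF lam).liftQ (X.projF lam) (by
    rw [relF, Submodule.span_le]
    rintro _ ⟨P, ω, rfl⟩
    change X.projF lam _ = 0
    rw [map_sub, gen, projF_tmul, projF_tmul]
    simp [inclF])

/-- The Lie-* algebra `B(λ, Q)`. The bracket is the composition of `B ⊠ B → D ⊠ D` with the map
`D ⊠ D → Δ_!(Ω)` that sends `1 ⊠ 1` to `Q · 1'`, where the antisymmetric section `1'` of `Δ_!(Ω)` is
normalised by `(id ⊠ h)(1' · (1 ⊠ g)) = dg`, that is, `(h ⊠ id)(1' · (g ⊠ 1)) = -dg`. -/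
def BDil (lam Q : ℂ) : StarAlg X where
  carrier := X.BDilMod lam
  par i := if i = 0 then ⊤ else ⊥
  cent ω := (X.relF lam).mkQ (X.gen (X.inclF lam ω))
  br b b' g := (X.relF lam).mkQ (X.gen (X.inclF lam
    (-(X.scal Q • X.d (X.actR (X.projB lam b) g)) <• X.projB lam b')))

/-! ### The bc-system -/

/-- The `n`-th tensor power `Ωⁿ` of `Ω`, `n ∈ ℤ`. A section `α` is given by its coefficients `α(z)`
with respect to all coordinates, `α = α(z) dzⁿ`. -/
def Pow (n : ℤ) : Submodule X.R (X.Coord → X.R) where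
  carrier := {s | ∀ (z w : X.Coord) (u : X.Rˣ), X.d w = (u : X.R) • X.d z →
    s z = ((u ^ n : X.Rˣ) : X.R) * s w}
  add_mem' {s t} hs ht z w u h := by
    simp only [Pi.add_apply, hs z w u h, ht z w u h, mul_add]
  zero_mem' z w u h := by simp
  smul_mem' r s hs z w u h := by
    simp only [Pi.smul_apply, hs z w u h, smul_eq_mul]
    ring

/-- Some coordinate. -/
def coord₀ : X.Coord := ⟨X.exists_coord.choose, X.exists_coord.choose_spec⟩

/-- The product `Ωᵐ × Ω¹⁻ᵐ → Ω`; it does not depend on the coordinate used. -/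
def pair {m m' : ℤ} (α : X.Pow m) (β : X.Pow m') : X.Om :=
  (α.1 X.coord₀ * β.1 X.coord₀) • X.d X.coord₀

/-- The map `Ωᵐ ⊗ D → Ωᵐ`, `α ⊗ P ↦ P(g) α`. -/
def evPow {m : ℤ} (g : X.R) : X.Ind (X.Pow m) →ₗ[X.R] X.Pow m :=
  TensorProduct.lift (LinearMap.mk₂ X.R (fun P (α : X.Pow m) => X.actR P g • α)
    (fun P P' α => by rw [map_add, LinearMap.add_apply, add_smul])
    (fun r P α => by
      have : X.actR (r • P) g = r * X.actR P g := by
        have h : X.actR (X.fn r) = Algebra.lmul X.k X.R r := X.liftDO_fn _ _ _ _ _ _ r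
        rw [smul_DO, map_mul, h]
        rfl
      rw [this, mul_smul])
    (fun P α α' => smul_add _ α α')
    (fun r P α => smul_comm _ r α))

/-- The map `Ωᵐ × (Ω¹⁻ᵐ ⊗ D) → Ω`, `(α, β ⊗ P) ↦ (αβ) · P`. -/
def pairD {m m' : ℤ} (α : X.Pow m) : X.Ind (X.Pow m') →+ X.Om :=
  TensorProduct.liftAddHom
    (AddMonoidHom.mk' (fun P : X.DO =>
      AddMonoidHom.mk' (fun β : X.Pow m' => X.pair α β <• P)
        (fun β β' => by
          rw [← smul_add]; congr 1
          simp [pair, mul_add, add_smul]))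
      (fun P P' => by ext β; simp [add_smul]))
    (fun r P β => by
      change X.pair α β <• (X.fn r * P) = X.pair α (r • β) <• P
      rw [MulOpposite.op_mul, mul_smul, om_fn]
      congr 1
      simp only [pair, smul_smul]
      congr 1
      change _ = _ * (r * _)
      ring)

/-- The (super) Lie-* algebra `B_bc(M) = Ω ⊕ M ⊕ M*` for `M = Ωⁿ ⊗ D`, `M* = Ω¹⁻ⁿ ⊗ D`: `Ω` is
central and even, `M` and `M*` are odd, and the bracket of `α ∈ Ωⁿ` and `β ∈ Ω¹⁻ⁿ` (in either order)
is `αβ ∈ Ω ⊂ Δ_!(Ω)`. -/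
def BBC (n : ℤ) : StarAlg X where
  carrier := X.Om × X.Ind (X.Pow n) × X.Ind (X.Pow (1 - n))
  par i := if i = 0 then Submodule.prod ⊤ ⊥ else Submodule.prod ⊥ ⊤
  cent ω := (ω, 0, 0)
  br b b' g := (X.pairD (X.evPow g b.2.1) b'.2.2 + X.pairD (X.evPow g b.2.2) b'.2.1, 0, 0)

/-! ### The extensions `Θ'_c` -/

/-- The extension `0 → Ω → Θ'_c → Θ → 0` (dual to the `c`-projective connections). A section is a
vector field `ξ` together with a form `s(z)` for every coordinate `z`, such that
`s(w) = s(z) + (c/12) ⟨ξ, {w, z} dz²⟩` with the Schwarzian derivative `{w, z}`. -/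
def Theta (c : ℂ) : Submodule X.R (X.Th × (X.Coord → X.Om)) where
  carrier := {s | ∀ (z w : X.Coord) (u : X.Rˣ) (u₁ u₂ : X.R), X.d w = (u : X.R) • X.d z →
    X.d (u : X.R) = u₁ • X.d z → X.d u₁ = u₂ • X.d z →
    s.2 w = s.2 z + (X.scal (c / 12) * (((u⁻¹ : X.Rˣ) : X.R) * u₂ -
      X.scal (3 / 2) * (((u⁻¹ : X.Rˣ) : X.R) * u₁) ^ 2) * s.1 z) • X.d z}
  add_mem' {s t} hs ht z w u u₁ u₂ h h₁ h₂ := by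
    simp only [Prod.snd_add, Prod.fst_add, Pi.add_apply, hs z w u u₁ u₂ h h₁ h₂,
      ht z w u u₁ u₂ h h₁ h₂, Derivation.add_apply, mul_add, add_smul]
    abel
  zero_mem' z w u u₁ u₂ h h₁ h₂ := by simp
  smul_mem' r s hs z w u u₁ u₂ h h₁ h₂ := by
    simp only [Prod.smul_snd, Prod.smul_fst, Pi.smul_apply, hs z w u u₁ u₂ h h₁ h₂, smul_add,
      smul_smul, smul_eq_mul, Derivation.smul_apply]
    congr 2
    ring

/-- The embedding `Ω → Θ'_c`. -/
def inclTheta (c : ℂ) (ω : X.Om) : X.Theta c := ⟨(0, fun _ => ω), fun _ _ _ _ _ _ _ _ => by simp⟩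

end Fam

namespace Hom

variable {X Y : Fam} (h : Hom X Y)

/-- The local structure of `F_λ`: `s'` is the transport of `s`. -/
def RelF {lam : ℂ} (s : X.F lam) (s' : Y.F lam) : Prop :=
  s'.1.1 = h.fn s.1.1 ∧ ∀ z, s'.1.2 (h.crd z) = h.om (s.1.2 z)

/-- The local structure of `Ωⁿ`: `α'` is the transport of `α`. -/
def RelPow {n : ℤ} (α : X.Pow n) (α' : Y.Pow n) : Prop :=
  ∀ z, α'.1 (h.crd z) = h.fn (α.1 z)

/-- The local structure of `Θ'_c`: `s'` is the transport of `s`. -/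
def RelTheta {c : ℂ} (s : X.Theta c) (s' : Y.Theta c) : Prop :=
  h.RelVec s.1.1 s'.1.1 ∧ ∀ z, s'.1.2 (h.crd z) = h.om (s.1.2 z)

end Hom

/-! ### The two chiral algebras -/

/-- The chiral algebra `A(λ, Q)` of the linear dilaton, with its local structure. -/
structure DilatonAlg (lam Q : ℂ) : Type 1 where
  alg : LocalChirAlg
  ι : ∀ X : Fam, (X.BDil lam Q).carrier →ₗ[X.DOᵐᵒᵖ] (alg.obj X).carrier
  isEnvelope : ∀ X, IsEnvelope (X.BDil lam Q) (alg.obj X) (ι X)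
  ι_local : ∀ {X Y : Fam} (h : Hom X Y) (s : X.F lam) (s' : Y.F lam), h.RelF s s' →
    alg.map h (ι X ((X.relF lam).mkQ (X.gen s))) = ι Y ((Y.relF lam).mkQ (Y.gen s'))

/-- The embedding `F_λ → A(λ, Q)`. -/
def DilatonAlg.ofF {lam Q : ℂ} (A : DilatonAlg lam Q) {X : Fam} (s : X.F lam) :
    (A.alg.obj X).carrier := A.ι X ((X.relF lam).mkQ (X.gen s))

/-- The chiral algebra `A_bc(n)` of the bc-system, with its local structure. -/
structure BCAlg (n : ℤ) : Type 1 where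
  alg : LocalChirAlg
  ι : ∀ X : Fam, (X.BBC n).carrier →ₗ[X.DOᵐᵒᵖ] (alg.obj X).carrier
  isEnvelope : ∀ X, IsEnvelope (X.BBC n) (alg.obj X) (ι X)
  ι_local₁ : ∀ {X Y : Fam} (h : Hom X Y) (α : X.Pow n) (α' : Y.Pow n), h.RelPow α α' →
    alg.map h (ι X (0, X.gen α, 0)) = ι Y (0, Y.gen α', 0)
  ι_local₂ : ∀ {X Y : Fam} (h : Hom X Y) (β : X.Pow (1 - n)) (β' : Y.Pow (1 - n)), h.RelPow β β' →
    alg.map h (ι X (0, 0, X.gen β)) = ι Y (0, 0, Y.gen β')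

/-- The embedding `Ωⁿ → A_bc(n)`. -/
def BCAlg.b {n : ℤ} (C : BCAlg n) {X : Fam} (α : X.Pow n) : (C.alg.obj X).carrier :=
  C.ι X (0, X.gen α, 0)

/-- The embedding `Ω¹⁻ⁿ → A_bc(n)`. -/
def BCAlg.c {n : ℤ} (C : BCAlg n) {X : Fam} (β : X.Pow (1 - n)) : (C.alg.obj X).carrier :=
  C.ι X (0, 0, X.gen β)

/-! ### The fermion number current -/

/-- The identification of `Ωⁿ ⊠ Ω¹⁻ⁿ(Δ) / Ωⁿ ⊠ Ω¹⁻ⁿ(-Δ)` with `F_{2n-1}`: the class of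
`p(x,y) / (z(x) - z(y)) · α ⊠ β` is the section `s` of `F_{2n-1}`. In terms of the coordinate `z`,
`s = (f, r dz)` corresponds to `(f(y) / (z(x) - z(y)) + r(y)) dz(x)ⁿ dz(y)¹⁻ⁿ`. -/
def IsPolarClass {X : Fam} {n : ℤ} (z : X.Coord) (p : X.RR) (α : X.Pow n) (β : X.Pow (1 - n))
    (s : X.F (2 * n - 1)) : Prop :=
  ∃ r : X.R, s.1.2 z = r • X.d z ∧
    p * (α.1 z ⊗ₜ β.1 z) - 1 ⊗ₜ s.1.1 - (1 ⊗ₜ r) * X.diag z ∈ KaehlerDifferential.ideal X.k X.R ^ 2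

/-- `J` extends the fermion number current
`J̃(f(x,y) · α ⊠ β) = (h ⊠ id)({f(x,y) · α ⊠ β})` on `F_{2n-1}`. -/
def ExtendsCurrent {n : ℤ} {Q : ℂ} (A : DilatonAlg (2 * n - 1) Q) (C : BCAlg n)
    (J : LocalChirHom A.alg C.alg) : Prop :=
  ∀ (X : Fam) (z : X.Coord) (p : X.RR) (α : X.Pow n) (β : X.Pow (1 - n)) (s : X.F (2 * n - 1)),
    IsPolarClass z p α β s →
      (J.app X).toFun (A.ofF s) = (C.alg.obj X).br (X.pole z p) (C.b α) (C.c β) 1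

/-! ### Energy-momentum tensors -/

/-- A system of `𝒪`-linear maps `Θ → A / Ω`. -/
abbrev PreTensor (A : LocalChirAlg) : Type 1 :=
  ∀ X : Fam, X.Th →ₗ[X.R] (A.obj X).carrier ⧸ LinearMap.range (A.obj X).unit

/-- The condition that determines `T̃ : Θ → A / Ω`: for every section `ξ'` of `A` that projects to
`T̃(ξ)` and every section `l`, `(h ⊠ id)({ξ' ⊠ l}) = -Lie_ξ(l) - l · ξ`. -/
def IsPreTensor (A : LocalChirAlg) (T : PreTensor A) : Prop :=
  ∀ (X : Fam) (ξ : X.Th) (ξ' l : (A.obj X).carrier),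
    (LinearMap.range (A.obj X).unit).mkQ ξ' = T X ξ →
      A.IsLie ξ l (-((A.obj X).br 1 ξ' l 1) - l <• X.vec ξ)

/-- Compatibility of `T̃ : Θ → A / Ω` with the local structures. -/
def PreTensor.IsLocal {A : LocalChirAlg} (T : PreTensor A) : Prop :=
  ∀ {X Y : Fam} (h : Hom X Y) (ξ : X.Th) (ξ' : Y.Th) (a : (A.obj X).carrier), h.RelVec ξ ξ' →
    (LinearMap.range (A.obj X).unit).mkQ a = T X ξ →
      (LinearMap.range (A.obj Y).unit).mkQ (A.map h a) = T Y ξ'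

/-- The extension `0 → Ω → Θ' → Θ → 0` induced from `0 → Ω → A → A / Ω → 0` by means of
`T̃ : Θ → A / Ω`. The energy-momentum tensor `Θ' → A` is the second projection. -/
def PreTensor.ext {A : LocalChirAlg} (T : PreTensor A) (X : Fam) :
    Submodule X.R (X.Th × (A.obj X).carrier) :=
  LinearMap.eqLocus ((LinearMap.range (A.obj X).unit).mkQ ∘ₗ LinearMap.snd X.R _ _)
    (T X ∘ₗ LinearMap.fst X.R _ _)

/-- `e` is an isomorphism between `Θ'_c` and the extension `Θ'` induced by `T̃`, as extensions of `Θ`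
by `Ω` in local `𝒪`-modules. -/
structure IsExtIso {A : LocalChirAlg} (T : PreTensor A) (c : ℂ)
    (e : ∀ X : Fam, X.Theta c ≃ₗ[X.R] T.ext X) : Prop where
  proj : ∀ X s, (e X s).1.1 = s.1.1
  incl : ∀ X ω, (e X (X.inclTheta c ω)).1 = (0, (A.obj X).unit ω)
  isLocal : ∀ {X Y : Fam} (h : Hom X Y) (s : X.Theta c) (s' : Y.Theta c), h.RelTheta s s' →
    (e Y s').1.2 = A.map h (e X s).1.2

end Chiral

end

open scoped TensorProduct RightActions

noncomputable section

namespace Chiral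

open AddMonoidHom (mk' mulLeft compHom)
open AlgHom (commutes toLinearMap_apply)
open Algebra (smul_def lsmul)
open Algebra.TensorProduct (lmul' tmul_mul_tmul one_def)
open Derivation (leibniz leibniz_pow)
open Finset (range coe_range sum_add_distrib sum_range_succ' smul_sum sum_congr mem_range sum_eq_zero sum_range_succ
  sum_range_one)
open Function (iterate_succ_apply Injective)
open HahnSeries (single ofPowerSeries single_mul_single ofPowerSeries_X)
open Ideal (mul_mem_mul mul_mem_left pow_mem_pow pow_le_pow_right)
open Int (negSucc negSucc_eq ofNat_eq_natCast cast_smul_eq_zsmul)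
open IsLocalization (ringHom_ext)
open KaehlerDifferential (D_apply span_range_eq_ideal map_D polynomialEquiv polynomialEquiv_D)
open LinearEquiv (ofBijective)
open LinearMap (comp_apply mk₂ mk₂_apply flip_apply rTensor_tmul liftBaseChange_tmul liftBaseChange coprod)
open List (map_map)
open Module (End)
open MulOpposite (unop op_mul op unop_injective op_add op_one)
open Nat (cast_zero)
open Polynomial (X_mul_C derivative_X X_mul aeval)
open PowerSeries (coeff_C_mul coeff coeff_mk coeff_one coeff_mul coeff_C coeff_X constantCoeff
  coeff_zero_eq_constantCoeff_apply isUnit_iff_constantCoeff coeff_succ_X_mul coeff_one_mul)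
open Ring (choose_natCast)
open Set (mem_Iio)
open Submodule (span mem_top span_induction subset_span mkQ_surjective smul_mem)
open Submodule.Quotient (mk_eq_zero)
open TensorProduct (induction_on tmul_smul smul_tmul' tmul_add)
open Units (val_mul val_pow_eq_pow_val val_one)

/-! ### Binomial sums -/

section BinomialSum

variable {W W' : Type} [AddCommGroup W'] [AddCommGroup W]

/-- A sequence that vanishes eventually. -/
def EvZero (f : ℕ → W) : Prop := ∃ J, ∀ j, J ≤ j → f j = 0

/-- The finite sum `∑ⱼ (m choose j) fⱼ` for `m ∈ ℤ` and an eventually vanishing sequence `f`. -/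
def bsum (m : ℤ) (f : ℕ → W) : W := ∑ᶠ j, Ring.choose m j • f j

theorem bsum_eq {f : ℕ → W} {J : ℕ} (h : ∀ j, J ≤ j → f j = 0) (m : ℤ) :
    bsum m f = ∑ j ∈ range J, Ring.choose m j • f j := by
  apply finsum_eq_sum_of_support_subset
  intro j hj
  by_contra hc
  simp only [coe_range, mem_Iio, not_lt] at hc
  exact hj (by simp [h j hc])

theorem EvZero.add {f g : ℕ → W} (hf : EvZero f) (hg : EvZero g) : EvZero fun j => f j + g j := by
  obtain ⟨J, hJ⟩ := hf
  obtain ⟨K, hK⟩ := hg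
  exact ⟨max J K, fun j hj => by
    change f j + g j = 0
    rw [hJ j (le_of_max_le_left hj), hK j (le_of_max_le_right hj), add_zero]⟩

theorem EvZero.map {f : ℕ → W} (hf : EvZero f) (F : W →+ W') : EvZero fun j => F (f j) := by
  obtain ⟨J, hJ⟩ := hf
  exact ⟨J, fun j hj => (congrArg F (hJ j hj)).trans (map_zero F)⟩

theorem EvZero.map_seq {f : ℕ → W} (hf : EvZero f) (F : ℕ → W → W') (hF : ∀ j, F j 0 = 0) :
    EvZero fun j => F j (f j) := by
  obtain ⟨J, hJ⟩ := hf
  exact ⟨J, fun j hj => (congrArg (F j) (hJ j hj)).trans (hF j)⟩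

theorem EvZero.smul {M : Type} [SMulZeroClass M W] {f : ℕ → W} (hf : EvZero f) (c : ℕ → M) :
    EvZero fun j => c j • f j :=
  hf.map_seq (fun j x => c j • x) fun _ => smul_zero _

theorem EvZero.neg {f : ℕ → W} (hf : EvZero f) : EvZero fun j => - f j :=
  hf.map_seq (fun _ x => -x) fun _ => neg_zero

theorem EvZero.succ {f : ℕ → W} (hf : EvZero f) : EvZero fun j => f (j + 1) := by
  obtain ⟨J, hJ⟩ := hf
  exact ⟨J, fun j hj => hJ _ (by omega)⟩

theorem bsum_congr {f g : ℕ → W} (m : ℤ) (h : ∀ j, f j = g j) : bsum m f = bsum m g := by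
  rw [funext h]

theorem bsum_zero_fun (m : ℤ) : bsum m (fun _ => (0 : W)) = 0 := by simp [bsum]

theorem bsum_add {f g : ℕ → W} (hf : EvZero f) (hg : EvZero g) (m : ℤ) :
    bsum m (fun j => f j + g j) = bsum m f + bsum m g := by
  obtain ⟨J, hJ⟩ := hf
  obtain ⟨K, hK⟩ := hg
  have hf' : ∀ j, max J K ≤ j → f j = 0 := fun j hj => hJ j (le_of_max_le_left hj)
  have hg' : ∀ j, max J K ≤ j → g j = 0 := fun j hj => hK j (le_of_max_le_right hj)
  rw [bsum_eq hf', bsum_eq hg', bsum_eq (J := max J K) (fun j hj => by rw [hf' j hj, hg' j hj, add_zero]),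
    ← sum_add_distrib]
  simp

theorem bsum_map {f : ℕ → W} (hf : EvZero f) (F : W →+ W') (m : ℤ) :
    bsum m (fun j => F (f j)) = F (bsum m f) := by
  obtain ⟨J, hJ⟩ := hf
  rw [bsum_eq hJ, bsum_eq (J := J) (fun j hj => by rw [hJ j hj, map_zero]), map_sum]
  simp

theorem bsum_neg {f : ℕ → W} (m : ℤ) : bsum m (fun j => - f j) = - bsum m f := by
  simp [bsum, finsum_neg_distrib]

theorem bsum_sub {f g : ℕ → W} (hf : EvZero f) (hg : EvZero g) (m : ℤ) :
    bsum m (fun j => f j - g j) = bsum m f - bsum m g := by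
  simp only [sub_eq_add_neg]
  rw [bsum_add hf hg.neg, bsum_neg]

theorem bsum_zero (f : ℕ → W) : bsum 0 f = f 0 := by
  rw [bsum, finsum_eq_single _ 0]
  · simp
  · intro j hj
    rw [Ring.choose_zero_pos ℤ (Nat.pos_of_ne_zero hj), zero_smul]

theorem bsum_succ {f : ℕ → W} (hf : EvZero f) (m : ℤ) :
    bsum (m + 1) f = bsum m f + bsum m (fun j => f (j + 1)) := by
  obtain ⟨J, hJ⟩ := hf
  rw [bsum_eq (J := J + 1) fun j hj => hJ j (by omega), bsum_eq (J := J + 1) fun j hj => hJ j (by omega),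
    bsum_eq (J := J) fun j hj => hJ (j + 1) (by omega), sum_range_succ', sum_range_succ']
  simp only [Ring.choose_succ_succ, add_smul, sum_add_distrib, Ring.choose_zero_right]
  abel

/-- A doubly indexed family that vanishes outside a finite square. -/
def EvZero₂ (f : ℕ → ℕ → W) : Prop := ∃ J, ∀ i j, (J ≤ i ∨ J ≤ j) → f i j = 0

theorem bsum_comm {f : ℕ → ℕ → W} (hf : EvZero₂ f) (m p : ℤ) :
    bsum m (fun i => bsum p (fun j => f i j)) = bsum p (fun j => bsum m (fun i => f i j)) := by
  obtain ⟨J, hJ⟩ := hf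
  rw [bsum_eq (J := J), bsum_eq (J := J)]
  · simp_rw [fun i => bsum_eq (f := fun j => f i j) (J := J) (fun j hj => hJ i j (Or.inr hj)) p,
      fun j => bsum_eq (f := fun i => f i j) (J := J) (fun i hi => hJ i j (Or.inl hi)) m,
      smul_sum]
    rw [Finset.sum_comm]
    simp_rw [smul_smul, mul_comm]
  · intro j hj
    rw [show (fun i => f i j) = fun _ => 0 from funext fun i => hJ i j (Or.inr hj), bsum_zero_fun]
  · intro i hi
    rw [show (fun j => f i j) = fun _ => 0 from funext fun j => hJ i j (Or.inl hi), bsum_zero_fun]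

theorem bsum_bsum_add {f : ℕ → W} (hf : EvZero f) (m p : ℤ) :
    bsum m (fun i => bsum p (fun q => f (i + q))) = bsum (m + p) f := by
  obtain ⟨J, hJ⟩ := hf
  rw [bsum_eq (J := J), bsum_eq (J := J) hJ]
  · simp_rw [fun i => bsum_eq (f := fun q => f (i + q)) (J := J - i) (fun q hq => hJ _ (by omega)) p,
      smul_sum, smul_smul, Ring.add_choose_eq _ (Commute.all m p), Finset.sum_smul]
    rw [← Finset.sum_finset_product' (range J ×ˢ range J |>.filter
      fun x => x.1 + x.2 < J) _ _ (by intro x; simp; omega)]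
    symm
    rw [Finset.sum_sigma']
    refine Finset.sum_bij' (fun x _ => (x.2.1, x.2.2)) (fun y _ => ⟨y.1 + y.2, (y.1, y.2)⟩)
      ?_ ?_ ?_ ?_ ?_
    · rintro ⟨a, b, c⟩ h
      simp at h ⊢; omega
    · rintro ⟨a, b⟩ h
      simp at h ⊢; omega
    · rintro ⟨a, b, c⟩ h
      simp at h ⊢; omega
    · rintro ⟨a, b⟩ h; rfl
    · rintro ⟨a, b, c⟩ h
      have := Finset.HasAntidiagonal.mem_antidiagonal.1 (Finset.mem_sigma.1 h).2
      simp only at this ⊢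
      rw [← this]
  · intro i hi
    rw [show (fun q => f (i + q)) = fun _ => 0 from funext fun q => hJ _ (by omega), bsum_zero_fun]

theorem bsum_trinomial {G : ℕ → ℕ → W} (hG : EvZero₂ G) (p : ℤ) :
    bsum p (fun j => bsum j (fun l => G l j)) =
      bsum p (fun l => bsum (p - l) (fun q => G l (l + q))) := by
  obtain ⟨J, hJ⟩ := hG
  rw [bsum_eq (J := J), bsum_eq (J := J)]
  · simp_rw [fun j : ℕ => bsum_eq (f := fun l => G l j) (J := J) (fun l hl => hJ l j (Or.inl hl)) j,
      fun l : ℕ => bsum_eq (f := fun q => G l (l + q)) (J := J - l)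
        (fun q hq => hJ _ _ (Or.inr (by omega))) (p - l), smul_sum, smul_smul]
    rw [Finset.sum_comm]
    refine sum_congr rfl fun l hl => ?_
    rw [mem_range] at hl
    rw [← Finset.sum_range_add_sum_Ico _ hl.le, sum_eq_zero, zero_add,
      Finset.sum_Ico_eq_sum_range]
    · refine sum_congr rfl fun q hq => ?_
      have := Ring.choose_smul_choose p (n := l + q) (k := l) (by omega)
      rw [choose_natCast, mul_comm]
      rw [nsmul_eq_mul, Nat.add_sub_cancel_left] at this
      rw [this]
    · intro j hj
      rw [mem_range] at hj
      rw [choose_natCast, Nat.choose_eq_zero_of_lt hj]; simp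
  · intro l hl
    rw [show (fun q => G l (l + q)) = fun _ => 0 from funext fun q => hJ _ _ (Or.inl hl), bsum_zero_fun]
  · intro j hj
    rw [show (fun l => G l j) = fun _ => 0 from funext fun l => hJ _ _ (Or.inr hj), bsum_zero_fun]

/-- `(m choose j+1) (j+1) = (m choose j) (m - j)`. -/
theorem bsum_absorb {f : ℕ → W} (hf : EvZero f) (m : ℤ) :
    bsum m (fun j => (j : ℤ) • f j) = bsum m (fun j => (m - j) • f (j + 1)) := by
  obtain ⟨J, hJ⟩ := hf
  rw [bsum_eq (J := J + 1) fun j hj => by rw [hJ j (by omega), smul_zero],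
    bsum_eq (J := J) fun j hj => by rw [hJ (j + 1) (by omega), smul_zero], sum_range_succ']
  simp only [cast_zero, zero_smul, smul_zero, add_zero]
  refine sum_congr rfl fun j _ => ?_
  rw [smul_smul, smul_smul]
  congr 1
  have := Ring.choose_smul_choose m (n := j + 1) (k := j) (by omega)
  rw [Nat.choose_succ_self_right, nsmul_eq_mul, Nat.add_sub_cancel_left, Ring.choose_one_right] at this
  rw [← this, mul_comm]

/-- `(m choose j+1) (j+1) = m (m-1 choose j)`. -/
theorem bsum_absorb_left {f : ℕ → W} (hf : EvZero f) (m : ℤ) :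
    bsum m (fun j => (j : ℤ) • f j) = m • bsum (m - 1) (fun j => f (j + 1)) := by
  obtain ⟨J, hJ⟩ := hf
  rw [bsum_eq (J := J + 1) fun j hj => by rw [hJ j (by omega), smul_zero],
    bsum_eq (J := J) fun j hj => hJ (j + 1) (by omega), sum_range_succ', smul_sum]
  simp only [cast_zero, zero_smul, smul_zero, add_zero]
  refine sum_congr rfl fun j _ => ?_
  rw [smul_smul, smul_smul]
  congr 1
  have := Ring.choose_smul_choose m (n := j + 1) (k := 1) (by omega)
  rw [Nat.choose_one_right, nsmul_eq_mul, Nat.add_sub_cancel, Ring.choose_one_right] at this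
  rw [mul_comm, this, Nat.cast_one]

/-- `(m choose j) (m-j) = m (m-1 choose j)`. -/
theorem bsum_absorb_right {g : ℕ → W} (hg : EvZero g) (m : ℤ) :
    bsum m (fun j => (m - j) • g j) = m • bsum (m - 1) g := by
  have h : EvZero fun j => g (j - 1) := by
    obtain ⟨J, hJ⟩ := hg
    exact ⟨J + 1, fun j hj => hJ _ (by omega)⟩
  have h1 := bsum_absorb h m
  have h2 := bsum_absorb_left h m
  simp only [Nat.add_sub_cancel] at h1 h2
  rw [← h1, h2]

theorem bsum_neg_one {f : ℕ → W} (hf : EvZero f) : bsum (-1) f = f 0 - bsum (-1) fun j => f (j + 1) := by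
  have := bsum_succ hf (-1)
  rw [neg_add_cancel, bsum_zero] at this
  rw [this]; abel

/-- A triply indexed family that satisfies the recursion of Pascal's triangle vanishes if it vanishes
on two planes. -/
theorem pascal_eq_zero {G : ℤ → ℤ → ℤ → W} (h : ∀ m n k, G m (n + 1) k = G (m + 1) n k - G m n (k + 1))
    (h0 : ∀ n k, G 0 n k = 0) (h1 : ∀ m k, G m 0 k = 0) (m n k : ℤ) : G m n k = 0 := by
  have hpos : ∀ (i : ℕ) n k, G i n k = 0 := by
    intro i
    induction i with
    | zero => exact h0
    | succ i ih =>
      intro n k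
      have := h i n k
      rw [ih, ih, sub_zero] at this
      exact_mod_cast this.symm
  have hpos' : ∀ (i : ℕ) m k, G m i k = 0 := by
    intro i
    induction i with
    | zero => exact h1
    | succ i ih =>
      intro m k
      have := h m i k
      rw [ih, ih, sub_zero] at this
      exact_mod_cast this
  have hneg : ∀ (i j : ℕ) k, G (-i) (-j) k = 0 := by
    intro i
    induction i with
    | zero => intro j k; exact_mod_cast h0 (-j) k
    | succ i ih =>
      intro j
      induction j with
      | zero => intro k; exact_mod_cast h1 _ k
      | succ j jh =>
        intro k
        have := h (-(i + 1 : ℕ)) (-(j + 1 : ℕ)) (k - 1)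
        rw [show (-(j + 1 : ℕ) + 1 : ℤ) = -j by push_cast; ring,
          show (-(i + 1 : ℕ) + 1 : ℤ) = -i by push_cast; ring, jh, ih, sub_add_cancel, zero_sub] at this
        exact neg_eq_zero.1 this.symm
  rcases Int.eq_nat_or_neg m with ⟨i, rfl | rfl⟩
  · exact hpos i n k
  · rcases Int.eq_nat_or_neg n with ⟨j, rfl | rfl⟩
    · exact hpos' j _ k
    · exact hneg i j k

theorem bsum_natCast (m : ℕ) (f : ℕ → W) :
    bsum m f = ∑ j ∈ range (m + 1), Ring.choose (m : ℤ) j • f j := by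
  apply finsum_eq_sum_of_support_subset
  intro j hj
  by_contra hc
  simp only [coe_range, mem_Iio, not_lt] at hc
  refine hj ?_
  beta_reduce
  rw [choose_natCast, Nat.choose_eq_zero_of_lt (by omega)]
  simp

theorem bsum_natCast_eq_zero {m : ℕ} {f : ℕ → W} (h : ∀ j ≤ m, f j = 0) : bsum m f = 0 := by
  rw [bsum_natCast]
  exact sum_eq_zero fun j hj => by rw [h j (by simpa [Nat.lt_succ_iff] using hj), smul_zero]

theorem bsum_smul {f : ℕ → W} (hf : EvZero f) (c m : ℤ) : bsum m (fun j => c • f j) = c • bsum m f :=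
  bsum_map hf (zsmulAddGroupHom c) m

theorem bsum_csmul [Module ℂ W] {f : ℕ → W} (hf : EvZero f) (c : ℂ) (m : ℤ) :
    bsum m (fun j => c • f j) = c • bsum m f :=
  bsum_map hf (DistribSMul.toAddMonoidHom W c) m

theorem bsum_mul_left {A : Type} [Ring A] {f : ℕ → A} (hf : EvZero f) (x : A) (m : ℤ) :
    bsum m (fun j => x * f j) = x * bsum m f :=
  bsum_map hf (mulLeft x) m

theorem bsum_linearMap [Module ℂ W] [Module ℂ W'] {f : ℕ → W} (hf : EvZero f) (F : W →ₗ[ℂ] W') (m : ℤ) :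
    bsum m (fun j => F (f j)) = F (bsum m f) :=
  bsum_map hf F.toAddMonoidHom m

theorem EvZero.sub {f g : ℕ → W} (hf : EvZero f) (hg : EvZero g) : EvZero fun j => f j - g j := by
  simpa only [sub_eq_add_neg] using hf.add hg.neg

theorem EvZero₂.of {f : ℕ → ℕ → W} (h : ∃ J, ∀ i, J ≤ i → ∀ j, f i j = 0) (h' : ∀ i, EvZero (f i)) :
    EvZero₂ f := by
  obtain ⟨J, hJ⟩ := h
  choose K hK using h'
  refine ⟨max J ((range J).sup K), fun i j hij => ?_⟩
  by_cases hi : J ≤ i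
  · exact hJ i hi j
  · rcases hij with hij | hij
    · exact absurd (le_of_max_le_left hij) hi
    · exact hK i j ((Finset.le_sup (Finset.mem_range.2 (not_le.1 hi))).trans (le_of_max_le_right hij))

theorem EvZero₂.evZero_bsum {f : ℕ → ℕ → W} (hf : EvZero₂ f) (p : ℤ) :
    EvZero fun i => bsum p (f i) := by
  obtain ⟨J, hJ⟩ := hf
  refine ⟨J, fun i hi => ?_⟩
  have : f i = fun _ => 0 := funext fun j => hJ i j (Or.inl hi)
  change bsum p (f i) = 0
  rw [this, bsum_zero_fun]

/-- The sign `(-1)ⁿ`. -/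
def sg (n : ℤ) : ℤ := n.negOnePow

theorem sg_zero : sg 0 = 1 := by simp [sg]
theorem sg_succ (n : ℤ) : sg (n + 1) = - sg n := by simp [sg, Int.negOnePow_succ]
theorem sg_add (m n : ℤ) : sg (m + n) = sg m * sg n := by simp [sg, Int.negOnePow_add]
theorem sg_mul_self (n : ℤ) : sg n * sg n = 1 := by
  rw [sg, ← val_mul, Int.units_mul_self]; rfl

end BinomialSum

/-! ### Free field vertex superalgebras -/

/-- The singular parts `φⁱ(x) φʲ(y) ∼ gᵢⱼ / (x - y) ^ (ord + 1)` of the operator product expansions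
of a system of free fields; the fields are even if `ord` is odd and odd if `ord` is even. -/
structure FieldData : Type 1 where
  I : Type
  ord : ℕ
  g : I → I → ℂ
  symm : ∀ i j, g i j = g j i

namespace FieldData

variable (F : FieldData)

/-- The sign with which two of the fields commute. -/
def eps : ℂ := (-1) ^ (F.ord + 1)

theorem eps_mul_eps : F.eps * F.eps = 1 := by
  rw [eps, ← pow_add, ← two_mul, pow_mul]; simp

/-- The relations of (super)commutativity between the creation operators. -/
inductive Rel : FreeAlgebra ℂ (F.I × ℕ) → FreeAlgebra ℂ (F.I × ℕ) → Prop
  | comm (p q) : Rel (.ι ℂ p * .ι ℂ q) (F.eps • (.ι ℂ q * .ι ℂ p))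

/-- The Fock space: the free supercommutative algebra generated by the creation operators. -/
def Fock : Type := RingQuot F.Rel

instance : Ring F.Fock := inferInstanceAs (Ring (RingQuot F.Rel))
instance : Algebra ℂ F.Fock := inferInstanceAs (Algebra ℂ (RingQuot F.Rel))

/-- The projection from the free algebra. -/
def mkFock : FreeAlgebra ℂ (F.I × ℕ) →ₐ[ℂ] F.Fock := RingQuot.mkAlgHom ℂ F.Rel

/-- The creation operator `φⁱ₍₋ᵣ₋₁₎`. -/
def cr (p : F.I × ℕ) : F.Fock := F.mkFock (.ι ℂ p)

theorem cr_comm (p q) : F.cr p * F.cr q = F.eps • (F.cr q * F.cr p) := by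
  have : F.mkFock _ = F.mkFock _ := RingQuot.mkAlgHom_rel ℂ (Rel.comm (F := F) p q)
  simpa [cr] using this

/-- The universal property of the Fock space as an algebra. -/
def lift {S : Type} [Ring S] [Algebra ℂ S] (f : F.I × ℕ → S)
    (h : ∀ p q, f p * f q = F.eps • (f q * f p)) : F.Fock →ₐ[ℂ] S :=
  RingQuot.liftAlgHom ℂ ⟨FreeAlgebra.lift ℂ f, by
    intro x y hxy
    cases hxy with
    | comm p q => simpa using h p q⟩

@[simp]
theorem lift_cr {S : Type} [Ring S] [Algebra ℂ S] (f : F.I × ℕ → S)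
    (h : ∀ p q, f p * f q = F.eps • (f q * f p)) (p) : F.lift f h (F.cr p) = f p :=
  (RingQuot.liftAlgHom_mkAlgHom_apply ..).trans (FreeAlgebra.lift_ι_apply _ _)

variable {F}

/-- The Fock space is generated from the vacuum by the creation operators. -/
theorem Fock.induction {P : F.Fock → Prop} (one : P 1) (add : ∀ v w, P v → P w → P (v + w))
    (smul : ∀ (c : ℂ) v, P v → P (c • v)) (cr : ∀ p v, P v → P (F.cr p * v)) (v : F.Fock) : P v := by
  let S : Submodule ℂ F.Fock :=
    { carrier := {v | P v}
      add_mem' := fun {a b} => add a b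
      zero_mem' := by simpa using smul 0 1 one
      smul_mem' := smul }
  have key : ∀ a : FreeAlgebra ℂ (F.I × ℕ), ∀ v ∈ S, F.mkFock a * v ∈ S := by
    intro a
    induction a using FreeAlgebra.induction with
    | grade0 c =>
      intro v hv
      rw [commutes]
      exact (smul_def c v).symm ▸ S.smul_mem c hv
    | grade1 p => exact fun v hv => cr p v hv
    | mul a b ha hb =>
      intro v hv
      rw [map_mul, mul_assoc]
      exact ha _ (hb _ hv)
    | add a b ha hb =>
      intro v hv
      rw [map_add, add_mul]
      exact S.add_mem (ha _ hv) (hb _ hv)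
  obtain ⟨a, rfl⟩ : ∃ a, F.mkFock a = v := RingQuot.mkAlgHom_surjective ℂ F.Rel v
  have := key a 1 one
  rwa [mul_one] at this

variable (F)

/-- The algebra map that computes the derivation with given values `D p` on the generators, twisted
by the automorphism that multiplies the generators with the sign `s`. -/
def derAux (s : ℂ) (D : F.I × ℕ → F.Fock)
    (h : ∀ p q, s • (F.cr p * D q) + D p * F.cr q = F.eps • (s • (F.cr q * D p) + D q * F.cr p)) :
    F.Fock →ₐ[ℂ] Matrix (Fin 2) (Fin 2) F.Fock :=
  F.lift (fun p => !![s • F.cr p, D p; 0, F.cr p]) (by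
    intro p q
    rw [Matrix.mul_fin_two, Matrix.mul_fin_two, Matrix.smul_of]
    ext i j
    fin_cases i <;> fin_cases j
    · have := F.cr_comm p q
      simp [this, smul_smul]; ring_nf
    · simpa using h p q
    · simp
    · simpa using F.cr_comm p q)

theorem derAux_cr (s : ℂ) (D : F.I × ℕ → F.Fock) (h) (p) :
    F.derAux s D h (F.cr p) = !![s • F.cr p, D p; 0, F.cr p] := F.lift_cr ..

/-- The (twisted) derivation with given values on the generators. -/
def der (s : ℂ) (D : F.I × ℕ → F.Fock)
    (h : ∀ p q, s • (F.cr p * D q) + D p * F.cr q = F.eps • (s • (F.cr q * D p) + D q * F.cr p)) :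
    F.Fock →ₗ[ℂ] F.Fock :=
  Matrix.entryLinearMap ℂ F.Fock 0 1 ∘ₗ (F.derAux s D h).toLinearMap

theorem derAux_diag (s : ℂ) (D : F.I × ℕ → F.Fock) (h) (v : F.Fock) :
    F.derAux s D h v 1 1 = v ∧ F.derAux s D h v 1 0 = 0 := by
  induction v using Fock.induction with
  | one => simp
  | add v w hv hw => simp [hv, hw]
  | smul c v hv => simp [hv]
  | cr p v hv =>
    rw [map_mul, derAux_cr, Matrix.mul_apply, Matrix.mul_apply]
    simp [hv]

theorem der_one (s : ℂ) (D : F.I × ℕ → F.Fock) (h) : F.der s D h 1 = 0 := by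
  simp [der]

theorem der_cr_mul (s : ℂ) (D : F.I × ℕ → F.Fock) (h) (p) (v : F.Fock) :
    F.der s D h (F.cr p * v) = D p * v + s • (F.cr p * F.der s D h v) := by
  change F.derAux s D h _ 0 1 = _ + s • (_ * F.derAux s D h v 0 1)
  rw [map_mul, derAux_cr, Matrix.mul_apply]
  simp [derAux_diag, add_comm]

/-- The parity automorphism. -/
def theta : F.Fock →ₐ[ℂ] F.Fock :=
  F.lift (fun p => F.eps • F.cr p) (by
    intro p q
    simp only [smul_mul_smul_comm, F.cr_comm p q, smul_smul]
    ring_nf)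

@[simp] theorem theta_cr_mul (p) (v : F.Fock) :
    F.theta (F.cr p * v) = F.eps • (F.cr p * F.theta v) := by
  simp [theta]

@[simp] theorem theta_theta (v : F.Fock) : F.theta (F.theta v) = v := by
  induction v using Fock.induction with
  | one => simp
  | add v w hv hw => simp [hv, hw]
  | smul c v hv => simp [hv]
  | cr p v hv => simp [hv, smul_smul, F.eps_mul_eps]

/-- The translation operator. -/
def trans : F.Fock →ₗ[ℂ] F.Fock :=
  F.der 1 (fun p => (p.2 + 1 : ℂ) • F.cr (p.1, p.2 + 1)) (by
    intro p q
    simp only [one_smul, mul_smul_comm, smul_mul_assoc, smul_add, F.cr_comm p, F.cr_comm _ q]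
    rw [smul_comm F.eps, smul_comm F.eps, add_comm])

@[simp] theorem trans_one : F.trans 1 = 0 := F.der_one ..

theorem trans_cr_mul (p) (v : F.Fock) : F.trans (F.cr p * v) =
    (p.2 + 1 : ℂ) • (F.cr (p.1, p.2 + 1) * v) + F.cr p * F.trans v := by
  rw [trans, der_cr_mul, one_smul, smul_mul_assoc]

/-- The annihilation operator `φⁱ₍ₘ₎`, `m ≥ 0`. -/
def an (i : F.I) (m : ℕ) : F.Fock →ₗ[ℂ] F.Fock :=
  F.der F.eps (fun p => algebraMap ℂ _ (if m = p.2 + F.ord then F.g i p.1 * Ring.choose (m : ℤ) F.ord else 0)) (by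
    intro p q
    generalize (if m = p.2 + F.ord then F.g i p.1 * Ring.choose (m : ℤ) F.ord else 0 : ℂ) = c
    generalize (if m = q.2 + F.ord then F.g i q.1 * Ring.choose (m : ℤ) F.ord else 0 : ℂ) = c'
    rw [← Algebra.commutes, ← Algebra.commutes, ← smul_def, ← smul_def,
      smul_add, smul_smul F.eps F.eps, F.eps_mul_eps, one_smul,
      add_comm])

@[simp] theorem an_one (i m) : F.an i m 1 = 0 := F.der_one ..

/-- The commutator of the modes `φⁱ₍ₘ₎` and `φʲ₍ₙ₎`. -/
def contr (i j : F.I) (m n : ℤ) : ℂ := if m + n + 1 = F.ord then F.g i j * Ring.choose m F.ord else 0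

theorem an_cr_mul (i m) (p) (v : F.Fock) : F.an i m (F.cr p * v) =
    F.contr i p.1 m (negSucc p.2) • v + F.eps • (F.cr p * F.an i m v) := by
  rw [an, der_cr_mul, ← smul_def, contr]
  have : (m : ℤ) + negSucc p.2 + 1 = F.ord ↔ m = p.2 + F.ord := by
    rw [negSucc_eq]; omega
  simp only [this]

theorem theta_an (i m) (v : F.Fock) : F.theta (F.an i m v) = F.eps • F.an i m (F.theta v) := by
  induction v using Fock.induction with
  | one => simp
  | add v w hv hw => simp [hv, hw]
  | smul c v hv => simp [hv, smul_comm c]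
  | cr p v hv =>
    simp only [an_cr_mul, map_add, map_smul, theta_cr_mul, hv, smul_add, smul_smul, mul_smul_comm,
      F.eps_mul_eps, one_smul, ← mul_assoc, one_mul]

theorem an_an (i j m n) (v : F.Fock) : F.an i m (F.an j n v) = F.eps • F.an j n (F.an i m v) := by
  induction v using Fock.induction with
  | one => simp
  | add v w hv hw => simp [hv, hw]
  | smul c v hv => simp [hv, smul_comm c]
  | cr p v hv =>
    simp only [an_cr_mul, map_add, map_smul, hv, smul_add, smul_smul, mul_smul_comm,
      F.eps_mul_eps, one_smul, ← mul_assoc, one_mul]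
    abel

theorem trans_an (i m) (v : F.Fock) :
    F.an i m (F.trans v) = F.trans (F.an i m v) + (m : ℂ) • F.an i (m - 1) v := by
  induction v using Fock.induction with
  | one => simp
  | add v w hv hw => simp only [map_add, hv, hw, smul_add]; abel
  | smul c v hv => simp only [map_smul, hv, smul_add, smul_comm c]
  | cr p v hv =>
    simp only [trans_cr_mul, an_cr_mul, map_add, map_smul, hv, smul_add, mul_add, mul_smul_comm]
    have : (p.2 + 1 : ℂ) * F.contr i p.1 m (negSucc (p.2 + 1)) =
        m * F.contr i p.1 (m - 1 : ℕ) (negSucc p.2) := by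
      unfold contr
      rcases m with _ | m
      · rw [if_neg (by rw [negSucc_eq]; push_cast; omega)]; simp
      · have h : ((m + 1 : ℕ) : ℤ) + negSucc (p.2 + 1) + 1 = F.ord ↔ m = p.2 + F.ord := by
          rw [negSucc_eq]; push_cast; omega
        have h' : ((m + 1 - 1 : ℕ) : ℤ) + negSucc p.2 + 1 = F.ord ↔ m = p.2 + F.ord := by
          rw [negSucc_eq]; push_cast; omega
        simp only [h, h']
        split_ifs with hm
        · have := Nat.choose_mul_succ_eq m F.ord
          rw [show m + 1 - F.ord = p.2 + 1 by omega] at this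
          rw [choose_natCast, choose_natCast]
          have h := congrArg (Nat.cast (R := ℂ)) this
          push_cast at h ⊢
          linear_combination (-F.g i p.1) * h
        · simp
    linear_combination (norm := module) this • v

/-- The mode `φⁱ₍ₘ₎`, `m ∈ ℤ`. -/
def phi (i : F.I) : ℤ → F.Fock →ₗ[ℂ] F.Fock
  | .ofNat m => F.an i m
  | .negSucc r => LinearMap.mulLeft ℂ (F.cr (i, r))

theorem phi_natCast (i m) : F.phi i (m : ℕ) = F.an i m := rfl

theorem phi_negSucc (i r) (v : F.Fock) : F.phi i (.negSucc r) v = F.cr (i, r) * v := rfl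

theorem contr_symm (i j m n) : F.contr i j m n = - F.eps * F.contr j i n m := by
  unfold contr
  by_cases h : m + n + 1 = F.ord
  · rw [if_pos h, if_pos (by omega), F.symm j i]
    obtain rfl : n = -(m - F.ord + 1) := by omega
    rw [Ring.choose_neg]
    rw [show m - F.ord + 1 + F.ord - 1 = m by ring, Units.smul_def, smul_eq_mul, eps]
    push_cast
    have : ((-1 : ℂ) ^ F.ord) * (-1) ^ F.ord = 1 := by rw [← pow_add, ← two_mul, pow_mul]; simp
    rw [Int.cast_negOnePow_natCast]
    linear_combination (- F.g i j * (Ring.choose m F.ord : ℤ)) * this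
  · rw [if_neg h, if_neg (by omega), mul_zero]

theorem phi_comm (i j m n) (v : F.Fock) : F.phi i m (F.phi j n v) =
    F.eps • F.phi j n (F.phi i m v) + F.contr i j m n • v := by
  rcases m with m | r <;> rcases n with n | s
  · have : F.contr i j (Int.ofNat m) (Int.ofNat n) = 0 := by
      unfold contr
      split_ifs with h
      · have : m < F.ord := by
          simp only [ofNat_eq_natCast] at h; omega
        simp only [ofNat_eq_natCast]
        rw [choose_natCast, Nat.choose_eq_zero_of_lt this]; simp
      · rfl
    rw [this, zero_smul, add_zero]
    exact F.an_an i j m n v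
  · rw [add_comm]
    exact F.an_cr_mul i m (j, s) v
  · have := F.an_cr_mul j n (i, r) v
    rw [contr_symm]
    change F.cr (i, r) * F.an j n v = F.eps • F.an j n (F.cr (i, r) * v) + _
    simp only [ofNat_eq_natCast]
    rw [this, smul_add, smul_smul, smul_smul, F.eps_mul_eps]
    module
  · have : F.contr i j (negSucc r) (negSucc s) = 0 := by
      unfold contr
      rw [if_neg (by rw [negSucc_eq, negSucc_eq]; omega)]
    rw [this, zero_smul, add_zero]
    change F.cr (i, r) * (F.cr (j, s) * v) = F.eps • (F.cr (j, s) * (F.cr (i, r) * v))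
    rw [← mul_assoc, F.cr_comm, smul_mul_assoc, mul_assoc]

theorem theta_phi (i m) (v : F.Fock) : F.theta (F.phi i m v) = F.eps • F.phi i m (F.theta v) := by
  rcases m with m | r
  · exact F.theta_an i m v
  · exact F.theta_cr_mul (i, r) v

theorem phi_trans (i m) (v : F.Fock) :
    F.phi i m (F.trans v) = F.trans (F.phi i m v) + (m : ℂ) • F.phi i (m - 1) v := by
  rcases m with m | r
  · rcases m with _ | m
    · have := F.trans_an i 0 v
      change F.an i 0 _ = F.trans (F.an i 0 v) + _
      simpa using this
    · have := F.trans_an i (m + 1) v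
      rw [show (Int.ofNat (m + 1) - 1 : ℤ) = (m : ℕ) by simp]
      exact this
  · have := F.trans_cr_mul (i, r) v
    rw [show (negSucc r - 1 : ℤ) = negSucc (r + 1) by rw [negSucc_eq, negSucc_eq]; push_cast; ring]
    rw [phi_negSucc, phi_negSucc, phi_negSucc, this, negSucc_eq]
    push_cast
    module

theorem exists_bound (v : F.Fock) : ∃ J : ℕ, ∀ i, ∀ m, J ≤ m → F.an i m v = 0 := by
  induction v using Fock.induction with
  | one => exact ⟨0, fun i m _ => F.an_one i m⟩
  | add v w hv hw =>
    obtain ⟨J, hJ⟩ := hv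
    obtain ⟨K, hK⟩ := hw
    exact ⟨max J K, fun i m h => by
      rw [map_add, hJ i m (le_of_max_le_left h), hK i m (le_of_max_le_right h), add_zero]⟩
  | smul c v hv =>
    obtain ⟨J, hJ⟩ := hv
    exact ⟨J, fun i m h => by rw [map_smul, hJ i m h, smul_zero]⟩
  | cr p v hv =>
    obtain ⟨J, hJ⟩ := hv
    refine ⟨max J (p.2 + F.ord + 1), fun i m h => ?_⟩
    rw [an_cr_mul, hJ i m (le_of_max_le_left h), contr, if_neg]
    · simp
    · have := le_of_max_le_right h
      rw [negSucc_eq]; omega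

theorem evZero_an (i) (v : F.Fock) : EvZero fun m => F.an i m v :=
  let ⟨J, hJ⟩ := F.exists_bound v
  ⟨J, hJ i⟩

/-- All annihilation operators at once. -/
def anF (i : F.I) : F.Fock →ₗ[ℂ] ℕ →₀ F.Fock where
  toFun v := Finsupp.ofSupportFinite (fun m => F.an i m v) (by
    obtain ⟨J, hJ⟩ := F.exists_bound v
    refine (range J).finite_toSet.subset fun m hm => ?_
    by_contra hc
    exact hm (hJ i m (by simpa using hc)))
  map_add' v w := Finsupp.ext fun m => map_add (F.an i m) v w
  map_smul' c v := Finsupp.ext fun m => map_smul (F.an i m) c v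

theorem anF_apply (i m) (v : F.Fock) : F.anF i v m = F.an i m v := rfl

/-- The divided powers of the translation operator. -/
def tpow (r : ℕ) : F.Fock →ₗ[ℂ] F.Fock := ((r.factorial : ℂ)⁻¹) • F.trans ^ r

theorem tpow_zero (v : F.Fock) : F.tpow 0 v = v := by simp [tpow]

theorem trans_tpow (r) (v : F.Fock) : F.trans (F.tpow r v) = (r + 1 : ℂ) • F.tpow (r + 1) v := by
  simp only [tpow, LinearMap.smul_apply, map_smul, pow_succ', End.mul_apply, smul_smul,
    Nat.factorial_succ]
  congr 1
  push_cast
  field_simp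

theorem tpow_trans (r) (v : F.Fock) : F.tpow r (F.trans v) = (r + 1 : ℂ) • F.tpow (r + 1) v := by
  rw [← trans_tpow]
  simp only [tpow, LinearMap.smul_apply, map_smul]
  rw [← End.mul_apply, ← End.mul_apply, (Commute.self_pow F.trans r).eq]

theorem tpow_one_right (r) : F.tpow (r + 1) 1 = 0 := by
  simp [tpow, pow_succ]

end FieldData

namespace FieldData

variable (F : FieldData)

/-- Auxiliary: the recursion for the modes `a₍ₙ₎ (φ₍₋ᵣ₋₁₎ b)` in terms of the modes `a₍ₙ₎ b`. -/
def raiseAux (p : F.I × ℕ) (G : F.Fock →ₗ[ℂ] (ℤ → F.Fock)) : F.Fock →ₗ[ℂ] (ℤ → F.Fock) :=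
  LinearMap.pi fun n => LinearMap.mulLeft ℂ (F.cr p) ∘ₗ LinearMap.proj n ∘ₗ G ∘ₗ F.theta.toLinearMap -
    (Finsupp.lsum ℂ fun j : ℕ => Ring.choose (negSucc p.2) j •
      (LinearMap.proj (negSucc p.2 + n - j) ∘ₗ G)) ∘ₗ F.anF p.1 ∘ₗ F.theta.toLinearMap

theorem raiseAux_apply (p : F.I × ℕ) (G : F.Fock →ₗ[ℂ] (ℤ → F.Fock)) (a : F.Fock) (n : ℤ) :
    F.raiseAux p G a n = F.cr p * G (F.theta a) n -
      bsum (.negSucc p.2) fun j => G (F.an p.1 j (F.theta a)) (negSucc p.2 + n - j) := by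
  simp only [raiseAux, LinearMap.pi_apply, LinearMap.sub_apply, comp_apply,
    LinearMap.mulLeft_apply, LinearMap.proj_apply, toLinearMap_apply]
  congr 1
  rw [Finsupp.lsum_apply, Finsupp.sum, bsum]
  symm
  apply finsum_eq_sum_of_support_subset
  intro j hj
  rw [Finset.mem_coe, Finsupp.mem_support_iff]
  intro h
  rw [anF_apply] at h
  exact hj (by simp [h])

theorem evZero_apply_an (G : F.Fock →ₗ[ℂ] (ℤ → F.Fock)) (i) (a : F.Fock) (k : ℕ → ℤ) :
    EvZero fun j => G (F.an i j a) (k j) :=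
  (F.evZero_an i a).map_seq (fun j x => G x (k j)) fun j => by simp

/-- The recursion for the modes `a₍ₙ₎ (φ₍₋ᵣ₋₁₎ b)` in terms of the modes `a₍ₙ₎ b`. -/
def raise (p : F.I × ℕ) : End ℂ (F.Fock →ₗ[ℂ] (ℤ → F.Fock)) where
  toFun := F.raiseAux p
  map_add' G G' := by
    ext a n
    simp only [raiseAux_apply, LinearMap.add_apply, Pi.add_apply, mul_add]
    rw [bsum_add (F.evZero_apply_an ..) (F.evZero_apply_an ..)]
    abel
  map_smul' c G := by
    ext a n
    simp only [raiseAux_apply, LinearMap.smul_apply, Pi.smul_apply, mul_smul_comm, smul_sub,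
      RingHom.id_apply]
    rw [bsum_csmul (F.evZero_apply_an ..)]

theorem raise_apply (p : F.I × ℕ) (G : F.Fock →ₗ[ℂ] (ℤ → F.Fock)) (a : F.Fock) (n : ℤ) :
    F.raise p G a n = F.cr p * G (F.theta a) n -
      bsum (.negSucc p.2) fun j => G (F.an p.1 j (F.theta a)) (negSucc p.2 + n - j) :=
  F.raiseAux_apply p G a n

theorem evZero₂_an_an (i j) (a : F.Fock) : EvZero₂ fun m n => F.an i m (F.an j n a) := by
  obtain ⟨J, hJ⟩ := F.exists_bound a
  refine ⟨J, fun m n h => ?_⟩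
  beta_reduce
  rcases h with h | h
  · rw [an_an, hJ i m h, map_zero, smul_zero]
  · rw [hJ j n h, map_zero]

theorem raise_raise (p q : F.I × ℕ) : F.raise p * F.raise q = F.eps • (F.raise q * F.raise p) := by
  have key (p q : F.I × ℕ) (G : F.Fock →ₗ[ℂ] (ℤ → F.Fock)) (a : F.Fock) (n : ℤ) :
      F.raise p (F.raise q G) a n = F.cr p * (F.cr q * G a n)
        - F.cr p * bsum (.negSucc q.2) (fun i => G (F.an q.1 i a) (negSucc q.2 + n - i))
        - F.eps • (F.cr q * bsum (.negSucc p.2) (fun j => G (F.an p.1 j a) (negSucc p.2 + n - j)))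
        + F.eps • bsum (.negSucc p.2) (fun j => bsum (.negSucc q.2) fun i =>
            G (F.an q.1 i (F.an p.1 j a)) (negSucc q.2 + (negSucc p.2 + n - j) - i)) := by
    rw [raise_apply, raise_apply, theta_theta, mul_sub]
    simp only [raise_apply, theta_an, theta_theta, map_smul, Pi.smul_apply, mul_smul_comm]
    have h1 (j : ℕ) := bsum_csmul (F.evZero_apply_an G q.1 (F.an p.1 j a)
      (fun i => negSucc q.2 + (negSucc p.2 + n - j) - i)) F.eps (.negSucc q.2)
    simp only [h1, ← smul_sub]
    have e1 := F.evZero_apply_an G p.1 a fun j => negSucc p.2 + n - j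
    have e2 : EvZero fun j => F.cr q * G (F.an p.1 j a) (negSucc p.2 + n - j) :=
      e1.map (mulLeft (F.cr q))
    have e3 : EvZero fun j => bsum (.negSucc q.2) fun i =>
            G (F.an q.1 i (F.an p.1 j a)) (negSucc q.2 + (negSucc p.2 + n - j) - i) := by
      obtain ⟨J, hJ⟩ := F.evZero_an p.1 a
      exact ⟨J, fun j hj => by simp [hJ j hj, bsum_zero_fun]⟩
    rw [bsum_csmul (e2.sub e3), bsum_sub e2 e3, bsum_mul_left e1, smul_sub]
    abel
  ext G a n
  simp only [End.mul_apply, LinearMap.smul_apply, Pi.smul_apply, key]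
  rw [← mul_assoc, F.cr_comm p q, bsum_comm]
  · have h2 (i j : ℕ) : G (F.an q.1 j (F.an p.1 i a)) (negSucc q.2 + (negSucc p.2 + n - i) - j) =
        F.eps • G (F.an p.1 i (F.an q.1 j a)) (negSucc p.2 + (negSucc q.2 + n - j) - i) := by
      rw [an_an, map_smul, Pi.smul_apply]
      ring_nf
    simp only [h2]
    have h3 (j : ℕ) := bsum_csmul (F.evZero_apply_an G p.1 (F.an q.1 j a)
      (fun i => negSucc p.2 + (negSucc q.2 + n - j) - i)) F.eps (.negSucc p.2)
    simp only [h3]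
    rw [bsum_csmul (by
      obtain ⟨J, hJ⟩ := F.evZero_an q.1 a
      exact ⟨J, fun j hj => by simp [hJ j hj, bsum_zero_fun]⟩)]
    simp only [smul_sub, smul_add, smul_smul, F.eps_mul_eps, one_smul, smul_mul_assoc, mul_assoc]
    abel
  · obtain ⟨J, hJ⟩ := F.evZero₂_an_an q.1 p.1 a
    refine ⟨J, fun i j h => ?_⟩
    beta_reduce at hJ ⊢
    rw [hJ j i h.symm, map_zero, Pi.zero_apply]

/-- The modes `a₍ₙ₎ 1` applied to the vacuum. -/
def vacMode : F.Fock →ₗ[ℂ] (ℤ → F.Fock) :=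
  LinearMap.pi fun n => match n with
    | .ofNat _ => 0
    | .negSucc r => F.tpow r

/-- The product `a₍ₙ₎ b` of the vertex algebra. -/
def md (n : ℤ) : F.Fock →ₗ[ℂ] F.Fock →ₗ[ℂ] F.Fock :=
  mk₂ ℂ (fun a b => F.lift F.raise F.raise_raise b F.vacMode a n)
    (fun a a' b => by rw [map_add, Pi.add_apply]) (fun c a b => by rw [map_smul, Pi.smul_apply])
    (fun a b b' => by rw [map_add]; rfl) (fun c a b => by rw [map_smul]; rfl)

theorem md_natCast_one (n : ℕ) (a : F.Fock) : F.md n a 1 = 0 := by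
  simp only [md, mk₂_apply, map_one]
  rfl

theorem md_negSucc_one (r : ℕ) (a : F.Fock) : F.md (.negSucc r) a 1 = F.tpow r a := by
  simp only [md, mk₂_apply, map_one]
  rfl

theorem md_cr_mul (n : ℤ) (a : F.Fock) (p) (b : F.Fock) :
    F.md n a (F.cr p * b) = F.cr p * F.md n (F.theta a) b -
      bsum (.negSucc p.2) fun j => F.md (negSucc p.2 + n - j) (F.an p.1 j (F.theta a)) b := by
  simp only [md, mk₂_apply, map_mul, lift_cr, End.mul_apply, raise_apply]

theorem evZero_md_an (i) (a : F.Fock) (k : ℕ → ℤ) (b : F.Fock) :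
    EvZero fun j => F.md (k j) (F.an i j a) b :=
  (F.evZero_an i a).map_seq (fun j x => F.md (k j) x b) fun j => by simp

theorem exists_md_bound (a b : F.Fock) : ∃ K : ℕ, ∀ n : ℤ, K ≤ n → F.md n a b = 0 := by
  induction b using Fock.induction generalizing a with
  | one =>
    refine ⟨0, fun n hn => ?_⟩
    obtain ⟨m, rfl⟩ := Int.eq_ofNat_of_zero_le hn
    exact F.md_natCast_one m a
  | add b b' h h' =>
    obtain ⟨K, hK⟩ := h a
    obtain ⟨L, hL⟩ := h' a
    exact ⟨max K L, fun n hn => by rw [map_add, hK n (by omega), hL n (by omega), add_zero]⟩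
  | smul c b h =>
    obtain ⟨K, hK⟩ := h a
    exact ⟨K, fun n hn => by rw [map_smul, hK n hn, smul_zero]⟩
  | cr p b h =>
    obtain ⟨J, hJ⟩ := F.evZero_an p.1 (F.theta a)
    obtain ⟨K, hK⟩ := h (F.theta a)
    choose L hL using fun j => h (F.an p.1 j (F.theta a))
    refine ⟨max K ((range J).sup L + J + p.2 + 1), fun n hn => ?_⟩
    rw [md_cr_mul, hK n (by omega), mul_zero, zero_sub, neg_eq_zero]
    rw [show (fun j : ℕ => F.md (negSucc p.2 + n - j) (F.an p.1 j (F.theta a)) b) = fun _ => 0 from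
      funext fun j => ?_, bsum_zero_fun]
    by_cases hj : J ≤ j
    · simp [hJ j hj]
    · have := Finset.le_sup (f := L) (Finset.mem_range.2 (not_le.1 hj))
      refine hL j _ ?_
      rw [negSucc_eq]
      push_cast at hn ⊢
      omega

theorem evZero_md (k : ℤ) (a b : F.Fock) : EvZero fun j => F.md (k + j) a b := by
  obtain ⟨K, hK⟩ := F.exists_md_bound a b
  exact ⟨(K - k).toNat, fun j hj => hK _ (by omega)⟩

end FieldData

namespace FieldData

variable (F : FieldData)

theorem theta_trans (v : F.Fock) : F.theta (F.trans v) = F.trans (F.theta v) := by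
  induction v using Fock.induction with
  | one => simp
  | add v w hv hw => simp [hv, hw]
  | smul c v hv => simp [hv]
  | cr p v hv => simp [trans_cr_mul, hv, smul_comm F.eps]

theorem theta_tpow (r) (v : F.Fock) : F.theta (F.tpow r v) = F.tpow r (F.theta v) := by
  simp only [tpow, LinearMap.smul_apply, map_smul]
  congr 1
  induction r with
  | zero => simp
  | succ r ih => simp only [pow_succ', End.mul_apply, theta_trans, ih]

theorem theta_md (n : ℤ) (a b : F.Fock) : F.theta (F.md n a b) = F.md n (F.theta a) (F.theta b) := by
  induction b using Fock.induction generalizing a n with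
  | one =>
    rcases n with n | r
    · simp only [ofNat_eq_natCast, md_natCast_one, map_one, map_zero]
    · rw [map_one F.theta, md_negSucc_one, md_negSucc_one, theta_tpow]
  | add v w hv hw => simp [hv, hw]
  | smul c v hv => simp [hv]
  | cr p b h =>
    rw [theta_cr_mul, map_smul, md_cr_mul, md_cr_mul, map_sub, theta_cr_mul, smul_sub, h]
    congr 1
    rw [← bsum_csmul (F.evZero_md_an ..), ← toLinearMap_apply,
      ← bsum_linearMap (F.evZero_md_an ..)]
    simp only [toLinearMap_apply, h, theta_an, map_smul, LinearMap.smul_apply]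

/-- The vacuum is a left unit. -/
theorem md_one_left (n : ℤ) (b : F.Fock) : F.md n 1 b = if n = -1 then b else 0 := by
  induction b using Fock.induction generalizing n with
  | one =>
    rcases n with n | r
    · rw [ofNat_eq_natCast, md_natCast_one, if_neg (by omega)]
    · rw [md_negSucc_one]
      rcases r with _ | r
      · rw [tpow_zero]; simp
      · rw [tpow_one_right, if_neg (by rw [negSucc_eq]; omega)]
  | add v w hv hw => simp only [map_add, hv, hw]; split_ifs <;> simp
  | smul c v hv => simp only [map_smul, hv]; split_ifs <;> simp
  | cr p b h =>
    rw [md_cr_mul, map_one, h]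
    simp [bsum_zero_fun]

theorem an_cr (i m) (p) : F.an i m (F.cr p) = F.contr i p.1 m (negSucc p.2) • 1 := by
  have := F.an_cr_mul i m p 1
  rwa [mul_one, an_one, mul_zero, smul_zero, add_zero] at this

theorem theta_cr (p) : F.theta (F.cr p) = F.eps • F.cr p := by
  simpa using F.theta_cr_mul p 1

theorem trans_cr (p) : F.trans (F.cr p) = (p.2 + 1 : ℂ) • F.cr (p.1, p.2 + 1) := by
  simpa using F.trans_cr_mul p 1

theorem tpow_cr (i r) : F.tpow r (F.cr (i, 0)) = F.cr (i, r) := by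
  induction r with
  | zero => exact F.tpow_zero _
  | succ r ih =>
    have h : (r + 1 : ℂ) ≠ 0 := by exact_mod_cast r.succ_ne_zero
    have := F.trans_tpow r (F.cr (i, 0))
    rw [ih, trans_cr] at this
    exact (smul_right_injective _ h this).symm

/-- The modes of the generating fields. -/
theorem md_cr_left (n : ℤ) (i) (b : F.Fock) : F.md n (F.cr (i, 0)) b = F.phi i n b := by
  induction b using Fock.induction generalizing n with
  | one =>
    rcases n with n | r
    · rw [ofNat_eq_natCast, md_natCast_one, phi_natCast, an_one]
    · rw [md_negSucc_one, tpow_cr, phi_negSucc, mul_one]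
  | add v w hv hw => simp only [map_add, hv, hw]
  | smul c v hv => simp only [map_smul, hv]
  | cr p b h =>
    rw [md_cr_mul, theta_cr, map_smul, LinearMap.smul_apply, h]
    have key := F.phi_comm i p.1 n (.negSucc p.2) b
    rw [phi_negSucc, phi_negSucc] at key
    rw [key, mul_smul_comm, sub_eq_add_neg]
    congr 1
    rw [bsum, finsum_eq_single _ F.ord]
    · rw [map_smul, an_cr, map_smul, map_smul, LinearMap.smul_apply, LinearMap.smul_apply, md_one_left]
      have h1 : F.contr p.1 i F.ord (negSucc 0) = F.g p.1 i := by
        rw [contr, if_pos (by simp), choose_natCast]; simp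
      rw [h1, contr_symm F i, contr]
      by_cases hc : negSucc p.2 + n + 1 = F.ord
      · rw [if_pos hc, if_pos (by omega), ← cast_smul_eq_zsmul ℂ]
        module
      · rw [if_neg hc, if_neg (by omega)]
        simp
    · intro j hj
      rw [map_smul, an_cr, contr, if_neg (by rw [negSucc_eq]; omega)]
      simp

theorem md_trans_one (n : ℤ) (a : F.Fock) :
    F.md n (F.trans a) 1 = (-n) • F.md (n - 1) a 1 := by
  rcases n with n | r
  · rw [ofNat_eq_natCast, md_natCast_one]
    rcases n with _ | n
    · simp
    · rw [show ((n + 1 : ℕ) : ℤ) - 1 = (n : ℕ) by simp, md_natCast_one, smul_zero]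
  · rw [show negSucc r - 1 = negSucc (r + 1) by
      rw [negSucc_eq, negSucc_eq]; push_cast; ring, md_negSucc_one, md_negSucc_one, tpow_trans,
      ← cast_smul_eq_zsmul ℂ, negSucc_eq]
    push_cast
    congr 1
    ring

theorem evZero_md_an_pred (i) (a : F.Fock) (k : ℕ → ℤ) (b : F.Fock) :
    EvZero fun j => F.md (k j) (F.an i (j - 1) a) b := by
  obtain ⟨J, hJ⟩ := F.evZero_an i a
  exact ⟨J + 1, fun j hj => by simp [hJ (j - 1) (by omega)]⟩

theorem md_trans (n : ℤ) (a b : F.Fock) : F.md n (F.trans a) b = (-n) • F.md (n - 1) a b := by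
  induction b using Fock.induction generalizing a n with
  | one => exact F.md_trans_one n a
  | add v w hv hw => simp only [map_add, hv, hw, smul_add]
  | smul c v hv => simp only [map_smul, hv, smul_comm c]
  | cr p b h =>
    rw [md_cr_mul, md_cr_mul, theta_trans, h, smul_sub, mul_smul_comm]
    congr 1
    simp only [trans_an, map_add, LinearMap.add_apply, map_smul, LinearMap.smul_apply, h]
    generalize F.theta a = a'
    have e1 := F.evZero_md_an p.1 a' (fun j => negSucc p.2 + n - j - 1) b
    have e2 := F.evZero_md_an_pred p.1 a' (fun j => negSucc p.2 + n - j) b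
    simp only [← Int.cast_natCast (R := ℂ), cast_smul_eq_zsmul]
    rw [bsum_add (e1.smul _)
      (e2.smul _), bsum_absorb e2, ← bsum_smul
      (F.evZero_md_an ..), ← bsum_add (e1.smul _)]
    · refine bsum_congr _ fun j => ?_
      rw [Nat.add_sub_cancel, show negSucc p.2 + n - ((j + 1 : ℕ) : ℤ) = negSucc p.2 + (n - 1) - j by
        push_cast; ring, show negSucc p.2 + n - j - 1 = negSucc p.2 + (n - 1) - j by ring,
        ← add_smul]
      congr 1; ring
    · exact (F.evZero_md_an p.1 a' _ b).smul _

theorem phi_negSucc_md (i r) (n : ℤ) (a b : F.Fock) : F.phi i (.negSucc r) (F.md n a b) =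
    F.md n (F.theta a) (F.phi i (.negSucc r) b) +
      bsum (.negSucc r) fun j => F.md (negSucc r + n - j) (F.an i j a) b := by
  rw [phi_negSucc, phi_negSucc, md_cr_mul, theta_theta]
  abel

theorem an_tpow (i m r) (a : F.Fock) : F.an i m (F.tpow r a) =
    bsum m fun j => F.md (m + negSucc r - j) (F.an i j a) 1 := by
  induction r generalizing a with
  | zero =>
    rw [tpow_zero, bsum_natCast, sum_range_succ, sum_eq_zero, zero_add]
    · rw [show (m : ℤ) + negSucc 0 - m = negSucc 0 by ring, md_negSucc_one, tpow_zero,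
        choose_natCast]
      simp
    · intro j hj
      rw [mem_range] at hj
      obtain ⟨s, hs⟩ : ∃ s : ℕ, (m : ℤ) + negSucc 0 - j = s :=
        ⟨m - 1 - j, by rw [negSucc_eq]; omega⟩
      rw [hs, md_natCast_one, smul_zero]
  | succ r ih =>
    have h : (r + 1 : ℂ) ≠ 0 := by exact_mod_cast r.succ_ne_zero
    have := ih (F.trans a)
    rw [tpow_trans, map_smul] at this
    apply smul_right_injective _ h
    simp only [this]
    simp only [trans_an, map_add, LinearMap.add_apply, map_smul, LinearMap.smul_apply, md_trans]
    have e1 := F.evZero_md_an i a (fun j => m + negSucc r - j - 1) 1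
    have e2 := F.evZero_md_an_pred i a (fun j => m + negSucc r - j) 1
    simp only [← Int.cast_natCast (R := ℂ), cast_smul_eq_zsmul]
    rw [bsum_add (e1.smul _)
      (e2.smul _), bsum_absorb e2, ← bsum_csmul
      (F.evZero_md_an ..), ← bsum_add (e1.smul _)]
    · refine bsum_congr _ fun j => ?_
      rw [Nat.add_sub_cancel, show (m : ℤ) + negSucc r - ((j + 1 : ℕ) : ℤ) = m + negSucc (r + 1) - j by
        rw [negSucc_eq, negSucc_eq]; push_cast; ring,
        show m + negSucc r - j - 1 = m + negSucc (r + 1) - j by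
        rw [negSucc_eq, negSucc_eq]; push_cast; ring, ← add_smul, ← cast_smul_eq_zsmul ℂ,
        negSucc_eq]
      congr 1; push_cast; ring
    · exact (F.evZero_md_an i a _ 1).smul _

theorem evZero₂_md_an_an (i j) (a : F.Fock) (k : ℕ → ℕ → ℤ) (b : F.Fock) :
    EvZero₂ fun m n => F.md (k m n) (F.an i m (F.an j n a)) b := by
  obtain ⟨J, hJ⟩ := F.evZero₂_an_an i j a
  exact ⟨J, fun m n h => by
    beta_reduce at hJ ⊢
    rw [hJ m n h, map_zero, LinearMap.zero_apply]⟩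

/-- The commutator formula for the modes of the generating fields. -/
theorem phi_md (i) (m n : ℤ) (a b : F.Fock) : F.phi i m (F.md n a b) =
    F.md n (F.theta a) (F.phi i m b) + bsum m fun j => F.md (m + n - j) (F.an i j a) b := by
  rcases m with m | r
  swap
  · exact F.phi_negSucc_md i r n a b
  rw [ofNat_eq_natCast]
  induction b using Fock.induction generalizing a n with
  | one =>
    rw [phi_natCast, an_one, map_zero, zero_add]
    rcases n with n | r
    · rw [ofNat_eq_natCast, md_natCast_one, map_zero, bsum_natCast_eq_zero]
      intro j hj
      obtain ⟨s, hs⟩ : ∃ s : ℕ, (m : ℤ) + n - j = s := ⟨m + n - j, by omega⟩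
      rw [hs, md_natCast_one]
    · rw [md_negSucc_one, an_tpow]
  | add v w hv hw =>
    simp only [map_add, hv, hw]
    rw [bsum_add (F.evZero_md_an ..) (F.evZero_md_an ..)]
    abel
  | smul c v hv =>
    simp only [map_smul, hv, smul_add]
    rw [bsum_csmul (F.evZero_md_an ..)]
  | cr p b h =>
    rw [← phi_negSucc]
    set P := negSucc p.2 with hP
    have hC := F.phi_negSucc_md p.1 p.2
    rw [← hP] at hC
    have h1 (n : ℤ) (a b : F.Fock) : F.md n a (F.phi p.1 P b) = F.phi p.1 P (F.md n (F.theta a) b) -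
        bsum P fun j => F.md (P + n - j) (F.an p.1 j (F.theta a)) b := by
      rw [hC, theta_theta]; abel
    have e2 : EvZero₂ fun j l : ℕ => F.md (m + (P + n - j) - l) (F.an i l (F.an p.1 j (F.theta a))) b := by
      obtain ⟨J, hJ⟩ := F.evZero₂_md_an_an i p.1 (F.theta a) (fun l j => m + (P + n - j) - l) b
      exact ⟨J, fun j l h => hJ l j h.symm⟩
    have e3 : EvZero₂ fun j l : ℕ => F.md (P + (m + n - j) - l) (F.an p.1 l (F.an i j (F.theta a))) b := by
      obtain ⟨J, hJ⟩ := F.evZero₂_md_an_an p.1 i (F.theta a) (fun l j => P + (m + n - j) - l) b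
      exact ⟨J, fun j l h => hJ l j h.symm⟩
    have E1 : F.phi i m (bsum P fun j => F.md (P + n - j) (F.an p.1 j (F.theta a)) b) =
        F.eps • bsum P (fun j => F.md (P + n - j) (F.an p.1 j a) (F.phi i m b)) +
        bsum P (fun j => bsum m fun l =>
          F.md (m + (P + n - j) - l) (F.an i l (F.an p.1 j (F.theta a))) b) := by
      rw [← bsum_linearMap (F.evZero_md_an ..), ← bsum_csmul (F.evZero_md_an ..),
        ← bsum_add ((F.evZero_md_an p.1 a _ _).smul _) (e2.evZero_bsum _)]
      refine bsum_congr _ fun j => ?_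
      rw [h, theta_an, theta_theta, map_smul, LinearMap.smul_apply]
    have E2 : (bsum m fun j => F.md (m + n - j) (F.an i j a) (F.phi p.1 P b)) =
        F.eps • F.phi p.1 P (bsum m fun j => F.md (m + n - j) (F.an i j (F.theta a)) b) -
        F.eps • bsum m (fun j => bsum P fun l =>
          F.md (P + (m + n - j) - l) (F.an p.1 l (F.an i j (F.theta a))) b) := by
      rw [← bsum_linearMap (F.evZero_md_an ..), ← bsum_csmul (e3.evZero_bsum _), ← bsum_csmul
        ((F.evZero_md_an i (F.theta a) _ _).map_seq (fun j x => F.phi p.1 P x) (by simp)), ← bsum_sub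
        ((F.evZero_md_an i (F.theta a) _ _).map_seq (fun j x => F.eps • F.phi p.1 P x) (by simp))
        ((e3.evZero_bsum _).smul _)]
      refine bsum_congr _ fun j => ?_
      rw [h1]
      simp only [theta_an, map_smul, LinearMap.smul_apply]
      rw [bsum_csmul (F.evZero_md_an ..)]
    have E3 : bsum P (fun j => bsum m fun l =>
          F.md (m + (P + n - j) - l) (F.an i l (F.an p.1 j (F.theta a))) b) =
        F.eps • bsum m (fun j => bsum P fun l =>
          F.md (P + (m + n - j) - l) (F.an p.1 l (F.an i j (F.theta a))) b) := by
      rw [bsum_comm e2, ← bsum_csmul (e3.evZero_bsum _)]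
      refine bsum_congr _ fun l => ?_
      rw [← bsum_csmul (F.evZero_md_an ..)]
      refine bsum_congr _ fun j => ?_
      rw [an_an, map_smul, LinearMap.smul_apply, show (m : ℤ) + (P + n - j) - l = P + (m + n - l) - j by ring]
    rw [h1, map_sub, phi_comm, h, theta_theta, E1, E2, E3, phi_comm, map_add (F.md n (F.theta a)),
      map_smul (F.md n (F.theta a)), map_smul (F.md n (F.theta a)), h1, theta_theta, map_add, smul_add,
      smul_sub]
    abel

theorem trans_md (n : ℤ) (a b : F.Fock) :
    F.trans (F.md n a b) = F.md n (F.trans a) b + F.md n a (F.trans b) := by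
  induction b using Fock.induction generalizing a n with
  | one =>
    rw [trans_one, map_zero, add_zero]
    rcases n with n | r
    · rw [ofNat_eq_natCast, md_natCast_one, md_natCast_one, map_zero]
    · rw [md_negSucc_one, md_negSucc_one, trans_tpow, tpow_trans]
  | add v w hv hw => simp only [map_add, hv, hw]; abel
  | smul c v hv => simp only [map_smul, hv, smul_add]
  | cr p b h =>
    rw [← phi_negSucc]
    set P := negSucc p.2 with hP
    have h1 (n : ℤ) (Q : ℤ) (a b : F.Fock) : F.md n a (F.phi p.1 Q b) =
        F.phi p.1 Q (F.md n (F.theta a) b) -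
        bsum Q fun j => F.md (Q + n - j) (F.an p.1 j (F.theta a)) b := by
      rw [phi_md, theta_theta]; abel
    have h2 (Q : ℤ) (v : F.Fock) : F.trans (F.phi p.1 Q v) =
        F.phi p.1 Q (F.trans v) - (Q : ℂ) • F.phi p.1 (Q - 1) v := by
      rw [phi_trans]; abel
    have e1 := F.evZero_md_an p.1 (F.theta a) (fun j => P + n - j) b
    have e2 := F.evZero_md_an p.1 (F.theta a) (fun j => P + n - j) (F.trans b)
    have e3 := F.evZero_md_an_pred p.1 (F.theta a) (fun j => P + n - j) b
    have e4 : EvZero fun j => F.md (P + n - j) (F.trans (F.an p.1 j (F.theta a))) b :=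
      (F.evZero_an p.1 (F.theta a)).map_seq (fun j x => F.md (P + n - j) (F.trans x) b) (by simp)
    have E : (bsum P fun j => F.md (P + n - j) (F.an p.1 j (F.trans (F.theta a))) b) =
        bsum P (fun j => F.md (P + n - j) (F.trans (F.an p.1 j (F.theta a))) b) +
        P • bsum (P - 1) (fun j => F.md (P - 1 + n - j) (F.an p.1 j (F.theta a)) b) := by
      have := bsum_absorb_left e3 P
      simp only [Nat.add_sub_cancel] at this
      rw [show (fun j : ℕ => F.md (P - 1 + n - j) (F.an p.1 j (F.theta a)) b) =
        fun j : ℕ => F.md (P + n - (j + 1 : ℕ)) (F.an p.1 j (F.theta a)) b from funext fun j => by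
          rw [show P - 1 + n - j = P + n - (j + 1 : ℕ) by push_cast; ring], ← this,
        ← bsum_add e4 (e3.smul _)]
      refine bsum_congr _ fun j => ?_
      rw [trans_an, map_add, LinearMap.add_apply, map_smul, LinearMap.smul_apply,
        ← cast_smul_eq_zsmul ℂ]
      simp
    rw [h1, map_sub, h2, h, h1, theta_trans, E, h2, map_sub, map_smul, h1, h1, ← bsum_linearMap e1,
      bsum_congr P fun j => h _ _, bsum_add e4 e2, map_add, cast_smul_eq_zsmul,
      cast_smul_eq_zsmul, smul_sub]
    abel

theorem phi_tpow (i) (m : ℤ) (r : ℕ) (v : F.Fock) : F.phi i m (F.tpow r v) =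
    ∑ j ∈ range (r + 1), Ring.choose m j • F.tpow (r - j) (F.phi i (m - j) v) := by
  induction r generalizing m with
  | zero => simp [tpow_zero]
  | succ r ih =>
    have h : (r + 1 : ℂ) ≠ 0 := by exact_mod_cast r.succ_ne_zero
    apply smul_right_injective _ h
    simp only
    rw [← map_smul, ← trans_tpow, phi_trans, ih, ih, map_sum]
    simp only [map_zsmul, trans_tpow]
    rw [sum_range_succ' (n := r + 1), sum_range_succ', smul_add, smul_sum,
      smul_sum, sum_range_succ (n := r), add_right_comm, sum_range_succ (n := r),
      ← add_assoc, ← sum_add_distrib]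
    congr 1
    · congr 1
      · refine sum_congr rfl fun j hj => ?_
        rw [mem_range] at hj
        obtain ⟨s, rfl⟩ : ∃ s, r = j + 1 + s := ⟨r - j - 1, by omega⟩
        have hc := Ring.choose_smul_choose m (n := j + 1) (k := 1) (by omega)
        rw [Nat.choose_one_right, nsmul_eq_mul, Nat.add_sub_cancel, Ring.choose_one_right] at hc
        have hc' := congrArg (Int.cast (R := ℂ)) hc
        push_cast at hc'
        rw [show j + 1 + s - (j + 1) = s by omega, show j + 1 + s - j = s + 1 by omega,
          show j + 1 + s + 1 - (j + 1) = s + 1 by omega,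
          show m - 1 - (j : ℤ) = m - ((j + 1 : ℕ) : ℤ) by push_cast; ring]
        simp only [← cast_smul_eq_zsmul ℂ, smul_smul, ← add_smul]
        congr 1
        push_cast
        linear_combination - hc'
      · have hc := Ring.choose_smul_choose m (n := r + 1) (k := 1) (by omega)
        rw [Nat.choose_one_right, nsmul_eq_mul, Nat.add_sub_cancel, Ring.choose_one_right] at hc
        have hc' := congrArg (Int.cast (R := ℂ)) hc
        push_cast at hc'
        rw [Nat.sub_self, Nat.sub_self, show m - 1 - (r : ℤ) = m - ((r + 1 : ℕ) : ℤ) by push_cast; ring]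
        simp only [← cast_smul_eq_zsmul ℂ, smul_smul]
        congr 1
        rw [hc']
    · simp

theorem phi_bsum_tpow (i) (m : ℤ) {S : ℕ → F.Fock} (hS : EvZero S) :
    F.phi i m (bsum (-1) fun l => F.tpow l (S l)) =
      bsum (-1) fun l => F.tpow l (bsum m fun j => sg j • F.phi i (m - j) (S (l + j))) := by
  obtain ⟨J, hJ⟩ := hS
  have hc (l : ℕ) : Ring.choose (-1 : ℤ) l = sg l := by
    rw [Ring.choose_neg, show (1 : ℤ) + l - 1 = l by ring, choose_natCast]
    simp [sg, Units.smul_def]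
  have hb (l : ℕ) : (bsum m fun j => sg j • F.phi i (m - j) (S (l + j))) =
      ∑ j ∈ range (J - l), Ring.choose m j • sg j • F.phi i (m - j) (S (l + j)) :=
    bsum_eq (fun j hj => by rw [hJ _ (by omega), map_zero, smul_zero]) m
  rw [bsum_eq (J := J) fun j hj => by rw [hJ j hj, map_zero], bsum_eq (J := J) fun l hl => by
    rw [hb, show J - l = 0 by omega]; simp]
  simp only [hb, map_sum, map_zsmul, phi_tpow, smul_sum, hc]
  rw [Finset.sum_comm' (t' := range J) (s' := fun j => Finset.Ico j J)
    (by intro x y; simp; omega), Finset.sum_comm' (t' := range J)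
    (s' := fun j => range (J - j)) (s := range J) (t := fun l => range (J - l))
    (by intro x y; simp; omega)]
  refine sum_congr rfl fun j hj => ?_
  rw [Finset.sum_Ico_eq_sum_range]
  refine sum_congr rfl fun l hl => ?_
  rw [Nat.add_sub_cancel_left, add_comm j l, Nat.cast_add, sg_add]
  simp only [smul_smul]
  ring_nf

end FieldData

namespace FieldData

variable (F : FieldData)

/-- The even part of a vector (for odd fields). -/
def ev (a : F.Fock) : F.Fock := (2⁻¹ : ℂ) • (a + F.theta a)

/-- The odd part of a vector (for odd fields). -/
def od (a : F.Fock) : F.Fock := (2⁻¹ : ℂ) • (a - F.theta a)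

theorem ev_theta (a : F.Fock) : F.ev (F.theta a) = F.ev a := by
  rw [ev, theta_theta, add_comm, ev]

theorem od_theta (a : F.Fock) : F.od (F.theta a) = - F.od a := by
  rw [od, od, theta_theta]; module

theorem theta_ev (a : F.Fock) : F.theta (F.ev a) = F.ev a := by
  rw [ev, map_smul, map_add, theta_theta, add_comm]

theorem theta_od (a : F.Fock) : F.theta (F.od a) = - F.od a := by
  rw [od, map_smul, map_sub, theta_theta]; module

theorem ev_add_od (a : F.Fock) : F.ev a + F.od a = a := by
  rw [ev, od]; module

theorem ev_one : F.ev 1 = 1 := by rw [ev, map_one]; module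

theorem od_one : F.od 1 = 0 := by rw [od, map_one]; module

theorem eps_eq : F.eps = 1 ∨ F.eps = -1 := neg_one_pow_eq_or ℂ _

theorem theta_of_eps (h : F.eps = 1) (a : F.Fock) : F.theta a = a := by
  induction a using Fock.induction with
  | one => simp
  | add v w hv hw => simp [hv, hw]
  | smul c v hv => simp [hv]
  | cr p v hv => simp [hv, h]

theorem od_of_eps (h : F.eps = 1) (a : F.Fock) : F.od a = 0 := by
  rw [od, F.theta_of_eps h]; module

theorem ev_of_eps (h : F.eps = 1) (a : F.Fock) : F.ev a = a := by
  rw [ev, F.theta_of_eps h]; module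

theorem ev_phi (h : F.eps = -1) (i m) (a : F.Fock) : F.ev (F.phi i m a) = F.phi i m (F.od a) := by
  rw [ev, od, theta_phi, h, map_smul, map_sub]; module

theorem od_phi (h : F.eps = -1) (i m) (a : F.Fock) : F.od (F.phi i m a) = F.phi i m (F.ev a) := by
  rw [ev, od, theta_phi, h, map_smul, map_add]; module

/-- The product `±b₍ₙ₎a` with the sign of the transposition of `a` and `b`. -/
def sm (n : ℤ) (b a : F.Fock) : F.Fock := F.md n b (F.ev a) + F.md n (F.theta b) (F.od a)

theorem sm_phi (n : ℤ) (b : F.Fock) (i) (p : ℤ) (a : F.Fock) : F.sm n b (F.phi i p a) =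
    F.phi i p (F.sm n b a) - bsum p fun j => F.sm (p + n - j) (F.an i j b) (F.theta a) := by
  have h1 (n : ℤ) (b a : F.Fock) : F.md n b (F.phi i p a) = F.phi i p (F.md n (F.theta b) a) -
      bsum p fun j => F.md (p + n - j) (F.an i j (F.theta b)) a := by
    rw [phi_md, theta_theta]; abel
  rcases F.eps_eq with h | h
  · simp only [sm, F.od_of_eps h, F.ev_of_eps h, map_zero, add_zero, h1, F.theta_of_eps h]
  · simp only [sm, F.ev_phi h, F.od_phi h, h1, theta_theta, F.ev_theta, F.od_theta, map_neg, map_add,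
      theta_an, h, LinearMap.neg_apply, neg_smul, one_smul, neg_neg]
    rw [bsum_add (F.evZero_md_an ..) (F.evZero_md_an ..)]
    abel

/-- The iterated product `±b₍q₎(a₍p₎c)` with the sign of the transposition of `a` and `b`. -/
def sb (q : ℤ) (b : F.Fock) (p : ℤ) (a c : F.Fock) : F.Fock :=
  F.md q b (F.md p (F.ev a) c) + F.md q (F.theta b) (F.md p (F.od a) c)

theorem phi_md_md (i) (p q r : ℤ) (b a c : F.Fock) : F.phi i p (F.md q b (F.md r a c)) =
    F.md q (F.theta b) (F.md r (F.theta a) (F.phi i p c)) +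
      bsum p (fun j => F.md q (F.theta b) (F.md (p + r - j) (F.an i j a) c)) +
      bsum p (fun j => F.md (p + q - j) (F.an i j b) (F.md r a c)) := by
  rw [phi_md, phi_md, map_add, bsum_linearMap (F.evZero_md_an ..)]

theorem evZero_md_md_an (i q) (b a : F.Fock) (k : ℕ → ℤ) (c : F.Fock) :
    EvZero fun j => F.md q b (F.md (k j) (F.an i j a) c) :=
  (F.evZero_md_an i a k c).map_seq (fun _ x => F.md q b x) (by simp)

theorem phi_sb (i) (p q r : ℤ) (b a c : F.Fock) : F.phi i p (F.sb q b r a c) =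
    F.sb q (F.theta b) r (F.theta a) (F.phi i p c) +
      bsum p (fun j => F.sb q b (p + r - j) (F.an i j a) c) +
      bsum p (fun j => F.sb (p + q - j) (F.an i j b) r (F.theta a) c) := by
  rcases F.eps_eq with h | h
  · simp only [sb, F.od_of_eps h, F.ev_of_eps h, map_zero, add_zero, phi_md_md, F.theta_of_eps h,
      LinearMap.zero_apply]
  · have h1 (j : ℕ) : F.ev (F.an i j a) = F.an i j (F.od a) := F.ev_phi h i j a
    have h2 (j : ℕ) : F.od (F.an i j a) = F.an i j (F.ev a) := F.od_phi h i j a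
    simp only [sb, map_add, phi_md_md, theta_ev, theta_od, theta_theta, ev_theta, od_theta, h1, h2,
      theta_an, h, map_neg, LinearMap.neg_apply, neg_smul, one_smul, neg_neg]
    rw [bsum_add (F.evZero_md_md_an ..) (F.evZero_md_md_an ..),
      bsum_add (F.evZero_md_an ..) (F.evZero_md_an ..)]
    abel

theorem trans_sb (q r : ℤ) (b a c : F.Fock) : F.trans (F.sb q b r a c) =
    F.sb q b r a (F.trans c) - q • F.sb (q - 1) b r a c - r • F.sb q b (r - 1) a c := by
  simp only [sb, map_add, trans_md, md_trans, map_zsmul, smul_add]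
  module

theorem evZero_sb (q : ℕ → ℤ) (b : F.Fock) (k : ℤ) (a c : F.Fock) :
    EvZero fun j => F.sb (q j) b (k + j) a c :=
  ((F.evZero_md k (F.ev a) c).map_seq (fun j x => F.md (q j) b x) (by simp)).add
    ((F.evZero_md k (F.od a) c).map_seq (fun j x => F.md (q j) (F.theta b) x) (by simp))

/-- The left side of the Borcherds identity. -/
def borL (m n k : ℤ) (a b c : F.Fock) : F.Fock :=
  bsum m fun j => F.md (m + k - j) (F.md (n + j) a b) c

/-- The first term on the right of the Borcherds identity. -/
def borR (m n k : ℤ) (a b c : F.Fock) : F.Fock :=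
  bsum n fun j => sg j • F.md (m + n - j) a (F.md (k + j) b c)

/-- The second term on the right of the Borcherds identity. -/
def borS (m n k : ℤ) (a b c : F.Fock) : F.Fock :=
  bsum n fun j => sg j • F.sb (n + k - j) b (m + j) a c

/-- The difference of the two sides of the Borcherds identity. -/
def defect (m n k : ℤ) (a b c : F.Fock) : F.Fock :=
  F.borL m n k a b c - F.borR m n k a b c + sg n • F.borS m n k a b c

theorem evZero_borL (k : ℕ → ℤ) (n : ℤ) (a b c : F.Fock) :
    EvZero fun j => F.md (k j) (F.md (n + j) a b) c :=
  (F.evZero_md n a b).map_seq (fun j x => F.md (k j) x c) (by simp)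

theorem evZero_borR (n : ℕ → ℤ) (k : ℤ) (a b c : F.Fock) :
    EvZero fun j => F.md (n j) a (F.md (k + j) b c) :=
  (F.evZero_md k b c).map_seq (fun j x => F.md (n j) a x) (by simp)

theorem defect_pascal (m n k : ℤ) (a b c : F.Fock) : F.defect m (n + 1) k a b c =
    F.defect (m + 1) n k a b c - F.defect m n (k + 1) a b c := by
  have hL : F.borL (m + 1) n k a b c = F.borL m n (k + 1) a b c + F.borL m (n + 1) k a b c := by
    rw [borL, bsum_succ (F.evZero_borL ..), borL, borL]
    congr 1
    · refine bsum_congr _ fun j => ?_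
      rw [show m + 1 + k - (j : ℤ) = m + (k + 1) - j by ring]
    · refine bsum_congr _ fun j => ?_
      push_cast
      rw [show m + 1 + k - (j + 1 : ℤ) = m + k - j by ring, show n + (j + 1 : ℤ) = n + 1 + j by ring]
  have hR : F.borR m (n + 1) k a b c = F.borR (m + 1) n k a b c - F.borR m n (k + 1) a b c := by
    rw [borR, bsum_succ ((F.evZero_borR ..).smul _), borR, borR, sub_eq_add_neg, ← bsum_neg]
    congr 1
    · refine bsum_congr _ fun j => ?_
      rw [show m + (n + 1) - (j : ℤ) = m + 1 + n - j by ring]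
    · refine bsum_congr _ fun j => ?_
      push_cast
      rw [sg_succ, show m + (n + 1) - (j + 1 : ℤ) = m + n - j by ring,
        show k + (j + 1 : ℤ) = k + 1 + j by ring, neg_smul]
  have hS : F.borS m (n + 1) k a b c = F.borS m n (k + 1) a b c - F.borS (m + 1) n k a b c := by
    rw [borS, bsum_succ ((F.evZero_sb ..).smul _), borS, borS, sub_eq_add_neg, ← bsum_neg]
    congr 1
    · refine bsum_congr _ fun j => ?_
      rw [show n + 1 + k - (j : ℤ) = n + (k + 1) - j by ring]
    · refine bsum_congr _ fun j => ?_
      push_cast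
      rw [sg_succ, show n + 1 + k - (j + 1 : ℤ) = n + k - j by ring,
        show m + (j + 1 : ℤ) = m + 1 + j by ring, neg_smul]
  rw [defect, defect, defect, hL, hR, hS, sg_succ]
  module

theorem trans_bsum {g g' : ℤ → ℤ → F.Fock} (hg : ∀ x y, F.trans (g x y) = g' x y - x • g (x - 1) y - y • g x (y - 1))
    (e : ∀ (q : ℕ → ℤ) k, EvZero fun j => g (q j) (k + j)) (e' : ∀ (q : ℕ → ℤ) k, EvZero fun j => g' (q j) (k + j)) (m n k : ℤ) :
    F.trans (bsum n fun j => sg j • g (m + n - j) (k + j)) = (bsum n fun j => sg j • g' (m + n - j) (k + j)) -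
      (m • bsum n fun j => sg j • g (m - 1 + n - j) (k + j)) - k • bsum n fun j => sg j • g (m + n - j) (k - 1 + j) := by
  have e0 := (e' (fun j => m + n - j) k).smul fun j => sg j
  have e1 := (e (fun j => m - 1 + n - j) k).smul fun j => sg j
  have e2 := (e (fun j => m + n - j) (k - 1)).smul fun j => sg j
  have e3 := e1.smul fun _ => m
  have e5 := e2.smul fun j => (j : ℤ)
  have e6 := e2.succ.smul fun j => n - j
  rw [← bsum_linearMap ((e _ _).smul _), ← bsum_smul e1, ← bsum_smul e2, sub_sub,
    ← add_zero (bsum n (fun j => m • sg j • _)),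
    ← sub_eq_zero.2 (bsum_absorb e2 n), ← bsum_sub e5 e6, ← bsum_add e3 (e5.sub e6),
    ← bsum_add (e3.add (e5.sub e6)) (e2.smul _), ← bsum_sub e0 ((e3.add (e5.sub e6)).add (e2.smul _))]
  refine bsum_congr _ fun j => ?_
  push_cast
  rw [map_zsmul, hg, sg_succ, show m - 1 + n - (j : ℤ) = m + n - j - 1 by ring, show k - 1 + (j : ℤ) = k + j - 1 by ring,
    show m + n - (j + 1 : ℤ) = m + n - j - 1 by ring, show k - 1 + (j + 1 : ℤ) = k + j by ring]
  module

theorem defect_trans (m n k : ℤ) (a b c : F.Fock) : F.trans (F.defect m n k a b c) =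
    F.defect m n k a b (F.trans c) - m • F.defect (m - 1) n k a b c - k • F.defect m n (k - 1) a b c := by
  have hL : F.trans (F.borL m n k a b c) = F.borL m n k a b (F.trans c)
      - m • F.borL (m - 1) n k a b c - k • F.borL m n (k - 1) a b c := by
    simp only [borL]
    rw [← bsum_linearMap (F.evZero_borL ..), ← bsum_absorb_right (F.evZero_borL ..),
      ← bsum_smul (F.evZero_borL ..), ← bsum_sub (F.evZero_borL ..)
        ((F.evZero_borL ..).smul _), ← bsum_sub
        ((F.evZero_borL ..).sub
          ((F.evZero_borL ..).smul _))
        ((F.evZero_borL ..).smul _)]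
    refine bsum_congr _ fun j => ?_
    rw [trans_md, md_trans, show m - 1 + k - j = m + k - j - 1 by ring,
      show m + (k - 1) - j = m + k - j - 1 by ring]
    module
  have hR := F.trans_bsum (g := fun x y => F.md x a (F.md y b c)) (g' := fun x y => F.md x a (F.md y b (F.trans c)))
    (fun x y => by
      simp only [trans_md, md_trans, map_add, map_zsmul]
      module)
    (fun _ _ => F.evZero_borR ..) (fun _ _ => F.evZero_borR ..) m n k
  have hS := F.trans_bsum (g := fun x y => F.sb x b y a c) (fun _ _ => F.trans_sb ..) (fun _ _ => F.evZero_sb ..) (fun _ _ => F.evZero_sb ..) k n m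
  simp only [add_comm _ n] at hS
  rw [defect, map_add, map_sub, map_zsmul, hL, borR, borS, hR, hS, defect, defect, defect]
  simp only [borR, borS]
  module

end FieldData

theorem EvZero₂.of_right {W : Type} [AddCommGroup W] {f : ℕ → ℕ → W}
    (h : ∃ J, ∀ j, J ≤ j → ∀ i, f i j = 0) (h' : ∀ j, EvZero fun i => f i j) : EvZero₂ f := by
  obtain ⟨J, hJ⟩ := EvZero₂.of (f := fun j i => f i j) h h'
  exact ⟨J, fun i j hij => hJ j i hij.symm⟩

theorem EvZero₂.swap {W : Type} [AddCommGroup W] {f : ℕ → ℕ → W} (h : EvZero₂ f) :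
    EvZero₂ fun i j => f j i := by
  obtain ⟨J, hJ⟩ := h
  exact ⟨J, fun i j hij => hJ j i hij.symm⟩

namespace FieldData

variable (F : FieldData)

theorem evZero_an_apply {W : Type} [AddCommGroup W] (i) (b : F.Fock) (G : ℕ → ℕ → F.Fock → W)
    (hG : ∀ j l, G j l 0 = 0) (h : ∀ l, EvZero fun j => G j l (F.an i l b)) :
    EvZero₂ fun j l => G j l (F.an i l b) := by
  apply EvZero₂.of_right _ h
  obtain ⟨J, hJ⟩ := F.evZero_an i b
  exact ⟨J, fun l hl j => by beta_reduce at hJ; rw [hJ l hl, hG]⟩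

theorem phi_borR (i) (p m n k : ℤ) (a b c : F.Fock) : F.phi i p (F.borR m n k a b c) =
    F.borR m n k (F.theta a) (F.theta b) (F.phi i p c) +
      bsum p (fun l => F.borR (m + p - l) n k (F.an i l a) b c) +
      bsum p (fun l => F.borR m n (k + p - l) (F.theta a) (F.an i l b) c) := by
  have e1 : EvZero₂ fun j l : ℕ => sg j • F.md (m + p - l + n - j) (F.an i l a) (F.md (k + j) b c) :=
    F.evZero_an_apply i a (fun j l x => sg j • F.md (m + p - l + n - j) x (F.md (k + j) b c))
      (by simp) fun l => (F.evZero_borR ..).smul _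
  have e2 : EvZero₂ fun j l : ℕ =>
      sg j • F.md (m + n - j) (F.theta a) (F.md (k + p - l + j) (F.an i l b) c) :=
    F.evZero_an_apply i b (fun j l x => sg j • F.md (m + n - j) (F.theta a) (F.md (k + p - l + j) x c))
      (by simp) fun l => (F.evZero_borR ..).smul _
  simp only [borR]
  rw [← bsum_comm e1, ← bsum_comm e2, ← bsum_linearMap ((F.evZero_borR ..).smul _),
    ← bsum_add ((F.evZero_borR ..).smul _) (e1.evZero_bsum _),
    ← bsum_add (((F.evZero_borR ..).smul _).add (e1.evZero_bsum _)) (e2.evZero_bsum _)]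
  refine bsum_congr _ fun j => ?_
  rw [map_zsmul, phi_md_md, bsum_smul (F.evZero_md_an ..), bsum_smul (F.evZero_md_md_an ..),
    ← smul_add, ← smul_add, add_right_comm]
  simp only [show ∀ l : ℕ, p + (m + n - j) - l = m + p - l + n - (j : ℤ) by intros; ring,
    show ∀ l : ℕ, p + (k + j) - l = k + p - l + (j : ℤ) by intros; ring]

theorem phi_borS (i) (p m n k : ℤ) (a b c : F.Fock) : F.phi i p (F.borS m n k a b c) =
    F.borS m n k (F.theta a) (F.theta b) (F.phi i p c) +
      bsum p (fun l => F.borS (m + p - l) n k (F.an i l a) b c) +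
      bsum p (fun l => F.borS m n (k + p - l) (F.theta a) (F.an i l b) c) := by
  have z1 (q r) (b c) : F.sb q b r 0 c = 0 := by simp [sb, ev, od]
  have z2 (q r) (a c) : F.sb q 0 r a c = 0 := by simp [sb]
  have e1 : EvZero₂ fun j l : ℕ => sg j • F.sb (n + k - j) b (m + p - l + j) (F.an i l a) c :=
    F.evZero_an_apply i a (fun j l x => sg j • F.sb (n + k - j) b (m + p - l + j) x c)
      (by simp [z1]) fun l => (F.evZero_sb ..).smul _
  have e2 : EvZero₂ fun j l : ℕ =>
      sg j • F.sb (n + (k + p - l) - j) (F.an i l b) (m + j) (F.theta a) c :=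
    F.evZero_an_apply i b (fun j l x => sg j • F.sb (n + (k + p - l) - j) x (m + j) (F.theta a) c)
      (by simp [z2]) fun l => (F.evZero_sb ..).smul _
  simp only [borS]
  rw [← bsum_comm e1, ← bsum_comm e2, ← bsum_linearMap ((F.evZero_sb ..).smul _),
    ← bsum_add ((F.evZero_sb ..).smul _) (e1.evZero_bsum _),
    ← bsum_add (((F.evZero_sb ..).smul _).add (e1.evZero_bsum _)) (e2.evZero_bsum _)]
  refine bsum_congr _ fun j => ?_
  rw [map_zsmul, phi_sb,
    bsum_smul ((F.evZero_an i a).map_seq (fun l x => F.sb (n + k - j) b (m + p - l + j) x c) (by simp [z1])),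
    bsum_smul ((F.evZero_an i b).map_seq (fun l x => F.sb (n + (k + p - l) - j) x (m + j) (F.theta a) c)
      (by simp [z2])), ← smul_add, ← smul_add]
  simp only [show ∀ l : ℕ, p + (m + j) - l = m + p - l + (j : ℤ) by intros; ring,
    show ∀ l : ℕ, p + (n + k - j) - l = n + (k + p - l) - (j : ℤ) by intros; ring]

theorem phi_borL (i) (p m n k : ℤ) (a b c : F.Fock) : F.phi i p (F.borL m n k a b c) =
    F.borL m n k (F.theta a) (F.theta b) (F.phi i p c) +
      bsum p (fun l => F.borL (m + p - l) n k (F.an i l a) b c) +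
      bsum p (fun l => F.borL m n (k + p - l) (F.theta a) (F.an i l b) c) := by
  have e1 : EvZero₂ fun j l : ℕ => F.md (m + (k + p - l) - j) (F.md (n + j) (F.theta a) (F.an i l b)) c :=
    F.evZero_an_apply i b (fun j l x => F.md (m + (k + p - l) - j) (F.md (n + j) (F.theta a) x) c)
      (by simp) fun l => F.evZero_borL ..
  have e2 (j : ℕ) : EvZero₂ fun l q : ℕ =>
      F.md (p + m + k - j - q) (F.md (q + n + j - l) (F.an i l a) b) c := by
    apply EvZero₂.of
    · obtain ⟨J, hJ⟩ := F.evZero_an i a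
      exact ⟨J, fun l hl q => by beta_reduce at hJ; simp [hJ l hl]⟩
    · intro l
      have := (F.evZero_md (n + j - l) (F.an i l a) b).map_seq
        (fun q x => F.md (p + m + k - j - q) x c) (by simp)
      simpa only [show ∀ q : ℕ, n + j - l + (q : ℤ) = q + n + j - l by intros; ring] using this
  have e3 : EvZero₂ fun j l : ℕ => bsum (p - l) fun q : ℕ =>
      F.md (p + m + k - l - (j + q : ℕ)) (F.md (n + (j + q : ℕ)) (F.an i l a) b) c := by
    refine F.evZero_an_apply i a (fun j l x => bsum (p - l) fun q : ℕ =>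
      F.md (p + m + k - l - (j + q : ℕ)) (F.md (n + (j + q : ℕ)) x b) c)
      (by simp [bsum_zero_fun]) fun l => ?_
    obtain ⟨J, hJ⟩ := F.evZero_md n (F.an i l a) b
    refine ⟨J, fun j hj => ?_⟩
    have : ∀ q : ℕ, F.md (n + (j + q : ℕ)) (F.an i l a) b = 0 := fun q => hJ (j + q) (by omega)
    simp only [this, map_zero, LinearMap.zero_apply, bsum_zero_fun]
  have E3 (l : ℕ) : F.borL (m + p - l) n k (F.an i l a) b c = bsum m fun j => bsum (p - l) fun q : ℕ =>
      F.md (p + m + k - l - (j + q : ℕ)) (F.md (n + (j + q : ℕ)) (F.an i l a) b) c := by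
    rw [bsum_bsum_add (f := fun t : ℕ => F.md (p + m + k - l - t) (F.md (n + t) (F.an i l a) b) c)
      (F.evZero_borL ..), borL, show m + p - (l : ℤ) = m + (p - l) by ring]
    refine bsum_congr _ fun j => ?_
    rw [show m + (p - l) + k - (j : ℤ) = p + m + k - l - j by ring]
  rw [bsum_congr p E3, ← bsum_comm e3]
  simp only [borL]
  rw [← bsum_comm e1, ← bsum_linearMap (F.evZero_borL ..),
    ← bsum_add (F.evZero_borL ..) (e3.evZero_bsum _),
    ← bsum_add ((F.evZero_borL ..).add (e3.evZero_bsum _)) (e1.evZero_bsum _)]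
  refine bsum_congr _ fun j => ?_
  rw [phi_md, theta_md, add_assoc]
  congr 1
  have E4 (q : ℕ) : F.md (p + (m + k - j) - q) (F.an i q (F.md (n + j) a b)) c =
      F.md (m + (k + p - q) - j) (F.md (n + j) (F.theta a) (F.an i q b)) c +
      bsum q fun l => F.md (p + m + k - j - q) (F.md (q + n + j - l) (F.an i l a) b) c := by
    rw [← phi_natCast, phi_md, ← flip_apply (F.md (p + (m + k - j) - q)), map_add,
      ← bsum_linearMap (F.evZero_md_an ..)]
    simp only [flip_apply, phi_natCast]
    rw [show p + (m + k - j) - (q : ℤ) = m + (k + p - q) - j by ring]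
    congr 1
    refine bsum_congr _ fun l => ?_
    rw [show m + (k + p - q) - (j : ℤ) = p + m + k - j - q by ring, add_assoc (q : ℤ)]
  have e4 : EvZero fun q : ℕ => bsum q fun l : ℕ =>
      F.md (p + m + k - j - q) (F.md (q + n + j - l) (F.an i l a) b) c := by
    obtain ⟨J, hJ⟩ := e2 j
    refine ⟨J, fun q hq => ?_⟩
    have : ∀ l : ℕ, F.md (p + m + k - j - q) (F.md (q + n + j - l) (F.an i l a) b) c = 0 :=
      fun l => hJ l q (Or.inr hq)
    simp [this, bsum_zero_fun]
  have e5 : EvZero fun q : ℕ => F.md (m + (k + p - q) - j) (F.md (n + j) (F.theta a) (F.an i q b)) c :=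
    (F.evZero_an i b).map_seq (fun q x => F.md (m + (k + p - q) - j) (F.md (n + j) (F.theta a) x) c)
      (by simp)
  rw [bsum_congr p E4, bsum_add e5 e4, bsum_trinomial (e2 j), add_comm]
  congr 1
  refine bsum_congr _ fun l => bsum_congr _ fun q => ?_
  push_cast
  rw [show p + m + k - j - ((l : ℤ) + q) = p + m + k - l - (j + q) by ring,
    show (l : ℤ) + q + n + j - l = n + (j + q) by ring]

theorem evZero_defect_left (i) (m : ℕ → ℤ) (n k : ℤ) (a b c : F.Fock) :
    (EvZero fun j => F.borL (m j) n k (F.an i j a) b c) ∧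
    (EvZero fun j => F.borR (m j) n k (F.an i j a) b c) ∧
    (EvZero fun j => F.borS (m j) n k (F.an i j a) b c) := by
  refine ⟨(F.evZero_an i a).map_seq (fun j x => F.borL (m j) n k x b c) ?_,
    (F.evZero_an i a).map_seq (fun j x => F.borR (m j) n k x b c) ?_,
    (F.evZero_an i a).map_seq (fun j x => F.borS (m j) n k x b c) ?_⟩
  · simp [borL, bsum_zero_fun]
  · simp [borR, bsum_zero_fun]
  · simp [borS, sb, ev, od, bsum_zero_fun]

theorem evZero_defect_right (i) (m n : ℤ) (k : ℕ → ℤ) (a b c : F.Fock) :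
    (EvZero fun j => F.borL m n (k j) a (F.an i j b) c) ∧
    (EvZero fun j => F.borR m n (k j) a (F.an i j b) c) ∧
    (EvZero fun j => F.borS m n (k j) a (F.an i j b) c) := by
  refine ⟨(F.evZero_an i b).map_seq (fun j x => F.borL m n (k j) a x c) ?_,
    (F.evZero_an i b).map_seq (fun j x => F.borR m n (k j) a x c) ?_,
    (F.evZero_an i b).map_seq (fun j x => F.borS m n (k j) a x c) ?_⟩
  · simp [borL, bsum_zero_fun]
  · simp [borR, bsum_zero_fun]
  · simp [borS, sb, bsum_zero_fun]

theorem phi_defect (i) (p m n k : ℤ) (a b c : F.Fock) : F.phi i p (F.defect m n k a b c) =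
    F.defect m n k (F.theta a) (F.theta b) (F.phi i p c) +
      bsum p (fun l => F.defect (m + p - l) n k (F.an i l a) b c) +
      bsum p (fun l => F.defect m n (k + p - l) (F.theta a) (F.an i l b) c) := by
  obtain ⟨l1, l2, l3⟩ := F.evZero_defect_left i (fun l => m + p - l) n k a b c
  obtain ⟨r1, r2, r3⟩ := F.evZero_defect_right i m n (fun l => k + p - l) (F.theta a) b c
  simp only [defect]
  rw [bsum_add (l1.sub l2) (l3.smul _), bsum_sub l1 l2, bsum_smul l3,
    bsum_add (r1.sub r2) (r3.smul _), bsum_sub r1 r2, bsum_smul r3,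
    map_add, map_sub, map_zsmul, phi_borL, phi_borR, phi_borS]
  module

end FieldData

theorem bsum_eq_zero {W : Type} [AddCommGroup W] {f : ℕ → W} (m : ℤ) (h : ∀ j, f j = 0) :
    bsum m f = 0 := by
  rw [funext h, bsum_zero_fun]

namespace FieldData

variable (F : FieldData)

theorem defect_add_left (m n k : ℤ) (a a' b c : F.Fock) :
    F.defect m n k (a + a') b c = F.defect m n k a b c + F.defect m n k a' b c := by
  have h1 : F.ev (a + a') = F.ev a + F.ev a' := by simp only [ev, map_add]; module
  have h2 : F.od (a + a') = F.od a + F.od a' := by simp only [od, map_add]; module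
  have hs (q b r) : F.sb q b r (a + a') c = F.sb q b r a c + F.sb q b r a' c := by
    simp only [sb, h1, h2, map_add, LinearMap.add_apply]; abel
  simp only [defect, borL, borR, borS, map_add, LinearMap.add_apply, hs, smul_add]
  rw [bsum_add (F.evZero_borL ..) (F.evZero_borL ..),
    bsum_add ((F.evZero_borR ..).smul _) ((F.evZero_borR ..).smul _),
    bsum_add ((F.evZero_sb ..).smul _) ((F.evZero_sb ..).smul _)]
  module

theorem defect_smul_left (m n k : ℤ) (s : ℂ) (a b c : F.Fock) :
    F.defect m n k (s • a) b c = s • F.defect m n k a b c := by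
  have h1 : F.ev (s • a) = s • F.ev a := by simp only [ev, map_smul]; module
  have h2 : F.od (s • a) = s • F.od a := by simp only [od, map_smul]; module
  have hs (q b r) : F.sb q b r (s • a) c = s • F.sb q b r a c := by
    simp only [sb, h1, h2, map_smul, LinearMap.smul_apply, smul_add]
  simp only [defect, borL, borR, borS, map_smul, LinearMap.smul_apply, hs,
    smul_comm (sg _) s]
  rw [bsum_csmul (F.evZero_borL ..), bsum_csmul ((F.evZero_borR ..).smul _),
    bsum_csmul ((F.evZero_sb ..).smul _)]
  module

theorem defect_add_right (m n k : ℤ) (a b c c' : F.Fock) :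
    F.defect m n k a b (c + c') = F.defect m n k a b c + F.defect m n k a b c' := by
  have hs (q b r a) : F.sb q b r a (c + c') = F.sb q b r a c + F.sb q b r a c' := by
    simp only [sb, map_add]; abel
  simp only [defect, borL, borR, borS, map_add, hs, smul_add]
  rw [bsum_add (F.evZero_borL ..) (F.evZero_borL ..),
    bsum_add ((F.evZero_borR ..).smul _) ((F.evZero_borR ..).smul _),
    bsum_add ((F.evZero_sb ..).smul _) ((F.evZero_sb ..).smul _)]
  module

theorem defect_smul_right (m n k : ℤ) (s : ℂ) (a b c : F.Fock) :
    F.defect m n k a b (s • c) = s • F.defect m n k a b c := by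
  have hs (q b r a) : F.sb q b r a (s • c) = s • F.sb q b r a c := by
    simp only [sb, map_smul, smul_add]
  simp only [defect, borL, borR, borS, map_smul, hs, smul_comm (sg _) s]
  rw [bsum_csmul (F.evZero_borL ..), bsum_csmul ((F.evZero_borR ..).smul _),
    bsum_csmul ((F.evZero_sb ..).smul _)]
  module

/-- The Borcherds identity follows if it holds on the vacuum. -/
theorem defect_eq_zero_of_one (S : Submodule ℂ F.Fock) (hθ : ∀ a ∈ S, F.theta a ∈ S)
    (han : ∀ a ∈ S, ∀ i j, F.an i j a ∈ S) (h : ∀ a ∈ S, ∀ b m n k, F.defect m n k a b 1 = 0)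
    {a : F.Fock} (ha : a ∈ S) (m n k : ℤ) (b c : F.Fock) : F.defect m n k a b c = 0 := by
  induction c using Fock.induction generalizing m n k a b with
  | one => exact h a ha b m n k
  | add v w hv hw => rw [defect_add_right, hv ha, hw ha, add_zero]
  | smul s v hv => rw [defect_smul_right, hv ha, smul_zero]
  | cr p c ih =>
    have := F.phi_defect p.1 (.negSucc p.2) m n k (F.theta a) (F.theta b) c
    rw [ih (hθ a ha), map_zero, bsum_congr _ fun l => ih (han _ (hθ a ha) p.1 l) _ .., bsum_zero_fun,
      bsum_congr (f := fun l => F.defect ..) _ fun l => ih (hθ _ (hθ a ha)) _ ..,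
      bsum_zero_fun, add_zero, add_zero, theta_theta, theta_theta, phi_negSucc] at this
    exact this.symm

theorem defect_one_left (m n k : ℤ) (b c : F.Fock) : F.defect m n k 1 b c = 0 := by
  have hsb (q b r) : F.sb q b r 1 c = if r = -1 then F.md q b c else 0 := by
    rw [sb, ev_one, od_one, map_zero, LinearMap.zero_apply, map_zero, add_zero, md_one_left]
    split_ifs <;> simp
  refine pascal_eq_zero (G := fun m n k => F.defect m n k 1 b c)
    (fun m n k => F.defect_pascal m n k 1 b c) (fun n k => ?_) (fun m k => ?_) m n k
  · have hS : F.borS 0 n k 1 b c = 0 := by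
      rw [borS]
      refine bsum_eq_zero _ fun j => ?_
      rw [hsb, if_neg (by omega), smul_zero]
    have hL : F.borL 0 n k 1 b c = if n = -1 then F.md k b c else 0 := by
      rw [borL, bsum_zero, md_one_left]
      simp only [cast_zero, add_zero, sub_zero, zero_add]
      split_ifs <;> simp
    have hR : F.borR 0 n k 1 b c = if n = -1 then F.md k b c else 0 := by
      rw [borR]
      simp only [md_one_left]
      by_cases hn : 0 ≤ n
      · lift n to ℕ using hn
        rw [if_neg (by omega), bsum_natCast_eq_zero]
        intro j hj
        rw [if_neg (by omega), smul_zero]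
      · rw [bsum_eq (J := 1) (fun j hj => by rw [if_neg (by omega), smul_zero])]
        simp [sg_zero]
    rw [defect, hL, hR, hS]; simp
  · have hL : F.borL m 0 k 1 b c = 0 := by
      rw [borL]
      refine bsum_eq_zero _ fun j => ?_
      rw [md_one_left, if_neg (by omega), map_zero, LinearMap.zero_apply]
    rw [defect, hL, borR, borS, bsum_zero, bsum_zero, md_one_left, hsb, cast_zero, sg_zero]
    simp only [add_zero, sub_zero, zero_add]
    split_ifs <;> simp

theorem md_one_eq_zero {n : ℤ} (hn : 0 ≤ n) (a : F.Fock) : F.md n a 1 = 0 := by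
  lift n to ℕ using hn
  exact F.md_natCast_one n a

theorem md_neg_one_one (a : F.Fock) : F.md (-1) a 1 = a := by
  rw [show (-1 : ℤ) = .negSucc 0 from rfl, md_negSucc_one, tpow_zero]

theorem defect_zero_right (m n k : ℤ) (a b : F.Fock) : F.defect m n k a b 0 = 0 := by
  have := F.defect_smul_right m n k 0 a b 0
  rwa [zero_smul, zero_smul] at this

theorem defect_zero_vacuum (n k : ℤ) (a b : F.Fock) : F.defect 0 n k a b 1 = 0 := by
  have hS (k) : F.borS 0 n k a b 1 = 0 := by
    rw [borS]
    refine bsum_eq_zero _ fun j => ?_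
    rw [sb, md_one_eq_zero F (by omega), md_one_eq_zero F (by omega)]
    simp
  have hneg : ∀ s : ℕ, F.defect 0 n (-1 - s) a b 1 = 0 := by
    intro s
    induction s with
    | zero =>
      rw [defect, hS, borL, bsum_zero, borR, bsum_eq (J := 1) (fun j hj => by
        rw [md_one_eq_zero F (by omega), map_zero, smul_zero])]
      simp [sg_zero, md_neg_one_one]
    | succ s ih =>
      have := F.defect_trans 0 n (-1 - s) a b 1
      rw [ih, trans_one, defect_zero_right, map_zero, zero_smul, zero_sub, neg_zero, zero_sub, eq_comm,
        neg_eq_zero, ← cast_smul_eq_zsmul ℂ, smul_eq_zero] at this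
      rcases this with h | h
      · rw [Int.cast_eq_zero] at h; omega
      · rw [← h]; push_cast; ring_nf
  by_cases hk : 0 ≤ k
  · rw [defect, hS, borL, bsum_zero, md_one_eq_zero F (by simpa using hk), borR, bsum_congr n (g := fun _ => 0)
      fun j => by rw [md_one_eq_zero F (by omega), map_zero, smul_zero], bsum_zero_fun]
    simp
  · obtain ⟨s, rfl⟩ : ∃ s : ℕ, k = -1 - s := ⟨(-1 - k).toNat, by omega⟩
    exact hneg s

theorem sb_cr (q : ℤ) (b : F.Fock) (r : ℤ) (i) (c : F.Fock) :
    F.sb q b r (F.cr (i, 0)) c = F.md q (F.theta b) (F.phi i r c) := by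
  rcases F.eps_eq with h | h
  · rw [sb, F.od_of_eps h, F.ev_of_eps h, F.theta_of_eps h, md_cr_left]; simp
  · rw [sb, ev, od, theta_cr, h, ← md_cr_left]; simp [← two_smul ℂ, smul_smul]

theorem defect_cr (m n k : ℤ) (i) (b c : F.Fock) : F.defect m n k (F.cr (i, 0)) b c = 0 := by
  let S : Submodule ℂ F.Fock := span ℂ {1, F.cr (i, 0)}
  have hS {a : F.Fock} : a ∈ S ↔ ∃ s t : ℂ, s • 1 + t • F.cr (i, 0) = a := Submodule.mem_span_pair
  have hcr : F.cr (i, 0) ∈ S := hS.2 ⟨0, 1, by simp⟩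
  refine F.defect_eq_zero_of_one S ?_ ?_ ?_ hcr m n k b c
  · intro a ha
    obtain ⟨s, t, rfl⟩ := hS.1 ha
    exact hS.2 ⟨s, t * F.eps, by simp [theta_cr, smul_smul]⟩
  · intro a ha j l
    obtain ⟨s, t, rfl⟩ := hS.1 ha
    rw [map_add, map_smul, map_smul, an_one, an_cr, smul_zero, zero_add, smul_smul]
    exact hS.2 ⟨_, 0, by simp; rfl⟩
  · intro a ha b m n k
    obtain ⟨s, t, rfl⟩ := hS.1 ha
    rw [defect_add_left, defect_smul_left, defect_smul_left, defect_one_left, smul_zero, zero_add]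
    rw [pascal_eq_zero (G := fun m n k => F.defect m n k (F.cr (i, 0)) b 1)
      (fun m n k => F.defect_pascal m n k _ b 1) (fun n k => F.defect_zero_vacuum n k _ b), smul_zero]
    intro m k
    rw [defect, borR, borS, bsum_zero, bsum_zero, cast_zero, sg_zero, sb_cr]
    simp only [add_zero, sub_zero, zero_add, one_smul, md_cr_left]
    rw [phi_md, borL]
    simp only [md_cr_left, zero_add, phi_natCast]
    abel

/-- The modes of an iterated product. -/
theorem md_phi (i) (p n : ℤ) (a b : F.Fock) : F.md n (F.phi i p a) b =
    (bsum p fun j => sg j • F.phi i (p - j) (F.md (n + j) a b)) -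
      sg p • bsum p fun j => sg j • F.md (p + n - j) (F.theta a) (F.an i j b) := by
  have := F.defect_cr 0 p n i a b
  rw [defect, borL, borR, borS, bsum_zero] at this
  simp only [cast_zero, add_zero, zero_add, sub_zero, md_cr_left, sb_cr, phi_natCast] at this
  linear_combination (norm := module) this

theorem choose_neg_one (l : ℕ) : Ring.choose (-1 : ℤ) l = sg l := by
  rw [Ring.choose_neg, show (1 : ℤ) + l - 1 = l by ring, choose_natCast]
  simp [sg, Units.smul_def]

theorem evZero_tpow_md (n : ℤ) (a b : F.Fock) : EvZero fun j => F.tpow j (F.md (n + j) a b) :=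
  (F.evZero_md n a b).map_seq (fun j x => F.tpow j x) (by simp)

theorem sm_eq (n : ℤ) (b a : F.Fock) :
    F.sm n b a = -(sg n • bsum (-1) fun j => F.tpow j (F.md (n + j) a b)) := by
  have e1 := F.evZero_tpow_md
  induction a using Fock.induction generalizing n b with
  | one =>
    rw [sm, ev_one, od_one, map_zero, add_zero]
    by_cases hn : 0 ≤ n
    · rw [md_one_eq_zero F hn, bsum_congr _ (g := fun _ => 0) fun j => by
        rw [md_one_left, if_neg (by omega), map_zero], bsum_zero_fun, smul_zero, neg_zero]
    · obtain ⟨r, rfl⟩ := Int.eq_negSucc_of_lt_zero (not_le.1 hn)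
      rw [md_negSucc_one, bsum, finsum_eq_single _ r, md_one_left, if_pos (by omega), choose_neg_one, smul_smul,
        ← sg_add, show negSucc r + r = -1 by omega]
      · simp [sg]
      · intro j hj
        rw [md_one_left, if_neg (by omega), map_zero, smul_zero]
  | add v w hv hw =>
    have : F.sm n b (v + w) = F.sm n b v + F.sm n b w := by
      simp only [sm, ev, od, map_add, map_smul, map_sub]; module
    simp only [this, hv, hw, map_add, LinearMap.add_apply]
    rw [bsum_add (e1 ..) (e1 ..)]
    module
  | smul c v hv =>
    have : F.sm n b (c • v) = c • F.sm n b v := by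
      simp only [sm, ev, od, map_add, map_smul, map_sub]; module
    simp only [this, hv, map_smul, LinearMap.smul_apply]
    rw [bsum_csmul (e1 ..)]
    module
  | cr q a ih =>
    rw [← phi_negSucc]
    generalize negSucc q.2 = p
    have hθ (n b) : F.sm n b (F.theta a) =
        -(sg n • bsum (-1) fun j => F.tpow j (F.md (n + j) (F.theta a) b)) := by
      have h1 : F.sm n b (F.theta a) = F.theta (F.sm n (F.theta b) a) := by
        rw [sm, sm, map_add, theta_md, theta_md, theta_theta, ev_theta, od_theta, theta_ev,
          theta_od]
      rw [h1, ih, map_neg, map_zsmul, ← toLinearMap_apply F.theta, ← bsum_linearMap (e1 ..)]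
      simp only [toLinearMap_apply, theta_tpow, theta_md, theta_theta]
    have e2 : EvZero₂ fun l j : ℕ => F.tpow l (sg j • F.md (p + (n + l) - j) (F.theta a) (F.an q.1 j b)) :=
      F.evZero_an_apply q.1 b (fun l j x => F.tpow l (sg j • F.md (p + (n + l) - j) (F.theta a) x))
        (by simp) fun j => by
          have := (F.evZero_md (p + n - j) (F.theta a) (F.an q.1 j b)).map_seq
            (fun l x => F.tpow l (sg j • x)) (by simp)
          simpa only [show ∀ l : ℕ, p + n - j + (l : ℤ) = p + (n + l) - j by intros; ring] using this
    have e3 (l : ℕ) : EvZero fun j : ℕ => sg j • F.md (p + (n + l) - j) (F.theta a) (F.an q.1 j b) :=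
      (F.evZero_an q.1 b).map_seq (fun j x => sg j • F.md (p + (n + l) - j) (F.theta a) x) (by simp)
    have e4 : EvZero fun l : ℕ => F.tpow l (bsum p fun j : ℕ =>
        sg j • F.phi q.1 (p - j) (F.md (n + (l + j : ℕ)) a b)) := by
      obtain ⟨J, hJ⟩ := F.evZero_md n a b
      refine ⟨J, fun l hl => ?_⟩
      have : ∀ j : ℕ, F.md (n + (l + j : ℕ)) a b = 0 := fun j => hJ (l + j) (by omega)
      simp only [this, map_zero, smul_zero, bsum_zero_fun]
    have E1 := F.phi_bsum_tpow q.1 p (F.evZero_md n a b)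
    have E2 (l : ℕ) : F.tpow l (F.md (n + l) (F.phi q.1 p a) b) =
        F.tpow l (bsum p fun j : ℕ => sg j • F.phi q.1 (p - j) (F.md (n + (l + j : ℕ)) a b)) -
        sg p • bsum p fun j : ℕ => F.tpow l (sg j • F.md (p + (n + l) - j) (F.theta a) (F.an q.1 j b)) := by
      rw [bsum_linearMap (e3 l), md_phi, map_sub, map_zsmul]
      push_cast
      simp only [add_assoc]
    rw [sm_phi, ih, map_neg, map_zsmul, E1, bsum_congr _ E2, bsum_sub e4
      ((e2.evZero_bsum _).smul _), bsum_smul (e2.evZero_bsum _),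
      bsum_comm e2]
    have E3 (j : ℕ) : F.sm (p + n - j) (F.an q.1 j b) (F.theta a) = -((sg n * sg p) • bsum (-1) fun l : ℕ =>
        F.tpow l (sg j • F.md (p + (n + l) - j) (F.theta a) (F.an q.1 j b))) := by
      rw [hθ]
      simp only [map_zsmul]
      rw [bsum_smul]
      · rw [smul_smul]
        congr 2
        · rw [mul_assoc, ← sg_add, ← sg_add]
          simp only [sg]
          congr 1
          rw [Int.negOnePow_eq_iff]
          exact ⟨-j, by ring⟩
        · refine bsum_congr _ fun l => ?_
          rw [show p + n - j + (l : ℤ) = p + (n + l) - j by ring]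
      · have := e1 (p + n - j) (F.theta a) (F.an q.1 j b)
        simpa only [show ∀ l : ℕ, p + n - j + (l : ℤ) = p + (n + l) - j by intros; ring] using this
    rw [bsum_congr _ E3, bsum_neg, bsum_smul (e2.swap.evZero_bsum _)]
    module

/-- The Borcherds identity. -/
theorem defect_eq_zero (m n k : ℤ) (a b c : F.Fock) : F.defect m n k a b c = 0 := by
  refine F.defect_eq_zero_of_one ⊤ (fun _ _ => trivial) (fun _ _ _ _ => trivial) ?_
    (mem_top (x := a)) m n k b c
  clear a b c m n k
  intro a _ b
  have hpos : ∀ (m : ℕ) n k, F.defect m n k a b 1 = 0 := by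
    intro m
    induction m with
    | zero => exact fun n k => F.defect_zero_vacuum n k a b
    | succ m ih =>
      intro n k
      have := F.defect_pascal m n k a b 1
      rw [ih, ih, sub_zero] at this
      exact_mod_cast this.symm
  have hrec (n k) : F.defect (-1) (n + 1) k a b 1 = - F.defect (-1) n (k + 1) a b 1 := by
    rw [defect_pascal, neg_add_cancel, defect_zero_vacuum, zero_sub]
  have h0 (n) : F.defect (-1) n (-1) a b 1 = 0 := by
    have hL : F.borL (-1) n (-1) a b 1 = bsum (-1) fun j => F.tpow (j + 1) (F.md (n + j) a b) := by
      refine bsum_congr _ fun j => ?_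
      rw [show (-1 : ℤ) + -1 - j = .negSucc (j + 1) by omega, md_negSucc_one]
    have hR : F.borR (-1) n (-1) a b 1 = F.md (n - 1) a b := by
      rw [borR, bsum_eq (J := 1) fun j hj => by rw [md_one_eq_zero F (by omega), map_zero, smul_zero]]
      simp [sg_zero, md_neg_one_one, show (-1 : ℤ) + n = n - 1 by ring]
    have hS : F.borS (-1) n (-1) a b 1 = F.sm (n - 1) b a := by
      rw [borS, bsum_eq (J := 1) fun j hj => by
        rw [sb, md_one_eq_zero F (by omega), md_one_eq_zero F (by omega)]; simp]
      simp [sg_zero, sb, sm, md_neg_one_one, show n + (-1 : ℤ) = n - 1 by ring]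
    have hsg : sg n = - sg (n - 1) := by rw [← sg_succ, sub_add_cancel]
    rw [defect, hL, hR, hS, sm_eq, bsum_neg_one (F.evZero_tpow_md ..), hsg, smul_neg, neg_smul, neg_neg, smul_smul, sg_mul_self]
    simp only [cast_zero, add_zero, tpow_zero, Nat.cast_add, Nat.cast_one,
      show ∀ j : ℕ, n - 1 + ((j : ℤ) + 1) = n + j by intros; ring]
    simp
  have h1 : ∀ (s : ℕ) n, F.defect (-1) n (-1 + s) a b 1 = 0 ∧ F.defect (-1) n (-1 - s) a b 1 = 0 := by
    intro s
    induction s with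
    | zero => exact fun n => ⟨by simpa using h0 n, by simpa using h0 n⟩
    | succ s ih =>
      intro n
      constructor
      · have := hrec n (-1 + s)
        rw [(ih _).1, eq_comm, neg_eq_zero] at this
        rw [← this]; push_cast; ring_nf
      · have := hrec (n - 1) (-1 - s - 1)
        rw [sub_add_cancel, sub_add_cancel, (ih _).2, neg_zero] at this
        rw [← this]; push_cast; ring_nf
  have hm1 (n k) : F.defect (-1) n k a b 1 = 0 := by
    rcases le_total (-1) k with h | h
    · obtain ⟨s, rfl⟩ : ∃ s : ℕ, k = -1 + s := ⟨(k + 1).toNat, by omega⟩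
      exact (h1 s n).1
    · obtain ⟨s, rfl⟩ : ∃ s : ℕ, k = -1 - s := ⟨(-1 - k).toNat, by omega⟩
      exact (h1 s n).2
  have hneg : ∀ (s : ℕ) n k, F.defect (-1 - s) n k a b 1 = 0 := by
    intro s
    induction s with
    | zero => simpa using hm1
    | succ s ih =>
      intro n k
      have := F.defect_trans (-1 - s) n k a b 1
      rw [ih, trans_one, defect_zero_right, ih, map_zero, smul_zero, zero_sub, sub_zero, eq_comm,
        neg_eq_zero, ← cast_smul_eq_zsmul ℂ, smul_eq_zero] at this
      rcases this with h | h
      · rw [Int.cast_eq_zero] at h; omega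
      · rw [← h]; push_cast; ring_nf
  intro m n k
  by_cases hk : 0 ≤ m
  · lift m to ℕ using hk
    exact hpos m n k
  · obtain ⟨s, rfl⟩ : ∃ s : ℕ, m = -1 - s := ⟨(-1 - m).toNat, by omega⟩
    exact hneg s n k

end FieldData

namespace FieldData

variable (F : FieldData)

/-- The projection of the Fock space to the line of the vacuum. -/
def vac : F.Fock →ₐ[ℂ] ℂ := F.lift (fun _ => 0) (by simp)

theorem vac_cr_mul (p) (v : F.Fock) : F.vac (F.cr p * v) = 0 := by simp [vac]

/-- The grading of the Fock space by the number of creation operators, in the form of the map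
`v ↦ ∑ tⁿ vₙ`. -/
def grad : F.Fock →ₐ[ℂ] Polynomial F.Fock :=
  F.lift (fun p => Polynomial.C (F.cr p) * Polynomial.X) (by
    intro p q
    have h (a b : F.Fock) : Polynomial.C a * Polynomial.X * (Polynomial.C b * Polynomial.X) =
        Polynomial.C (a * b) * Polynomial.X ^ 2 := by
      rw [mul_assoc, ← mul_assoc Polynomial.X, X_mul_C, mul_assoc, ← mul_assoc, ← sq,
        ← Polynomial.C_mul]
    rw [h, h, F.cr_comm, ← Polynomial.smul_C, smul_mul_assoc])

theorem grad_cr_mul (p) (v : F.Fock) :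
    F.grad (F.cr p * v) = Polynomial.C (F.cr p) * Polynomial.X * F.grad v := by simp [grad]

/-- The matrix of the contractions of the fields is a multiple of a permutation matrix. -/
structure Nondeg where
  dual : F.I → F.I
  scale : ℂ
  ne_zero : scale ≠ 0
  eq_scale : ∀ i, F.g (dual i) i = scale
  eq_zero : ∀ i j, i ≠ j → F.g (dual i) j = 0

variable {F} (N : F.Nondeg)

/-- The derivation dual to a creation operator. -/
def Nondeg.dn (p : F.I × ℕ) : F.Fock →ₗ[ℂ] F.Fock :=
  (N.scale * (p.2 + F.ord).choose F.ord)⁻¹ • F.an (N.dual p.1) (p.2 + F.ord)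

theorem Nondeg.dn_cr_mul [DecidableEq F.I] (p q) (v : F.Fock) : N.dn p (F.cr q * v) =
    (if p = q then v else 0) + F.eps • (F.cr q * N.dn p v) := by
  rw [dn, LinearMap.smul_apply, LinearMap.smul_apply, an_cr_mul, smul_add, mul_smul_comm,
    smul_comm F.eps, contr, smul_smul]
  congr 1
  have h1 : ((p.2 + F.ord : ℕ) : ℤ) + negSucc q.2 + 1 = F.ord ↔ p.2 = q.2 := by
    rw [negSucc_eq]; push_cast; omega
  have h2 : p = q ↔ p.2 = q.2 ∧ p.1 = q.1 := by rw [Prod.ext_iff, and_comm]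
  have h3 : N.scale * ((p.2 + F.ord).choose F.ord : ℂ) ≠ 0 :=
    mul_ne_zero N.ne_zero (by exact_mod_cast (Nat.choose_pos (by omega)).ne')
  simp only [h1, h2]
  by_cases h : p.2 = q.2
  · by_cases h' : p.1 = q.1
    · rw [if_pos h, if_pos ⟨h, h'⟩, choose_natCast, ← h', N.eq_scale]
      push_cast
      rw [inv_mul_cancel₀ h3, one_smul]
    · rw [if_pos h, if_neg (by tauto), N.eq_zero _ _ h']; simp
  · rw [if_neg h, if_neg (by tauto)]; simp

theorem Nondeg.derivative_grad [Fintype F.I] (v : F.Fock) : ∃ J : ℕ, ∀ K, J ≤ K →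
    Polynomial.X * Polynomial.derivative (F.grad v) =
      ∑ p ∈ Finset.univ ×ˢ range K, F.grad (F.cr p * N.dn p v) := by
  classical
  induction v using Fock.induction with
  | one => exact ⟨0, fun K _ => by simp [dn]⟩
  | add v w hv hw =>
    obtain ⟨J, hJ⟩ := hv
    obtain ⟨J', hJ'⟩ := hw
    refine ⟨max J J', fun K hK => ?_⟩
    simp only [map_add, mul_add, sum_add_distrib]
    rw [hJ K (by omega), hJ' K (by omega)]
  | smul c v hv =>
    obtain ⟨J, hJ⟩ := hv
    refine ⟨J, fun K hK => ?_⟩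
    simp only [map_smul, mul_smul_comm, Polynomial.derivative_smul]
    rw [hJ K hK, smul_sum]
  | cr q v hv =>
    obtain ⟨J, hJ⟩ := hv
    refine ⟨max J (q.2 + 1), fun K hK => ?_⟩
    have h1 (p : F.I × ℕ) : F.grad (F.cr p * N.dn p (F.cr q * v)) =
        (if p = q then F.grad (F.cr p * v) else 0) +
          Polynomial.C (F.cr q) * Polynomial.X * F.grad (F.cr p * N.dn p v) := by
      rw [N.dn_cr_mul, mul_add, map_add, mul_smul_comm, ← mul_assoc, F.cr_comm p q, smul_mul_assoc,
        smul_smul, F.eps_mul_eps, one_smul, mul_assoc, grad_cr_mul F q]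
      congr 1
      split_ifs <;> simp
    simp only [h1, sum_add_distrib]
    rw [Finset.sum_ite_eq', if_pos (by simp; omega), ← Finset.mul_sum, ← hJ K (by omega), grad_cr_mul,
      Polynomial.derivative_mul, Polynomial.derivative_C_mul, derivative_X, mul_one, mul_add]
    congr 1
    · rw [← mul_assoc, X_mul_C]
    · rw [← mul_assoc, ← mul_assoc, ← mul_assoc, X_mul_C]

/-- A vector that is annihilated by all annihilation operators is a multiple of the vacuum. -/
theorem Nondeg.eq_vac (N : F.Nondeg) [Fintype F.I] {v : F.Fock} (h : ∀ i m, F.an i m v = 0) :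
    v = F.vac v • 1 := by
  obtain ⟨J, hJ⟩ := N.derivative_grad v
  have h0 := hJ J le_rfl
  simp only [dn, LinearMap.smul_apply, h, smul_zero, mul_zero, map_zero, Finset.sum_const_zero] at h0
  have hc (n : ℕ) : (F.grad v).coeff (n + 1) = 0 := by
    have := congrArg (Polynomial.coeff · (n + 1)) h0
    simp only [Polynomial.coeff_X_mul, Polynomial.coeff_derivative, Polynomial.coeff_zero] at this
    have h2 : ((n : F.Fock) + 1) = algebraMap ℂ F.Fock (n + 1) := by simp
    rw [h2, ← Algebra.commutes, ← smul_def, smul_eq_zero] at this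
    exact this.resolve_left (by exact_mod_cast n.succ_ne_zero)
  have hC : F.grad v = Polynomial.C ((F.grad v).coeff 0) := by
    ext (_ | n)
    · simp
    · rw [hc, Polynomial.coeff_C_succ]
  have e1 : ∀ v, (F.grad v).eval 1 = v := by
    intro v
    induction v using Fock.induction with
    | one => simp
    | add v w hv hw => simp [hv, hw]
    | smul c v hv => simp [hv, Polynomial.eval_smul]
    | cr p v hv => rw [grad_cr_mul, mul_assoc, X_mul, Polynomial.eval_C_mul,
        Polynomial.eval_mul_X, hv, mul_one]
  have e0 : ∀ v, (F.grad v).coeff 0 = F.vac v • 1 := by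
    intro v
    induction v using Fock.induction with
    | one => simp
    | add v w hv hw => simp [hv, hw, add_smul]
    | smul c v hv => simp [hv, mul_smul]
    | cr p v hv => rw [grad_cr_mul, mul_assoc, Polynomial.coeff_C_mul, X_mul,
        Polynomial.coeff_mul_X_zero, mul_zero, vac_cr_mul, zero_smul]
  conv_lhs => rw [← e1 v, hC, Polynomial.eval_C, e0]

theorem Nondeg.eq_vac_tensor (N : F.Nondeg) [Fintype F.I] {R : Type} [CommRing R] [Algebra ℂ R] {x : R ⊗[ℂ] F.Fock}
    (h : ∀ i m, (F.an i m).lTensor R x = 0) : ∃ r : R, x = r ⊗ₜ 1 := by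
  classical
  let b := Module.Basis.ofVectorSpace ℂ R
  let e := TensorProduct.equivFinsuppOfBasisLeft (N := F.Fock) b
  have he (f : F.Fock →ₗ[ℂ] F.Fock) (x) (i) : e (f.lTensor R x) i = f (e x i) := by
    induction x using induction_on with
    | zero => simp
    | add x y hx hy => simp [hx, hy]
    | tmul r v => simp [e]
  have key (i) : e x i = F.vac (e x i) • 1 := N.eq_vac fun j m => by rw [← he, h]; simp
  refine ⟨(e x).sum fun i v => F.vac v • b i, ?_⟩
  have : e.symm (e x) = _ := TensorProduct.equivFinsuppOfBasisLeft_symm_apply b (e x)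
  rw [e.symm_apply_apply] at this
  conv_lhs => rw [this]
  rw [Finsupp.sum, Finsupp.sum, TensorProduct.sum_tmul]
  refine sum_congr rfl fun i _ => ?_
  rw [key, tmul_smul, smul_tmul']
  simp

end FieldData

open KaehlerDifferential (D)

namespace Fam

variable (X : Fam)

/-! ### Coordinates -/

instance algR : Algebra ℂ X.R := ((algebraMap X.k X.R).comp (algebraMap ℂ X.k)).toAlgebra

instance : IsScalarTower ℂ X.k X.R := .of_algebraMap_eq fun _ => rfl

theorem scal_eq (c : ℂ) : X.scal c = algebraMap ℂ X.R c := rfl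

variable {X} (z : X.Coord)

/-- The isomorphism `f ↦ f dz` of functions with differentials. -/
def omEquiv : X.R ≃ₗ[X.R] X.Om :=
  ofBijective (LinearMap.toSpanSingleton X.R X.Om (X.d z)) z.2

theorem omEquiv_apply (f : X.R) : omEquiv z f = f • X.d z := rfl

/-- The vector field `d/dz`. -/
def ddz : X.Th := (omEquiv z).symm.toLinearMap.compDer (D X.k X.R)

theorem d_eq (f : X.R) : X.d f = ddz z f • X.d z := by
  rw [← omEquiv_apply]
  exact ((omEquiv z).apply_symm_apply _).symm

theorem smul_d_inj {f g : X.R} (h : f • X.d z = g • X.d z) : f = g :=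
  (omEquiv z).injective h

theorem ddz_self : ddz z z = 1 :=
  smul_d_inj z (by rw [← d_eq, one_smul])

theorem vec_apply_eq (ξ : X.Th) (f : X.R) : ξ f = ξ z * ddz z f := by
  rw [← ξ.liftKaehlerDifferential_comp_D f, d_eq z f, map_smul, ξ.liftKaehlerDifferential_comp_D,
    smul_eq_mul, mul_comm]

theorem vec_eq (ξ : X.Th) : ξ = ξ z • ddz z := by
  ext f
  exact vec_apply_eq z ξ f

theorem lift_smul_d (ξ : X.Th) (f : X.R) :
    ξ.liftKaehlerDifferential (f • X.d z) = f * ξ z := by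
  rw [map_smul, ξ.liftKaehlerDifferential_comp_D, smul_eq_mul]

/-- The unit `dw/dz`. -/
def jac (z w : X.Coord) : X.Rˣ where
  val := ddz z w
  inv := ddz w z
  val_inv := by
    apply smul_d_inj z
    rw [mul_comm, mul_smul, ← d_eq, ← d_eq, one_smul]
  inv_val := by
    apply smul_d_inj w
    rw [mul_comm, mul_smul, ← d_eq, ← d_eq, one_smul]

theorem d_jac (z w : X.Coord) : X.d w = (jac z w : X.R) • X.d z := d_eq z w

theorem eq_jac {z w : X.Coord} {u : X.Rˣ} (h : X.d w = (u : X.R) • X.d z) : u = jac z w :=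
  Units.ext (smul_d_inj z (by rw [← h, ← d_jac]))

/-! ### The ideal of the diagonal -/

variable (X) in
/-- The ideal of the diagonal. -/
abbrev idl : Ideal X.RR := KaehlerDifferential.ideal X.k X.R

theorem mem_idl {q : X.RR} : q ∈ X.idl ↔ lmul' X.k q = 0 := Iff.rfl

theorem sub_mem_idl (q : X.RR) : q - 1 ⊗ₜ lmul' X.k q ∈ X.idl := by
  rw [mem_idl, map_sub]; simp

theorem diag_mem_idl (z : X.R) : X.diag z ∈ X.idl := by
  rw [mem_idl, diag]; simp

theorem one_tmul_smul_toCotangent (c : X.R) (x : X.idl) :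
    c • X.idl.toCotangent x = X.idl.toCotangent ((1 ⊗ₜ[X.k] c : X.RR) • x) := by
  have h : ((c ⊗ₜ[X.k] (1 : X.R) : X.RR) - 1 ⊗ₜ c) ∈ X.idl := diag_mem_idl c
  rw [map_smul]
  have h2 : c • X.idl.toCotangent x = (c ⊗ₜ[X.k] (1 : X.R) : X.RR) • X.idl.toCotangent x :=
    (algebraMap_smul X.RR c _).symm
  rw [h2, ← sub_eq_zero, ← sub_smul, ← map_smul, Ideal.toCotangent_eq_zero, pow_two]
  exact mul_mem_mul h x.2

theorem diag_sub_mem (r : X.R) :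
    X.diag r - (1 ⊗ₜ ddz z r) * X.diag z ∈ X.idl ^ 2 := by
  have h := d_eq z r
  rw [d, D_apply, D_apply] at h
  have h2 := (one_tmul_smul_toCotangent (ddz z r)
    ⟨(1 : X.R) ⊗ₜ[X.k] (z : X.R) - (z : X.R) ⊗ₜ[X.k] (1 : X.R),
      KaehlerDifferential.one_smul_sub_smul_one_mem_ideal X.k (z : X.R)⟩)
  have h3 := (Ideal.toCotangent_eq X.idl).1 (h.trans h2)
  have := (X.idl ^ 2).neg_mem h3
  convert this using 1
  simp [diag]
  ring

theorem exists_idl_one {q : X.RR} (hq : q ∈ X.idl) :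
    ∃ c : X.R, q - (1 ⊗ₜ c) * X.diag z ∈ X.idl ^ 2 := by
  rw [idl, ← span_range_eq_ideal] at hq
  induction hq using span_induction with
  | mem x hx =>
    obtain ⟨s, rfl⟩ := hx
    refine ⟨- ddz z s, ?_⟩
    have := (X.idl ^ 2).neg_mem (diag_sub_mem z s)
    convert this using 1
    simp [diag, TensorProduct.tmul_neg]
    ring
  | zero => exact ⟨0, by simp⟩
  | add x y _ _ hx hy =>
    obtain ⟨c, hc⟩ := hx
    obtain ⟨c', hc'⟩ := hy
    refine ⟨c + c', ?_⟩
    convert (X.idl ^ 2).add_mem hc hc' using 1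
    rw [tmul_add]; ring
  | smul p x hx hc =>
    obtain ⟨c, hc⟩ := hc
    refine ⟨lmul' X.k p * c, ?_⟩
    have h1 := (X.idl ^ 2).mul_mem_left p hc
    have h2 : (p - 1 ⊗ₜ lmul' X.k p) * ((1 ⊗ₜ c) * X.diag z) ∈ X.idl ^ 2 := by
      rw [pow_two]
      exact mul_mem_mul (sub_mem_idl p) (mul_mem_left _ _ (diag_mem_idl _))
    convert (X.idl ^ 2).add_mem h1 h2 using 1
    have : (1 : X.R) ⊗ₜ[X.k] (lmul' X.k p * c) =
        (1 ⊗ₜ[X.k] lmul' X.k p) * (1 ⊗ₜ[X.k] c) := by simp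
    rw [this, smul_eq_mul]; ring

/-- The powers of the ideal of the diagonal are generated by the powers of `z(x) - z(y)`, up to
higher powers. -/
theorem exists_idl_pow (j : ℕ) {q : X.RR} (hq : q ∈ X.idl ^ j) :
    ∃ c : X.R, q - (1 ⊗ₜ c) * X.diag z ^ j ∈ X.idl ^ (j + 1) := by
  induction j generalizing q with
  | zero => exact ⟨_, by rw [pow_zero, mul_one, zero_add, pow_one]; exact sub_mem_idl q⟩
  | succ j ih =>
    rw [pow_succ] at hq
    induction hq using Submodule.mul_induction_on' with
    | mem_mul_mem m hm n hn =>
      obtain ⟨c, hc⟩ := ih hm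
      obtain ⟨c', hc'⟩ := exists_idl_one z hn
      refine ⟨c * c', ?_⟩
      have h1 := mul_mem_mul hc hn
      have h2 := mul_mem_mul (pow_mem_pow (diag_mem_idl (X := X) z) j) hc'
      rw [← pow_succ] at h1
      rw [← pow_add] at h2
      convert (X.idl ^ (j + 1 + 1)).add_mem h1 (mul_mem_left _ (1 ⊗ₜ c) h2) using 1
      have : (1 : X.R) ⊗ₜ[X.k] (c * c') = (1 ⊗ₜ[X.k] c) * (1 ⊗ₜ[X.k] c') := by simp
      rw [this]; ring
    | add x _ y _ hx hy =>
      obtain ⟨c, hc⟩ := hx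
      obtain ⟨c', hc'⟩ := hy
      refine ⟨c + c', ?_⟩
      convert (X.idl ^ (j + 1 + 1)).add_mem hc hc' using 1
      rw [tmul_add]; ring

/-- The Taylor expansion of a function near the diagonal. -/
theorem exists_taylor (q : X.RR) (L : ℕ) :
    ∃ c : ℕ → X.R, q - ∑ j ∈ range L, (1 ⊗ₜ c j) * X.diag z ^ j ∈ X.idl ^ L := by
  induction L with
  | zero => exact ⟨0, by simp⟩
  | succ L ih =>
    obtain ⟨c, hc⟩ := ih
    obtain ⟨c', hc'⟩ := exists_idl_pow z L hc
    refine ⟨Function.update c L c', ?_⟩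
    rw [sum_range_succ, Function.update_self, ← sub_sub]
    convert hc' using 3
    refine sum_congr rfl fun j hj => ?_
    rw [Function.update_of_ne (by simp at hj; omega)]

/-- Elements of `W` agree with powers of `z(x) - z(y)` up to invertible functions and up to terms of
high order. -/
theorem exists_W {w : X.RR} (hw : w ∈ X.W) :
    ∃ d : ℕ, ∀ L, ∃ q : X.RR, w * q - X.diag z ^ d ∈ X.idl ^ L := by
  induction hw using Submonoid.closure_induction with
  | mem w hw =>
    rcases hw with hw | ⟨w, rfl⟩
    · refine ⟨0, fun L => ?_⟩
      obtain ⟨c, hc⟩ := hw.exists_right_inv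
      have h : 1 - w * (1 ⊗ₜ c) ∈ X.idl := by
        rw [mem_idl, map_sub, map_mul]; simp [hc]
      obtain ⟨e, he⟩ : (w * (1 ⊗ₜ c)) ∣ 1 - (1 - w * (1 ⊗ₜ c)) ^ L := by
        have := sub_dvd_pow_sub_pow (1 : X.RR) (1 - w * (1 ⊗ₜ c)) L
        rwa [one_pow, sub_sub_cancel] at this
      refine ⟨(1 ⊗ₜ c) * e, ?_⟩
      rw [← mul_assoc, ← he, pow_zero, sub_sub_cancel_left]
      exact (X.idl ^ L).neg_mem (pow_mem_pow h L)
    · refine ⟨1, fun L => ?_⟩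
      have h0 := diag_sub_mem z (w : X.R)
      set u := jac z w
      have hu : (1 : X.R) ⊗ₜ[X.k] (ddz z (w : X.R)) * (1 ⊗ₜ[X.k] ((u⁻¹ : X.Rˣ) : X.R)) = 1 := by
        rw [tmul_mul_tmul, show ddz z (w : X.R) = (u : X.R) from rfl]; simp [one_def]
      have h2 : X.diag w * (1 ⊗ₜ ((u⁻¹ : X.Rˣ) : X.R)) - X.diag z ∈ X.idl ^ 2 := by
        convert (X.idl ^ 2).mul_mem_right (1 ⊗ₜ[X.k] ((u⁻¹ : X.Rˣ) : X.R)) h0 using 1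
        linear_combination (X.diag (z : X.R)) * hu
      have key : ∀ L, ∃ q : X.RR, X.diag w * q - X.diag z ∈ X.idl ^ (L + 2) := by
        intro L
        induction L with
        | zero => exact ⟨_, h2⟩
        | succ L ih =>
          obtain ⟨q, hq⟩ := ih
          obtain ⟨c, hc⟩ := exists_idl_pow z _ hq
          refine ⟨q - (1 ⊗ₜ c) * X.diag z ^ (L + 1) * (1 ⊗ₜ ((u⁻¹ : X.Rˣ) : X.R)), ?_⟩
          have h3 := mul_mem_mul (pow_mem_pow (diag_mem_idl (X := X) z) (L + 1)) h2
          rw [← pow_add] at h3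
          convert (X.idl ^ (L + 2 + 1)).sub_mem hc (mul_mem_left _ (1 ⊗ₜ c) h3) using 1
          ring
      obtain ⟨q, hq⟩ := key L
      exact ⟨q, by rw [pow_one]; exact pow_le_pow_right (by omega) hq⟩
  | one => exact ⟨0, fun L => ⟨1, by simp⟩⟩
  | mul w w' _ _ h h' =>
    obtain ⟨d, h⟩ := h
    obtain ⟨d', h'⟩ := h'
    refine ⟨d + d', fun L => ?_⟩
    obtain ⟨q, hq⟩ := h L
    obtain ⟨q', hq'⟩ := h' L
    refine ⟨q * q', ?_⟩
    convert (X.idl ^ L).add_mem ((X.idl ^ L).mul_mem_right (w' * q') hq)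
      ((X.idl ^ L).mul_mem_left (X.diag z ^ d) hq') using 1
    ring

/-! ### Functions with poles along the diagonal -/

/-- The function `z(x) - z(y)` with its inverse. -/
def dk : X.Kˣ := (IsLocalization.map_units X.K (⟨_, X.diag_mem z⟩ : X.W)).unit

/-- The powers of `dk z` in `K`. -/
notation:max "δ[" z "," n "]" => Units.val (dk z ^ (n : ℤ))

theorem dk_val : (dk z : X.K) = algebraMap X.RR X.K (X.diag z) := rfl

theorem in1_apply (f : X.R) : X.in1 f = algebraMap X.RR X.K (f ⊗ₜ 1) := rfl

theorem in2_apply (f : X.R) : X.in2 f = algebraMap X.RR X.K (1 ⊗ₜ f) := rfl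

theorem in1_mul_in2 (f g : X.R) : X.in1 f * X.in2 g = algebraMap X.RR X.K (f ⊗ₜ g) := by
  rw [in1_apply, in2_apply, ← map_mul]; simp

theorem dk_eq : (dk z : X.K) = X.in1 z - X.in2 z := by
  rw [dk_val, diag, map_sub]; rfl

/-- An additive function on `K` that vanishes on functions of sufficiently high order near the
diagonal. -/
def IsFin {A : Type} [AddCommGroup A] (B : X.K → A) : Prop :=
  ∀ f, ∃ N, ∀ q ∈ X.idl ^ N, B (algebraMap X.RR X.K q * f) = 0

/-- An additive function on `K` that vanishes on functions of high order near the diagonal is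
determined by its values on `c(y) (z(x) - z(y))ⁿ`. -/
theorem eq_zero_of_isFin {A : Type} [AddCommGroup A] (z : X.Coord) (B : X.K →+ A)
    (hB : IsFin B) (h : ∀ c (n : ℤ), B (X.in2 c * (dk z ^ n : X.Kˣ)) = 0) (f : X.K) : B f = 0 := by
  obtain ⟨⟨p, w⟩, hf⟩ := IsLocalization.surj X.W f
  simp only at hf
  obtain ⟨d, hd⟩ := exists_W z w.2
  obtain ⟨L, hL⟩ := hB (f * ((dk z ^ (-d : ℤ) : X.Kˣ) : X.K))
  obtain ⟨q, hq⟩ := hd L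
  have hz : (dk z : X.K) ^ d * ((dk z ^ (-d : ℤ) : X.Kˣ) : X.K) = 1 := by
    rw [← val_pow_eq_pow_val, ← val_mul, zpow_neg, zpow_natCast, mul_inv_cancel]; rfl
  have h1 : f = algebraMap X.RR X.K (p * q) * ((dk z ^ (-d : ℤ) : X.Kˣ) : X.K) -
      algebraMap X.RR X.K (w * q - X.diag z ^ d) * (f * ((dk z ^ (-d : ℤ) : X.Kˣ) : X.K)) := by
    rw [map_mul, ← hf, map_sub, map_mul, map_pow, ← dk_val]
    linear_combination (-f) * hz
  have h2 (p : X.RR) (n : ℤ) : B (algebraMap X.RR X.K p * ((dk z ^ n : X.Kˣ) : X.K)) = 0 := by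
    obtain ⟨M, hM⟩ := hB ((dk z ^ n : X.Kˣ) : X.K)
    obtain ⟨c, hc⟩ := exists_taylor z p M
    have := hM _ hc
    rw [map_sub, sub_mul, map_sub, sub_eq_zero] at this
    rw [this, map_sum, Finset.sum_mul, map_sum]
    refine sum_eq_zero fun j _ => ?_
    rw [map_mul (algebraMap X.RR X.K), map_pow, ← dk_val, ← in2_apply, mul_assoc, ← val_pow_eq_pow_val, ← val_mul,
      ← zpow_natCast, ← zpow_add]
    exact h _ _
  rw [h1, map_sub, hL _ hq, sub_zero, h2]

end Fam

/-! ### Pairing of Laurent series with sequences -/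

section Pairing

variable {R A : Type} [CommRing R] [AddCommGroup A] [Module R A]

/-- A sequence indexed by `ℤ` that vanishes for large indices. -/
def EvZ (m : ℤ → A) : Prop := ∃ M, ∀ n, M ≤ n → m n = 0

theorem exists_lt_coeff_eq_zero (F : LaurentSeries R) : ∃ N : ℤ, ∀ n < N, F.coeff n = 0 :=
  ⟨F.order, fun _ hn => HahnSeries.coeff_eq_zero_of_lt_order hn⟩

/-- The finite sum `∑ₙ Fₙ mₙ`, for a Laurent series `F` and a sequence `m` that vanishes for large
indices. -/
def lpair (F : LaurentSeries R) (m : ℤ → A) : A := ∑ᶠ n, F.coeff n • m n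

theorem lpair_support (F : LaurentSeries R) {m : ℤ → A} (hm : EvZ m) :
    (Function.support fun n => F.coeff n • m n).Finite := by
  obtain ⟨M, hM⟩ := hm
  obtain ⟨N, hN⟩ := exists_lt_coeff_eq_zero F
  refine (Set.finite_Ico N M).subset fun n hn => ?_
  rw [Set.mem_Ico]
  by_contra hc
  rw [not_and_or, not_le, not_lt] at hc
  rcases hc with h | h
  · exact hn (by simp [hN n h])
  · exact hn (by simp [hM n h])

theorem lpair_add_left (F G : LaurentSeries R) {m : ℤ → A} (hm : EvZ m) :
    lpair (F + G) m = lpair F m + lpair G m := by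
  rw [lpair, lpair, lpair, ← finsum_add_distrib (lpair_support F hm) (lpair_support G hm)]
  simp only [HahnSeries.coeff_add, add_smul]

theorem lpair_add_right (F : LaurentSeries R) {m m' : ℤ → A} (hm : EvZ m) (hm' : EvZ m') :
    lpair F (fun n => m n + m' n) = lpair F m + lpair F m' := by
  rw [lpair, lpair, lpair, ← finsum_add_distrib (lpair_support F hm) (lpair_support F hm')]
  simp only [smul_add]

theorem lpair_map {A' : Type} [AddCommGroup A'] [Module R A'] (F : LaurentSeries R) {m : ℤ → A}
    (hm : EvZ m) (f : A →ₗ[R] A') : lpair F (fun n => f (m n)) = f (lpair F m) := by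
  have := f.toAddMonoidHom.map_finsum (lpair_support F hm)
  simp only [LinearMap.toAddMonoidHom_coe, map_smul] at this
  exact this.symm

theorem lpair_C_mul (c : R) (F : LaurentSeries R) {m : ℤ → A} (hm : EvZ m) :
    lpair (HahnSeries.C c * F) m = c • lpair F m := by
  rw [lpair, lpair, smul_finsum' _ (lpair_support F hm)]
  refine finsum_congr fun n => ?_
  rw [HahnSeries.C_mul_eq_smul, HahnSeries.coeff_smul, smul_eq_mul, mul_smul]

theorem lpair_single (k : ℤ) (c : R) (m : ℤ → A) : lpair (single k c) m = c • m k := by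
  rw [lpair, finsum_eq_single _ k]
  · rw [HahnSeries.coeff_single_same]
  · intro n hn
    rw [HahnSeries.coeff_single_of_ne hn, zero_smul]

theorem lpair_single_mul (k : ℤ) (F : LaurentSeries R) (m : ℤ → A) :
    lpair (single k 1 * F) m = lpair F fun n => m (n + k) := by
  rw [lpair, lpair, ← finsum_comp_equiv (Equiv.addRight k)]
  refine finsum_congr fun n => ?_
  rw [Equiv.coe_addRight, HahnSeries.coeff_single_mul_add, one_mul]

theorem coeff_ofPowerSeries_of_neg (G : PowerSeries R) {n : ℤ} (hn : n < 0) :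
    (ofPowerSeries ℤ R G).coeff n = 0 := by
  rw [PowerSeries.coeff_coe, if_pos hn]

theorem coeff_ofPowerSeries_natCast (G : PowerSeries R) (n : ℕ) :
    (ofPowerSeries ℤ R G).coeff n = coeff n G :=
  LaurentSeries.coeff_coe_powerSeries G n

theorem lpair_ofPowerSeries (G : PowerSeries R) {m : ℤ → A} {N : ℕ} (h : ∀ n : ℕ, N ≤ n → m n = 0) :
    lpair (ofPowerSeries ℤ R G) m =
      ∑ i ∈ range N, coeff i G • m i := by
  rw [lpair, finsum_eq_sum_of_support_subset (s := (range N).map Nat.castEmbedding)]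
  · simp [LaurentSeries.coeff_coe_powerSeries]
  · intro n hn
    have h0 : 0 ≤ n := by
      by_contra hc
      exact hn (by simp only [coeff_ofPowerSeries_of_neg G (not_le.1 hc), zero_smul])
    lift n to ℕ using h0
    simp only [Finset.coe_map, Set.mem_image, coe_range, mem_Iio]
    refine ⟨n, ?_, rfl⟩
    by_contra hc
    exact hn (by simp only [h n (not_lt.1 hc), smul_zero])

theorem lpair_eq_zero_of_dvd {N : ℕ} {G : PowerSeries R} (hG : PowerSeries.X ^ N ∣ G)
    (F : LaurentSeries R) {m : ℤ → A} {M : ℤ} (hM : ∀ n, M ≤ n → m n = 0)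
    (hF : ∀ n, n + N < M → F.coeff n = 0) :
    lpair (ofPowerSeries ℤ R G * F) m = 0 := by
  obtain ⟨G', rfl⟩ := hG
  rw [map_mul, HahnSeries.ofPowerSeries_X_pow, mul_assoc, lpair_single_mul, lpair]
  refine finsum_eq_zero_of_forall_eq_zero fun n => ?_
  by_cases h : M ≤ n + N
  · rw [hM _ h, smul_zero]
  · rw [HahnSeries.coeff_mul, sum_eq_zero, zero_smul]
    intro ij hij
    rw [Finset.mem_antidiagonal] at hij
    by_cases h1 : ij.1 < 0
    · rw [coeff_ofPowerSeries_of_neg _ h1, zero_mul]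
    · rw [hF ij.2 (by omega), mul_zero]

end Pairing

namespace Fam

variable {X : Fam} (z : X.Coord)

/-! ### Taylor expansions -/

/-- The Taylor coefficient `(1/n!) (d/dz)ⁿ f`. -/
def tc (n : ℕ) (f : X.R) : X.R := ((n.factorial : ℂ)⁻¹) • (ddz z)^[n] f

theorem tc_zero (f : X.R) : tc z 0 f = f := by simp [tc]

theorem tc_one (f : X.R) : tc z 1 f = ddz z f := by simp [tc]

theorem tc_succ (n : ℕ) (f : X.R) : ((n : ℂ) + 1) • tc z (n + 1) f = tc z n (ddz z f) := by
  rw [tc, tc, iterate_succ_apply, smul_smul, Nat.factorial_succ]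
  congr 1
  have h : (n : ℂ) + 1 ≠ 0 := by exact_mod_cast n.succ_ne_zero
  have h' : (n.factorial : ℂ) ≠ 0 := by exact_mod_cast n.factorial_ne_zero
  push_cast
  field_simp

/-- The Taylor expansion `f(y + t) = exp(t d/dz) f` as a power series in `t`. -/
def taylor : X.R →ₐ[X.k] PowerSeries X.R :=
  have hiter (n : ℕ) (f g : X.R) : (ddz z)^[n] (f + g) = (ddz z)^[n] f + (ddz z)^[n] g := by
    induction n generalizing f g with
    | zero => rfl
    | succ n ih => simp only [iterate_succ_apply, map_add, ih]
  have hconst (n : ℕ) (c : X.k) : tc z n (algebraMap X.k X.R c) = if n = 0 then algebraMap X.k X.R c else 0 := by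
    rcases n with _ | n
    · simp [tc]
    · have h : (ddz z)^[n] 0 = 0 := by
        simp
      simp [tc, iterate_succ_apply, h]
  have hadd (n : ℕ) (f g : X.R) : tc z n (f + g) = tc z n f + tc z n g := by
    rw [tc, tc, tc, hiter, smul_add]
  have hmk (f : X.R) : PowerSeries.derivative X.R (PowerSeries.mk fun n => tc z n f) =
      PowerSeries.mk fun n => tc z n (ddz z f) := by
    ext n
    rw [PowerSeries.coeff_derivative, coeff_mk,
      coeff_mk, ← tc_succ, smul_def, mul_comm]
    simp
  { toFun := fun f => PowerSeries.mk fun n => tc z n f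
    map_one' := by
      ext n
      rw [coeff_mk, ← map_one (algebraMap X.k X.R), hconst, coeff_one, map_one]
    map_mul' := fun f g => by
      ext n
      induction n generalizing f g with
      | zero => simp [tc_zero, coeff_mul]
      | succ n ih =>
        have h : ((n : ℂ) + 1) ≠ 0 := by exact_mod_cast n.succ_ne_zero
        apply smul_right_injective _ h
        have e (F : PowerSeries X.R) : ((n : ℂ) + 1) • coeff (n + 1) F =
            coeff n (PowerSeries.derivative X.R F) := by
          rw [PowerSeries.coeff_derivative, smul_def, mul_comm]
          simp
        simp only [e]
        rw [leibniz, hmk, hmk, hmk, leibniz, map_add]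
        simp only [smul_eq_mul]
        rw [← ih, ← ih]
        simp only [coeff_mk, hadd]
    map_zero' := by
      ext n
      have := hadd n 0 0
      rw [add_zero] at this
      simpa using this
    map_add' := fun f g => by ext n; simp [hadd]
    commutes' := fun c => by
      ext n
      rw [coeff_mk, hconst, IsScalarTower.algebraMap_apply X.k X.R (PowerSeries X.R)]
      exact (coeff_C n _).symm }

theorem coeff_taylor (f : X.R) (n : ℕ) : coeff n (taylor z f) = tc z n f := by
  rw [taylor]
  exact coeff_mk n fun n => tc z n f

theorem taylor_coord : taylor z (z : X.R) = PowerSeries.C (z : X.R) + PowerSeries.X := by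
  ext n
  rw [coeff_taylor]
  rcases n with _ | _ | n
  · simp [tc_zero]
  · simp [tc_one, ddz_self]
  · have : (ddz z)^[n] 0 = 0 := by
      induction n with
      | zero => rfl
      | succ n ih => rw [iterate_succ_apply, map_zero, ih]
    simp [tc, ddz_self, coeff_X, this]

/-- The Taylor expansion of functions on the square near the diagonal. -/
def tauR : X.RR →ₐ[X.k] PowerSeries X.R :=
  Algebra.TensorProduct.lift (taylor z) (IsScalarTower.toAlgHom X.k X.R (PowerSeries X.R))
    (fun _ _ => Commute.all _ _)

theorem tauR_tmul (f g : X.R) : tauR z (f ⊗ₜ g) = taylor z f * PowerSeries.C g := rfl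

theorem constantCoeff_tauR (q : X.RR) :
    constantCoeff (tauR z q) = lmul' X.k q := by
  induction q using induction_on with
  | zero => simp
  | add a b ha hb => rw [map_add, map_add, map_add, ha, hb]
  | tmul f g =>
    rw [tauR_tmul, map_mul, ← coeff_zero_eq_constantCoeff_apply, coeff_taylor, tc_zero]
    simp

theorem X_pow_dvd_tauR {N : ℕ} {q : X.RR} (hq : q ∈ X.idl ^ N) :
    PowerSeries.X ^ N ∣ tauR z q := by
  have h1 : X.idl ≤ (Ideal.span {(PowerSeries.X : PowerSeries X.R)}).comap (tauR z) := by
    intro p hp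
    rw [Ideal.mem_comap, Ideal.mem_span_singleton, PowerSeries.X_dvd_iff, constantCoeff_tauR]
    exact mem_idl.1 hp
  have h2 := Ideal.le_comap_pow (tauR z) N (Ideal.pow_right_mono h1 N hq)
  rwa [Ideal.span_singleton_pow, Ideal.mem_comap, Ideal.mem_span_singleton] at h2

theorem tauR_diag : tauR z (X.diag z) = PowerSeries.X := by
  rw [diag, map_sub, tauR_tmul, tauR_tmul, taylor_coord]; simp

theorem isUnit_tau (w : X.W) :
    IsUnit (((ofPowerSeries ℤ X.R).comp (tauR z : X.RR →+* PowerSeries X.R)) w) := by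
  have h : X.W ≤ (IsUnit.submonoid (LaurentSeries X.R)).comap
      ((ofPowerSeries ℤ X.R).comp (tauR z : X.RR →+* PowerSeries X.R)) := by
    have hX : IsUnit (single (1 : ℤ) (1 : X.R)) :=
      IsUnit.of_mul_eq_one (single (-1 : ℤ) 1)
        (by rw [single_mul_single]; simp)
    rw [W, Submonoid.closure_le]
    rintro p (hp | ⟨w, rfl⟩)
    · change IsUnit (ofPowerSeries ℤ X.R (tauR z p))
      apply IsUnit.map
      rw [isUnit_iff_constantCoeff, constantCoeff_tauR]
      exact hp
    · change IsUnit (ofPowerSeries ℤ X.R (tauR z (X.diag w)))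
      obtain ⟨G, hG⟩ : PowerSeries.X ∣ tauR z (X.diag w) := by
        have := X_pow_dvd_tauR z (N := 1) (q := X.diag w) (by rw [pow_one]; exact diag_mem_idl _)
        rwa [pow_one] at this
      have h1 : constantCoeff G = ddz z (w : X.R) := by
        have : coeff 1 (tauR z (X.diag w)) = ddz z (w : X.R) := by
          rw [diag, map_sub, tauR_tmul, tauR_tmul]
          simp [coeff_taylor, tc_one]
        rw [← this, hG, show (1 : ℕ) = 0 + 1 from rfl, coeff_succ_X_mul,
          coeff_zero_eq_constantCoeff_apply]
      rw [hG, map_mul, ofPowerSeries_X]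
      refine hX.mul (IsUnit.map _ ?_)
      rw [isUnit_iff_constantCoeff, h1]
      exact (jac z w).isUnit
  exact h w.2

/-- The expansion of functions with poles along the diagonal as Laurent series in
`t = z(x) - z(y)`. -/
def tau : X.K →+* LaurentSeries X.R := IsLocalization.lift (isUnit_tau z)

theorem tau_algebraMap (q : X.RR) :
    tau z (algebraMap X.RR X.K q) = ofPowerSeries ℤ X.R (tauR z q) :=
  IsLocalization.lift_eq _ _

theorem tau_in1 (f : X.R) : tau z (X.in1 f) = ofPowerSeries ℤ X.R (taylor z f) := by
  rw [in1_apply, tau_algebraMap, tauR_tmul]; simp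

theorem tau_in2 (f : X.R) : tau z (X.in2 f) = HahnSeries.C f := by
  rw [in2_apply, tau_algebraMap, tauR_tmul]; simp

theorem tau_dk (n : ℤ) : tau z δ[z,n] = single n 1 := by
  have h (n : ℕ) : tau z δ[z,n] = single (n : ℤ) 1 := by
    rw [zpow_natCast, val_pow_eq_pow_val, map_pow, dk_val, tau_algebraMap, tauR_diag, ← map_pow,
      HahnSeries.ofPowerSeries_X_pow]
  obtain ⟨n, rfl | rfl⟩ := n.eq_nat_or_neg
  · exact h n
  · have h1 : tau z δ[z,-n] * tau z δ[z,n] = 1 := by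
      rw [← map_mul, ← val_mul, ← zpow_add]; simp
    rw [h] at h1
    have h2 := congrArg (· * single (-n : ℤ) (1 : X.R)) h1
    simpa only [mul_assoc, single_mul_single, add_neg_cancel, mul_one, one_mul,
      HahnSeries.single_zero_one] using h2

theorem tau_in2_mul_dk (c : X.R) (n : ℤ) :
    tau z (X.in2 c * δ[z,n]) = single n c := by
  rw [map_mul, tau_in2, tau_dk, HahnSeries.C_apply, single_mul_single]; simp

theorem isFin_lpair {A : Type} [AddCommGroup A] [Module X.R A] (z : X.Coord) {m : ℤ → A} (hm : EvZ m) :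
    IsFin fun f : X.K => lpair (tau z f) m := by
  intro f
  obtain ⟨M, hM⟩ := hm
  obtain ⟨N, hN⟩ := exists_lt_coeff_eq_zero (tau z f)
  refine ⟨(M - N).toNat, fun q hq => ?_⟩
  beta_reduce
  rw [map_mul, tau_algebraMap]
  exact lpair_eq_zero_of_dvd (X_pow_dvd_tauR z hq) _ hM fun n hn => hN n (by omega)

/-- A sequence defines an additive function on `K`. -/
def lpairHom {A : Type} [AddCommGroup A] [Module X.R A] (z : X.Coord) {m : ℤ → A} (hm : EvZ m) :
    X.K →+ A where
  toFun f := lpair (tau z f) m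
  map_zero' := by simp [lpair]
  map_add' f g := by rw [map_add, lpair_add_left _ _ hm]

end Fam

namespace Fam

variable {X : Fam} (z : X.Coord)

/-! ### Differential operators -/

theorem DO_induction {p : X.DO → Prop} (fn : ∀ f, p (X.fn f)) (vec : ∀ ξ, p (X.vec ξ))
    (add : ∀ P Q, p P → p Q → p (P + Q)) (mul : ∀ P Q, p P → p Q → p (P * Q)) (P : X.DO) : p P := by
  obtain ⟨a, rfl⟩ : ∃ a, X.mkDO a = P := RingQuot.mkAlgHom_surjective X.k X.DRel P
  induction a using FreeAlgebra.induction with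
  | grade0 c =>
    rw [commutes, ← X.fn.commutes]
    exact fn _
  | grade1 s =>
    rcases s with f | ξ
    · exact fn f
    · exact vec ξ
  | mul a b ha hb => rw [map_mul]; exact mul _ _ ha hb
  | add a b ha hb => rw [map_add]; exact add _ _ ha hb

theorem vec_smul (f : X.R) (ξ : X.Th) : X.vec (f • ξ) = X.fn f * X.vec ξ := by
  rw [vec, mkDO_rel X (.vec_smul f ξ), map_mul]; rfl

theorem vec_mul_fn (ξ : X.Th) (f : X.R) : X.vec ξ * X.fn f = X.fn f * X.vec ξ + X.fn (ξ f) := by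
  have := mkDO_rel X (.leibniz ξ f)
  rwa [map_mul, map_add, map_mul] at this

theorem liftDO_vec {S : Type} [Ring S] [Algebra X.k S] (j : X.R →ₐ[X.k] S) (v : X.Th → S)
    (hadd : ∀ ξ η, v (ξ + η) = v ξ + v η) (hsmul : ∀ f ξ, v (f • ξ) = j f * v ξ)
    (hleib : ∀ ξ f, v ξ * j f = j f * v ξ + j (ξ f))
    (hlie : ∀ ξ η, v ⁅ξ, η⁆ = v ξ * v η - v η * v ξ) (ξ : X.Th) :
    X.liftDO j v hadd hsmul hleib hlie (X.vec ξ) = v ξ :=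
  (RingQuot.liftAlgHom_mkAlgHom_apply ..).trans (FreeAlgebra.lift_ι_apply _ _)

theorem actR_fn (f : X.R) (g : X.R) : X.actR (X.fn f) g = f * g := by
  have : X.actR (X.fn f) = _ := X.liftDO_fn _ _ _ _ _ _ f
  rw [this]; rfl

theorem actR_vec (ξ : X.Th) (g : X.R) : X.actR (X.vec ξ) g = ξ g := by
  have : X.actR (X.vec ξ) = _ := liftDO_vec _ _ _ _ _ _ ξ
  rw [this]; rfl

theorem act1_fn (f : X.R) (p : X.K) : X.act1 (X.fn f) p = X.in1 f * p := by
  have : X.act1 (X.fn f) = _ := X.liftDO_fn _ _ _ _ _ _ f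
  rw [this]; rfl

theorem act1_vec (ξ : X.Th) (p : X.K) : X.act1 (X.vec ξ) p = X.vec1 ξ p := by
  have : X.act1 (X.vec ξ) = _ := liftDO_vec _ _ _ _ _ _ ξ
  rw [this]; rfl

theorem act2_fn (f : X.R) (p : X.K) : X.act2 (X.fn f) p = X.in2 f * p := by
  have : X.act2 (X.fn f) = _ := X.liftDO_fn _ _ _ _ _ _ f
  rw [this]; rfl

theorem act2_vec (ξ : X.Th) (p : X.K) : X.act2 (X.vec ξ) p = X.vec2 ξ p := by
  have : X.act2 (X.vec ξ) = _ := liftDO_vec _ _ _ _ _ _ ξ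
  rw [this]; rfl

theorem om_vec (ξ : X.Th) (ω : X.Om) : ω <• X.vec ξ = - X.d (ξ.liftKaehlerDifferential ω) := by
  change unop (X.actOm (X.vec ξ)) ω = _
  have : X.actOm (X.vec ξ) = _ := liftDO_vec _ _ _ _ _ _ ξ
  rw [this]; rfl

/-- The operator `(d/dz)ⁱ`. -/
def dop (i : ℕ) : X.DO := X.vec (ddz z) ^ i

theorem dop_succ (i : ℕ) : dop z (i + 1) = X.vec (ddz z) * dop z i := pow_succ' _ _

theorem dop_zero : dop z 0 = 1 := pow_zero _

theorem actR_dop (i : ℕ) (g : X.R) : X.actR (dop z i) g = (ddz z)^[i] g := by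
  induction i with
  | zero => rw [dop_zero, map_one]; rfl
  | succ i ih => rw [dop_succ, map_mul, End.mul_apply, ih, actR_vec, Function.iterate_succ_apply']

/-- The restriction to the diagonal of `P` applied in the first variable. -/
def diagAct (P : X.DO) (q : X.RR) : X.R :=
  lmul' X.k ((X.actR P).rTensor X.R q)

theorem diagAct_tmul (P : X.DO) (f g : X.R) : diagAct P (f ⊗ₜ g) = X.actR P f * g := by
  simp [diagAct]

theorem diagAct_add (P : X.DO) (q q' : X.RR) : diagAct P (q + q') = diagAct P q + diagAct P q' := by
  simp [diagAct]

theorem diagAct_zero (P : X.DO) : diagAct P 0 = 0 := by simp [diagAct]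

theorem diagAct_add_left (P Q : X.DO) (q : X.RR) : diagAct (P + Q) q = diagAct P q + diagAct Q q := by
  simp [diagAct, LinearMap.rTensor_add]

theorem diagAct_fn_mul (r : X.R) (P : X.DO) (q : X.RR) : diagAct (X.fn r * P) q = r * diagAct P q := by
  induction q using induction_on with
  | zero => simp [diagAct_zero]
  | add a b ha hb => rw [diagAct_add, diagAct_add, ha, hb, mul_add]
  | tmul f g => rw [diagAct_tmul, diagAct_tmul, map_mul, End.mul_apply, actR_fn, mul_assoc]

theorem der1_diag (i : ℕ) : X.der1 (ddz z) (X.diag z ^ i) = i • X.diag z ^ (i - 1) := by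
  have : X.der1 (ddz z) (X.diag z) = 1 := by
    change (ddz z).toLinearMap.rTensor X.R _ = 1
    rw [diag, map_sub, rTensor_tmul, rTensor_tmul]
    simp [ddz_self, one_def]
  rw [leibniz_pow, this]; simp

theorem rTensor_actR_vec (ξ : X.Th) (q : X.RR) : (X.actR (X.vec ξ)).rTensor X.R q = X.der1 ξ q := by
  have : X.actR (X.vec ξ) = ξ.toLinearMap := LinearMap.ext fun g => actR_vec ξ g
  rw [this]; rfl

theorem rTensor_actR_mul (P Q : X.DO) (q : X.RR) :
    (X.actR (P * Q)).rTensor X.R q = (X.actR P).rTensor X.R ((X.actR Q).rTensor X.R q) := by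
  rw [map_mul, Module.End.mul_eq_comp, LinearMap.rTensor_comp_apply]

theorem rTensor_dop (m i : ℕ) :
    (X.actR (dop z m)).rTensor X.R (X.diag z ^ i) = i.descFactorial m • X.diag z ^ (i - m) := by
  induction m with
  | zero => rw [dop_zero, map_one]; simp [Module.End.one_eq_id]
  | succ m ih =>
    rw [dop_succ, rTensor_actR_mul, ih, map_nsmul, rTensor_actR_vec, der1_diag, smul_smul,
      Nat.descFactorial_succ, Nat.sub_sub, mul_comm]

/-- The coefficient of `(d/dz)ⁱ` in the operator `P`. -/
def sym (i : ℕ) (P : X.DO) : X.R := ((i.factorial : ℂ)⁻¹) • diagAct P (X.diag z ^ i)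

theorem sym_dop (m i : ℕ) : sym z i (dop z m) = if m = i then 1 else 0 := by
  rw [sym, diagAct, rTensor_dop, map_nsmul, map_pow, mem_idl.1 (diag_mem_idl (X := X) z)]
  rcases lt_trichotomy i m with h | h | h
  · rw [Nat.descFactorial_of_lt h, if_neg h.ne']; simp
  · subst h
    rw [Nat.descFactorial_self, if_pos rfl, Nat.sub_self, pow_zero, ← Nat.cast_smul_eq_nsmul ℂ, smul_smul,
      inv_mul_cancel₀ (by exact_mod_cast i.factorial_ne_zero), one_smul]
  · rw [zero_pow (by omega), if_neg h.ne]; simp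

/-- Every differential operator is of the form `∑ pᵢ (d/dz)ⁱ`. -/
theorem exists_normal (P : X.DO) :
    ∃ N, ∀ M, N ≤ M → P = ∑ i ∈ range M, X.fn (sym z i P) * dop z i := by
  let S : AddSubgroup X.DO := AddSubgroup.closure {P | ∃ c i, P = X.fn c * dop z i}
  have hS (c i) : X.fn c * dop z i ∈ S := AddSubgroup.subset_closure ⟨c, i, rfl⟩
  have hfn (f : X.R) : ∀ Q ∈ S, X.fn f * Q ∈ S := by
    intro Q hQ
    induction hQ using AddSubgroup.closure_induction with
    | mem Q hQ =>
      obtain ⟨c, i, rfl⟩ := hQ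
      rw [← mul_assoc, ← map_mul]
      exact hS _ _
    | zero => rw [mul_zero]; exact S.zero_mem
    | add P Q _ _ hP hQ => rw [mul_add]; exact S.add_mem hP hQ
    | neg P _ hP => rw [mul_neg]; exact S.neg_mem hP
  have hd : ∀ Q ∈ S, X.vec (ddz z) * Q ∈ S := by
    intro Q hQ
    induction hQ using AddSubgroup.closure_induction with
    | mem Q hQ =>
      obtain ⟨c, i, rfl⟩ := hQ
      rw [← mul_assoc, vec_mul_fn, add_mul, mul_assoc, ← dop_succ]
      exact S.add_mem (hS _ _) (hS _ _)
    | zero => rw [mul_zero]; exact S.zero_mem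
    | add P Q _ _ hP hQ => rw [mul_add]; exact S.add_mem hP hQ
    | neg P _ hP => rw [mul_neg]; exact S.neg_mem hP
  have hall (P : X.DO) : ∀ Q ∈ S, P * Q ∈ S := by
    induction P using DO_induction with
    | fn f => exact hfn f
    | vec ξ =>
      intro Q hQ
      rw [vec_eq z ξ, vec_smul, mul_assoc]
      exact hfn _ _ (hd _ hQ)
    | add P P' h h' => intro Q hQ; rw [add_mul]; exact S.add_mem (h Q hQ) (h' Q hQ)
    | mul P P' h h' => intro Q hQ; rw [mul_assoc]; exact h _ (h' Q hQ)
  have hP : P ∈ S := by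
    have := hall P 1 (by simpa [dop_zero] using hS 1 0)
    rwa [mul_one] at this
  have hadd (i : ℕ) (P Q : X.DO) : sym z i (P + Q) = sym z i P + sym z i Q := by
    rw [sym, sym, sym, diagAct_add_left, smul_add]
  have hzero (i : ℕ) : sym z i (0 : X.DO) = 0 := by simpa using hadd i 0 0
  have hneg (i : ℕ) (P : X.DO) : sym z i (-P) = - sym z i P := by
    rw [eq_neg_iff_add_eq_zero, ← hadd, neg_add_cancel, hzero]
  induction hP using AddSubgroup.closure_induction with
  | mem Q hQ =>
    obtain ⟨c, m, rfl⟩ := hQ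
    refine ⟨m + 1, fun M hM => ?_⟩
    have h (i : ℕ) : sym z i (X.fn c * dop z m) = if m = i then c else 0 := by
      rw [sym, diagAct_fn_mul, ← mul_smul_comm, ← sym, sym_dop]; simp
    simp only [h]
    rw [Finset.sum_eq_single m]
    · simp
    · intro i _ hi
      rw [if_neg hi.symm]; simp
    · intro hm
      rw [mem_range] at hm; omega
  | zero => exact ⟨0, fun M _ => by simp [hzero]⟩
  | add P Q _ _ hP hQ =>
    obtain ⟨N, hN⟩ := hP
    obtain ⟨N', hN'⟩ := hQ
    refine ⟨max N N', fun M hM => ?_⟩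
    simp only [hadd, map_add, add_mul, sum_add_distrib]
    rw [← hN M (by omega), ← hN' M (by omega)]
  | neg P _ hP =>
    obtain ⟨N, hN⟩ := hP
    refine ⟨N, fun M hM => ?_⟩
    simp only [hneg, map_neg, neg_mul, Finset.sum_neg_distrib]
    rw [← hN M hM]

/-- Sums over the terms of a section `∑ aᵢ ⊗ Pᵢ` of `A ⊗ D`, in terms of its normal form. -/
theorem list_sum_eq {A : Type} [AddCommGroup A] [Module X.R A] (z : X.Coord) (l : List (X.DO × A)) :
    ∃ N, ∀ M, N ≤ M → ∀ {B : Type} [AddCommGroup B] (Φ : X.DO →+ A →+ B),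
      (∀ r P a, Φ (X.fn r * P) a = Φ P (r • a)) → (l.map fun t => Φ t.1 t.2).sum =
        ∑ i ∈ range M, Φ (dop z i) (l.map fun t => sym z i t.1 • t.2).sum := by
  induction l with
  | nil => exact ⟨0, fun M _ B _ Φ _ => by simp⟩
  | cons t l ih =>
    obtain ⟨N, hN⟩ := ih
    obtain ⟨N', hN'⟩ := exists_normal z t.1
    refine ⟨max N N', fun M hM B _ Φ hΦ => ?_⟩
    simp only [List.map_cons, List.sum_cons, map_add, sum_add_distrib]
    rw [hN M (by omega) Φ hΦ]
    congr 1
    conv_lhs => rw [hN' M (by omega), map_sum, AddMonoidHom.finsetSum_apply]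
    exact sum_congr rfl fun i _ => hΦ ..

theorem der_mem (δ : Derivation X.k X.RR X.RR) {N : ℕ} {q : X.RR} (hq : q ∈ X.idl ^ (N + 1)) :
    δ q ∈ X.idl ^ N := by
  induction N generalizing q with
  | zero => simp
  | succ N ih =>
    rw [pow_succ] at hq
    induction hq using Submodule.mul_induction_on' with
    | mem_mul_mem m hm n hn =>
      rw [leibniz, smul_eq_mul, smul_eq_mul]
      refine Ideal.add_mem _ (Ideal.mul_mem_right _ _ hm) ?_
      rw [pow_succ']
      exact mul_mem_mul hn (ih hm)
    | add x _ y _ hx hy => rw [map_add]; exact Ideal.add_mem _ hx hy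

/-! ### Functions on `K` that vanish to high order -/

section IsFin

variable {A : Type} [AddCommGroup A]

theorem IsFin.mul_left {B : X.K → A} (hB : IsFin B) (g : X.K) : IsFin fun f => B (g * f) := by
  intro f
  obtain ⟨N, hN⟩ := hB (g * f)
  exact ⟨N, fun q hq => by beta_reduce; rw [mul_left_comm, hN q hq]⟩

theorem IsFin.add {B B' : X.K → A} (hB : IsFin B) (hB' : IsFin B') : IsFin fun f => B f + B' f := by
  intro f
  obtain ⟨N, hN⟩ := hB f
  obtain ⟨N', hN'⟩ := hB' f
  refine ⟨max N N', fun q hq => ?_⟩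
  beta_reduce
  rw [hN q (pow_le_pow_right (by omega) hq), hN' q (pow_le_pow_right (by omega) hq),
    add_zero]

theorem IsFin.map {A' : Type} [AddCommGroup A'] {B : X.K → A} (hB : IsFin B) (F : A → A') (h0 : F 0 = 0) :
    IsFin fun f => F (B f) := by
  intro f
  obtain ⟨N, hN⟩ := hB f
  exact ⟨N, fun q hq => by beta_reduce; rw [hN q hq, h0]⟩

theorem IsFin.sub {B B' : X.K → A} (hB : IsFin B) (hB' : IsFin B') : IsFin fun f => B f - B' f := by
  simpa only [sub_eq_add_neg] using hB.add (hB'.map (fun x => -x) neg_zero)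

theorem isFin_zero : IsFin fun _ : X.K => (0 : A) := fun _ => ⟨0, fun _ _ => rfl⟩

theorem isFin_sum (N : ℕ) {B : ℕ → X.K → A} (h : ∀ i, IsFin (B i)) : IsFin fun f => ∑ i ∈ range N, B i f := by
  induction N with
  | zero => simpa using isFin_zero
  | succ N ih => simpa only [sum_range_succ] using ih.add (h N)

theorem IsFin.extDer {B : X.K →+ A} (hB : IsFin B) (δ : Derivation X.k X.RR X.RR) :
    IsFin fun f => B (X.extDer δ f) := by
  intro f
  obtain ⟨N, hN⟩ := hB f
  obtain ⟨N', hN'⟩ := hB (X.extDer δ f)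
  refine ⟨max (N + 1) N', fun q hq => ?_⟩
  beta_reduce
  rw [leibniz, extDer_algebraMap, map_add, smul_eq_mul, smul_eq_mul,
    hN' q (pow_le_pow_right (by omega) hq), mul_comm, zero_add]
  exact hN _ (der_mem δ (pow_le_pow_right (by omega) hq))

theorem IsFin.act1 {B : X.K →+ A} (hB : IsFin B) (P : X.DO) : IsFin fun f => B (X.act1 P f) := by
  induction P using DO_induction generalizing B with
  | fn g => simp only [act1_fn]; exact hB.mul_left _
  | vec ξ => simp only [act1_vec]; exact hB.extDer _
  | add P Q hP hQ => simp only [map_add, LinearMap.add_apply]; exact (hP hB).add (hQ hB)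
  | mul P Q hP hQ =>
    simp only [map_mul, End.mul_apply]
    exact hQ (B := B.comp (X.act1 P).toAddMonoidHom) (hP hB)

theorem IsFin.act2 {B : X.K →+ A} (hB : IsFin B) (P : X.DO) : IsFin fun f => B (X.act2 P f) := by
  induction P using DO_induction generalizing B with
  | fn g => simp only [act2_fn]; exact hB.mul_left _
  | vec ξ => simp only [act2_vec]; exact hB.extDer _
  | add P Q hP hQ => simp only [map_add, LinearMap.add_apply]; exact (hP hB).add (hQ hB)
  | mul P Q hP hQ =>
    simp only [map_mul, End.mul_apply]
    exact hQ (B := B.comp (X.act2 P).toAddMonoidHom) (hP hB)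

theorem swap_algebraMap (q : X.RR) : X.swap (algebraMap X.RR X.K q) =
    algebraMap X.RR X.K (Algebra.TensorProduct.comm X.k X.R X.R q) :=
  IsLocalization.map_eq _ _

theorem swap_in1 (f : X.R) : X.swap (X.in1 f) = X.in2 f := by
  rw [in1_apply, swap_algebraMap]; rfl

theorem swap_in2 (f : X.R) : X.swap (X.in2 f) = X.in1 f := by
  rw [in2_apply, swap_algebraMap]; rfl

theorem swap_dk (z : X.Coord) (n : ℤ) : X.swap δ[z,n] = sg n • δ[z,n] := by
  have h : Units.map (X.swap : X.K →* X.K) (dk z) = (-1) * dk z := by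
    ext
    change X.swap (dk z : X.K) = _
    rw [dk_eq, map_sub, swap_in1, swap_in2, val_mul, dk_eq]; simp
  have h2 : X.swap δ[z,n] = ((Units.map (X.swap : X.K →* X.K) (dk z)) ^ n : X.Kˣ) := by
    rw [← map_zpow]; rfl
  rw [h2, h, (Commute.neg_one_left (dk z)).mul_zpow, val_mul, zsmul_eq_mul]
  congr 1
  rw [sg, Int.negOnePow_def]
  rcases Int.even_or_odd n with hn | hn
  · rw [hn.neg_one_zpow, hn.neg_one_zpow]; simp
  · rw [hn.neg_one_zpow, hn.neg_one_zpow]; simp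

theorem IsFin.swap {B : X.K → A} (hB : IsFin B) : IsFin fun f => B (X.swap f) := by
  intro f
  obtain ⟨N, hN⟩ := hB (X.swap f)
  refine ⟨N, fun q hq => ?_⟩
  beta_reduce
  rw [map_mul, swap_algebraMap]
  apply hN
  have h : X.idl ≤ X.idl.comap (Algebra.TensorProduct.comm X.k X.R X.R : X.RR →+* X.RR) := by
    rw [idl, ← span_range_eq_ideal, Ideal.span_le]
    rintro _ ⟨s, rfl⟩
    have : X.diag s ∈ X.idl := diag_mem_idl s
    rw [idl, ← span_range_eq_ideal] at this
    simpa [diag] using this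
  exact Ideal.le_comap_pow _ N (Ideal.pow_right_mono h N hq)

end IsFin

theorem vec1_in2 (ξ : X.Th) (s : X.R) : X.vec1 ξ (X.in2 s) = 0 := by
  rw [in2_apply, vec1_apply]; simp

theorem vec2_in1 (ξ : X.Th) (s : X.R) : X.vec2 ξ (X.in1 s) = 0 := by
  rw [in1_apply, vec2_apply]; simp

theorem vec1_in1 (ξ : X.Th) (s : X.R) : X.vec1 ξ (X.in1 s) = X.in1 (ξ s) := by
  rw [in1_apply, vec1_apply]; rfl

theorem vec2_in2 (ξ : X.Th) (s : X.R) : X.vec2 ξ (X.in2 s) = X.in2 (ξ s) := by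
  rw [in2_apply, vec2_apply]; rfl

theorem act1_mul_in2 (P : X.DO) (f : X.K) (s : X.R) : X.act1 P (f * X.in2 s) = X.act1 P f * X.in2 s := by
  induction P using DO_induction generalizing f with
  | fn g => rw [act1_fn, act1_fn, mul_assoc]
  | vec ξ => rw [act1_vec, act1_vec, leibniz, vec1_in2]; simp [mul_comm]
  | add P Q hP hQ => rw [map_add, LinearMap.add_apply, LinearMap.add_apply, hP, hQ, add_mul]
  | mul P Q hP hQ => rw [map_mul X.act1, End.mul_apply, End.mul_apply, hQ, hP]

theorem der_zpow {B : Type} [CommRing B] [Algebra X.k B] (δ : Derivation X.k B B) (u : Bˣ) (n : ℤ) :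
    δ ((u ^ n : Bˣ) : B) = n • (((u ^ (n - 1) : Bˣ) : B) * δ u) := by
  have h (n : ℕ) : δ ((u ^ n : Bˣ) : B) = (n : ℤ) • (((u ^ ((n : ℤ) - 1) : Bˣ) : B) * δ u) := by
    rcases n with _ | n
    · simp
    · rw [val_pow_eq_pow_val, leibniz_pow]
      simp
  obtain ⟨n, rfl | rfl⟩ := n.eq_nat_or_neg
  · rw [zpow_natCast, h]
  · have h1 : δ (((u ^ n : Bˣ) : B) * ((u ^ (-n : ℤ) : Bˣ) : B)) = 0 := by
      rw [← val_mul, ← zpow_natCast, ← zpow_add]; simp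
    rw [leibniz, h] at h1
    have hu : IsUnit ((u ^ n : Bˣ) : B) := Units.isUnit _
    apply hu.mul_left_cancel
    rw [smul_eq_mul, smul_eq_mul] at h1
    have e1 : ((u ^ (-n - 1 : ℤ) : Bˣ) : B) * ((u ^ n : Bˣ) : B) = ((u ^ (-1 : ℤ) : Bˣ) : B) := by
      rw [← val_mul, ← zpow_natCast, ← zpow_add]; ring_nf
    have e2 : ((u ^ (-n : ℤ) : Bˣ) : B) * ((u ^ ((n : ℤ) - 1) : Bˣ) : B) = ((u ^ (-1 : ℤ) : Bˣ) : B) := by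
      rw [← val_mul, ← zpow_add]; ring_nf
    simp only [zsmul_eq_mul] at h1 ⊢
    push_cast at h1 e1 e2 ⊢
    linear_combination h1 + (n : B) * δ u * e1 - (n : B) * δ u * e2

theorem vec1_dk (z : X.Coord) (n : ℤ) :
    X.vec1 (ddz z) δ[z,n] = n • δ[z,n - 1] := by
  rw [der_zpow, dk_eq, map_sub, vec1_in1, vec1_in2, ddz_self]; simp

theorem vec2_dk (z : X.Coord) (n : ℤ) :
    X.vec2 (ddz z) δ[z,n] = -(n • δ[z,n - 1]) := by
  rw [der_zpow, dk_eq, map_sub, vec2_in1, vec2_in2, ddz_self]; simp; ring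

theorem factorial_mul_choose_succ (n : ℤ) (i : ℕ) :
    ((i + 1).factorial * Ring.choose n (i + 1) : ℤ) = (i.factorial * Ring.choose n i) * (n - i) := by
  have h1 := Ring.descPochhammer_eq_factorial_smul_choose n (i + 1)
  have h2 := Ring.descPochhammer_eq_factorial_smul_choose n i
  rw [nsmul_eq_mul] at h1 h2
  rw [← h1, ← h2, descPochhammer_succ_right, Polynomial.smeval_mul]
  congr 1
  simp [Polynomial.smeval_sub, Polynomial.smeval_X, Polynomial.smeval_natCast]

theorem act1_dop_dk (z : X.Coord) (i : ℕ) (n : ℤ) : X.act1 (dop z i) δ[z,n] =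
    (i.factorial * Ring.choose n i : ℤ) • δ[z,n - i] := by
  induction i with
  | zero => rw [dop_zero, map_one]; simp
  | succ i ih =>
    rw [dop_succ, map_mul, End.mul_apply, ih, map_zsmul, act1_vec, vec1_dk, smul_smul,
      factorial_mul_choose_succ]
    rw [show n - (i : ℤ) - 1 = n - ((i + 1 : ℕ) : ℤ) by push_cast; ring]

theorem act2_dop_dk (z : X.Coord) (i : ℕ) (n : ℤ) : X.act2 (dop z i) δ[z,n] =
    (sg i * (i.factorial * Ring.choose n i) : ℤ) • δ[z,n - i] := by
  induction i with
  | zero => rw [dop_zero, map_one]; simp [sg]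
  | succ i ih =>
    rw [dop_succ, map_mul, End.mul_apply, ih, map_zsmul, act2_vec, vec2_dk, zsmul_neg, smul_smul,
      ← neg_zsmul, factorial_mul_choose_succ, show n - (i : ℤ) - 1 = n - ((i + 1 : ℕ) : ℤ) by push_cast; ring]
    have : sg ((i + 1 : ℕ) : ℤ) = - sg i := by push_cast; exact sg_succ _
    rw [this]
    congr 1; ring

end Fam

namespace Fam

variable {X : Fam} (z : X.Coord)

theorem dk_mul (m n : ℤ) :
    δ[z,m] * δ[z,n] = δ[z,m + n] := by
  rw [← val_mul, ← zpow_add]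

theorem dk_natCast (n : ℕ) :
    δ[z,n] = algebraMap X.RR X.K (X.diag z ^ n) := by
  rw [zpow_natCast, val_pow_eq_pow_val, dk_val, map_pow]

theorem exists_order (P : X.DO) : ∃ d, ∀ N, ∀ q ∈ X.idl ^ (N + d), (X.actR P).rTensor X.R q ∈ X.idl ^ N := by
  induction P using DO_induction with
  | fn f =>
    refine ⟨0, fun N q hq => ?_⟩
    have : (X.actR (X.fn f)).rTensor X.R q = (f ⊗ₜ 1) * q := by
      induction q using induction_on generalizing N with
      | zero => simp
      | tmul a b => rw [rTensor_tmul, actR_fn]; simp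
      | add a b ha hb => 
        rw [map_add, mul_add, ha 0 (by simp), hb 0 (by simp)]
    rw [this]
    exact mul_mem_left _ _ hq
  | vec ξ =>
    refine ⟨1, fun N q hq => ?_⟩
    rw [rTensor_actR_vec]
    exact der_mem _ hq
  | add P Q hP hQ =>
    obtain ⟨d, hd⟩ := hP
    obtain ⟨d', hd'⟩ := hQ
    refine ⟨max d d', fun N q hq => ?_⟩
    rw [map_add, LinearMap.rTensor_add, LinearMap.add_apply]
    exact Ideal.add_mem _ (hd N q (pow_le_pow_right (by omega) hq))
      (hd' N q (pow_le_pow_right (by omega) hq))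
  | mul P Q hP hQ =>
    obtain ⟨d, hd⟩ := hP
    obtain ⟨d', hd'⟩ := hQ
    refine ⟨d + d', fun N q hq => ?_⟩
    rw [rTensor_actR_mul]
    exact hd N _ (hd' _ q (by rwa [add_assoc]))

theorem exists_diagAct_eq_zero (P : X.DO) : ∃ N, ∀ q ∈ X.idl ^ N, diagAct P q = 0 := by
  obtain ⟨d, hd⟩ := exists_order P
  refine ⟨1 + d, fun q hq => ?_⟩
  have := hd 1 q hq
  rw [pow_one] at this
  exact mem_idl.1 this

end Fam

open Fam

section Pre

variable {X : Fam} {C : Type} [AddCommGroup C] [Module X.R C]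

/-- The sum over `i` of `Φ ((d/dz)ⁱ, D((z(x) - z(y))ⁱ f) / i!)`. If `D f` stands for
`(h ⊠ id)` of a section `u(f)` of `A ⊗ D`, this is the value of `Φ` on `u(f)`. -/
def dsum {B : Type} [AddCommGroup B] (z : X.Coord) (Φ : X.DO →+ C →+ B) (u : X.K →+ C) (f : X.K) : B :=
  ∑ᶠ i : ℕ, Φ (dop z i) (X.scal ((i.factorial : ℂ)⁻¹) • u (δ[z,i] * f))

theorem Fam.IsFin.exists_dk {C : Type} [AddCommGroup C] {u : X.K → C} (hu : IsFin u) (z : X.Coord) (f : X.K) :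
    ∃ N : ℕ, ∀ i : ℕ, N ≤ i → u (δ[z,i] * f) = 0 := by
  obtain ⟨N, hN⟩ := hu f
  refine ⟨N, fun i hi => ?_⟩
  rw [dk_natCast]
  exact hN _ (pow_le_pow_right hi (pow_mem_pow (diag_mem_idl _) _))

section

variable {B : Type} [AddCommGroup B] (z : X.Coord)

theorem dsum_eq_sum (Φ : X.DO →+ C →+ B) (u : X.K →+ C) (f : X.K) {N : ℕ}
    (hN : ∀ i : ℕ, N ≤ i → u (δ[z,i] * f) = 0) : dsum z Φ u f = ∑ i ∈ range N,
      Φ (dop z i) (X.scal ((i.factorial : ℂ)⁻¹) • u (δ[z,i] * f)) := by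
  apply finsum_eq_sum_of_support_subset
  intro i hi
  by_contra h
  apply hi
  rw [coe_range, mem_Iio, not_lt] at h
  beta_reduce
  rw [hN i h, smul_zero, map_zero]

theorem finite_dsum (Φ : X.DO →+ C →+ B) {u : X.K →+ C} (hu : IsFin u) (f : X.K) : Function.HasFiniteSupport
    fun i : ℕ => Φ (dop z i) (X.scal ((i.factorial : ℂ)⁻¹) • u (δ[z,i] * f)) := by
  obtain ⟨N, hN⟩ := hu.exists_dk z f
  refine (range N).finite_toSet.subset fun i hi => ?_
  by_contra h
  rw [coe_range, mem_Iio, not_lt] at h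
  exact hi (by beta_reduce; rw [hN i h, smul_zero, map_zero])

theorem dsum_eq_add {z : X.Coord} {Φ Ψ Θ : X.DO →+ C →+ B} {u v w : X.K →+ C} (hv : IsFin v) (hw : IsFin w) {f g h : X.K}
    (H : ∀ (P : X.DO) (s : X.R) (q : X.K), Φ P (s • u (q * f)) = Ψ P (s • v (q * g)) + Θ P (s • w (q * h))) :
    dsum z Φ u f = dsum z Ψ v g + dsum z Θ w h := by
  rw [dsum, finsum_congr fun i => H .., finsum_add_distrib (finite_dsum z _ hv _) (finite_dsum z _ hw _)]; rfl

theorem dsum_add (Φ : X.DO →+ C →+ B) {u : X.K →+ C} (hu : IsFin u) (f f' : X.K) :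
    dsum z Φ u (f + f') = dsum z Φ u f + dsum z Φ u f' :=
  dsum_eq_add hu hu fun P s q => by rw [mul_add, map_add, smul_add, map_add]

theorem dsum_smul {z : X.Coord} {Φ Ψ : X.DO →+ C →+ C} {u : X.K →+ C} (hu : IsFin u) (s : X.R) (f : X.K)
    (H : ∀ P x, Ψ P x = s • Φ P x) : dsum z Ψ u f = s • dsum z Φ u f := by
  rw [dsum, finsum_congr fun i => H _ _, ← smul_finsum' _ (finite_dsum z _ hu _)]; rfl

theorem isFin_dsum_left {z : X.Coord} {Φ : X.K → X.DO →+ C →+ B} {u : X.K →+ C} (hu : IsFin u) (f : X.K)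
    (H : ∀ P x, IsFin fun g => Φ g P x) : IsFin fun g => dsum z (Φ g) u f := by
  obtain ⟨N, hN⟩ := hu.exists_dk z f
  simp only [dsum_eq_sum z _ u f hN]
  exact isFin_sum N fun i => H _ _

theorem isFin_dsum (Φ : X.DO →+ C →+ B) {u : X.K →+ C} (hu : IsFin u) :
    IsFin (dsum z Φ u) := by
  intro f
  obtain ⟨N, hN⟩ := hu f
  refine ⟨N, fun q hq => ?_⟩
  rw [dsum_eq_sum z Φ u _ (N := 0), Finset.sum_range_zero]
  intro i _
  rw [← mul_assoc, dk_natCast, ← map_mul]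
  exact hN _ (mul_mem_left _ _ hq)

end

theorem expand_mul_fn (l : List (X.DO × C)) (s g : X.R) :
    expand X (l.map fun t => (t.1 * X.fn s, t.2)) g = expand X l (s * g) := by
  rw [expand, map_map, expand]
  congr 1
  apply List.map_congr_left
  intro t _
  simp only [Function.comp_apply]
  rw [map_mul, End.mul_apply, actR_fn]

variable [Module X.DOᵐᵒᵖ C]

/-- The linearity properties of a chiral bracket, recorded as in `ChirAlg`. -/
structure IsPre (br : X.K → C → C → X.R → C) : Prop where
  fn_act : ∀ (f : X.R) (a : C), a <• X.fn f = f • a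
  delta : ∀ f a b, ∃ l : List (X.DO × C), ∀ g, br f a b g = expand X l g
  add : ∀ f f' a b g, br (f + f') a b g = br f a b g + br f' a b g
  add_left : ∀ f a a' b g, br f (a + a') b g = br f a b g + br f a' b g
  add_right : ∀ f a b b' g, br f a (b + b') g = br f a b g + br f a b' g
  left : ∀ f r a b g, br f (r • a) b g = br (f * X.in1 r) a b g
  right : ∀ f s a b g, br f a (s • b) g = br (f * X.in2 s) a b g
  fn1 : ∀ f r a b g, br (f * X.in1 r) a b g = br f a b (r * g)
  fn2 : ∀ f s a b g, br (f * X.in2 s) a b g = s • br f a b g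
  vec1 : ∀ f (ξ : X.Th) a b g, br f (a <• X.vec ξ) b g - br (X.vec1 ξ f) a b g = br f a b (ξ g)
  vec2 : ∀ f (ξ : X.Th) a b g, br f a (b <• X.vec ξ) g - br (X.vec2 ξ f) a b g = br f a b g <• X.vec ξ

theorem ChirAlg.isPre (A : ChirAlg X) : IsPre A.br :=
  ⟨A.fn_act, A.br_delta, A.br_add, A.br_add_left, A.br_add_right, A.br_left, A.br_right, A.br_fn1,
    A.br_fn2, A.br_vec1, A.br_vec2⟩

namespace IsPre

variable {br : X.K → C → C → X.R → C} (H : IsPre br) (z : X.Coord)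

/-- The bracket as a bilinear map in its first two arguments. -/
def brR (c : C) (g : X.R) : X.K →+ C →+ C :=
  mk' (fun f => mk' (fun x => br f x c g) fun x y => H.add_left f x y c g)
    fun f f' => by ext x; exact H.add ..

/-- The bracket as a bilinear map in its first and third arguments. -/
def brL (a : C) (g : X.R) : X.K →+ C →+ C :=
  mk' (fun f => mk' (fun x => br f a x g) fun x y => H.add_right f a x y g)
    fun f f' => by ext x; exact H.add ..

/-- The bracket as an additive function of the section of `K`. -/
def brK (a b : C) (g : X.R) : X.K →+ C :=
  mk' (fun f => br f a b g) fun f f' => H.add f f' a b g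

@[simp] theorem brK_apply (a b : C) (g : X.R) (f : X.K) : H.brK a b g f = br f a b g := rfl

include H

theorem zero_left (f : X.K) (b : C) (g : X.R) : br f 0 b g = 0 := (H.brR b g f).map_zero
theorem zero_right (f : X.K) (a : C) (g : X.R) : br f a 0 g = 0 := (H.brL a g f).map_zero
theorem zero (a b : C) (g : X.R) : br 0 a b g = 0 := (H.brK a b g).map_zero
theorem neg_left (f : X.K) (a b : C) (g : X.R) : br f (-a) b g = - br f a b g := (H.brR b g f).map_neg a
theorem neg_right (f : X.K) (a b : C) (g : X.R) : br f a (-b) g = - br f a b g := (H.brL a g f).map_neg b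
theorem zsmul_left (n : ℤ) (f : X.K) (a b : C) (g : X.R) : br f (n • a) b g = n • br f a b g :=
  (H.brR b g f).map_zsmul n a
theorem zsmul_right (n : ℤ) (f : X.K) (a b : C) (g : X.R) : br f a (n • b) g = n • br f a b g :=
  (H.brL a g f).map_zsmul n b
theorem zsmul (n : ℤ) (f : X.K) (a b : C) (g : X.R) : br (n • f) a b g = n • br f a b g :=
  map_zsmul (H.brK a b g) n f

theorem eq_one (f : X.K) (a b : C) (g : X.R) : br f a b g = br (f * X.in1 g) a b 1 := by
  rw [H.fn1, mul_one]

theorem right_smul (f : X.K) (s : X.R) (a b : C) (g : X.R) : br f a (s • b) g = s • br f a b g := by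
  rw [H.right, H.fn2]

theorem scal_left (f : X.K) (s : ℂ) (a b : C) (g : X.R) : br f (X.scal s • a) b g = X.scal s • br f a b g := by
  have : X.in1 (X.scal s) = X.in2 (X.scal s) := by
    rw [Fam.scal, commutes, commutes]
  rw [H.left, this, H.fn2]

theorem algebraMap_mul (f : X.K) (a b : C) (l : List (X.DO × C)) (hl : ∀ g, br f a b g = expand X l g)
    (q : X.RR) : br (algebraMap X.RR X.K q * f) a b 1 = (l.map fun t => diagAct t.1 q • t.2).sum := by
  induction q using induction_on with
  | zero =>
    rw [map_zero, zero_mul, H.zero]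
    simp [diagAct_zero]
  | add p q hp hq =>
    rw [map_add, add_mul, H.add, hp, hq, ← List.sum_map_add]
    simp only [diagAct_add, add_smul]
  | tmul r s =>
    rw [← in1_mul_in2, mul_comm, ← mul_assoc, H.fn2, H.fn1, mul_one, hl, expand, List.smul_sum, map_map]
    congr 1
    apply List.map_congr_left
    intro t _
    simp [diagAct_tmul, smul_smul, mul_comm]

theorem isFin (a b : C) (g : X.R) : IsFin (H.brK a b g) := by
  have h1 : IsFin (H.brK a b 1) := by
    intro f
    obtain ⟨l, hl⟩ := H.delta f a b
    have : ∃ N, ∀ q ∈ X.idl ^ N, ∀ t ∈ l, diagAct t.1 q = 0 := by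
      clear hl
      induction l with
      | nil => exact ⟨0, by simp⟩
      | cons t l ih =>
        obtain ⟨N, hN⟩ := ih
        obtain ⟨N', hN'⟩ := exists_diagAct_eq_zero t.1
        refine ⟨max N N', fun q hq s hs => ?_⟩
        rcases List.mem_cons.1 hs with rfl | hs
        · exact hN' q (pow_le_pow_right (by omega) hq)
        · exact hN q (pow_le_pow_right (by omega) hq) s hs
    obtain ⟨N, hN⟩ := this
    refine ⟨N, fun q hq => ?_⟩
    rw [brK_apply, H.algebraMap_mul f a b l hl]
    apply List.sum_eq_zero
    intro x hx
    obtain ⟨t, ht, rfl⟩ := List.mem_map.1 hx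
    rw [hN q hq t ht, zero_smul]
  have : (H.brK a b g : X.K → C) = fun f => H.brK a b 1 (X.in1 g * f) := by
    funext f
    rw [brK_apply, brK_apply, H.eq_one, mul_comm]
  rw [this]
  exact h1.mul_left _

theorem list_sum {B : Type} [AddCommGroup B] (z : X.Coord) (Φ : X.DO →+ C →+ B)
    (hΦ : ∀ r P a, Φ (X.fn r * P) a = Φ P (r • a)) {f : X.K} {a b : C} {l : List (X.DO × C)}
    (hl : ∀ g, br f a b g = expand X l g) :
    (l.map fun t => Φ t.1 t.2).sum = dsum z Φ (H.brK a b 1) f := by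
  obtain ⟨N, hN⟩ := list_sum_eq z l
  obtain ⟨N', hN'⟩ := (H.isFin a b 1).exists_dk z f
  rw [dsum_eq_sum z Φ _ f (N := max N N') fun i hi => hN' i (by omega), hN (max N N') (by omega) Φ hΦ]
  refine sum_congr rfl fun i _ => ?_
  rw [brK_apply, dk_natCast, H.algebraMap_mul f a b l hl, List.smul_sum, map_map]
  congr 3
  funext t
  rw [Function.comp_apply, smul_smul, sym, X.scal_eq, ← smul_def]

theorem evZ_mode (a b : C) : EvZ fun n : ℤ => br δ[z,n] a b 1 := by
  obtain ⟨N, hN⟩ := (H.isFin a b 1).exists_dk z 1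
  refine ⟨N, fun n hn => ?_⟩
  lift n to ℕ using by omega
  have := hN n (by omega)
  rwa [mul_one] at this

/-- The bracket in terms of the modes. -/
theorem eq_lpair (f : X.K) (a b : C) (g : X.R) :
    br f a b g = lpair (tau z (f * X.in1 g)) fun n => br δ[z,n] a b 1 := by
  rw [H.eq_one, ← sub_eq_zero]
  refine eq_zero_of_isFin z (H.brK a b 1 - lpairHom z (H.evZ_mode z a b))
    ((H.isFin a b 1).sub (isFin_lpair z (H.evZ_mode z a b))) (fun c n => ?_) (f * X.in1 g)
  rw [AddMonoidHom.sub_apply, brK_apply, mul_comm, H.fn2]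
  change _ - lpair _ _ = 0
  rw [mul_comm, tau_in2_mul_dk, lpair_single, sub_self]

theorem mode_act_left (n : ℤ) (a b : C) : br δ[z,n] (a <• X.vec (ddz z)) b 1 =
    n • br δ[z,n - 1] a b 1 := by
  have := H.vec1 δ[z,n] (ddz z) a b 1
  rw [vec1_dk, H.zsmul, Derivation.map_one_eq_zero] at this
  have h0 : br δ[z,n] a b 0 = 0 := by
    rw [H.eq_one, map_zero, mul_zero, H.zero]
  rwa [h0, sub_eq_zero] at this

theorem mode_act_right (n : ℤ) (a b : C) : br δ[z,n] a (b <• X.vec (ddz z)) 1 =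
    br δ[z,n] a b 1 <• X.vec (ddz z) - n • br δ[z,n - 1] a b 1 := by
  have := H.vec2 δ[z,n] (ddz z) a b 1
  rw [vec2_dk, (H.brK a b 1).map_neg (n • _) |> (show br (-_) a b 1 = -br _ a b 1 from ·), H.zsmul] at this
  rw [← this]; abel

end IsPre

end Pre

open Fam

/-- Functions of three sections and three elements of `K` with the linearity properties of the terms of the Jacobi
identity for a chiral bracket. -/
structure IsTri {X : Fam} {C : Type} [AddCommGroup C] [Module X.R C] (G : C → C → C → X.K → X.K → X.K → C) : Prop where
  add_left : ∀ a a' b c f g h, G (a + a') b c f g h = G a b c f g h + G a' b c f g h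
  add_mid : ∀ a b b' c f g h, G a (b + b') c f g h = G a b c f g h + G a b' c f g h
  add_right : ∀ a b c c' f g h, G a b (c + c') f g h = G a b c f g h + G a b c' f g h
  smul_left : ∀ (s : X.R) a b c f g h, G (s • a) b c f g h = G a b c f (g * X.in1 s) h
  smul_mid : ∀ (s : X.R) a b c f g h, G a (s • b) c f g h = G a b c f g (h * X.in1 s)
  smul_right : ∀ (s : X.R) a b c f g h, G a b (s • c) f g h = s • G a b c f g h
  add₁ : ∀ a b c f f' g h, G a b c (f + f') g h = G a b c f g h + G a b c f' g h
  add₂ : ∀ a b c f g g' h, G a b c f (g + g') h = G a b c f g h + G a b c f g' h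
  add₃ : ∀ a b c f g h h', G a b c f g (h + h') = G a b c f g h + G a b c f g h'
  fin₁ : ∀ a b c g h, IsFin fun f => G a b c f g h
  fin₂ : ∀ a b c f h, IsFin fun g => G a b c f g h
  fin₃ : ∀ a b c f g, IsFin fun h => G a b c f g h
  smul₁ : ∀ s a b c f g h, G a b c (f * X.in2 s) g h = G a b c f g (h * X.in1 s)
  smul₂ : ∀ s a b c f g h, G a b c f (g * X.in2 s) h = s • G a b c f g h
  smul₃ : ∀ s a b c f g h, G a b c f g (h * X.in2 s) = s • G a b c f g h

namespace IsTri

variable {X : Fam} {C : Type} [AddCommGroup C] [Module X.R C] {G G' : C → C → C → X.K → X.K → X.K → C}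

theorem sub (H : IsTri G) (H' : IsTri G') : IsTri fun a b c f g h => G a b c f g h - G' a b c f g h := by
  constructor <;> intros
  · rw [H.add_left, H'.add_left]; abel
  · rw [H.add_mid, H'.add_mid]; abel
  · rw [H.add_right, H'.add_right]; abel
  · rw [H.smul_left, H'.smul_left]
  · rw [H.smul_mid, H'.smul_mid]
  · rw [H.smul_right, H'.smul_right, smul_sub]
  · rw [H.add₁, H'.add₁]; abel
  · rw [H.add₂, H'.add₂]; abel
  · rw [H.add₃, H'.add₃]; abel
  · exact (H.fin₁ _ _ _ _ _).sub (H'.fin₁ _ _ _ _ _)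
  · exact (H.fin₂ _ _ _ _ _).sub (H'.fin₂ _ _ _ _ _)
  · exact (H.fin₃ _ _ _ _ _).sub (H'.fin₃ _ _ _ _ _)
  · rw [H.smul₁, H'.smul₁]
  · rw [H.smul₂, H'.smul₂, smul_sub]
  · rw [H.smul₃, H'.smul₃, smul_sub]

theorem comp (H : IsTri G) (p q : C →ₗ[X.R] C) : IsTri fun a b c f g h => G (p a) (q b) c f g h :=
  ⟨fun _ _ => by simp only [map_add, H.add_left, implies_true], fun _ _ => by simp only [map_add, H.add_mid, implies_true],
    fun _ _ => H.add_right _ _, fun _ _ => by simp only [map_smul, H.smul_left, implies_true],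
    fun _ _ => by simp only [map_smul, H.smul_mid, implies_true], fun _ _ _ => H.smul_right _ _ _, fun _ _ => H.add₁ _ _,
    fun _ _ => H.add₂ _ _, fun _ _ => H.add₃ _ _, fun _ _ => H.fin₁ _ _, fun _ _ => H.fin₂ _ _, fun _ _ => H.fin₃ _ _,
    fun _ _ _ => H.smul₁ _ _ _, fun _ _ _ => H.smul₂ _ _ _, fun _ _ _ => H.smul₃ _ _ _⟩

theorem eq_zero (H : IsTri G) (z : X.Coord) {a b c : C}
    (h : ∀ n m k : ℤ, G a b c δ[z,n] δ[z,m] δ[z,k] = 0) (f g k : X.K) :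
    G a b c f g k = 0 := by
  refine eq_zero_of_isFin z (.mk' (fun f => G a b c f g k) fun f f' => H.add₁ ..) (H.fin₁ _ _ _ _ _) (fun s n => ?_) f
  rw [mul_comm]
  refine (H.smul₁ ..).trans ?_
  refine eq_zero_of_isFin z (.mk' (fun g => G a b c _ g _) fun g g' => H.add₂ ..) (H.fin₂ _ _ _ _ _) (fun t m => ?_) g
  rw [mul_comm (X.in2 t)]
  refine (H.smul₂ t ..).trans ((congrArg _ ?_).trans (smul_zero t))
  refine eq_zero_of_isFin z (.mk' (fun k => G a b c _ _ k) fun k k' => H.add₃ ..) (H.fin₃ _ _ _ _ _) (fun t k => ?_) _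
  rw [mul_comm (X.in2 t)]
  exact (H.smul₃ t ..).trans ((congrArg _ (h ..)).trans (smul_zero t))

end IsTri

namespace IsPre

variable {X : Fam} {C : Type} [AddCommGroup C] [Module X.R C] [Module X.DOᵐᵒᵖ C]
  {br : X.K → C → C → X.R → C} (H : IsPre br) (z : X.Coord)

/-- The contribution of `P` to `{{F · a ⊠ b} ⊠ c}`. -/
def jacΦ₁ (g h : X.K) (c : C) : X.DO →+ C →+ C :=
  (H.brR c 1).comp (mk' (fun P => h * X.act1 P g) fun P Q => by
    rw [map_add, LinearMap.add_apply, mul_add])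

/-- The contribution of `P` to `{a ⊠ {F · b ⊠ c}}`. -/
def jacΦ₂ (f g : X.K) (a : C) : X.DO →+ C →+ C :=
  (H.brL a 1).comp (mk' (fun P => g * X.act2 P f) fun P Q => by
    rw [map_add, LinearMap.add_apply, mul_add])

/-- The contribution of `P` to `σ₁₂ {b ⊠ {F · a ⊠ c}}`. -/
def jacΦ₃ (f h : X.K) (b : C) : X.DO →+ C →+ C :=
  (H.brL b 1).comp (mk' (fun P => h * X.swap (X.act1 P f)) fun P Q => by
    rw [map_add, LinearMap.add_apply, map_add, mul_add])

@[simp] theorem jacΦ₁_apply (g h : X.K) (c : C) (P : X.DO) (x : C) :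
    H.jacΦ₁ g h c P x = br (h * X.act1 P g) x c 1 := rfl
@[simp] theorem jacΦ₂_apply (f g : X.K) (a : C) (P : X.DO) (x : C) :
    H.jacΦ₂ f g a P x = br (g * X.act2 P f) a x 1 := rfl
@[simp] theorem jacΦ₃_apply (f h : X.K) (b : C) (P : X.DO) (x : C) :
    H.jacΦ₃ f h b P x = br (h * X.swap (X.act1 P f)) b x 1 := rfl

theorem jacΦ₁_fn (g h : X.K) (c : C) (r : X.R) (P : X.DO) (x : C) :
    H.jacΦ₁ g h c (X.fn r * P) x = H.jacΦ₁ g h c P (r • x) := by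
  rw [jacΦ₁_apply, jacΦ₁_apply, map_mul, End.mul_apply, act1_fn, H.left]
  congr 1; ring

theorem jacΦ₂_fn (f g : X.K) (c : C) (r : X.R) (P : X.DO) (x : C) :
    H.jacΦ₂ f g c (X.fn r * P) x = H.jacΦ₂ f g c P (r • x) := by
  rw [jacΦ₂_apply, jacΦ₂_apply, map_mul, End.mul_apply, act2_fn, H.right]
  congr 1; ring

theorem jacΦ₃_fn (f g : X.K) (c : C) (r : X.R) (P : X.DO) (x : C) :
    H.jacΦ₃ f g c (X.fn r * P) x = H.jacΦ₃ f g c P (r • x) := by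
  rw [jacΦ₃_apply, jacΦ₃_apply, map_mul, End.mul_apply, act1_fn, map_mul, swap_in1, H.right]
  congr 1; ring

/-- `{{F · a ⊠ b} ⊠ c}` for `F = f(x,y) g(x,z) h(y,z)`. -/
def jac₁ (a b c : C) (f g h : X.K) : C := dsum z (H.jacΦ₁ g h c) (H.brK a b 1) f

/-- `{a ⊠ {F · b ⊠ c}}` for `F = f(x,y) g(x,z) h(y,z)`. -/
def jac₂ (a b c : C) (f g h : X.K) : C := dsum z (H.jacΦ₂ f g a) (H.brK b c 1) h

/-- `σ₁₂ {b ⊠ {F · a ⊠ c}}` for `F = f(x,y) g(x,z) h(y,z)`. -/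
def jac₃ (a b c : C) (f g h : X.K) : C := dsum z (H.jacΦ₃ f h b) (H.brK a c 1) g

theorem jac₁_eq {a b : C} (c : C) {f : X.K} (g h : X.K) {l : List (X.DO × C)}
    (hl : ∀ g, br f a b g = expand X l g) :
    H.jac₁ z a b c f g h = (l.map fun t => br (h * X.act1 t.1 g) t.2 c 1).sum :=
  (H.list_sum z _ (H.jacΦ₁_fn g h c) hl).symm

theorem jac₂_eq (a : C) {b c : C} (f g : X.K) {h : X.K} {l : List (X.DO × C)}
    (hl : ∀ g, br h b c g = expand X l g) :
    H.jac₂ z a b c f g h = (l.map fun t => br (g * X.act2 t.1 f) a t.2 1).sum :=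
  (H.list_sum z _ (H.jacΦ₂_fn f g a) hl).symm

theorem jac₃_eq {a : C} (b : C) {c : C} (f : X.K) {g : X.K} (h : X.K) {l : List (X.DO × C)}
    (hl : ∀ k, br g a c k = expand X l k) :
    H.jac₃ z a b c f g h = (l.map fun t => br (h * X.swap (X.act1 t.1 f)) b t.2 1).sum :=
  (H.list_sum z _ (H.jacΦ₃_fn f h b) hl).symm

section

variable {z : X.Coord} {Φ Ψ : X.DO →+ C →+ C} (a a' b b' : C) (f : X.K) (s : X.R)

theorem dsum_add_left : dsum z Φ (H.brK (a + a') b 1) f = dsum z Φ (H.brK a b 1) f + dsum z Φ (H.brK a' b 1) f :=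
  dsum_eq_add (H.isFin _ _ _) (H.isFin _ _ _) fun P s q => by simp only [brK_apply, H.add_left, smul_add, map_add]

theorem dsum_add_right : dsum z Φ (H.brK a (b + b') 1) f = dsum z Φ (H.brK a b 1) f + dsum z Φ (H.brK a b' 1) f :=
  dsum_eq_add (H.isFin _ _ _) (H.isFin _ _ _) fun P s q => by simp only [brK_apply, H.add_right, smul_add, map_add]

theorem dsum_smul_left : dsum z Φ (H.brK (s • a) b 1) f = dsum z Φ (H.brK a b 1) (f * X.in1 s) :=
  finsum_congr fun i => by rw [brK_apply, brK_apply, H.left, mul_assoc]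

theorem dsum_smul_right : dsum z Φ (H.brK a (s • b) 1) f = dsum z Φ (H.brK a b 1) (f * X.in2 s) :=
  finsum_congr fun i => by rw [brK_apply, brK_apply, H.right, mul_assoc]

theorem dsum_of_add {Θ : X.DO →+ C →+ C} (h : ∀ P x, Φ P x = Ψ P x + Θ P x) :
    dsum z Φ (H.brK a b 1) f = dsum z Ψ (H.brK a b 1) f + dsum z Θ (H.brK a b 1) f :=
  dsum_eq_add (H.isFin _ _ _) (H.isFin _ _ _) fun _ _ _ => h ..

theorem dsum_of_smul (h : ∀ P x, Ψ P x = s • Φ P x) : dsum z Ψ (H.brK a b 1) f = s • dsum z Φ (H.brK a b 1) f :=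
  dsum_smul (H.isFin _ _ _) s f h

theorem dsum_in2 (h : ∀ P x, Ψ P x = Φ P (s • x)) : dsum z Φ (H.brK a b 1) (f * X.in2 s) = dsum z Ψ (H.brK a b 1) f :=
  finsum_congr fun i => by rw [h, brK_apply, brK_apply, ← mul_assoc, H.fn2, smul_comm]

theorem dsum_in2_smul (h : ∀ P x, Φ P (s • x) = s • Φ P x) :
    dsum z Φ (H.brK a b 1) (f * X.in2 s) = s • dsum z Φ (H.brK a b 1) f := by
  rw [← dsum_smul (Ψ := (compHom (DistribSMul.toAddMonoidHom C s)).comp Φ) (H.isFin _ _ _) s f fun P x => rfl]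
  exact H.dsum_in2 _ _ _ _ fun P x => (h P x).symm

theorem dsum_in1 (hΦ : ∀ r P a, Φ (X.fn r * P) a = Φ P (r • a)) (hΨ : ∀ r P a, Ψ (X.fn r * P) a = Ψ P (r • a))
    (h : ∀ P x, Ψ P x = Φ (P * X.fn s) x) : dsum z Φ (H.brK a b 1) (f * X.in1 s) = dsum z Ψ (H.brK a b 1) f := by
  obtain ⟨l, hl⟩ := H.delta f a b
  rw [← H.list_sum z _ hΨ hl, ← H.list_sum z _ hΦ (l := l.map fun t => (t.1 * X.fn s, t.2)) fun g => by
    rw [expand_mul_fn, H.fn1, hl], map_map]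
  simp only [h, Function.comp_def]

end

theorem isTri_jac₁ (z : X.Coord) : IsTri (H.jac₁ z) where
  add_left a a' b c f g h := H.dsum_add_left ..
  add_mid a b b' c f g h := H.dsum_add_right ..
  add_right a b c c' f g h := H.dsum_of_add _ _ _ fun P x => H.add_right ..
  smul_left s a b c f g h := (H.dsum_smul_left ..).trans (H.dsum_in1 _ _ _ _ (H.jacΦ₁_fn _ _ _) (H.jacΦ₁_fn _ _ _) fun P x => by
    rw [jacΦ₁_apply, jacΦ₁_apply, map_mul X.act1, End.mul_apply, act1_fn, mul_comm g])
  smul_mid s a b c f g h := (H.dsum_smul_right ..).trans (H.dsum_in2 _ _ _ _ fun P x => by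
    rw [jacΦ₁_apply, jacΦ₁_apply, H.left, mul_right_comm])
  smul_right s a b c f g h := H.dsum_of_smul _ _ _ _ fun P x => H.right_smul ..
  add₁ a b c f f' g h := dsum_add z _ (H.isFin a b 1) f f'
  add₂ a b c f g g' h := H.dsum_of_add _ _ _ fun P x => by simp only [jacΦ₁_apply, map_add, mul_add, H.add]
  add₃ a b c f g h h' := H.dsum_of_add _ _ _ fun P x => by simp only [jacΦ₁_apply, add_mul, H.add]
  fin₁ a b c g h := isFin_dsum z _ (H.isFin a b 1)
  fin₂ a b c f h := isFin_dsum_left (H.isFin _ _ _) _ fun P x => IsFin.act1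
    (B := (H.brK x c 1).comp (mulLeft h)) ((H.isFin x c 1).mul_left h) P
  fin₃ a b c f g := isFin_dsum_left (H.isFin _ _ _) _ fun P x => by
    simp only [jacΦ₁_apply, mul_comm _ (X.act1 P g)]
    exact (H.isFin x c 1).mul_left _
  smul₁ s a b c f g h := H.dsum_in2 _ _ _ _ fun P x => by rw [jacΦ₁_apply, jacΦ₁_apply, H.left, mul_right_comm]
  smul₂ s a b c f g h := H.dsum_of_smul _ _ _ _ fun P x => by rw [jacΦ₁_apply, act1_mul_in2, ← mul_assoc, H.fn2]; rfl
  smul₃ s a b c f g h := H.dsum_of_smul _ _ _ _ fun P x => by rw [jacΦ₁_apply, mul_right_comm, H.fn2]; rfl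

theorem isTri_jac₂ (z : X.Coord) : IsTri (H.jac₂ z) where
  add_left a a' b c f g h := H.dsum_of_add _ _ _ fun P x => H.add_left ..
  add_mid a b b' c f g h := H.dsum_add_left ..
  add_right a b c c' f g h := H.dsum_add_right ..
  smul_left s a b c f g h := finsum_congr fun i => by rw [jacΦ₂_apply, jacΦ₂_apply, H.left, mul_right_comm]
  smul_mid s a b c f g h := H.dsum_smul_left ..
  smul_right s a b c f g h := (H.dsum_smul_right ..).trans (H.dsum_in2_smul _ _ _ _ fun P x => H.right_smul ..)
  add₁ a b c f f' g h := H.dsum_of_add _ _ _ fun P x => by simp only [jacΦ₂_apply, map_add, mul_add, H.add]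
  add₂ a b c f g g' h := H.dsum_of_add _ _ _ fun P x => by simp only [jacΦ₂_apply, add_mul, H.add]
  add₃ a b c f g h h' := dsum_add z _ (H.isFin b c 1) h h'
  fin₁ a b c g h := isFin_dsum_left (H.isFin _ _ _) _ fun P x => IsFin.act2
    (B := (H.brK a x 1).comp (mulLeft g)) ((H.isFin a x 1).mul_left g) P
  fin₂ a b c f h := isFin_dsum_left (H.isFin _ _ _) _ fun P x => by
    simp only [jacΦ₂_apply, mul_comm _ (X.act2 P f)]
    exact (H.isFin a x 1).mul_left _
  fin₃ a b c f g := isFin_dsum z _ (H.isFin b c 1)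
  smul₁ s a b c f g h := (H.dsum_in1 _ _ _ _ (H.jacΦ₂_fn _ _ _) (H.jacΦ₂_fn _ _ _) fun P x => by
    rw [jacΦ₂_apply, jacΦ₂_apply, map_mul X.act2, End.mul_apply, act2_fn, mul_comm f]).symm
  smul₂ s a b c f g h := H.dsum_of_smul _ _ _ _ fun P x => by rw [jacΦ₂_apply, mul_right_comm, H.fn2]; rfl
  smul₃ s a b c f g h := H.dsum_in2_smul _ _ _ _ fun P x => H.right_smul ..

theorem isTri_jac₃ (z : X.Coord) : IsTri (H.jac₃ z) where
  add_left a a' b c f g h := H.dsum_add_left ..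
  add_mid a b b' c f g h := H.dsum_of_add _ _ _ fun P x => H.add_left ..
  add_right a b c c' f g h := H.dsum_add_right ..
  smul_left s a b c f g h := H.dsum_smul_left ..
  smul_mid s a b c f g h := finsum_congr fun i => by rw [jacΦ₃_apply, jacΦ₃_apply, H.left, mul_right_comm]
  smul_right s a b c f g h := (H.dsum_smul_right ..).trans (H.dsum_in2_smul _ _ _ _ fun P x => H.right_smul ..)
  add₁ a b c f f' g h := H.dsum_of_add _ _ _ fun P x => by simp only [jacΦ₃_apply, map_add, mul_add, H.add]
  add₂ a b c f g g' h := dsum_add z _ (H.isFin a c 1) g g'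
  add₃ a b c f g h h' := H.dsum_of_add _ _ _ fun P x => by simp only [jacΦ₃_apply, add_mul, H.add]
  fin₁ a b c g h := isFin_dsum_left (H.isFin _ _ _) _ fun P x => IsFin.act1
    (B := ((H.brK b x 1).comp (mulLeft h)).comp (X.swap : X.K →+ X.K)) ((H.isFin b x 1).mul_left h).swap P
  fin₂ a b c f h := isFin_dsum z _ (H.isFin a c 1)
  fin₃ a b c f g := isFin_dsum_left (H.isFin _ _ _) _ fun P x => by
    simp only [jacΦ₃_apply, mul_comm _ (X.swap _)]
    exact (H.isFin b x 1).mul_left _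
  smul₁ s a b c f g h := finsum_congr fun i => by
    rw [jacΦ₃_apply, jacΦ₃_apply, act1_mul_in2, map_mul, swap_in2, mul_assoc, mul_comm (X.in1 s)]
  smul₂ s a b c f g h := H.dsum_in2_smul _ _ _ _ fun P x => H.right_smul ..
  smul₃ s a b c f g h := H.dsum_of_smul _ _ _ _ fun P x => by rw [jacΦ₃_apply, mul_right_comm, H.fn2]; rfl

end IsPre

section

variable {X : Fam} {C : Type} [AddCommGroup C] [Module X.R C]

theorem factorial_smul (i : ℕ) (c : ℤ) (x : C) :
    (i.factorial * c : ℤ) • X.scal ((i.factorial : ℂ)⁻¹) • x = c • x := by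
  rw [← cast_smul_eq_zsmul X.R, ← cast_smul_eq_zsmul X.R, smul_smul]
  congr 1
  rw [X.scal_eq, ← map_intCast (algebraMap ℂ X.R), ← map_intCast (algebraMap ℂ X.R), ← map_mul]
  congr 1
  have : (i.factorial : ℂ) ≠ 0 := by exact_mod_cast i.factorial_ne_zero
  push_cast
  field_simp

end

namespace IsPre

variable {X : Fam} {C : Type} [AddCommGroup C] [Module X.R C] [Module X.DOᵐᵒᵖ C]
  {br : X.K → C → C → X.R → C} (H : IsPre br)

section Modes

variable (z : X.Coord) (a b c : C) (n m k : ℤ)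

theorem jac₁_dk : H.jac₁ z a b c δ[z,n] δ[z,m] δ[z,k] =
    bsum m fun j => br δ[z,m + k - j] (br δ[z,n + j] a b 1) c 1 := by
  refine finsum_congr fun i => ?_
  rw [jacΦ₁_apply, act1_dop_dk, mul_smul_comm, dk_mul, H.zsmul, H.scal_left, brK_apply, dk_mul, factorial_smul,
    add_comm (i : ℤ) n, show k + (m - i) = m + k - i by ring]

theorem jac₂_dk : H.jac₂ z a b c δ[z,n] δ[z,m] δ[z,k] =
    bsum n fun j => sg j • br δ[z,m + n - j] a (br δ[z,k + j] b c 1) 1 := by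
  refine finsum_congr fun i => ?_
  rw [jacΦ₂_apply, act2_dop_dk, mul_smul_comm, dk_mul, H.zsmul, H.right_smul, brK_apply, dk_mul, mul_smul,
    factorial_smul, add_comm (i : ℤ) k, show m + (n - i) = m + n - i by ring, smul_comm]

theorem jac₃_dk : H.jac₃ z a b c δ[z,n] δ[z,m] δ[z,k] =
    bsum n fun j => sg n • sg j • br δ[z,n + k - j] b (br δ[z,m + j] a c 1) 1 := by
  refine finsum_congr fun i => ?_
  have h : sg (n - i) = sg n * sg i := by
    rw [sg, Int.negOnePow_sub]; rfl
  rw [jacΦ₃_apply, act1_dop_dk, map_zsmul, swap_dk, h, mul_smul_comm, mul_smul_comm, dk_mul, H.zsmul, H.zsmul,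
    H.right_smul, brK_apply, dk_mul, smul_comm, factorial_smul, add_comm (i : ℤ) m,
    show k + (n - i) = n + k - i by ring, smul_comm, mul_smul, smul_comm (Ring.choose n i)]

end Modes

/-- The contribution of `P` to the transpose of a section of `A ⊗ D`. -/
def actΦ (g : X.R) : X.DO →+ C →+ C :=
  mk' (fun P => mk' (fun x => (g • x) <• P) fun x y => by rw [smul_add, smul_add])
    fun P Q => by ext x; exact add_smul ..

theorem actΦ_apply (g : X.R) (P : X.DO) (x : C) : actΦ g P x = (g • x) <• P := rfl

include H in
theorem actΦ_fn (g : X.R) (r : X.R) (P : X.DO) (x : C) : actΦ g (X.fn r * P) x = actΦ g P (r • x) := by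
  rw [actΦ_apply, actΦ_apply, op_mul, mul_smul, H.fn_act, smul_comm r g x]

/-- The transpose `σ₁₂ {f · b ⊠ a}`. -/
def tr (z : X.Coord) (b a : C) (f : X.K) (g : X.R) : C := dsum z (actΦ g) (H.brK b a 1) f

theorem tr_eq (z : X.Coord) {b a : C} {f : X.K} {l : List (X.DO × C)} (hl : ∀ g, br f b a g = expand X l g)
    (g : X.R) : H.tr z b a f g = expandSwap X l g :=
  (H.list_sum z _ (H.actΦ_fn g) hl).symm

section Tr

variable (z : X.Coord) (b b' a a' : C) (f : X.K) (g s : X.R)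

theorem tr_smul_right : H.tr z b (s • a) f g = H.tr z b a (f * X.in2 s) g := H.dsum_smul_right ..

theorem tr_smul_left : H.tr z (s • b) a f g = H.tr z b a (f * X.in1 s) g := H.dsum_smul_left ..

theorem tr_in1 : H.tr z b a (f * X.in1 s) g = s • H.tr z b a f g := by
  rw [tr, H.dsum_in1 _ _ _ _ (Ψ := (compHom (DistribSMul.toAddMonoidHom C s)).comp (actΦ g)) (H.actΦ_fn g)
    (fun r P a => congrArg (s • ·) (H.actΦ_fn ..)) fun P x => ?_, H.dsum_of_smul _ _ _ _ fun P x => rfl, tr]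
  rw [actΦ_apply, op_mul, mul_smul, H.fn_act]; rfl

theorem tr_in2 : H.tr z b a (f * X.in2 s) g = H.tr z b a f (s * g) := H.dsum_in2 _ _ _ _ fun P x => by
  rw [actΦ_apply, actΦ_apply, smul_smul, mul_comm]

theorem tr_add_left : H.tr z (b + b') a f g = H.tr z b a f g + H.tr z b' a f g := H.dsum_add_left ..

theorem tr_add_right : H.tr z b (a + a') f g = H.tr z b a f g + H.tr z b a' f g := H.dsum_add_right ..

theorem tr_add (f' : X.K) : H.tr z b a (f + f') g = H.tr z b a f g + H.tr z b a f' g :=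
  dsum_add z _ (H.isFin _ _ _) f f'

theorem isFin_tr : IsFin fun f => H.tr z b a f g := isFin_dsum z _ (H.isFin _ _ _)

theorem tr_swap_dk (n : ℤ) : H.tr z b a (X.swap δ[z,n]) 1 = sg n • ∑ᶠ t : ℕ,
    (X.scal ((t.factorial : ℂ)⁻¹) • br δ[z,n + t] b a 1) <• dop z t := by
  have h0 (x : X.K) (m : ℤ) : H.tr z b a (m • x) 1 = m • H.tr z b a x 1 :=
    map_zsmul (mk' _ fun f f' => H.tr_add z b a f 1 f') m x
  rw [swap_dk, h0]
  congr 1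
  refine finsum_congr fun t => ?_
  rw [actΦ_apply, one_smul, brK_apply, dk_mul, add_comm (t : ℤ)]

end Tr

end IsPre

namespace ChirAlg

variable {X : Fam} (A : ChirAlg X) (z : X.Coord)

theorem borcherds {i j : ZMod 2} {a b : A.carrier} (ha : a ∈ A.par i) (hb : b ∈ A.par j)
    (c : A.carrier) (m n k : ℤ) :
    (bsum m fun t => A.br δ[z,m + k - t] (A.br δ[z,n + t] a b 1) c 1) =
      (bsum n fun t => sg t • A.br δ[z,m + n - t] a (A.br δ[z,k + t] b c 1) 1) -
        sgn i j • bsum n fun t => sg n • sg t •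
          A.br δ[z,n + k - t] b (A.br δ[z,m + t] a c 1) 1 := by
  rw [← A.isPre.jac₁_dk, ← A.isPre.jac₂_dk, ← A.isPre.jac₃_dk]
  obtain ⟨l₁, h₁⟩ := A.br_delta δ[z,n] a b
  obtain ⟨l₂, h₂⟩ := A.br_delta δ[z,k] b c
  obtain ⟨l₃, h₃⟩ := A.br_delta δ[z,m] a c
  rw [A.isPre.jac₁_eq z _ _ _ h₁, A.isPre.jac₂_eq z _ _ _ h₂, A.isPre.jac₃_eq z _ _ _ h₃]
  exact A.jacobi i j a ha b hb c _ _ _ l₁ l₂ l₃ h₁ h₂ h₃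

theorem skew {i j : ZMod 2} {a b : A.carrier} (ha : a ∈ A.par i) (hb : b ∈ A.par j) (n : ℤ) :
    A.br δ[z,n] a b 1 = -(sgn i j • sg n • ∑ᶠ t : ℕ,
      (X.scal ((t.factorial : ℂ)⁻¹) • A.br δ[z,n + t] b a 1) <• dop z t) := by
  rw [← A.isPre.tr_swap_dk]
  obtain ⟨l, hl⟩ := A.br_delta (X.swap δ[z,n]) b a
  rw [A.isPre.tr_eq z hl]
  exact A.antisymm i j a ha b hb _ l hl 1

end ChirAlg

/-! ### The chiral algebra of free fields in a coordinate -/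

/-- The space of sections of the chiral algebra of the free fields `F`, in terms of the
coordinate `z`. -/
def Mdl (F : FieldData) {X : Fam} (_ : X.Coord) : Type := X.R ⊗[ℂ] F.Fock

namespace Mdl

variable {F : FieldData} {X : Fam} {z : X.Coord}

instance : AddCommGroup (Mdl F z) := inferInstanceAs (AddCommGroup (X.R ⊗[ℂ] F.Fock))
instance : Module X.R (Mdl F z) := inferInstanceAs (Module X.R (X.R ⊗[ℂ] F.Fock))
instance : Module X.k (Mdl F z) := inferInstanceAs (Module X.k (X.R ⊗[ℂ] F.Fock))
instance : Module ℂ (Mdl F z) := inferInstanceAs (Module ℂ (X.R ⊗[ℂ] F.Fock))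
instance : IsScalarTower ℂ X.R (Mdl F z) := inferInstanceAs (IsScalarTower ℂ X.R (X.R ⊗[ℂ] F.Fock))
instance : IsScalarTower X.k X.R (Mdl F z) := inferInstanceAs (IsScalarTower X.k X.R (X.R ⊗[ℂ] F.Fock))

/-- The section `r ⊗ v`. -/
def ten (r : X.R) (v : F.Fock) : Mdl F z := r ⊗ₜ[ℂ] v

theorem ten_add_left (r r' : X.R) (v : F.Fock) : (ten (r + r') v : Mdl F z) = ten r v + ten r' v :=
  TensorProduct.add_tmul r r' v

theorem ten_add_right (r : X.R) (v v' : F.Fock) : (ten r (v + v') : Mdl F z) = ten r v + ten r v' :=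
  tmul_add r v v'

theorem smul_ten (s r : X.R) (v : F.Fock) : s • (ten r v : Mdl F z) = ten (s * r) v := rfl

theorem ten_eq (r : X.R) (v : F.Fock) : (ten r v : Mdl F z) = r • ten 1 v := by
  rw [smul_ten, mul_one]

/-- `v ↦ r ⊗ v` as a linear map. -/
def tenL (r : X.R) : F.Fock →ₗ[ℂ] Mdl F z := TensorProduct.mk ℂ X.R F.Fock r

theorem tenL_apply (r : X.R) (v : F.Fock) : (tenL r v : Mdl F z) = ten r v := rfl

theorem ten_zero (r : X.R) : (ten r 0 : Mdl F z) = 0 := (tenL r).map_zero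
theorem ten_neg (r : X.R) (v : F.Fock) : (ten r (-v) : Mdl F z) = - ten r v := (tenL r).map_neg v
theorem ten_sub (r : X.R) (v w : F.Fock) : (ten r (v - w) : Mdl F z) = ten r v - ten r w := (tenL r).map_sub v w
theorem ten_zsmul (r : X.R) (n : ℤ) (v : F.Fock) : (ten r (n • v) : Mdl F z) = n • ten r v :=
  map_zsmul (tenL r) n v
theorem ten_smul (r : X.R) (c : ℂ) (v : F.Fock) : (ten r (c • v) : Mdl F z) = c • ten r v :=
  map_smul (tenL r) c v

theorem induction {p : Mdl F z → Prop} (ten : ∀ r v, p (ten r v)) (add : ∀ a b, p a → p b → p (a + b))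
    (a : Mdl F z) : p a := by
  refine induction_on a ?_ ten add
  have := ten 0 0
  rwa [ten_zero] at this

theorem induction_smul {p : Mdl F z → Prop} (ten : ∀ v, p (ten 1 v)) (add : ∀ a b, p a → p b → p (a + b))
    (smul : ∀ (r : X.R) a, p a → p (r • a)) (a : Mdl F z) : p a :=
  induction (fun r v => by rw [ten_eq]; exact smul r _ (ten v)) add a

variable (F z) in
/-- The derivation along `d/dz`. -/
def der : Mdl F z →ₗ[X.k] Mdl F z :=
  TensorProduct.AlgebraTensorModule.map (ddz z).toLinearMap (LinearMap.id : F.Fock →ₗ[ℂ] F.Fock) +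
    TensorProduct.AlgebraTensorModule.map (LinearMap.id : X.R →ₗ[X.k] X.R) F.trans

theorem der_ten (r : X.R) (v : F.Fock) : der F z (ten r v) = ten (ddz z r) v + ten r (F.trans v) := rfl

theorem der_smul (s : X.R) (a : Mdl F z) : der F z (s • a) = ddz z s • a + s • der F z a := by
  induction a using induction with
  | ten r v =>
    rw [smul_ten, der_ten, der_ten, smul_add, smul_ten, smul_ten, smul_ten, leibniz, ten_add_left,
      smul_eq_mul, smul_eq_mul, mul_comm r]
    abel
  | add a b ha hb => rw [smul_add, map_add, ha, hb, map_add, smul_add, smul_add]; abel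

/-- The right action of a vector field. -/
def vact (ξ : X.Th) : End X.k (Mdl F z) := -(der F z ∘ₗ lsmul X.k X.k (Mdl F z) (ξ z))

theorem vact_apply (ξ : X.Th) (a : Mdl F z) : vact ξ a = - der F z (ξ z • a) := rfl

/-- The right action of functions. -/
def fact : X.R →ₐ[X.k] (End X.k (Mdl F z))ᵐᵒᵖ where
  toFun f := op (lsmul X.k X.k (Mdl F z) f)
  map_one' := unop_injective (LinearMap.ext fun a => one_smul _ a)
  map_zero' := unop_injective (LinearMap.ext fun a => zero_smul _ a)
  map_add' f g := unop_injective (LinearMap.ext fun a => add_smul f g a)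
  map_mul' f g := unop_injective (LinearMap.ext fun a => by
    change (f * g) • a = g • f • a
    rw [smul_smul, mul_comm])
  commutes' c := unop_injective (LinearMap.ext fun a => algebraMap_smul X.R c a)

variable (F z) in
/-- The right action of differential operators. -/
def act : X.DO →ₐ[X.k] (End X.k (Mdl F z))ᵐᵒᵖ :=
  X.liftDO fact (fun ξ => op (vact ξ))
    (fun ξ η => unop_injective (LinearMap.ext fun a => by
      change vact (ξ + η) a = vact ξ a + vact η a
      rw [vact_apply, vact_apply, vact_apply, Derivation.add_apply, add_smul, map_add, neg_add]))
    (fun f ξ => unop_injective (LinearMap.ext fun a => by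
      change vact (f • ξ) a = vact ξ (f • a)
      rw [vact_apply, vact_apply, Derivation.smul_apply, smul_smul, smul_eq_mul, mul_comm]))
    (fun ξ f => unop_injective (LinearMap.ext fun a => by
      change f • vact ξ a = vact ξ (f • a) + ξ f • a
      rw [vact_apply, vact_apply, smul_comm, der_smul f, vec_apply_eq z ξ f, smul_smul (ddz z f), mul_comm (ddz z f),
        smul_neg]
      abel))
    (fun ξ η => unop_injective (LinearMap.ext fun a => by
      change vact ⁅ξ, η⁆ a = vact η (vact ξ a) - vact ξ (vact η a)
      simp only [vact_apply, map_neg, der_smul, Derivation.commutator_apply, smul_add,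
        map_add]
      rw [vec_apply_eq z ξ (η z), vec_apply_eq z η (ξ z)]
      simp only [sub_smul, smul_smul, map_sub, leibniz, add_smul, smul_eq_mul, mul_comm]
      abel))

instance : Module X.DOᵐᵒᵖ (Mdl F z) :=
  Module.compHom (Mdl F z) ((RingEquiv.opOp (End X.k (Mdl F z))).symm.toRingHom.comp
    (act F z : X.DO →+* (End X.k (Mdl F z))ᵐᵒᵖ).op)

theorem act_fn (a : Mdl F z) (f : X.R) : a <• X.fn f = f • a := by
  change unop (act F z (X.fn f)) a = _
  have : act F z (X.fn f) = _ := liftDO_fn _ _ _ _ _ _ _ f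
  rw [this]; rfl

theorem act_vec (a : Mdl F z) (ξ : X.Th) : a <• X.vec ξ = - der F z (ξ z • a) := by
  change unop (act F z (X.vec ξ)) a = _
  have : act F z (X.vec ξ) = _ := liftDO_vec _ _ _ _ _ _ ξ
  rw [this]; rfl

/-! ### The bracket -/

theorem evZ_ten (v w : F.Fock) : EvZ fun n : ℤ => (ten 1 (F.md n v w) : Mdl F z) := by
  obtain ⟨N, hN⟩ := F.exists_md_bound v w
  exact ⟨N, fun n hn => by beta_reduce; rw [hN n hn, ten_zero]⟩

theorem in1_csmul (c : ℂ) (r : X.R) : X.in1 (c • r) = X.in1 r * X.in2 (algebraMap ℂ X.R c) := by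
  have : X.in2 (algebraMap ℂ X.R c) = X.in1 (algebraMap ℂ X.R c) := by
    rw [IsScalarTower.algebraMap_apply ℂ X.k X.R, commutes, commutes]
  rw [this, ← map_mul, smul_def, mul_comm]

theorem lpair_in2 {A : Type} [AddCommGroup A] [Module X.R A] (f : X.K) (s : X.R) {m : ℤ → A} (hm : EvZ m) :
    lpair (tau z (f * X.in2 s)) m = s • lpair (tau z f) m := by
  rw [mul_comm, map_mul, tau_in2, lpair_C_mul _ _ hm]

variable (z) in
/-- The bracket `(h ⊠ id) {f · (1 ⊗ v) ⊠ (1 ⊗ w)}`. -/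
def lp (f : X.K) (v w : F.Fock) : Mdl F z := lpair (tau z f) fun n => (ten 1 (F.md n v w) : Mdl F z)

theorem lp_add (f f' : X.K) (v w : F.Fock) : lp z (f + f') v w = lp z f v w + lp z f' v w := by
  rw [lp, map_add, lpair_add_left _ _ (evZ_ten v w)]; rfl

theorem lp_add_left (f : X.K) (v v' w : F.Fock) : lp z f (v + v') w = lp z f v w + lp z f v' w := by
  rw [lp, lp, lp, ← lpair_add_right _ (evZ_ten v w) (evZ_ten v' w)]
  simp only [map_add, LinearMap.add_apply, ten_add_right]

theorem lp_add_right (f : X.K) (v w w' : F.Fock) : lp z f v (w + w') = lp z f v w + lp z f v w' := by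
  rw [lp, lp, lp, ← lpair_add_right _ (evZ_ten v w) (evZ_ten v w')]
  simp only [map_add, ten_add_right]

theorem lp_in2 (f : X.K) (s : X.R) (v w : F.Fock) : lp z (f * X.in2 s) v w = s • lp z f v w :=
  lpair_in2 f s (evZ_ten v w)

theorem csmul_lp (f : X.K) (c : ℂ) (v w : F.Fock) :
    c • lp z f v w = lpair (tau z f) fun n => (c • ten 1 (F.md n v w) : Mdl F z) := by
  have := lpair_map (tau z f) (evZ_ten (z := z) v w)
    (LinearMap.lsmul X.R (Mdl F z) (algebraMap ℂ X.R c))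
  simp only [LinearMap.lsmul_apply, algebraMap_smul] at this
  exact this.symm

theorem lp_smul_left (f : X.K) (c : ℂ) (v w : F.Fock) : lp z f (c • v) w = c • lp z f v w := by
  rw [csmul_lp, lp]
  simp only [map_smul, LinearMap.smul_apply, ten_smul]

theorem lp_smul_right (f : X.K) (c : ℂ) (v w : F.Fock) : lp z f v (c • w) = c • lp z f v w := by
  rw [csmul_lp, lp]
  simp only [map_smul, ten_smul]

theorem lp_dk (n : ℤ) (v w : F.Fock) : lp z δ[z,n] v w = ten 1 (F.md n v w) := by
  rw [lp, tau_dk, lpair_single, one_smul]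

theorem isFin_lp (v w : F.Fock) : IsFin fun f => lp z f v w := isFin_lpair z (evZ_ten v w)

/-- `lp` as an additive map. -/
def lpK (v w : F.Fock) : X.K →+ Mdl F z := mk' (fun f => lp z f v w) fun f f' => lp_add f f' v w

variable (z) in
/-- The bracket with `1 ⊗ w`. -/
def brAux (f : X.K) : X.R ⊗[ℂ] F.Fock →ₗ[ℂ] F.Fock →ₗ[ℂ] Mdl F z :=
  TensorProduct.lift (mk₂ ℂ
    (fun r v =>
      { toFun := fun w => lp z (f * X.in1 r) v w
        map_add' := fun w w' => lp_add_right ..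
        map_smul' := fun c w => lp_smul_right _ _ _ _ })
    (fun r r' v => LinearMap.ext fun w => by
      change lp _ _ _ _ = lp _ _ _ _ + lp ..
      rw [map_add, mul_add, lp_add])
    (fun c r v => LinearMap.ext fun w => by
      change lp _ _ _ _ = c • lp ..
      rw [in1_csmul, ← mul_assoc, lp_in2, algebraMap_smul])
    (fun r v v' => LinearMap.ext fun w => lp_add_left ..)
    (fun c r v => LinearMap.ext fun w => lp_smul_left ..))

variable (z) in
/-- The chiral bracket. -/
def br (f : X.K) (a b : Mdl F z) (g : X.R) : Mdl F z :=
  (brAux z (f * X.in1 g) a).liftBaseChange X.R b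

theorem br_ten (f : X.K) (r : X.R) (v : F.Fock) (s : X.R) (w : F.Fock) (g : X.R) :
    br z f (ten r v) (ten s w) g = s • lp z (f * X.in1 g * X.in1 r) v w := by
  change (brAux z (f * X.in1 g) (r ⊗ₜ v)).liftBaseChange X.R (s ⊗ₜ w) = _
  rw [liftBaseChange_tmul]; rfl

theorem br_add_right (f : X.K) (a b b' : Mdl F z) (g : X.R) :
    br z f a (b + b') g = br z f a b g + br z f a b' g := map_add (liftBaseChange X.R _) _ _

theorem br_ten_right (f : X.K) (a : Mdl F z) (s : X.R) (w : F.Fock) (g : X.R) :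
    br z f a (ten s w) g = s • brAux z (f * X.in1 g) a w := by
  change (brAux z (f * X.in1 g) a).liftBaseChange X.R (s ⊗ₜ w) = _
  rw [liftBaseChange_tmul]

theorem br_add_left (f : X.K) (a a' b : Mdl F z) (g : X.R) :
    br z f (a + a') b g = br z f a b g + br z f a' b g := by
  induction b using induction with
  | ten s w =>
    have : brAux z (f * X.in1 g) (a + a') = brAux z (f * X.in1 g) a + brAux z (f * X.in1 g) a' := map_add ..
    rw [br_ten_right, br_ten_right, br_ten_right, this, LinearMap.add_apply, smul_add]
  | add b b' h hb => rw [br_add_right, br_add_right, br_add_right, h, hb]; abel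

/-- To prove an identity between biadditive functions it suffices to consider pure tensors. -/
theorem induction₂ {p : Mdl F z → Mdl F z → Prop} (ten : ∀ r v s w, p (ten r v) (ten s w))
    (left : ∀ a a' b, p a b → p a' b → p (a + a') b) (right : ∀ a b b', p a b → p a b' → p a (b + b'))
    (a b : Mdl F z) : p a b := by
  induction a using induction with
  | ten r v =>
    induction b using induction with
    | ten s w => exact ten r v s w
    | add b b' h h' => exact right _ _ _ h h'
  | add a a' h h' => exact left _ _ _ h h'

theorem br_add (f f' : X.K) (a b : Mdl F z) (g : X.R) :
    br z (f + f') a b g = br z f a b g + br z f' a b g := by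
  induction a, b using induction₂ with
  | ten r v s w => rw [br_ten, br_ten, br_ten, add_mul, add_mul, lp_add, smul_add]
  | left a a' b h h' => rw [br_add_left, br_add_left, br_add_left, h, h']; abel
  | right a b b' h h' => rw [br_add_right, br_add_right, br_add_right, h, h']; abel

theorem br_left (f : X.K) (r : X.R) (a b : Mdl F z) (g : X.R) :
    br z f (r • a) b g = br z (f * X.in1 r) a b g := by
  induction a, b using induction₂ with
  | ten r' v s w =>
    rw [smul_ten, br_ten, br_ten, map_mul]
    congr 2; ring
  | left a a' b h h' => rw [smul_add, br_add_left, br_add_left, h, h']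
  | right a b b' h h' => rw [br_add_right, br_add_right, h, h']

theorem br_smul_right (f : X.K) (r : X.R) (a b : Mdl F z) (g : X.R) :
    br z f a (r • b) g = r • br z f a b g := map_smul (liftBaseChange X.R _) _ _

theorem br_fn2 (f : X.K) (s : X.R) (a b : Mdl F z) (g : X.R) :
    br z (f * X.in2 s) a b g = s • br z f a b g := by
  induction a, b using induction₂ with
  | ten r v s' w =>
    rw [br_ten, br_ten, smul_comm s s', ← lp_in2 _ s, mul_right_comm f, mul_right_comm (f * X.in1 g)]
  | left a a' b h h' => rw [br_add_left, br_add_left, h, h', smul_add]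
  | right a b b' h h' => rw [br_add_right, br_add_right, h, h', smul_add]

theorem br_fn1 (f : X.K) (r : X.R) (a b : Mdl F z) (g : X.R) :
    br z (f * X.in1 r) a b g = br z f a b (r * g) := by
  rw [br, br, map_mul, mul_assoc]

theorem br_neg_left (f : X.K) (a b : Mdl F z) (g : X.R) : br z f (-a) b g = - br z f a b g :=
  (mk' (fun a => br z f a b g) fun a a' => br_add_left f a a' b g).map_neg a

theorem br_neg_right (f : X.K) (a b : Mdl F z) (g : X.R) : br z f a (-b) g = - br z f a b g :=
  map_neg (liftBaseChange X.R _) _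

/-- The bracket as an additive function of the section of `K`. -/
def brK (a b : Mdl F z) (g : X.R) : X.K →+ Mdl F z :=
  mk' (fun f => br z f a b g) fun f f' => br_add f f' a b g

theorem isFin_br (a b : Mdl F z) (g : X.R) : IsFin fun f => br z f a b g := by
  induction a, b using induction₂ with
  | ten r v s w =>
    simp only [br_ten]
    refine IsFin.map ?_ (fun x => s • x) (smul_zero s)
    have := (isFin_lp (z := z) v w).mul_left (X.in1 g * X.in1 r)
    simpa only [mul_comm (X.in1 g * X.in1 r), mul_assoc] using this
  | left a a' b h h' => simp only [br_add_left]; exact h.add h'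
  | right a b b' h h' => simp only [br_add_right]; exact h.add h'

theorem lp_zsmul (n : ℤ) (f : X.K) (v w : F.Fock) : lp z (n • f) v w = n • lp z f v w :=
  map_zsmul (lpK v w) n f

theorem lp_neg (f : X.K) (v w : F.Fock) : lp z (-f) v w = - lp z f v w := map_neg (lpK v w) f

theorem lp_sub (f f' : X.K) (v w : F.Fock) : lp z (f - f') v w = lp z f v w - lp z f' v w :=
  map_sub (lpK v w) f f'

theorem lp_vec1 (f : X.K) (v w : F.Fock) : lp z (X.vec1 (ddz z) f) v w = - lp z f (F.trans v) w := by
  rw [← sub_eq_zero, sub_neg_eq_add]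
  have h1 : IsFin fun f => lp z (X.vec1 (ddz z) f) v w := IsFin.extDer (B := lpK v w) (isFin_lp v w) _
  refine eq_zero_of_isFin z (mk' (fun f => lp z (X.vec1 (ddz z) f) v w + lp z f (F.trans v) w)
    fun f f' => by rw [map_add, lp_add, lp_add]; abel) (h1.add (isFin_lp _ _)) (fun c n => ?_) f
  change lp z (X.vec1 _ _) v w + lp z _ _ _ = 0
  rw [leibniz, vec1_in2, smul_zero, add_zero, smul_eq_mul, mul_comm, vec1_dk, lp_in2, mul_comm, lp_in2,
    lp_dk, F.md_trans, ten_zsmul, lp_zsmul, lp_dk, neg_smul, smul_neg, add_neg_cancel]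

theorem der_lp (f : X.K) (v w : F.Fock) :
    der F z (lp z f v w) = lp z f v (F.trans w) + lp z (X.vec2 (ddz z) f) v w := by
  rw [← sub_eq_zero]
  have h1 : IsFin fun f => lp z (X.vec2 (ddz z) f) v w := IsFin.extDer (B := lpK v w) (isFin_lp v w) _
  have h2 : IsFin fun f => der F z (lp z f v w) := (isFin_lp v w).map _ (map_zero _)
  refine eq_zero_of_isFin z (mk' (fun f => der F z (lp z f v w) -
    (lp z f v (F.trans w) + lp z (X.vec2 (ddz z) f) v w)) fun f f' => by
      rw [map_add, lp_add, lp_add, lp_add, map_add]; abel) (h2.sub ((isFin_lp _ _).add h1)) (fun c n => ?_) f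
  change der F z (lp z _ v w) - (lp z _ _ _ + lp z (X.vec2 _ _) _ _) = 0
  rw [leibniz, vec2_in2, vec2_dk, smul_eq_mul, smul_eq_mul, lp_add, mul_comm, mul_comm (X.in2 c) (-_),
    lp_in2, lp_in2, lp_in2, lp_in2, der_smul, lp_dk, lp_dk, der_ten, lp_neg, lp_zsmul, lp_dk, F.trans_md,
    F.md_trans, ten_add_right, ten_zsmul, Derivation.map_one_eq_zero]
  have : (ten 0 (F.md n v w) : Mdl F z) = 0 := by rw [ten_eq, zero_smul]
  rw [this]
  module

theorem vec1_eq (z : X.Coord) (ξ : X.Th) (f : X.K) : X.vec1 ξ f = X.in1 (ξ z) * X.vec1 (ddz z) f := by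
  conv_lhs => rw [vec_eq z ξ]
  rw [← act1_vec, vec_smul, map_mul, End.mul_apply, act1_fn, act1_vec]

theorem vec2_eq (z : X.Coord) (ξ : X.Th) (f : X.K) : X.vec2 ξ f = X.in2 (ξ z) * X.vec2 (ddz z) f := by
  conv_lhs => rw [vec_eq z ξ]
  rw [← act2_vec, vec_smul, map_mul, End.mul_apply, act2_fn, act2_vec]

theorem br_vec1 (f : X.K) (ξ : X.Th) (a b : Mdl F z) (g : X.R) :
    br z f (a <• X.vec ξ) b g - br z (X.vec1 ξ f) a b g = br z f a b (ξ g) := by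
  induction a, b using induction₂ with
  | ten r v s w =>
    rw [act_vec, br_neg_left, smul_ten, der_ten, br_add_left, br_ten, br_ten, br_ten, br_ten, ← smul_add,
      ← smul_neg, ← smul_sub, neg_add, ← lp_vec1, vec1_eq z ξ f, vec_apply_eq z ξ g,
      leibniz (X.vec1 (ddz z)), leibniz (X.vec1 (ddz z)), vec1_in1, vec1_in1, ← lp_neg,
      ← lp_add, ← lp_sub]
    congr 2
    simp only [smul_eq_mul, map_mul]
    ring
  | left a a' b h h' =>
    rw [smul_add, br_add_left, br_add_left, br_add_left, ← h, ← h']; abel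
  | right a b b' h h' =>
    rw [br_add_right, br_add_right, br_add_right, ← h, ← h']; abel

theorem br_vec2 (f : X.K) (ξ : X.Th) (a b : Mdl F z) (g : X.R) :
    br z f a (b <• X.vec ξ) g - br z (X.vec2 ξ f) a b g = br z f a b g <• X.vec ξ := by
  induction a, b using induction₂ with
  | ten r v s w =>
    rw [act_vec, act_vec, br_neg_right, smul_ten, der_ten, br_add_right, br_ten, br_ten, br_ten, br_ten, smul_smul,
      der_smul, der_lp, vec2_eq z ξ f, leibniz (X.vec2 (ddz z)), leibniz (X.vec2 (ddz z)),
      vec2_in1, vec2_in1, smul_zero, zero_add, smul_zero, zero_add, smul_eq_mul (X.in1 r), smul_eq_mul (X.in1 g)]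
    have : X.in2 (ξ z) * X.vec2 (ddz z) f * X.in1 g * X.in1 r =
        X.in1 r * (X.in1 g * X.vec2 (ddz z) f) * X.in2 (ξ z) := by ring
    rw [this, lp_in2]
    module
  | left a a' b h h' =>
    rw [br_add_left, br_add_left, br_add_left, smul_add, ← h, ← h']; abel
  | right a b b' h h' =>
    rw [smul_add, br_add_right, br_add_right, br_add_right, smul_add, ← h, ← h']; abel

end Mdl

namespace Fam

variable {X : Fam}

theorem list_sum_range {M : Type} [AddCommMonoid M] (φ : ℕ → M) (N : ℕ) :
    ((List.range N).map φ).sum = ∑ i ∈ range N, φ i := by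
  induction N with
  | zero => simp
  | succ N ih => rw [List.range_succ, List.map_append, List.sum_append, ih, sum_range_succ]; simp

theorem diag_taylor_mem (z : X.Coord) (g : X.R) (N : ℕ) :
    g ⊗ₜ 1 - ∑ i ∈ range N, (1 ⊗ₜ tc z i g) * X.diag z ^ i ∈ X.idl ^ N := by
  obtain ⟨c, hc⟩ := exists_taylor z (g ⊗ₜ[X.k] (1 : X.R)) N
  have h (i : ℕ) (hi : i < N) : tc z i g = c i := by
    have h1 := PowerSeries.X_pow_dvd_iff.1 (X_pow_dvd_tauR z hc) i hi
    rw [map_sub, tauR_tmul, map_one, mul_one, map_sub, coeff_taylor, sub_eq_zero] at h1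
    rw [h1, map_sum, map_sum, Finset.sum_eq_single i]
    · rw [map_mul, map_pow, tauR_diag, tauR_tmul, map_one, one_mul, coeff_C_mul,
        PowerSeries.coeff_X_pow_self, mul_one]
    · intro j _ hj
      rw [map_mul, map_pow, tauR_diag, tauR_tmul, map_one, one_mul, coeff_C_mul,
        PowerSeries.coeff_X_pow, if_neg hj.symm, mul_zero]
    · intro h; exact absurd (Finset.mem_range.2 hi) h
  rwa [sum_congr rfl fun i hi => by rw [h i (Finset.mem_range.1 hi)]]

end Fam

namespace Mdl

variable {F : FieldData} {X : Fam} {z : X.Coord}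

theorem br_delta (f : X.K) (a b : Mdl F z) : ∃ l : List (X.DO × Mdl F z), ∀ g, br z f a b g = expand X l g := by
  obtain ⟨N, hN⟩ := isFin_br a b 1 f
  beta_reduce at hN
  refine ⟨(List.range N).map fun i => (dop z i,
    X.scal ((i.factorial : ℂ)⁻¹) • br z (δ[z,i] * f) a b 1), fun g => ?_⟩
  have h1 : br z f a b g = br z (f * X.in1 g) a b 1 := by rw [br_fn1, mul_one]
  have h2 := hN _ (diag_taylor_mem z g N)
  have h3 : algebraMap X.RR X.K (g ⊗ₜ 1 - ∑ i ∈ range N, (1 ⊗ₜ tc z i g) * X.diag z ^ i) * f =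
      f * X.in1 g - ∑ i ∈ range N, (δ[z,i] * f) * X.in2 (tc z i g) := by
    rw [map_sub, sub_mul, map_sum, Finset.sum_mul]
    congr 1
    · rw [in1_apply, mul_comm]
    · refine sum_congr rfl fun i _ => ?_
      rw [map_mul, ← dk_natCast, in2_apply]; ring
  rw [h3] at h2
  have h4 : br z (f * X.in1 g) a b 1 = br z (∑ i ∈ range N, (δ[z,i] * f) *
      X.in2 (tc z i g)) a b 1 := sub_eq_zero.1 (((brK a b 1).map_sub _ _).symm.trans h2)
  rw [h1, h4, expand, map_map]
  refine ((map_sum (brK a b 1) _ _).trans ?_)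
  rw [list_sum_range]
  refine sum_congr rfl fun i _ => ?_
  change br z _ a b 1 = X.actR (dop z i) g • X.scal _ • br z _ a b 1
  rw [br_fn2, smul_smul, actR_dop, tc, smul_def, mul_comm, X.scal_eq]

/-- The linearity properties of the bracket. -/
theorem isPre : IsPre (br z : X.K → Mdl F z → Mdl F z → X.R → Mdl F z) where
  fn_act f a := act_fn a f
  delta := br_delta
  add := br_add
  add_left := br_add_left
  add_right := br_add_right
  left := br_left
  right f s a b g := by rw [br_smul_right, br_fn2]
  fn1 := br_fn1
  fn2 := br_fn2
  vec1 := br_vec1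
  vec2 := br_vec2

theorem mode_ten (n : ℤ) (v w : F.Fock) : br z δ[z,n] (ten 1 v) (ten 1 w) 1 = ten 1 (F.md n v w) := by
  rw [br_ten, map_one, mul_one, mul_one, lp_dk, one_smul]

/-! ### Parity -/

variable (F z) in
/-- The parity operator. -/
def par : Mdl F z →ₗ[X.R] Mdl F z :=
  TensorProduct.AlgebraTensorModule.map (LinearMap.id : X.R →ₗ[X.R] X.R) F.theta.toLinearMap

theorem par_ten (r : X.R) (v : F.Fock) : par F z (ten r v) = ten r (F.theta v) := rfl

theorem par_par (a : Mdl F z) : par F z (par F z a) = a := by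
  induction a using induction with
  | ten r v => rw [par_ten, par_ten, F.theta_theta]
  | add a b ha hb => rw [map_add, map_add, ha, hb]

theorem par_der (a : Mdl F z) : par F z (der F z a) = der F z (par F z a) := by
  induction a using induction with
  | ten r v => rw [par_ten, der_ten, der_ten, map_add, par_ten, par_ten, F.theta_trans]
  | add a b ha hb => rw [map_add, map_add, ha, hb, map_add, map_add]

theorem par_act (a : Mdl F z) (P : X.DO) : par F z (a <• P) = par F z a <• P := by
  induction P using DO_induction generalizing a with
  | fn f => rw [act_fn, act_fn, map_smul]
  | vec ξ => rw [act_vec, act_vec, map_neg, par_der, map_smul]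
  | add P Q hP hQ => rw [op_add, add_smul, map_add, hP, hQ, add_smul]
  | mul P Q hP hQ => rw [op_mul, mul_smul, hQ, hP, mul_smul]

theorem par_lp (f : X.K) (v w : F.Fock) : par F z (lp z f v w) = lp z f (F.theta v) (F.theta w) := by
  rw [lp, ← lpair_map _ (evZ_ten v w)]
  simp only [par_ten, F.theta_md]; rfl

theorem par_br (f : X.K) (a b : Mdl F z) (g : X.R) :
    par F z (br z f a b g) = br z f (par F z a) (par F z b) g := by
  induction a, b using induction₂ with
  | ten r v s w => rw [br_ten, map_smul, par_lp, par_ten, par_ten, br_ten]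
  | left a a' b h h' => rw [map_add, br_add_left, br_add_left, map_add, h, h']
  | right a b b' h hb => rw [map_add, br_add_right, br_add_right, map_add, h, hb]

/-- The sign `(-1)ⁱ`. -/
def psg (i : ZMod 2) : ℤ := (-1) ^ i.val

theorem psg_zero : psg 0 = 1 := rfl
theorem psg_one : psg 1 = -1 := rfl
theorem psg_add (i j : ZMod 2) : psg (i + j) = psg i * psg j := by revert i j; decide

variable (F z) in
/-- The parity decomposition. -/
def parSub (i : ZMod 2) : Submodule X.DOᵐᵒᵖ (Mdl F z) where
  carrier := {a | par F z a = psg i • a}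
  add_mem' {a b} ha hb := by
    rw [Set.mem_ofPred_eq] at *
    rw [map_add, ha, hb, smul_add]
  zero_mem' := by simp
  smul_mem' P a ha := by
    induction P using MulOpposite.rec' with
    | _ P =>
      rw [Set.mem_ofPred_eq] at *
      rw [par_act, ha]
      exact smul_comm ..

theorem mem_parSub {i : ZMod 2} {a : Mdl F z} : a ∈ parSub F z i ↔ par F z a = psg i • a := Iff.rfl

/-- The even part. -/
def ev : Mdl F z →ₗ[X.R] Mdl F z := X.scal 2⁻¹ • (LinearMap.id + par F z)

/-- The odd part. -/
def od : Mdl F z →ₗ[X.R] Mdl F z := X.scal 2⁻¹ • (LinearMap.id - par F z)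

theorem ev_apply (a : Mdl F z) : ev a = X.scal 2⁻¹ • (a + par F z a) := rfl
theorem od_apply (a : Mdl F z) : od a = X.scal 2⁻¹ • (a - par F z a) := rfl

theorem scal_half (a : Mdl F z) : X.scal 2⁻¹ • (a + a) = a := by
  rw [X.scal_eq, algebraMap_smul]
  module

theorem ev_add_od (a : Mdl F z) : ev a + od a = a := by
  rw [ev_apply, od_apply, ← smul_add]
  conv_rhs => rw [← scal_half a]
  congr 1; abel

theorem ev_ten (r : X.R) (v : F.Fock) : ev (ten r v : Mdl F z) = ten r (F.ev v) := by
  rw [ev_apply, FieldData.ev, ten_smul, par_ten, ten_add_right, X.scal_eq, algebraMap_smul]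

theorem od_ten (r : X.R) (v : F.Fock) : od (ten r v : Mdl F z) = ten r (F.od v) := by
  rw [od_apply, FieldData.od, ten_smul, par_ten, ten_sub, X.scal_eq, algebraMap_smul]

theorem ev_mem (a : Mdl F z) : ev a ∈ parSub F z 0 := by
  rw [mem_parSub, psg_zero, one_smul, ev_apply, map_smul, map_add, par_par, add_comm]

theorem od_mem (a : Mdl F z) : od a ∈ parSub F z 1 := by
  rw [mem_parSub, psg_one, od_apply, map_smul, map_sub, par_par, neg_smul, one_smul, ← smul_neg, neg_sub]

theorem isInternal_parSub : DirectSum.IsInternal (parSub F z) := by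
  rw [DirectSum.isInternal_submodule_iff_isCompl (i := 0) (j := 1) _ (by decide) (by
    ext x; simp only [Set.mem_univ, Set.mem_insert_iff, Set.mem_singleton_iff, true_iff]; revert x; decide)]
  refine IsCompl.of_eq ?_ ?_
  · rw [Submodule.eq_bot_iff]
    rintro a ⟨h0, h1⟩
    have h0 : par F z a = psg 0 • a := h0
    have h1 : par F z a = psg 1 • a := h1
    rw [psg_zero, one_smul] at h0
    rw [psg_one, h0, neg_smul, one_smul] at h1
    rw [← scal_half a]
    nth_rewrite 1 [h1]
    rw [neg_add_cancel, smul_zero]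
  · rw [Submodule.eq_top_iff']
    intro a
    rw [← ev_add_od a]
    exact Submodule.add_mem_sup (ev_mem a) (od_mem a)

/-! ### The unit -/

variable (F z) in
/-- The unit `r dz ↦ r ⊗ 1`. -/
def unit : X.Om →ₗ[X.R] Mdl F z :=
  (LinearMap.toSpanSingleton X.R (Mdl F z) (ten 1 1)) ∘ₗ (omEquiv z).symm.toLinearMap

theorem unit_smul_d (r : X.R) : unit F z (r • X.d z) = ten r 1 := by
  rw [← omEquiv_apply]
  simp [unit, smul_ten]

theorem exists_om (z : X.Coord) (ω : X.Om) : ∃ r : X.R, ω = r • X.d z :=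
  ⟨(omEquiv z).symm ω, by rw [← omEquiv_apply, LinearEquiv.apply_symm_apply]⟩

theorem unit_act (ω : X.Om) (P : X.DO) : unit F z (ω <• P) = unit F z ω <• P := by
  induction P using DO_induction generalizing ω with
  | fn f => rw [om_fn, act_fn, map_smul]
  | vec ξ =>
    obtain ⟨r, rfl⟩ := exists_om z ω
    rw [om_vec, lift_smul_d, act_vec, unit_smul_d, smul_ten, der_ten, F.trans_one, ten_zero, add_zero, d_eq z,
      map_neg, unit_smul_d, mul_comm]
  | add P Q hP hQ => rw [op_add, add_smul, map_add, hP, hQ, add_smul]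
  | mul P Q hP hQ => rw [op_mul, mul_smul, hQ, hP, mul_smul]

theorem lp_one (f : X.K) (w : F.Fock) : lp z f 1 w = (tau z f).coeff (-1) • ten 1 w := by
  rw [lp, lpair, finsum_eq_single _ (-1)]
  · rw [F.md_one_left, if_pos rfl]
  · intro n hn
    rw [F.md_one_left, if_neg hn, ten_zero, smul_zero]

theorem br_unit_reg (p : X.RR) (ω : X.Om) (a : Mdl F z) (g : X.R) :
    br z (algebraMap X.RR X.K p) (unit F z ω) a g = 0 := by
  obtain ⟨r, rfl⟩ := exists_om z ω
  rw [unit_smul_d]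
  induction a using induction with
  | ten s w =>
    rw [br_ten, lp_one, in1_apply, in1_apply, ← map_mul, ← map_mul, tau_algebraMap,
      coeff_ofPowerSeries_of_neg _ (by norm_num), zero_smul, smul_zero]
  | add a b ha hb => rw [br_add_right, ha, hb, add_zero]

theorem pole_one (w : X.Coord) : X.pole w 1 * dk w = 1 := by
  rw [pole, dk_val, ← Localization.mk_one_eq_algebraMap, Localization.mk_mul, one_mul, mul_one]
  exact Localization.mk_self (⟨X.diag w, X.diag_mem w⟩ : X.W)

theorem coeff_tau_pole (w : X.Coord) (q : X.RR) :
    (tau z (X.pole w 1 * algebraMap X.RR X.K q)).coeff (-1) =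
      ((jac z w)⁻¹ : X.Rˣ) * lmul' X.k q := by
  have h0 : PowerSeries.X ∣ tauR z (X.diag w) := by
    have := X_pow_dvd_tauR z (N := 1) (q := X.diag w) (by rw [pow_one]; exact diag_mem_idl _)
    rwa [pow_one] at this
  obtain ⟨U, hU⟩ := h0
  have hU0 : constantCoeff U = jac z w := by
    have h1 : coeff 1 (tauR z (X.diag w)) = constantCoeff U := by
      rw [hU, coeff_succ_X_mul, PowerSeries.coeff_zero_eq_constantCoeff]
    rw [← h1, diag, map_sub, tauR_tmul, tauR_tmul, map_one, map_one, mul_one, one_mul, map_sub, coeff_taylor, tc_one,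
      coeff_C, if_neg one_ne_zero, sub_zero]
    rfl
  obtain ⟨V, hV⟩ : ∃ V, U * V = 1 := by
    have : IsUnit U := by rw [isUnit_iff_constantCoeff, hU0]; exact Units.isUnit _
    exact this.exists_right_inv
  have hV0 : constantCoeff V = ((jac z w)⁻¹ : X.Rˣ) := by
    have := congrArg constantCoeff hV
    rw [map_mul, hU0, map_one] at this
    exact (Units.eq_inv_of_mul_eq_one_left this)
  have h2 : tau z (X.pole w 1) = single (-1 : ℤ) 1 * ofPowerSeries ℤ X.R V := by
    have h3 := congrArg (tau z) (pole_one w)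
    rw [map_mul, dk_val, tau_algebraMap, hU, map_mul, ofPowerSeries_X, map_one (tau z)] at h3
    calc tau z (X.pole w 1) = tau z (X.pole w 1) * ((single (-1 : ℤ) 1 * single (1 : ℤ) 1) *
          ofPowerSeries ℤ X.R (U * V)) := by
          rw [hV, map_one (ofPowerSeries ℤ X.R), mul_one, single_mul_single, neg_add_cancel, mul_one]
          exact (mul_one _).symm
      _ = (tau z (X.pole w 1) * (single (1 : ℤ) 1 * ofPowerSeries ℤ X.R U)) *
          (single (-1 : ℤ) 1 * ofPowerSeries ℤ X.R V) := by rw [map_mul]; ring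
      _ = _ := by rw [h3, one_mul]
  rw [map_mul, h2, tau_algebraMap, mul_assoc, ← map_mul, ← constantCoeff_tauR z, ← hV0, ← map_mul]
  rw [HahnSeries.coeff_single_mul (r := (1 : X.R)), one_mul, sub_self]
  exact (coeff_ofPowerSeries_natCast _ 0).trans (coeff_zero_eq_constantCoeff_apply _)

theorem br_unit_pole (w : X.Coord) (a : Mdl F z) (g : X.R) : br z (X.pole w 1) (unit F z (X.d w)) a g = g • a := by
  rw [d_jac z w, unit_smul_d]
  induction a using induction with
  | ten s v =>
    rw [br_ten, lp_one, mul_assoc, in1_apply, in1_apply, ← map_mul, coeff_tau_pole, smul_ten, smul_ten, smul_ten]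
    congr 1
    simp only [tmul_mul_tmul, Algebra.TensorProduct.lmul'_apply_tmul, mul_one]
    rw [mul_comm g, Units.inv_mul_cancel_left, mul_comm]
  | add a b ha hb => rw [br_add_right, ha, hb, smul_add]

end Mdl

namespace FieldData

variable (F : FieldData)

theorem md_eq_sm (n : ℤ) (a b : F.Fock) :
    F.md n a b = -(sg n • bsum (-1) fun j => F.tpow j (F.sm (n + j) b a)) := by
  have h1 : F.md n a b = F.sm n a (F.ev b) + F.sm n (F.theta a) (F.od b) := by
    have e1 : F.ev (F.ev b) = F.ev b := by rw [ev, theta_ev]; module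
    have e2 : F.od (F.ev b) = 0 := by rw [od, theta_ev]; module
    have e3 : F.ev (F.od b) = 0 := by rw [ev, theta_od]; module
    have e4 : F.od (F.od b) = F.od b := by rw [od, theta_od]; module
    rw [sm, sm, e1, e2, e3, e4, theta_theta, map_zero, add_zero, zero_add, ← map_add, ev_add_od]
  rw [h1, sm_eq, sm_eq, ← neg_add, ← smul_add, ← bsum_add (F.evZero_tpow_md ..) (F.evZero_tpow_md ..)]
  congr 2
  refine bsum_congr _ fun j => ?_
  rw [← map_add]
  congr 1
  have hb : F.theta b = F.ev b - F.od b := by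
    conv_lhs => rw [← F.ev_add_od b, map_add, theta_ev, theta_od]
    abel
  have ha : F.theta a = F.ev a - F.od a := by
    conv_lhs => rw [← F.ev_add_od a, map_add, theta_ev, theta_od]
    abel
  have e1 : F.md (n + j) (F.ev b) a = F.md (n + j) (F.ev b) (F.ev a) + F.md (n + j) (F.ev b) (F.od a) := by
    rw [← map_add, ev_add_od]
  have e2 : F.md (n + j) b (F.ev a) = F.md (n + j) (F.ev b) (F.ev a) + F.md (n + j) (F.od b) (F.ev a) := by
    rw [← LinearMap.add_apply, ← map_add, ev_add_od]
  rw [sm, ha, hb, e1, e2, map_sub, map_sub, LinearMap.sub_apply]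
  abel

end FieldData

namespace Mdl

variable {F : FieldData} {X : Fam} {z : X.Coord}

theorem ten_one_act (w : F.Fock) : (ten 1 w : Mdl F z) <• X.vec (ddz z) = - ten 1 (F.trans w) := by
  rw [act_vec, ddz_self, one_smul, der_ten, Derivation.map_one_eq_zero]
  have : (ten 0 w : Mdl F z) = 0 := by rw [ten_eq, zero_smul]
  rw [this, zero_add]

theorem ten_one_dop (t : ℕ) (w : F.Fock) : (ten 1 w : Mdl F z) <• dop z t = sg t • ten 1 ((F.trans ^ t) w) := by
  induction t generalizing w with
  | zero => rw [dop_zero]; simp [sg]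
  | succ t ih =>
    have h2 : sg ((t + 1 : ℕ) : ℤ) = - sg t := by push_cast; exact sg_succ _
    rw [dop_succ, op_mul, mul_smul, ten_one_act, smul_neg, ih, h2, neg_smul, pow_succ, End.mul_apply]

theorem tr_ten (n : ℤ) (w v : F.Fock) : isPre.tr z (ten 1 w : Mdl F z) (ten 1 v) (X.swap δ[z,n]) 1 =
    sg n • ten 1 (bsum (-1) fun t => F.tpow t (F.md (n + t) w v)) := by
  rw [IsPre.tr_swap_dk, ← tenL_apply 1 (bsum _ _), ← bsum_linearMap (F.evZero_tpow_md ..)]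
  congr 1
  refine finsum_congr fun t => ?_
  beta_reduce
  rw [mode_ten, FieldData.choose_neg_one, tenL_apply, X.scal_eq, algebraMap_smul, ← ten_smul, ten_one_dop, map_smul]
  rfl

theorem skew_aux (v w : F.Fock) (f : X.K) : br z f (ten 1 v) (ten 1 w) 1 +
    (isPre.tr z (ten 1 w : Mdl F z) (ev (ten 1 v)) (X.swap f) 1 + isPre.tr z (par F z (ten 1 w)) (od (ten 1 v)) (X.swap f) 1) =
      0 := by
  have h1 (x y : Mdl F z) : IsFin fun f => isPre.tr z x y (X.swap f) 1 := (isPre.isFin_tr z x y 1).swap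
  refine eq_zero_of_isFin z (mk' (fun f => br z f (ten 1 v) (ten 1 w) 1 +
    (isPre.tr z (ten 1 w : Mdl F z) (ev (ten 1 v)) (X.swap f) 1 + isPre.tr z (par F z (ten 1 w)) (od (ten 1 v)) (X.swap f) 1))
    fun f f' => by rw [map_add, br_add, isPre.tr_add, isPre.tr_add]; abel)
    ((isFin_br (ten 1 v) (ten 1 w) 1).add ((h1 _ _).add (h1 _ _))) (fun c n => ?_) f
  rw [AddMonoidHom.mk'_apply, mul_comm, br_fn2, map_mul, swap_in2, isPre.tr_in1, isPre.tr_in1, ← smul_add, ← smul_add,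
    ev_ten, od_ten, par_ten, tr_ten, tr_ten, mode_ten, F.md_eq_sm, ← smul_add, ← ten_add_right, ten_neg, ten_zsmul,
    ← bsum_add]
  · simp only [← map_add]
    rw [show (fun j : ℕ => F.tpow j (F.sm (n + j) w v)) = fun j : ℕ => F.tpow j (F.md (n + j) w (F.ev v) +
      F.md (n + j) (F.theta w) (F.od v)) from rfl, neg_add_cancel, smul_zero]
  · exact F.evZero_tpow_md ..
  · exact F.evZero_tpow_md ..

/-- Skew symmetry. -/
theorem br_eq_tr (f : X.K) (a b : Mdl F z) (g : X.R) : br z f a b g =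
    -(isPre.tr z b (ev a) (X.swap f) g + isPre.tr z (par F z b) (od a) (X.swap f) g) := by
  rw [eq_neg_iff_add_eq_zero]
  suffices h : ∀ f, br z f a b 1 + (isPre.tr z b (ev a) (X.swap f) 1 +
      isPre.tr z (par F z b) (od a) (X.swap f) 1) = 0 by
    have := h (f * X.in1 g)
    rwa [br_fn1, mul_one, map_mul, swap_in1, isPre.tr_in2, isPre.tr_in2, mul_one] at this
  clear f g
  induction a using induction_smul with
  | ten v =>
    induction b using induction_smul with
    | ten w => exact skew_aux v w
    | add b b' h h' =>
      intro f
      rw [br_add_right, map_add, isPre.tr_add_left, isPre.tr_add_left]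
      linear_combination (norm := abel) h f + h' f
    | smul s b h =>
      intro f
      have := h (f * X.in2 s)
      rwa [br_fn2, ← br_smul_right, map_mul, swap_in2, ← isPre.tr_smul_left, ← isPre.tr_smul_left, ← map_smul] at this
  | add a a' h h' =>
    intro f
    rw [br_add_left, map_add, map_add, isPre.tr_add_right, isPre.tr_add_right]
    linear_combination (norm := abel) h f + h' f
  | smul r a h =>
    intro f
    have := h (f * X.in1 r)
    rwa [← br_left, map_mul, swap_in1, ← isPre.tr_smul_right, ← isPre.tr_smul_right, ← map_smul, ← map_smul] at this

theorem eq_zero_of_isTri {G : Mdl F z → Mdl F z → Mdl F z → X.K → X.K → X.K → Mdl F z} (H : IsTri G)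
    (h : ∀ v w u (n m k : ℤ),
      G (ten 1 v) (ten 1 w) (ten 1 u) δ[z,n] δ[z,m] δ[z,k] = 0)
    (a b c : Mdl F z) (f g k : X.K) : G a b c f g k = 0 := by
  induction a using induction_smul generalizing f g k with
  | ten v =>
    induction b using induction_smul generalizing f g k with
    | ten w =>
      induction c using induction_smul generalizing f g k with
      | ten u => exact H.eq_zero z (h v w u) f g k
      | add c c' h h' => rw [H.add_right, h, h', add_zero]
      | smul s c h => rw [H.smul_right, h, smul_zero]
    | add b b' h h' => rw [H.add_mid, h, h', add_zero]
    | smul s b h => rw [H.smul_mid, h]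
  | add a a' h h' => rw [H.add_left, h, h', add_zero]
  | smul s a h => rw [H.smul_left, h]

/-- The Jacobi identity. -/
theorem jac_eq (a b c : Mdl F z) (f g h : X.K) : isPre.jac₁ z a b c f g h = isPre.jac₂ z a b c f g h -
    (isPre.jac₃ z (ev a) b c f g h + isPre.jac₃ z (od a) (par F z b) c f g h) := by
  rw [← sub_sub, ← sub_eq_zero]
  refine eq_zero_of_isTri ((isPre.isTri_jac₁ z).sub (((isPre.isTri_jac₂ z).sub ((isPre.isTri_jac₃ z).comp ev .id)).sub
    ((isPre.isTri_jac₃ z).comp od (par F z)))) (fun v w u n m k => ?_) a b c f g h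
  have hz (q : ℕ → ℤ) (m : ℤ) (x y t : F.Fock) : EvZero fun j => sg j • F.md (q j) x (F.md (m + j) y t) :=
    (F.evZero_borR q m x y t).smul _
  rw [ev_ten, od_ten, par_ten, isPre.jac₁_dk, isPre.jac₂_dk, isPre.jac₃_dk, isPre.jac₃_dk]
  simp only [mode_ten, ← ten_zsmul, LinearMap.id_apply]
  simp only [← tenL_apply]
  rw [bsum_linearMap (F.evZero_borL _ n v w u), bsum_linearMap (hz ..), bsum_linearMap, bsum_linearMap,
    bsum_smul (hz ..), bsum_smul (hz ..), sub_sub, ← map_add, ← map_sub, ← map_sub, ← smul_add,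
    ← bsum_add (hz ..) (hz ..)]
  · have := F.defect_eq_zero m n k v w u
    rw [FieldData.defect, FieldData.borL, FieldData.borR, FieldData.borS] at this
    simp only [FieldData.sb, smul_add] at this
    rw [← sub_add, this, map_zero]
  · exact (hz ..).smul _
  · exact (hz ..).smul _

theorem zmod_two (i : ZMod 2) : i = 0 ∨ i = 1 := by revert i; decide

theorem ev_of_mem {i : ZMod 2} {a : Mdl F z} (ha : a ∈ parSub F z i) : ev a = if i = 0 then a else 0 := by
  rw [mem_parSub] at ha
  have hi : i = 0 ∨ i = 1 := zmod_two i
  rcases hi with rfl | rfl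
  · rw [if_pos rfl, ev_apply, ha, psg_zero, one_smul, scal_half]
  · rw [if_neg (by decide), ev_apply, ha, psg_one, neg_smul, one_smul, add_neg_cancel, smul_zero]

theorem od_of_mem {i : ZMod 2} {a : Mdl F z} (ha : a ∈ parSub F z i) : od a = if i = 0 then 0 else a := by
  have h := ev_add_od a
  rw [ev_of_mem ha] at h
  split_ifs at h ⊢ with hi
  · simpa using h
  · simpa using h

theorem sgn_zero (j : ZMod 2) : sgn 0 j = 1 := by revert j; decide
theorem sgn_one (j : ZMod 2) : sgn 1 j = psg j := by revert j; decide

variable (F z) in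
/-- The chiral algebra of the free fields `F`, in terms of the coordinate `z`. -/
abbrev chir : ChirAlg X where
  carrier := Mdl F z
  fn_act f a := act_fn a f
  par := parSub F z
  par_internal := isInternal_parSub
  br := br z
  br_delta := br_delta
  br_add := br_add
  br_add_left := br_add_left
  br_add_right := br_add_right
  br_par i j a ha b hb f g := by
    rw [mem_parSub] at *
    rw [par_br, ha, hb, isPre.zsmul_left, isPre.zsmul_right, smul_smul, psg_add]
  br_left := br_left
  br_right := isPre.right
  br_fn1 := br_fn1
  br_fn2 := br_fn2
  br_vec1 := br_vec1
  br_vec2 := br_vec2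
  antisymm i j a ha b hb f l hl g := by
    have hi : i = 0 ∨ i = 1 := zmod_two i
    rw [br_eq_tr, ← isPre.tr_eq z hl, ev_of_mem ha, od_of_mem ha, mem_parSub.1 hb]
    have hz (x : Mdl F z) : isPre.tr z x 0 (X.swap f) g = 0 :=
      (mk' (fun a => isPre.tr z x a (X.swap f) g) fun a a' => isPre.tr_add_right z x a a' (X.swap f) g).map_zero
    have hm (n : ℤ) (x y : Mdl F z) : isPre.tr z (n • x) y (X.swap f) g = n • isPre.tr z x y (X.swap f) g :=
      map_zsmul (mk' (fun a => isPre.tr z a y (X.swap f) g) fun a a' => isPre.tr_add_left z a a' y (X.swap f) g) n x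
    rcases hi with rfl | rfl
    · rw [if_pos rfl, if_pos rfl, hz, add_zero, sgn_zero, one_smul]
    · rw [if_neg (by decide), if_neg (by decide), hz, zero_add, sgn_one, hm]
  jacobi i j a ha b hb c f g h l₁ l₂ l₃ h₁ h₂ h₃ := by
    have hi : i = 0 ∨ i = 1 := zmod_two i
    rw [← isPre.jac₁_eq z c _ _ h₁, ← isPre.jac₂_eq z a _ _ h₂, ← isPre.jac₃_eq z b _ _ h₃, jac_eq,
      ev_of_mem ha, od_of_mem ha, mem_parSub.1 hb]
    have hz (x : Mdl F z) : isPre.jac₃ z 0 x c f g h = 0 :=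
      (mk' (fun a => isPre.jac₃ z a x c f g h) fun a a' => (isPre.isTri_jac₃ z).add_left a a' x c f g h).map_zero
    have hm (n : ℤ) (y x : Mdl F z) : isPre.jac₃ z y (n • x) c f g h = n • isPre.jac₃ z y x c f g h :=
      map_zsmul (mk' (fun a => isPre.jac₃ z y a c f g h) fun a a' => (isPre.isTri_jac₃ z).add_mid y a a' c f g h) n x
    rcases hi with rfl | rfl
    · rw [if_pos rfl, if_pos rfl, hz, add_zero, sgn_zero, one_smul]
    · rw [if_neg (by decide), if_neg (by decide), hz, zero_add, sgn_one, hm]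
  unit := unit F z
  unit_act := unit_act
  unit_even ω := by
    obtain ⟨r, rfl⟩ := exists_om z ω
    rw [mem_parSub, unit_smul_d, par_ten, map_one, psg_zero, one_smul]
  br_unit_reg := br_unit_reg
  br_unit_pole := br_unit_pole

end Mdl

theorem EvZero.congr {W : Type} [AddCommGroup W] {f g : ℕ → W} (hf : EvZero f) (h : ∀ j, f j = g j) : EvZero g := by
  rwa [← funext h]

namespace ChirAlg

variable {X : Fam} (A : ChirAlg X) (z : X.Coord)

instance : Module ℂ A.carrier := Module.compHom A.carrier (algebraMap ℂ X.R)

instance : IsScalarTower ℂ X.R A.carrier := .of_algebraMap_smul fun _ _ => rfl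

theorem scal_smul (c : ℂ) (a : A.carrier) : X.scal c • a = c • a := rfl

/-- The `n`-th product of `a` and `b` with respect to the coordinate `z`. -/
abbrev mode (n : ℤ) (a b : A.carrier) : A.carrier := A.br δ[z,n] a b 1

/-- The vacuum with respect to the coordinate `z`. -/
abbrev vac : A.carrier := A.unit (X.d z)

theorem act_vec_eq (ξ : X.Th) (a : A.carrier) : a <• X.vec ξ = (ξ z • a) <• X.vec (ddz z) := by
  conv_lhs => rw [vec_eq z ξ]
  rw [vec_smul, op_mul, mul_smul, A.fn_act]

theorem smul_act (ξ : X.Th) (r : X.R) (a : A.carrier) : (r • a) <• X.vec ξ = r • (a <• X.vec ξ) - ξ r • a := by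
  rw [← A.fn_act, ← A.fn_act, ← A.fn_act, smul_smul, smul_smul, ← op_mul, ← op_mul,
    vec_mul_fn, op_add, add_smul, add_sub_cancel_right]

variable {A} (z : X.Coord)

theorem csmul_mem {i : ZMod 2} {a : A.carrier} (ha : a ∈ A.par i) (c : ℂ) : c • a ∈ A.par i := by
  rw [← scal_smul, ← A.fn_act]
  exact (A.par i).smul_mem _ ha

theorem fsmul_mem {i : ZMod 2} {a : A.carrier} (ha : a ∈ A.par i) (c : X.R) : c • a ∈ A.par i := by
  rw [← A.fn_act]
  exact (A.par i).smul_mem _ ha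

theorem vac_mem : A.vac z ∈ A.par 0 := A.unit_even _

theorem vac_act : A.vac z <• X.vec (ddz z) = 0 := by
  rw [← A.unit_act, om_vec]
  have := lift_smul_d z (ddz z) 1
  rw [one_smul] at this
  rw [this, ddz_self, mul_one, Derivation.map_one_eq_zero, neg_zero, map_zero]

theorem zsmul_eq_zero {n : ℤ} (hn : n ≠ 0) {a : A.carrier} (h : n • a = 0) : a = 0 := by
  rw [← cast_smul_eq_zsmul ℂ] at h
  have := congrArg (fun x => (n : ℂ)⁻¹ • x) h
  simpa [smul_smul, hn] using this

theorem mode_vac (n : ℤ) (b : A.carrier) : A.mode z n (A.vac z) b = if n = -1 then b else 0 := by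
  have hneg (r : ℕ) : A.mode z (-1 - r) (A.vac z) b = if r = 0 then b else 0 := by
    induction r with
    | zero =>
      rw [if_pos rfl]
      have : δ[z,(-1 - (0 : ℕ) : ℤ)] = X.pole z 1 := by
        rw [cast_zero, sub_zero, zpow_neg_one]
        exact (Units.inv_eq_of_mul_eq_one_left (Mdl.pole_one z))
      rw [mode, this, A.br_unit_pole, one_smul]
    | succ r ih =>
      have h := A.isPre.mode_act_left z (-1 - r) (A.vac z) b
      rw [vac_act, A.isPre.zero_left] at h
      rw [if_neg (by omega), mode, show (-1 - ((r + 1 : ℕ) : ℤ)) = -1 - r - 1 by push_cast; ring]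
      exact zsmul_eq_zero (by omega) h.symm
  rcases lt_or_ge n 0 with hn | hn
  · obtain ⟨r, rfl⟩ : ∃ r : ℕ, n = -1 - r := ⟨(-1 - n).toNat, by omega⟩
    rw [hneg]
    congr 1
    simp
  · lift n to ℕ using hn
    rw [mode, dk_natCast, A.br_unit_reg, if_neg (by omega)]

theorem sgn_right_zero (i : ZMod 2) : sgn i 0 = 1 := by revert i; decide

theorem mode_vac_right_of_nonneg {z : X.Coord} {n : ℤ} (hn : 0 ≤ n) {i : ZMod 2} {a : A.carrier} (ha : a ∈ A.par i) :
    A.mode z n a (A.vac z) = 0 := by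
  rw [mode, A.skew z ha (vac_mem z), finsum_eq_zero_of_forall_eq_zero, smul_zero, smul_zero, neg_zero]
  intro t
  have h : A.br δ[z,n + t] (A.vac z) a 1 = _ := mode_vac z (n + t) a
  rw [if_neg (by omega)] at h
  rw [h, smul_zero, smul_zero]

theorem mode_neg_one_vac {i : ZMod 2} {a : A.carrier} (ha : a ∈ A.par i) :
    A.mode z (-1) a (A.vac z) = a := by
  rw [mode, A.skew z ha (vac_mem z), finsum_eq_single _ 0]
  · have h : A.br δ[z,-1] (A.vac z) a 1 = _ := mode_vac z (-1) a
    rw [if_pos rfl] at h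
    rw [cast_zero, add_zero, h, sgn_right_zero, dop_zero]
    simp [sg, Fam.scal]
  · intro t ht
    have h : A.br δ[z,-1 + t] (A.vac z) a 1 = _ := mode_vac z (-1 + t) a
    rw [if_neg (by omega)] at h
    rw [h, smul_zero, smul_zero]

theorem csmul_br_left (c : ℂ) (f : X.K) (a b : A.carrier) (g : X.R) : A.br f (c • a) b g = c • A.br f a b g :=
  A.isPre.scal_left f c a b g

theorem csmul_br_right (c : ℂ) (f : X.K) (a b : A.carrier) (g : X.R) : A.br f a (c • b) g = c • A.br f a b g :=
  A.isPre.right_smul f (X.scal c) a b g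

variable (A) in
/-- The `n`-th product with `a` as a linear map. -/
def modeL (n : ℤ) (a : A.carrier) : End ℂ A.carrier where
  toFun b := A.mode z n a b
  map_add' _ _ := A.br_add_right ..
  map_smul' c b := csmul_br_right c _ a b 1

end ChirAlg

/-! ### The universal property of the chiral algebra of free fields -/

/-- Sections with the operator product expansions of the free fields `F`. -/
structure IsFields (F : FieldData) {X : Fam} (A : ChirAlg X) (z : X.Coord) (β : F.I → A.carrier) : Prop where
  par : ∀ i, β i ∈ A.par (F.ord + 1 : ℕ)
  ope : ∀ i j (n : ℕ), A.mode z n (β i) (β j) = if n = F.ord then F.g i j • A.vac z else 0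

theorem FieldData.sgn_eps (F : FieldData) : ((sgn (F.ord + 1 : ℕ) (F.ord + 1 : ℕ) : ℤ) : ℂ) = F.eps := by
  rw [sgn, FieldData.eps, ZMod.val_natCast]
  push_cast
  rw [neg_one_pow_eq_pow_mod_two (R := ℂ) (F.ord + 1)]
  rcases Nat.mod_two_eq_zero_or_one (F.ord + 1) with h | h <;> rw [h]

theorem FieldData.psg_eps (F : FieldData) : ((Mdl.psg (F.ord + 1 : ℕ) : ℤ) : ℂ) = F.eps := by
  rw [Mdl.psg, FieldData.eps, ZMod.val_natCast]
  push_cast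
  exact (neg_one_pow_eq_pow_mod_two _).symm

namespace IsFields

variable {F : FieldData} {X : Fam} {A : ChirAlg X} {z : X.Coord} {β : F.I → A.carrier} (H : IsFields F A z β)

include H

theorem comm (i j : F.I) (m k : ℤ) (c : A.carrier) : A.mode z m (β i) (A.mode z k (β j) c) =
    F.eps • A.mode z k (β j) (A.mode z m (β i) c) + F.contr i j m k • c := by
  have h := A.borcherds z (H.par i) (H.par j) c m 0 k
  rw [bsum_zero, bsum_zero] at h
  have h2 : (bsum m fun t => A.br δ[z,m + k - t] (A.br δ[z,((0 : ℤ) + t)] (β i) (β j) 1) c 1) =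
      F.contr i j m k • c := by
    have h3 (t : ℕ) : A.br δ[z,((0 : ℤ) + t)] (β i) (β j) 1 = if t = F.ord then F.g i j • A.vac z else 0 := by
      rw [zero_add]; exact H.ope i j t
    rw [bsum, finsum_eq_single _ F.ord]
    · have h4 : A.br δ[z,m + k - F.ord] (A.vac z) c 1 = _ :=
        ChirAlg.mode_vac z (m + k - F.ord) c
      rw [h3, if_pos rfl, ChirAlg.csmul_br_left, h4, FieldData.contr]
      have : m + k - F.ord = -1 ↔ m + k + 1 = F.ord := by omega
      simp only [this]
      split_ifs
      · rw [← cast_smul_eq_zsmul ℂ, smul_smul, mul_comm]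
      · simp
    · intro t ht
      rw [h3, if_neg ht, A.isPre.zero_left, smul_zero]
  rw [h2, ← cast_smul_eq_zsmul ℂ (sgn _ _), F.sgn_eps] at h
  simp only [sg_zero, cast_zero, one_smul, add_zero, sub_zero, zero_add] at h
  rw [h]; abel

/-- The action of the algebra of creation operators. -/
def rep : F.Fock →ₐ[ℂ] End ℂ A.carrier :=
  F.lift (fun p => A.modeL z (negSucc p.2) (β p.1)) fun p q => LinearMap.ext fun c => by
    change A.mode z _ (β _) (A.mode z _ (β _) c) = F.eps • A.mode z _ (β _) (A.mode z _ (β _) c)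
    rw [H.comm, FieldData.contr, if_neg (by omega), zero_smul, add_zero]

/-- The map from the Fock space that sends the vacuum to the vacuum. -/
def map₀ : F.Fock →ₗ[ℂ] A.carrier := LinearMap.applyₗ (A.vac z) ∘ₗ H.rep.toLinearMap

theorem map₀_one : H.map₀ 1 = A.vac z := by
  change H.rep 1 (A.vac z) = _
  rw [map_one]; rfl

theorem map₀_cr_mul (p) (v : F.Fock) : H.map₀ (F.cr p * v) = A.mode z (negSucc p.2) (β p.1) (H.map₀ v) := by
  change H.rep (F.cr p * v) (A.vac z) = _
  rw [map_mul, rep, FieldData.lift_cr]; rfl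

theorem map₀_phi (i) (m : ℤ) (v : F.Fock) : H.map₀ (F.phi i m v) = A.mode z m (β i) (H.map₀ v) := by
  rcases m with m | m
  · change H.map₀ (F.an i m v) = A.mode z (m : ℤ) _ _
    induction v using FieldData.Fock.induction with
    | one => rw [F.an_one, map_zero, map₀_one, ChirAlg.mode_vac_right_of_nonneg (by omega) (H.par i)]
    | add v w hv hw => rw [map_add, map_add, hv, hw, map_add]; exact (A.br_add_right ..).symm
    | smul c v hv => rw [map_smul, map_smul, hv, map_smul]; exact (ChirAlg.csmul_br_right c ..).symm
    | cr p v hv =>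
      rw [F.an_cr_mul, map_add, map_smul, map_smul, map₀_cr_mul, map₀_cr_mul, hv,
        H.comm i p.1 m (negSucc p.2), add_comm]
  · rw [F.phi_negSucc, map₀_cr_mul]

theorem map₀_cr (i) : H.map₀ (F.cr (i, 0)) = β i := by
  have := H.map₀_cr_mul (i, 0) 1
  rw [mul_one, map₀_one] at this
  rw [this]
  exact ChirAlg.mode_neg_one_vac z (H.par i)

theorem map₀_trans (v : F.Fock) : H.map₀ (F.trans v) = - (H.map₀ v <• X.vec (ddz z)) := by
  induction v using FieldData.Fock.induction with
  | one => rw [F.trans_one, map_zero, map₀_one, ChirAlg.vac_act, neg_zero]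
  | add v w hv hw => rw [map_add, map_add, hv, hw, map_add, smul_add, neg_add]
  | smul c v hv =>
    rw [map_smul, map_smul, hv, map_smul, smul_neg, ← A.scal_smul, ← A.scal_smul, ← A.fn_act, ← A.fn_act, smul_smul,
      smul_smul, ← op_mul, ← op_mul, vec_mul_fn]
    simp [Fam.scal]
  | cr p v hv =>
    have h := A.isPre.mode_act_right z (negSucc p.2) (β p.1) (H.map₀ v)
    rw [F.trans_cr_mul, map_add, map_smul, map₀_cr_mul, map₀_cr_mul, map₀_cr_mul, hv, ChirAlg.mode, ChirAlg.mode,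
      A.isPre.neg_right, h]
    rw [show (negSucc (p.1, p.2 + 1).2 : ℤ) = negSucc p.2 - 1 by simp [negSucc_eq]; ring,
      ← cast_smul_eq_zsmul ℂ, Int.cast_negSucc, ChirAlg.mode]
    generalize A.br _ (β p.1) (H.map₀ v) 1 <• X.vec (ddz z) = x
    push_cast
    module

/-- Homogeneous vectors on which the map from the Fock space is known to be multiplicative. -/
def good (j : ZMod 2) : Set F.Fock :=
  {v | F.theta v = Mdl.psg j • v ∧ H.map₀ v ∈ A.par j ∧
    ∀ n w, H.map₀ (F.md n v w) = A.mode z n (H.map₀ v) (H.map₀ w)}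

theorem one_mem_good : (1 : F.Fock) ∈ H.good 0 := by
  refine ⟨by rw [map_one, Mdl.psg_zero, one_smul], by rw [map₀_one]; exact ChirAlg.vac_mem z, fun n w => ?_⟩
  rw [F.md_one_left, map₀_one, ChirAlg.mode_vac]
  split_ifs
  · rfl
  · exact map_zero _

theorem cr_mem_good (p) {j : ZMod 2} {v : F.Fock} (hv : v ∈ H.good j) :
    F.cr p * v ∈ H.good ((F.ord + 1 : ℕ) + j) := by
  obtain ⟨h1, h2, h3⟩ := hv
  refine ⟨?_, ?_, fun n w => ?_⟩
  · rw [F.theta_cr_mul, h1, Mdl.psg_add, ← cast_smul_eq_zsmul ℂ, ← cast_smul_eq_zsmul ℂ, Int.cast_mul, F.psg_eps,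
      mul_smul, mul_smul_comm]
  · rw [map₀_cr_mul]
    exact A.br_par _ _ _ (H.par p.1) _ h2 _ _
  · have h := A.borcherds z (H.par p.1) h2 (H.map₀ w) 0 (negSucc p.2) n
    rw [bsum_zero, cast_zero, sub_zero, zero_add, add_zero] at h
    have h5 : F.theta v = sgn (F.ord + 1 : ℕ) j • v := by
      have e := F.psg_eps
      rcases Mdl.zmod_two ((F.ord + 1 : ℕ) : ZMod 2) with h0 | h0 <;> rw [h0] at e ⊢
      · rw [F.theta_of_eps (by rw [← e]; simp [Mdl.psg_zero]), Mdl.sgn_zero, one_smul]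
      · rw [h1, Mdl.sgn_one]
    rw [← F.phi_negSucc, F.md_phi, map₀_phi]
    refine Eq.trans ?_ h.symm
    have e1 : EvZero fun t : ℕ => sg t • F.phi p.1 (negSucc p.2 - t) (F.md (n + t) v w) :=
      (F.evZero_md n v w).map_seq (fun t x => sg t • F.phi p.1 (negSucc p.2 - t) x) fun t => by simp
    have e2 : EvZero fun t : ℕ => sg t • F.md (negSucc p.2 + n - t) (F.theta v) (F.an p.1 t w) :=
      (F.evZero_an p.1 w).map_seq (fun t x => sg t • F.md (negSucc p.2 + n - t) (F.theta v) x) fun t => by simp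
    have e3 : EvZero fun t : ℕ => sg (negSucc p.2) • sg t •
        A.br δ[z,negSucc p.2 + n - t] (H.map₀ v) (A.br δ[z,((0 : ℤ) + t)] (β p.1) (H.map₀ w) 1) 1 := by
      refine (F.evZero_an p.1 w).map_seq (fun t x => sg (negSucc p.2) • sg t •
        A.br δ[z,negSucc p.2 + n - t] (H.map₀ v) (H.map₀ x) 1) (fun t => ?_) |>.congr fun t => ?_
      · rw [map_zero, A.isPre.zero_right, smul_zero, smul_zero]
      · rw [zero_add, ← F.phi_natCast, map₀_phi]
    rw [map_sub, map_zsmul, ← bsum_linearMap e1, ← bsum_linearMap e2, ← bsum_smul (f := fun t => H.map₀ _) (e2.map H.map₀.toAddMonoidHom),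
      ← bsum_smul e3]
    congr 1
    · refine bsum_congr _ fun t => ?_
      rw [map_zsmul, map₀_phi, h3, zero_add]
    · refine bsum_congr _ fun t => ?_
      rw [map_zsmul, h5, map_zsmul, LinearMap.smul_apply, map_zsmul, h3, ← F.phi_natCast, map₀_phi, zero_add,
        smul_comm (sgn _ _), smul_comm (sgn _ _)]

theorem add_mem_good {j : ZMod 2} {v w : F.Fock} (hv : v ∈ H.good j) (hw : w ∈ H.good j) : v + w ∈ H.good j := by
  obtain ⟨h1, h2, h3⟩ := hv
  obtain ⟨k1, k2, k3⟩ := hw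
  refine ⟨by rw [map_add, h1, k1, smul_add], by rw [map_add]; exact add_mem h2 k2, fun n u => ?_⟩
  rw [map_add, LinearMap.add_apply, map_add, h3, k3, map_add]
  exact (A.br_add_left ..).symm

theorem smul_mem_good (c : ℂ) {j : ZMod 2} {v : F.Fock} (hv : v ∈ H.good j) : c • v ∈ H.good j := by
  obtain ⟨h1, h2, h3⟩ := hv
  refine ⟨by rw [map_smul, h1, smul_comm], by rw [map_smul]; exact ChirAlg.csmul_mem h2 c, fun n u => ?_⟩
  rw [map_smul, LinearMap.smul_apply, map_smul, h3, map_smul]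
  exact (ChirAlg.csmul_br_left ..).symm

theorem exists_good (v : F.Fock) : ∃ v₀ ∈ H.good 0, ∃ v₁ ∈ H.good 1, v = v₀ + v₁ := by
  have h0 (j) : (0 : F.Fock) ∈ H.good j :=
    ⟨by rw [map_zero, smul_zero], by rw [map_zero]; exact zero_mem _, fun n w => by
      rw [map_zero, LinearMap.zero_apply, map_zero]; exact (A.isPre.zero_left ..).symm⟩
  induction v using FieldData.Fock.induction with
  | one => exact ⟨1, H.one_mem_good, 0, h0 1, (add_zero _).symm⟩
  | add v w hv hw =>
    obtain ⟨v₀, h₀, v₁, h₁, rfl⟩ := hv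
    obtain ⟨w₀, k₀, w₁, k₁, rfl⟩ := hw
    exact ⟨_, H.add_mem_good h₀ k₀, _, H.add_mem_good h₁ k₁, by abel⟩
  | smul c v hv =>
    obtain ⟨v₀, h₀, v₁, h₁, rfl⟩ := hv
    exact ⟨_, H.smul_mem_good c h₀, _, H.smul_mem_good c h₁, smul_add _ _ _⟩
  | cr p v hv =>
    obtain ⟨v₀, h₀, v₁, h₁, rfl⟩ := hv
    have k₀ := H.cr_mem_good p h₀
    have k₁ := H.cr_mem_good p h₁
    rcases Mdl.zmod_two ((F.ord + 1 : ℕ) : ZMod 2) with e | e <;> rw [e] at k₀ k₁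
    · exact ⟨_, k₀, _, k₁, mul_add _ _ _⟩
    · exact ⟨_, k₁, _, k₀, by rw [add_comm, mul_add]⟩

theorem map₀_md (n : ℤ) (v w : F.Fock) : H.map₀ (F.md n v w) = A.mode z n (H.map₀ v) (H.map₀ w) := by
  obtain ⟨v₀, h₀, v₁, h₁, rfl⟩ := H.exists_good v
  rw [map_add, LinearMap.add_apply, map_add, h₀.2.2, h₁.2.2, map_add]
  exact (A.br_add_left ..).symm

theorem map₀_ev (v : F.Fock) : H.map₀ (F.ev v) ∈ A.par 0 := by
  obtain ⟨v₀, h₀, v₁, h₁, rfl⟩ := H.exists_good v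
  have : F.ev (v₀ + v₁) = v₀ := by
    rw [FieldData.ev, map_add, h₀.1, h₁.1, Mdl.psg_zero, Mdl.psg_one]; module
  rw [this]; exact h₀.2.1

theorem map₀_od (v : F.Fock) : H.map₀ (F.od v) ∈ A.par 1 := by
  obtain ⟨v₀, h₀, v₁, h₁, rfl⟩ := H.exists_good v
  have : F.od (v₀ + v₁) = v₁ := by
    rw [FieldData.od, map_add, h₀.1, h₁.1, Mdl.psg_zero, Mdl.psg_one]; module
  rw [this]; exact h₁.2.1

/-- The map from the chiral algebra of free fields, as a map of `𝒪`-modules. -/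
def mapL : Mdl F z →ₗ[X.R] A.carrier := H.map₀.liftBaseChange X.R

theorem mapL_ten (r : X.R) (v : F.Fock) : H.mapL (Mdl.ten r v) = r • H.map₀ v :=
  liftBaseChange_tmul ..

theorem mapL_act (a : Mdl F z) (P : X.DO) : H.mapL (a <• P) = H.mapL a <• P := by
  induction P using DO_induction generalizing a with
  | fn f => rw [Mdl.act_fn, map_smul, A.fn_act]
  | vec ξ =>
    rw [Mdl.act_vec, A.act_vec_eq z ξ, ← map_smul]
    generalize ξ z • a = a
    induction a using Mdl.induction with
    | ten r v =>
      rw [Mdl.der_ten, map_neg, map_add, mapL_ten, mapL_ten, mapL_ten, map₀_trans, A.smul_act]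
      rw [smul_neg]; abel
    | add a b ha hb => rw [map_add, neg_add, map_add, ha, hb, map_add, smul_add]
  | add P Q hP hQ => rw [op_add, add_smul, map_add, hP, hQ, add_smul]
  | mul P Q hP hQ => rw [op_mul, mul_smul, hQ, hP, mul_smul]

theorem mapL_br (f : X.K) (a b : Mdl F z) (g : X.R) : A.br f (H.mapL a) (H.mapL b) g = H.mapL (Mdl.br z f a b g) := by
  induction a, b using Mdl.induction₂ with
  | ten r v s w =>
    rw [Mdl.br_ten, mapL_ten, mapL_ten, map_smul, A.isPre.right_smul, A.br_left, A.isPre.eq_lpair z, Mdl.lp,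
      ← lpair_map _ (Mdl.evZ_ten v w), mul_right_comm]
    congr 2
    funext n
    rw [mapL_ten, one_smul, map₀_md]
  | left a a' b h h' => rw [map_add, A.br_add_left, h, h', Mdl.br_add_left, map_add]
  | right a b b' h h' => rw [map_add, A.br_add_right, h, h', Mdl.br_add_right, map_add]

/-- The homomorphism from the chiral algebra of free fields determined by its values on the fields. -/
def hom : ChirHom (Mdl.chir F z) A where
  toFun := { toFun := H.mapL, map_add' := map_add _, map_smul' := fun P a => H.mapL_act a (unop P) }
  map_par i (a : Mdl F z) ha := by
    rcases Mdl.zmod_two i with rfl | rfl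
    · have h : Mdl.ev a = a := by rw [Mdl.ev_of_mem ha, if_pos rfl]
      change H.mapL a ∈ _
      rw [← h]
      clear ha h
      induction a using Mdl.induction with
      | ten r v => rw [Mdl.ev_ten, mapL_ten]; exact ChirAlg.fsmul_mem (H.map₀_ev v) r
      | add a b ha hb => rw [map_add, map_add]; exact add_mem ha hb
    · have h : Mdl.od a = a := by rw [Mdl.od_of_mem ha, if_neg (by decide)]
      change H.mapL a ∈ _
      rw [← h]
      clear ha h
      induction a using Mdl.induction with
      | ten r v => rw [Mdl.od_ten, mapL_ten]; exact ChirAlg.fsmul_mem (H.map₀_od v) r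
      | add a b ha hb => rw [map_add, map_add]; exact add_mem ha hb
  map_br := H.mapL_br
  map_unit ω := by
    obtain ⟨r, rfl⟩ := Mdl.exists_om z ω
    change H.mapL (Mdl.unit F z _) = _
    rw [Mdl.unit_smul_d, mapL_ten, map₀_one, map_smul]

theorem hom_ten (r : X.R) (v : F.Fock) : H.hom.toFun (Mdl.ten r v : Mdl F z) = r • H.map₀ v := H.mapL_ten r v

theorem hom_field (i : F.I) : H.hom.toFun (Mdl.ten 1 (F.cr (i, 0)) : Mdl F z) = β i := by
  rw [hom_ten, one_smul, map₀_cr]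

end IsFields

open Mdl (exists_om chir ten)

open ChirAlg (scal_smul smul_act)

open FieldData (contr phi_natCast)

open IsFields (map₀_cr map₀_trans map₀_md map₀_one)

/-! ### Maps of chiral algebras over morphisms of families -/

/-- A map of chiral algebras over a morphism of families. -/
structure IsSemi {X Y : Fam} (h : Hom X Y) (A : ChirAlg X) (B : ChirAlg Y) (u : A.carrier → B.carrier) : Prop where
  add : ∀ a b, u (a + b) = u a + u b
  smul : ∀ (r : X.R) a, u (r • a) = h.fn r • u a
  vec : ∀ (ξ : X.Th) (ξ' : Y.Th), h.RelVec ξ ξ' → ∀ a, u (a <• X.vec ξ) = u a <• Y.vec ξ'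
  par : ∀ i, ∀ a ∈ A.par i, u a ∈ B.par i
  br : ∀ f a b g, u (A.br f a b g) = B.br (h.kk f) (u a) (u b) (h.fn g)
  unit : ∀ ω, u (A.unit ω) = B.unit (h.om ω)

theorem LocalChirAlg.isSemi (A : LocalChirAlg) {X Y : Fam} (h : Hom X Y) : IsSemi h (A.obj X) (A.obj Y) (A.map h) :=
  ⟨map_add _, map_smulₛₗ _, A.map_vec h, A.map_par h, A.map_br h, A.map_unit h⟩

namespace Hom

variable {X Y Z : Fam}

theorem kk_algebraMap (h : Hom X Y) (q : X.RR) : h.kk (algebraMap X.RR X.K q) = algebraMap Y.RR Y.K (h.rr q) :=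
  IsLocalization.map_eq _ q

theorem kk_in1 (h : Hom X Y) (r : X.R) : h.kk (X.in1 r) = Y.in1 (h.fn r) := by
  rw [in1_apply, kk_algebraMap, rr_tmul, map_one]; rfl

theorem kk_in2 (h : Hom X Y) (r : X.R) : h.kk (X.in2 r) = Y.in2 (h.fn r) := by
  rw [in2_apply, kk_algebraMap, rr_tmul, map_one]; rfl

theorem kk_dk (h : Hom X Y) (z : X.Coord) (n : ℤ) :
    h.kk δ[z,n] = (dk (h.crd z) ^ n : Y.Kˣ) := by
  have : Units.map (h.kk : X.K →* Y.K) (dk z) = dk (h.crd z) := by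
    ext
    change h.kk (dk z : X.K) = _
    rw [dk_eq, map_sub, kk_in1, kk_in2, dk_eq]; rfl
  rw [← this, ← map_zpow]; rfl

theorem om_d (h : Hom X Y) (f : X.R) : h.om (X.d f) = Y.d (h.fn f) := by
  let _ : Algebra X.R Y.R := h.fn.toAlgebra
  let _ : Algebra X.k Y.k := h.base.toRingHom.toAlgebra
  let _ : Algebra X.k Y.R := ((algebraMap Y.k Y.R).comp h.base.toRingHom).toAlgebra
  have : IsScalarTower X.k X.R Y.R := .of_algebraMap_eq fun c => (h.comm c).symm
  have : IsScalarTower X.k Y.k Y.R := .of_algebraMap_eq fun _ => rfl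
  exact map_D X.k Y.k X.R Y.R f

theorem om_smul_d (h : Hom X Y) (r f : X.R) : h.om (r • X.d f) = h.fn r • Y.d (h.fn f) := by
  rw [map_smulₛₗ, om_d]

theorem fn_ddz (h : Hom X Y) (z : X.Coord) (f : X.R) : h.fn (ddz z f) = ddz (h.crd z) (h.fn f) :=
  smul_d_inj (h.crd z) (by
    rw [← d_eq]
    have := om_smul_d h (ddz z f) z
    rw [← d_eq, om_d] at this
    exact this.symm)

theorem relVec_ddz (h : Hom X Y) (z : X.Coord) : h.RelVec (ddz z) (ddz (h.crd z)) := fun g => (h.fn_ddz z g).symm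

theorem RelVec.apply_crd {h : Hom X Y} {ξ : X.Th} {ξ' : Y.Th} (H : h.RelVec ξ ξ') (z : X.Coord) :
    ξ' (h.crd z) = h.fn (ξ z) := H z

theorem fn_scal (h : Hom X Y) (c : ℂ) : h.fn (X.scal c) = Y.scal c := by
  rw [Fam.scal, h.comm, commutes]; rfl

theorem fn_csmul (h : Hom X Y) (c : ℂ) (r : X.R) : h.fn (c • r) = c • h.fn r := by
  rw [smul_def, map_mul, ← scal_eq, fn_scal, scal_eq, ← smul_def]

theorem fn_jac (h : Hom X Y) (z w : X.Coord) : h.fn (jac z w : X.R) = (jac (h.crd z) (h.crd w) : Y.R) := h.fn_ddz z w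

theorem crd_comp (g : Hom Y Z) (h : Hom X Y) (z : X.Coord) : (g.comp h).crd z = g.crd (h.crd z) := rfl

theorem kk_id (f : X.K) : (Hom.id X).kk f = f := by
  have : (Hom.id X).kk = RingHom.id X.K := ringHom_ext X.W (RingHom.ext fun q => by
    rw [RingHom.comp_apply, kk_algebraMap]
    change algebraMap _ _ _ = algebraMap _ _ _
    congr 1
    induction q using induction_on with
    | zero => rw [map_zero]
    | add a b ha hb => rw [map_add, ha, hb]
    | tmul a b => rw [rr_tmul]; rfl)
  rw [this]; rfl

theorem om_id (ω : X.Om) : (Hom.id X).om ω = ω := by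
  obtain ⟨z, hz⟩ := X.exists_coord
  obtain ⟨r, rfl⟩ := exists_om ⟨z, hz⟩ ω
  exact om_smul_d ..

theorem om_comp (g : Hom Y Z) (h : Hom X Y) (ω : X.Om) : (g.comp h).om ω = g.om (h.om ω) := by
  obtain ⟨z, hz⟩ := X.exists_coord
  obtain ⟨r, rfl⟩ := exists_om ⟨z, hz⟩ ω
  rw [om_smul_d, om_smul_d, om_smul_d]; rfl

theorem kk_comp (g : Hom Y Z) (h : Hom X Y) (f : X.K) : (g.comp h).kk f = g.kk (h.kk f) := by
  have : (g.comp h).kk = g.kk.comp h.kk := ringHom_ext X.W (RingHom.ext fun q => by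
    rw [RingHom.comp_apply, RingHom.comp_apply, RingHom.comp_apply, kk_algebraMap, kk_algebraMap, kk_algebraMap]
    congr 1
    induction q using induction_on with
    | zero => rw [map_zero, map_zero, map_zero]
    | add a b ha hb => rw [map_add, ha, hb, map_add, map_add]
    | tmul a b => rw [rr_tmul, rr_tmul, rr_tmul]; rfl)
  rw [this]; rfl

theorem rr_mem_idl (h : Hom X Y) {N : ℕ} {q : X.RR} (hq : q ∈ X.idl ^ N) : h.rr q ∈ Y.idl ^ N := by
  have : X.idl.map h.rr ≤ Y.idl := by
    rw [idl, ← span_range_eq_ideal, Ideal.map_span, Ideal.span_le]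
    rintro _ ⟨_, ⟨s, rfl⟩, rfl⟩
    rw [map_sub, rr_tmul, rr_tmul, map_one]
    exact KaehlerDifferential.one_smul_sub_smul_one_mem_ideal Y.k (h.fn s)
  exact (Ideal.pow_right_mono this N) (by rw [← Ideal.map_pow]; exact Ideal.mem_map_of_mem _ hq)

end Hom

theorem Fam.IsFin.comp_kk {X Y : Fam} (h : Hom X Y) {A : Type} [AddCommGroup A] {B : Y.K → A} (hB : IsFin B) :
    IsFin fun f => B (h.kk f) := by
  intro f
  obtain ⟨N, hN⟩ := hB (h.kk f)
  exact ⟨N, fun q hq => by beta_reduce; rw [map_mul, h.kk_algebraMap]; exact hN _ (h.rr_mem_idl hq)⟩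

namespace IsSemi

variable {X Y Z : Fam} {h : Hom X Y} {A : ChirAlg X} {B : ChirAlg Y}

theorem comp {C : ChirAlg Z} {g : Hom Y Z} {u : A.carrier → B.carrier} {v : B.carrier → C.carrier} (hu : IsSemi h A B u)
    (hv : IsSemi g B C v) : IsSemi (g.comp h) A C fun a => v (u a) where
  add a b := by rw [hu.add, hv.add]
  smul r a := by rw [hu.smul, hv.smul]; rfl
  vec ξ ξ' hξ a := by
    obtain ⟨z, hz⟩ := X.exists_coord
    let z : X.Coord := ⟨z, hz⟩
    have e : ξ' = g.fn (h.fn (ξ z)) • ddz (g.crd (h.crd z)) := by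
      rw [vec_eq (g.crd (h.crd z)) ξ']
      congr 1
      exact hξ z
    have e1 : h.RelVec ξ (h.fn (ξ z) • ddz (h.crd z)) := fun f => by
      rw [Derivation.smul_apply, smul_eq_mul, ← h.fn_ddz, ← map_mul, ← vec_apply_eq]
    rw [hu.vec ξ _ e1, e]
    exact hv.vec _ _ (fun f => by
      rw [Derivation.smul_apply, Derivation.smul_apply, smul_eq_mul, smul_eq_mul, map_mul, g.fn_ddz]) _
  par i a ha := hv.par i _ (hu.par i a ha)
  br f a b c := by rw [hu.br, hv.br, Hom.kk_comp]; rfl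
  unit ω := by rw [hu.unit, hv.unit, Hom.om_comp]

theorem neg {u : A.carrier → B.carrier} (hu : IsSemi h A B u) (a) : u (-a) = - u a := (mk' u hu.add).map_neg a
theorem sub {u : A.carrier → B.carrier} (hu : IsSemi h A B u) (a b) : u (a - b) = u a - u b :=
  (mk' u hu.add).map_sub a b

theorem csmul {u : A.carrier → B.carrier} (hu : IsSemi h A B u) (c : ℂ) (a) : u (c • a) = c • u a := by
  rw [← scal_smul, hu.smul, h.fn_scal]; rfl

theorem mode {u : A.carrier → B.carrier} (hu : IsSemi h A B u) (z : X.Coord) (n : ℤ) (a b) :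
    u (A.mode z n a b) = B.mode (h.crd z) n (u a) (u b) := by
  rw [ChirAlg.mode, hu.br, h.kk_dk, map_one]

theorem vac {u : A.carrier → B.carrier} (hu : IsSemi h A B u) (z : X.Coord) : u (A.vac z) = B.vac (h.crd z) := by
  rw [ChirAlg.vac, hu.unit, h.om_d]; rfl

theorem of_chirHom {A B : ChirAlg X} (Φ : ChirHom A B) : IsSemi (Hom.id X) A B Φ.toFun where
  add := map_add _
  smul r a := by rw [← A.fn_act, map_smul, B.fn_act]; rfl
  vec ξ ξ' hξ a := by
    have : ξ' = ξ := Derivation.ext hξ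
    rw [this, map_smul]
  par := Φ.map_par
  br f a b g := by rw [Hom.kk_id, ← Φ.map_br]; rfl
  unit ω := by rw [Φ.map_unit, Hom.om_id]

theorem comp_chirHom {A' : ChirAlg X} {u : A.carrier → B.carrier} (hu : IsSemi h A B u) (Φ : ChirHom A' A) :
    IsSemi h A' B fun a => u (Φ.toFun a) := (of_chirHom Φ).comp hu

theorem chirHom_comp {B' : ChirAlg Y} {u : A.carrier → B.carrier} (hu : IsSemi h A B u) (Φ : ChirHom B B') :
    IsSemi h A B' fun a => Φ.toFun (u a) := hu.comp (of_chirHom Φ)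

/-- Maps from the chiral algebra of free fields are determined by their values on the fields. -/
theorem ext {F : FieldData} {z : X.Coord} {u u' : (chir F z).carrier → B.carrier} (hu : IsSemi h (chir F z) B u)
    (hu' : IsSemi h (chir F z) B u')
    (H : ∀ i, u (ten 1 (F.cr (i, 0)) : Mdl F z) = u' (ten 1 (F.cr (i, 0)) : Mdl F z)) (a) : u a = u' a := by
  induction a using Mdl.induction_smul with
  | ten v =>
    induction v using FieldData.Fock.induction with
    | one =>
      have e : (ten 1 1 : Mdl F z) = (chir F z).unit (X.d z) := by
        rw [← one_smul X.R (X.d z)]; exact (Mdl.unit_smul_d 1).symm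
      rw [e, hu.unit, hu'.unit]
    | add v w hv hw => rw [Mdl.ten_add_right, hu.add, hu'.add, hv, hw]
    | smul c v hv =>
      rw [Mdl.ten_smul, ← algebraMap_smul X.R c]
      exact (hu.smul _ _).trans ((congrArg _ hv).trans (hu'.smul _ _).symm)
    | cr p v hv =>
      have e : (ten 1 (F.cr p * v) : Mdl F z) =
          (chir F z).br δ[z,negSucc p.2] (ten 1 (F.cr (p.1, 0)) : Mdl F z) (ten 1 v : Mdl F z) 1 := by
        refine Eq.trans ?_ (Mdl.mode_ten ..).symm
        rw [F.md_cr_left, F.phi_negSucc]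
      rw [e, hu.br, hu'.br, hv, H]
  | add a b ha hb => exact (hu.add a b).trans ((congrArg₂ _ ha hb).trans (hu'.add a b).symm)
  | smul r a ha => exact (hu.smul _ _).trans ((congrArg _ ha).trans (hu'.smul _ _).symm)

end IsSemi

open IsSemi (of_chirHom)

namespace Mdl

variable {F : FieldData} {X Y : Fam}

variable (F) in
/-- The map between the chiral algebras of free fields over a morphism of families. -/
def map (h : Hom X Y) (z : X.Coord) : Mdl F z →ₗ[ℂ] Mdl F (h.crd z) :=
  LinearMap.rTensor F.Fock { toFun := h.fn, map_add' := map_add _, map_smul' := h.fn_csmul }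

theorem map_ten (h : Hom X Y) (z : X.Coord) (r : X.R) (v : F.Fock) : map F h z (ten r v) = ten (h.fn r) v := rfl

theorem map_smul (h : Hom X Y) (z : X.Coord) (r : X.R) (a : Mdl F z) : map F h z (r • a) = h.fn r • map F h z a := by
  induction a using induction with
  | ten s v => rw [smul_ten, map_ten, map_ten, smul_ten, map_mul]
  | add a b ha hb => rw [smul_add, map_add, ha, hb, map_add, smul_add]

theorem map_lp (h : Hom X Y) (z : X.Coord) (f : X.K) (v w : F.Fock) :
    map F h z (lp z f v w) = lp (h.crd z) (h.kk f) v w := by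
  have h1 : IsFin fun f => map F h z (lp z f v w) := (isFin_lp v w).map _ (map_zero _)
  have h2 : IsFin fun f => lp (h.crd z) (h.kk f) v w := (isFin_lp v w).comp_kk h
  rw [← sub_eq_zero]
  refine eq_zero_of_isFin z (mk' (fun f => map F h z (lp z f v w) - lp (h.crd z) (h.kk f) v w)
    fun f g => ?_) (h1.sub h2) (fun c m => ?_) f
  · simp only [lp_add, map_add]; abel
  · change map F h z (lp z _ v w) - lp (h.crd z) (h.kk _) v w = 0
    rw [map_mul, h.kk_in2, h.kk_dk, mul_comm, lp_in2, mul_comm, lp_in2, lp_dk, lp_dk, map_smul, map_ten, map_one, sub_self]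

theorem isSemi_map (h : Hom X Y) (z : X.Coord) : IsSemi h (chir F z) (chir F (h.crd z)) (map F h z) where
  add := map_add _
  smul := map_smul h z
  vec ξ ξ' hξ (a : Mdl F z) := by
    change map F h z _ = _
    rw [act_vec, act_vec, hξ.apply_crd z, ← map_smul, map_neg]
    generalize ξ z • a = a
    congr 1
    induction a using induction with
    | ten r v => rw [der_ten, map_add, map_ten, map_ten, map_ten, der_ten, h.fn_ddz]
    | add a b ha hb => rw [map_add, map_add, map_add, map_add, ha, hb]
  par i (a : Mdl F z) ha := by
    have e : par F (h.crd z) (map F h z a) = map F h z (par F z a) := by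
      clear ha
      induction a using induction with
      | ten r v => rfl
      | add a b ha hb => rw [map_add, map_add, map_add, map_add, ha, hb]
    rw [mem_parSub] at ha ⊢
    rw [e, ha, map_zsmul]
  br f a b g := by
    change map F h z (br z f a b g) = br ..
    induction a, b using induction₂ with
    | ten r v s w =>
      rw [map_ten, map_ten, br_ten, br_ten, map_smul, map_lp, map_mul, map_mul, h.kk_in1, h.kk_in1]
    | left a a' b k k' => rw [br_add_left, map_add, k, k', map_add, br_add_left]
    | right a b b' k k' => rw [br_add_right, map_add, k, k', map_add, br_add_right]
  unit ω := by
    obtain ⟨r, rfl⟩ := exists_om z ω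
    change map F h z (unit F z _) = unit F _ _
    rw [h.om_smul_d, unit_smul_d, map_ten]
    exact (unit_smul_d (z := h.crd z) _).symm

theorem isFields (z : X.Coord) : IsFields F (chir F z) z fun i => (ten 1 (F.cr (i, 0)) : Mdl F z) where
  par i := by
    rw [mem_parSub, par_ten, F.theta_cr, ← F.psg_eps, ten_smul, cast_smul_eq_zsmul]
  ope i j n := by
    refine (mode_ten ..).trans ?_
    have e : (chir F z).vac z = (ten 1 1 : Mdl F z) := by
      rw [← unit_smul_d, one_smul]
    rw [F.md_cr_left, F.phi_natCast, F.an_cr, e, ten_smul, contr]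
    have : (n : ℤ) + negSucc 0 + 1 = F.ord ↔ n = F.ord := by rw [negSucc_eq]; omega
    simp only [this]
    split_ifs with hn
    · rw [hn, choose_natCast, Nat.choose_self]
      simp only [Nat.cast_one, Int.cast_one, mul_one]
      exact (algebraMap_smul X.R (F.g i j) (ten 1 1 : Mdl F z)).symm
    · exact zero_smul _ _

end Mdl

theorem ChirHom.ext {X : Fam} {A B : ChirAlg X} {Φ Ψ : ChirHom A B} (h : ∀ a, Φ.toFun a = Ψ.toFun a) : Φ = Ψ := by
  obtain ⟨f, _, _, _⟩ := Φ
  obtain ⟨g, _, _, _⟩ := Ψ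
  obtain rfl : f = g := LinearMap.ext h
  rfl

/-- The composition of homomorphisms of chiral algebras. -/
def ChirHom.comp {X : Fam} {A B C : ChirAlg X} (Ψ : ChirHom B C) (Φ : ChirHom A B) : ChirHom A C where
  toFun := Ψ.toFun ∘ₗ Φ.toFun
  map_par i a ha := Ψ.map_par i _ (Φ.map_par i a ha)
  map_br f a b g := by rw [comp_apply, comp_apply, Ψ.map_br, Φ.map_br]; rfl
  map_unit ω := by rw [comp_apply, Φ.map_unit, Ψ.map_unit]

/-- The identity of a chiral algebra. -/
def ChirHom.id {X : Fam} (A : ChirAlg X) : ChirHom A A := ⟨LinearMap.id, fun _ _ h => h, fun _ _ _ _ => rfl, fun _ => rfl⟩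

theorem ChirHom.ext_fields {X : Fam} {F : FieldData} {z : X.Coord} {A : ChirAlg X} {Φ Ψ : ChirHom (chir F z) A}
    (h : ∀ i, Φ.toFun (ten 1 (F.cr (i, 0)) : Mdl F z) = Ψ.toFun (ten 1 (F.cr (i, 0)) : Mdl F z)) : Φ = Ψ :=
  ChirHom.ext (IsSemi.ext (.of_chirHom Φ) (.of_chirHom Ψ) h)

theorem IsStarMap.comp {X : Fam} {B : StarAlg X} {A A' : ChirAlg X} {φ : B.carrier →ₗ[X.DOᵐᵒᵖ] A.carrier}
    (h : IsStarMap B A φ) (Φ : ChirHom A A') : IsStarMap B A' (Φ.toFun ∘ₗ φ) where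
  map_par i b hb := Φ.map_par i _ (h.map_par i b hb)
  map_br b b' g := by rw [comp_apply, comp_apply, Φ.map_br, h.map_br]; rfl
  map_cent ω := by rw [comp_apply, h.map_cent, Φ.map_unit]

/-! ### Local systems of free fields -/

/-- A system of Lie-* algebras, generated over the central `Ω` by free fields that depend on the choice of a
coordinate. -/
structure FieldSys : Type 1 where
  F : FieldData
  B : ∀ X : Fam, StarAlg X
  e : ∀ {X : Fam}, X.Coord → F.I → (B X).carrier
  isFields : ∀ {X : Fam} {A : ChirAlg X} {φ : (B X).carrier →ₗ[X.DOᵐᵒᵖ] A.carrier}, IsStarMap (B X) A φ →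
    ∀ z, IsFields F A z fun i => φ (e z i)
  exists_star : ∀ {X : Fam} {A : ChirAlg X} {z : X.Coord} {β : F.I → A.carrier}, IsFields F A z β →
    ∃ φ, IsStarMap (B X) A φ ∧ ∀ i, φ (e z i) = β i
  ext : ∀ {X : Fam} {A : ChirAlg X} (z : X.Coord) {φ φ' : (B X).carrier →ₗ[X.DOᵐᵒᵖ] A.carrier},
    IsStarMap (B X) A φ → IsStarMap (B X) A φ' → (∀ i, φ (e z i) = φ' (e z i)) → φ = φ'
  natural : ∀ {X Y : Fam} {h : Hom X Y} {A : ChirAlg X} {A' : ChirAlg Y} {u : A.carrier → A'.carrier}, IsSemi h A A' u →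
    ∀ {φ φ'}, IsStarMap (B X) A φ → IsStarMap (B Y) A' φ' → ∀ z w, (∀ i, u (φ (e z i)) = φ' (e (h.crd z) i)) →
      ∀ i, u (φ (e w i)) = φ' (e (h.crd w) i)

namespace FieldSys

variable (S : FieldSys) {X Y Z : Fam} (z : X.Coord)

/-- The star map to the chiral algebra of free fields that belongs to a coordinate. -/
def star : (S.B X).carrier →ₗ[X.DOᵐᵒᵖ] (chir S.F z).carrier := (S.exists_star (Mdl.isFields z)).choose

theorem isStarMap : IsStarMap (S.B X) (chir S.F z) (S.star z) :=
  (S.exists_star (Mdl.isFields z)).choose_spec.1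

theorem star_e (i) : S.star z (S.e z i) = (ten 1 (S.F.cr (i, 0)) : Mdl S.F z) :=
  (S.exists_star (Mdl.isFields z)).choose_spec.2 i

/-- The homomorphism from the chiral algebra of free fields determined by a star map. -/
def ofStar {A : ChirAlg X} {φ : (S.B X).carrier →ₗ[X.DOᵐᵒᵖ] A.carrier} (h : IsStarMap (S.B X) A φ) :
    ChirHom (chir S.F z) A := (S.isFields h z).hom

theorem ofStar_field {A : ChirAlg X} {φ : (S.B X).carrier →ₗ[X.DOᵐᵒᵖ] A.carrier}
    (h : IsStarMap (S.B X) A φ) (i) : (S.ofStar z h).toFun (ten 1 (S.F.cr (i, 0)) : Mdl S.F z) = φ (S.e z i) :=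
  (S.isFields h z).hom_field i

theorem ofStar_star {A : ChirAlg X} {φ : (S.B X).carrier →ₗ[X.DOᵐᵒᵖ] A.carrier}
    (h : IsStarMap (S.B X) A φ) (b) : (S.ofStar z h).toFun (S.star z b) = φ b :=
  LinearMap.congr_fun (S.ext z ((S.isStarMap z).comp (S.ofStar z h)) h fun i => by
    rw [comp_apply, star_e, ofStar_field]) b

theorem isEnvelope : IsEnvelope (S.B X) (chir S.F z) (S.star z) where
  isStarMap := S.isStarMap z
  universal A φ h := ⟨S.ofStar z h, S.ofStar_star z h, fun Φ hΦ => ChirHom.ext_fields fun i => by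
    rw [ofStar_field, ← star_e, hΦ]⟩

/-- The comparison of the chiral algebras of free fields that belong to two coordinates. -/
def cmp (z w : X.Coord) : ChirHom (chir S.F z) (chir S.F w) := S.ofStar z (S.isStarMap w)

theorem cmp_star (z w : X.Coord) (b) : (S.cmp z w).toFun (S.star z b) = S.star w b := S.ofStar_star z _ b

theorem cmp_cmp (z w : X.Coord) (a) : (S.cmp w z).toFun ((S.cmp z w).toFun a) = a := by
  have : (S.cmp w z).comp (S.cmp z w) = ChirHom.id _ := ChirHom.ext_fields fun i => by
    rw [← star_e]
    change (S.cmp w z).toFun ((S.cmp z w).toFun _) = _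
    rw [cmp_star, cmp_star]; rfl
  exact congrArg (fun Φ : ChirHom _ _ => Φ.toFun a) this

/-- The local structure. -/
def lmap (h : Hom X Y) (a : Mdl S.F X.coord₀) : Mdl S.F Y.coord₀ :=
  (S.cmp (h.crd X.coord₀) Y.coord₀).toFun (Mdl.map S.F h X.coord₀ a)

theorem isSemi_lmap (h : Hom X Y) : IsSemi h (chir S.F X.coord₀) (chir S.F Y.coord₀) (S.lmap h) :=
  (Mdl.isSemi_map h X.coord₀).chirHom_comp _

theorem lmap_star (h : Hom X Y) (z : X.Coord) (i) :
    S.lmap h (S.star X.coord₀ (S.e z i)) = S.star Y.coord₀ (S.e (h.crd z) i) := by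
  refine S.natural (S.isSemi_lmap h) (S.isStarMap _) (S.isStarMap _) X.coord₀ z (fun i => ?_) i
  rw [star_e, lmap, Mdl.map_ten, map_one, ← star_e, cmp_star]

theorem lmap_ext {h : Hom X Y} {u u' : Mdl S.F X.coord₀ → Mdl S.F Y.coord₀}
    (hu : IsSemi h (chir S.F X.coord₀) (chir S.F Y.coord₀) u)
    (hu' : IsSemi h (chir S.F X.coord₀) (chir S.F Y.coord₀) u')
    (H : ∀ i, u (S.star X.coord₀ (S.e X.coord₀ i)) = u' (S.star X.coord₀ (S.e X.coord₀ i))) (a) : u a = u' a :=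
  IsSemi.ext hu hu' (fun i => by rw [← star_e]; exact H i) a

theorem isBC_lmap (h : Hom X Y) :
    IsBC h.fn ({ toFun := S.lmap h, map_add' := (S.isSemi_lmap h).add, map_smul' := (S.isSemi_lmap h).smul } :
      Mdl S.F X.coord₀ →ₛₗ[h.fn] Mdl S.F Y.coord₀) := by
  let _ : Algebra X.R Y.R := h.fn.toAlgebra
  let _ : Module X.R (Mdl S.F Y.coord₀) := Module.compHom _ h.fn
  have _ : IsScalarTower X.R Y.R (Mdl S.F Y.coord₀) := ⟨fun a b m => mul_smul (h.fn a) b m⟩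
  have _ : IsScalarTower ℂ X.R Y.R := .of_algebraMap_eq fun c => (h.fn_scal c).symm
  have _ : IsScalarTower ℂ X.R (Mdl S.F Y.coord₀) := .of_algebraMap_smul fun c a => by
    change h.fn (X.scal c) • a = c • a
    rw [h.fn_scal, scal_eq, algebraMap_smul]
  have h1 : IsBaseChange X.R (Mdl.tenL 1 : S.F.Fock →ₗ[ℂ] Mdl S.F X.coord₀) := TensorProduct.isBaseChange ℂ S.F.Fock X.R
  refine IsBaseChange.of_comp h1 ?_
  let e : (Y.R ⊗[ℂ] S.F.Fock) ≃ₗ[Y.R] Mdl S.F Y.coord₀ :=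
    { toFun := (S.cmp (h.crd X.coord₀) Y.coord₀).toFun
      map_add' := map_add _
      map_smul' := fun r a => (of_chirHom (S.cmp (h.crd X.coord₀) Y.coord₀)).smul r a
      invFun := (S.cmp Y.coord₀ (h.crd X.coord₀)).toFun
      left_inv := S.cmp_cmp _ _
      right_inv := S.cmp_cmp _ _ }
  refine IsBaseChange.of_equiv e fun v => ?_
  change (S.cmp _ _).toFun _ = S.lmap h (ten 1 v)
  rw [lmap, Mdl.map_ten, map_one]; rfl

/-- The local chiral algebra of a local system of free fields. -/
def alg : LocalChirAlg where
  obj X := chir S.F X.coord₀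
  map h := { toFun := S.lmap h, map_add' := (S.isSemi_lmap h).add, map_smul' := (S.isSemi_lmap h).smul }
  map_id X a := S.lmap_ext (S.isSemi_lmap _) (of_chirHom (ChirHom.id _)) (fun i => S.lmap_star ..) a
  map_comp g h a := S.lmap_ext (S.isSemi_lmap _) ((S.isSemi_lmap h).comp (S.isSemi_lmap g))
    (fun i => by rw [lmap_star, lmap_star, lmap_star, Hom.crd_comp]) a
  isBC h := S.isBC_lmap h
  map_vec h := (S.isSemi_lmap h).vec
  map_par h := (S.isSemi_lmap h).par
  map_br h := (S.isSemi_lmap h).br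
  map_unit h := (S.isSemi_lmap h).unit

/-- A local chiral algebra which on every family is the enveloping algebra of the system `S`. -/
structure Env (L : LocalChirAlg) where
  ι : ∀ X : Fam, (S.B X).carrier →ₗ[X.DOᵐᵒᵖ] (L.obj X).carrier
  isEnvelope : ∀ X, IsEnvelope (S.B X) (L.obj X) (ι X)
  ι_local : ∀ {X Y : Fam} (h : Hom X Y) (z : X.Coord) (i), L.map h (ι X (S.e z i)) = ι Y (S.e (h.crd z) i)

/-- The enveloping algebra of a local system of free fields. -/
def env : S.Env S.alg where
  ι X := S.star X.coord₀
  isEnvelope X := S.isEnvelope X.coord₀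
  ι_local h z i := S.lmap_star h z i

namespace Env

variable {S} {L : LocalChirAlg} (E : S.Env L) (z : X.Coord)

/-- The section that corresponds to a free field. -/
def field (i : S.F.I) : (L.obj X).carrier := E.ι X (S.e z i)

theorem map_field (h : Hom X Y) (z : X.Coord) (i) : L.map h (E.field z i) = E.field (h.crd z) i := E.ι_local h z i

theorem isFields : IsFields S.F (L.obj X) z (E.field z) := S.isFields (E.isEnvelope X).isStarMap z

/-- The isomorphism with the chiral algebra of free fields that belongs to a coordinate. -/
def frame : ChirHom (chir S.F z) (L.obj X) := S.ofStar z (E.isEnvelope X).isStarMap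

theorem frame_field (i) : (E.frame z).toFun (ten 1 (S.F.cr (i, 0)) : Mdl S.F z) = E.field z i :=
  S.ofStar_field z _ i

theorem frame_bijective : Function.Bijective (E.frame z).toFun := by
  obtain ⟨Φ, hΦ, -⟩ := (E.isEnvelope X).universal _ _ (S.isStarMap z)
  refine Function.bijective_iff_has_inverse.2 ⟨Φ.toFun, fun a => ?_, fun a => ?_⟩
  · have : Φ.comp (E.frame z) = ChirHom.id _ := ChirHom.ext_fields fun i => by
      change Φ.toFun ((E.frame z).toFun _) = _
      rw [frame_field, field, hΦ, star_e]; rfl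
    exact congrArg (fun Φ : ChirHom _ _ => Φ.toFun a) this
  · have : (E.frame z).comp Φ = ChirHom.id _ :=
      ((E.isEnvelope X).universal _ _ (E.isEnvelope X).isStarMap).unique (fun b => by
        change (E.frame z).toFun (Φ.toFun _) = _
        rw [hΦ, frame, ofStar_star]) fun b => rfl
    exact congrArg (fun Φ : ChirHom _ _ => Φ.toFun a) this

/-- Maps from the enveloping algebra are determined by their values on the fields. -/
theorem semi_ext {h : Hom X Y} {B : ChirAlg Y} {u u' : (L.obj X).carrier → B.carrier}
    (hu : IsSemi h (L.obj X) B u) (hu' : IsSemi h (L.obj X) B u') (H : ∀ i, u (E.field z i) = u' (E.field z i)) (a) :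
    u a = u' a := by
  obtain ⟨a, rfl⟩ := (E.frame_bijective z).2 a
  exact IsSemi.ext (hu.comp_chirHom (E.frame z)) (hu'.comp_chirHom (E.frame z))
    (fun i => by rw [frame_field]; exact H i) a

theorem map_frame (h : Hom X Y) (z : X.Coord) (a : Mdl S.F z) :
    L.map h ((E.frame z).toFun a) = (E.frame (h.crd z)).toFun (Mdl.map S.F h z a) :=
  IsSemi.ext ((L.isSemi h).comp_chirHom (E.frame z)) ((Mdl.isSemi_map h z).chirHom_comp (E.frame (h.crd z)))
    (fun i => by rw [frame_field, map_field, Mdl.map_ten, map_one, frame_field]) a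

end Env

end FieldSys

open ChirHom (ext_fields)

namespace ChirAlg

variable {X : Fam} (A : ChirAlg X)

theorem br_one_act_left (a b : A.carrier) (P : X.DO) (g : X.R) : A.br 1 (a <• P) b g = A.br 1 a b (X.actR P g) := by
  induction P using DO_induction generalizing a g with
  | fn f => rw [A.fn_act, A.br_left, A.br_fn1, actR_fn]
  | vec ξ =>
    have := A.br_vec1 1 ξ a b g
    rwa [Derivation.map_one_eq_zero, A.isPre.zero, sub_zero, ← actR_vec] at this
  | add P Q hP hQ =>
    rw [op_add, add_smul, A.br_add_left, hP, hQ, map_add, LinearMap.add_apply, A.isPre.eq_one,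
      A.isPre.eq_one _ _ _ (X.actR Q g), A.isPre.eq_one _ _ _ (_ + _), map_add, mul_add, A.br_add]
  | mul P Q hP hQ => rw [op_mul, mul_smul, hQ, hP, map_mul]; rfl

theorem br_one_act_right (a b : A.carrier) (P : X.DO) (g : X.R) : A.br 1 a (b <• P) g = A.br 1 a b g <• P := by
  induction P using DO_induction generalizing b with
  | fn f => rw [A.fn_act, A.isPre.right_smul, A.fn_act]
  | vec ξ =>
    have := A.br_vec2 1 ξ a b g
    rwa [Derivation.map_one_eq_zero, A.isPre.zero, sub_zero] at this
  | add P Q hP hQ => rw [op_add, add_smul, A.br_add_right, hP, hQ, add_smul]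
  | mul P Q hP hQ => rw [op_mul, mul_smul, hQ, hP, mul_smul]

theorem br_one_unit_left (ω : X.Om) (a : A.carrier) (g : X.R) : A.br 1 (A.unit ω) a g = 0 := by
  rw [← A.br_unit_reg 1 ω a g, map_one]

theorem br_one_unit_right (ω : X.Om) {i : ZMod 2} {a : A.carrier} (ha : a ∈ A.par i) (g : X.R) :
    A.br 1 a (A.unit ω) g = 0 := by
  rw [A.antisymm i 0 a ha _ (A.unit_even ω) 1 [] (fun g => by rw [map_one, br_one_unit_left]; rfl)]
  simp [expandSwap]

variable {A}

theorem mode_natCast_of_br_one {z : X.Coord} {m : ℕ} {a b c : A.carrier}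
    (h : ∀ g, A.br 1 a b g = ((ddz z)^[m] g) • c) (n : ℕ) :
    A.mode z n a b = if n = m then m.factorial • c else 0 := by
  have h1 := A.isPre.algebraMap_mul 1 a b [(dop z m, c)] (fun g => by rw [h]; simp [expand, actR_dop]) (X.diag z ^ n)
  rw [mul_one] at h1
  have h2 := sym_dop z m n
  rw [ChirAlg.mode, dk_natCast, h1]
  simp only [List.map_cons, List.map_nil, List.sum_cons, List.sum_nil, add_zero]
  have h3 : diagAct (dop z m) (X.diag z ^ n) = (n.factorial : ℂ) • sym z n (dop z m) := by
    rw [sym, smul_smul, mul_inv_cancel₀ (by exact_mod_cast n.factorial_ne_zero), one_smul]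
  rw [h3, h2]
  by_cases hn : n = m
  · subst hn
    rw [if_pos rfl, if_pos rfl, smul_assoc, one_smul, Nat.cast_smul_eq_nsmul]
  · rw [if_neg (Ne.symm hn), if_neg hn, smul_zero, zero_smul]

theorem br_one_of_mode {z : X.Coord} {m : ℕ} {a b c : A.carrier} (h : ∀ n : ℕ, A.mode z n a b = if n = m then c else 0)
    (g : X.R) : A.br 1 a b g = tc z m g • c := by
  have h' (n : ℕ) : A.br δ[z,n] a b 1 = if n = m then c else 0 := h n
  rw [A.isPre.eq_lpair z, one_mul, tau_in1, lpair_ofPowerSeries (N := m + 1) _ fun n hn => by rw [h', if_neg (by omega)],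
    Finset.sum_eq_single m]
  · rw [coeff_taylor, h', if_pos rfl]
  · intro n _ hn
    rw [h', if_neg hn, smul_zero]
  · intro hm; simp at hm

/-- The extension of an `𝒪`-linear map to the induced `D`-module. -/
def indLift {L : Type} [AddCommGroup L] [Module X.R L] (f : L →ₗ[X.R] A.carrier) : X.Ind L →ₗ[X.DOᵐᵒᵖ] A.carrier :=
  let p : X.Ind L →+ A.carrier := TensorProduct.liftAddHom
    (mk' (fun P : X.DO => mk' (fun s : L => f s <• P) fun s t => by rw [map_add, smul_add])
      fun P Q => by ext s; simp [add_smul])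
    fun r P s => by
      change f s <• (X.fn r * P) = f (r • s) <• P
      rw [op_mul, mul_smul, A.fn_act, map_smul]
  { toFun := p
    map_add' := map_add p
    map_smul' := fun P x => by
      induction P using MulOpposite.rec' with
      | _ P =>
      induction x using induction_on with
      | zero => simp
      | add a b ha hb => rw [smul_add, map_add, map_add, ha, hb, smul_add]
      | tmul Q s =>
        change f s <• (Q * P) = (f s <• Q) <• P
        rw [op_mul, mul_smul] }

theorem indLift_tmul {L : Type} [AddCommGroup L] [Module X.R L] (f : L →ₗ[X.R] A.carrier) (P : X.DO) (s : L) :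
    indLift f (P ⊗ₜ s) = f s <• P := rfl

theorem indLift_gen {L : Type} [AddCommGroup L] [Module X.R L] (f : L →ₗ[X.R] A.carrier) (s : L) :
    indLift f (X.gen s) = f s := by
  rw [gen, indLift_tmul, op_one, one_smul]

end ChirAlg

theorem Fam.tmul_eq_gen_act {X : Fam} {L : Type} [AddCommGroup L] [Module X.R L] (P : X.DO) (s : L) :
    (P ⊗ₜ s : X.Ind L) = X.gen s <• P := by
  change _ = ((1 : X.DO) * P) ⊗ₜ[X.R] s
  rw [one_mul]

theorem Fam.gen_smul {X : Fam} {L : Type} [AddCommGroup L] [Module X.R L] (r : X.R) (s : L) :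
    X.gen (r • s) = X.gen s <• X.fn r := by
  rw [gen, tmul_smul, ← tmul_eq_gen_act, smul_tmul', smul_DO, mul_one]

theorem Fam.gen_add {X : Fam} {L : Type} [AddCommGroup L] [Module X.R L] (s t : L) : X.gen (s + t) = X.gen s + X.gen t :=
  tmul_add ..

/-- A Lie-* bracket that is compatible with the action of differential operators. -/
structure StarAlg.IsBilin {X : Fam} (B : StarAlg X) : Prop where
  add_left : ∀ b c d g, B.br (b + c) d g = B.br b d g + B.br c d g
  add_right : ∀ b c d g, B.br b (c + d) g = B.br b c g + B.br b d g
  act_left : ∀ b c (P : X.DO) g, B.br (b <• P) c g = B.br b c (X.actR P g)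
  act_right : ∀ b c (P : X.DO) g, B.br b (c <• P) g = B.br b c g <• P

theorem StarAlg.IsBilin.map_br {X : Fam} {B : StarAlg X} (hB : B.IsBilin) {A : ChirAlg X}
    (φ : B.carrier →ₗ[X.DOᵐᵒᵖ] A.carrier) {G : Set B.carrier} (hG : span X.DOᵐᵒᵖ G = ⊤)
    (h : ∀ b ∈ G, ∀ c ∈ G, ∀ g, A.br 1 (φ b) (φ c) g = φ (B.br b c g)) (b c : B.carrier) (g : X.R) :
    A.br 1 (φ b) (φ c) g = φ (B.br b c g) := by
  have hb : b ∈ span X.DOᵐᵒᵖ G := by rw [hG]; trivial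
  have hc : c ∈ span X.DOᵐᵒᵖ G := by rw [hG]; trivial
  have e (b g) : B.br b 0 g = 0 := by simpa using hB.add_right b 0 0 g
  have e' (b g) : B.br 0 b g = 0 := by simpa using hB.add_left 0 0 b g
  induction hb using span_induction generalizing g with
  | zero => rw [map_zero, A.isPre.zero_left, e', map_zero]
  | add b b' _ _ h1 h2 => rw [map_add, A.br_add_left, h1, h2, hB.add_left, map_add]
  | smul P b _ h1 =>
    induction P using MulOpposite.rec' with
    | _ P => rw [map_smul, A.br_one_act_left, hB.act_left, h1]
  | mem b hb =>
    induction hc using span_induction with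
    | zero => rw [map_zero, A.isPre.zero_right, e, map_zero]
    | add b b' _ _ h1 h2 => rw [map_add, A.br_add_right, h1, h2, hB.add_right, map_add]
    | smul P b _ h1 =>
      induction P using MulOpposite.rec' with
      | _ P => rw [map_smul, A.br_one_act_right, hB.act_right, h1, map_smul]
    | mem c hc => exact h b hb c hc g

/-! ### The linear dilaton -/

namespace Fam

variable {X : Fam} (z : X.Coord)

theorem jac_mul (z w v : X.Coord) : jac z v = jac z w * jac w v :=
  (eq_jac (by rw [val_mul, mul_comm, mul_smul, ← d_jac, ← d_jac])).symm

theorem jac_self : jac z z = 1 := (eq_jac (by rw [val_one, one_smul])).symm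

theorem jac_inv (z w : X.Coord) : (jac z w)⁻¹ = jac w z := by
  rw [inv_eq_iff_mul_eq_one, ← jac_mul, jac_self]

/-- The logarithmic differential. -/
def dlog (u : X.Rˣ) : X.Om := ((u⁻¹ : X.Rˣ) : X.R) • X.d (u : X.R)

theorem dlog_mul (u v : X.Rˣ) : dlog (u * v) = dlog u + dlog v := by
  rw [dlog, dlog, dlog, val_mul, leibniz, smul_add, smul_smul, smul_smul, mul_inv, val_mul,
    add_comm, Units.inv_mul_cancel_right, mul_right_comm, Units.inv_mul, one_mul]

theorem dlog_one : dlog (1 : X.Rˣ) = 0 := by rw [dlog, val_one, Derivation.map_one_eq_zero, smul_zero]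

theorem dlog_eq (u : X.Rˣ) : dlog u = (((u⁻¹ : X.Rˣ) : X.R) * ddz z u) • X.d z := by
  rw [dlog, d_eq z, smul_smul]

/-- The section of `F_λ` with the function `1` and the form `0` with respect to the coordinate `z`. -/
def secF (lam : ℂ) (z : X.Coord) : X.F lam :=
  ⟨(1, fun w => -(X.scal (lam / 2) • dlog (jac z w))), fun v w u h => by
    change -(X.scal (lam / 2) • dlog (jac z w)) = -(X.scal (lam / 2) • dlog (jac z v)) - (X.scal (lam / 2) * 1 * _) • _
    rw [eq_jac h, jac_mul z v w, dlog_mul, smul_add, neg_add, sub_eq_add_neg, dlog, dlog, mul_one, mul_smul]⟩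

theorem secF_self (lam : ℂ) (z : X.Coord) : (secF lam z).1.2 z = 0 := by
  change -(X.scal (lam / 2) • dlog (jac z z)) = 0
  rw [jac_self, dlog_one, smul_zero, neg_zero]

theorem F_apply {lam : ℂ} (s : X.F lam) (z w : X.Coord) :
    s.1.2 w = s.1.2 z - (X.scal (lam / 2) * s.1.1) • dlog (jac z w) := by
  rw [s.2 z w _ (d_jac z w), dlog, smul_smul]

theorem F_ext {lam : ℂ} (z : X.Coord) {s t : X.F lam} (h : s.1.1 = t.1.1) (h' : s.1.2 z = t.1.2 z) : s = t :=
  Subtype.ext (Prod.ext h (funext fun w => by rw [F_apply s z w, F_apply t z w, h, h']))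

theorem F_eq {lam : ℂ} (z : X.Coord) (s : X.F lam) : s = s.1.1 • secF lam z + X.inclF lam (s.1.2 z) :=
  F_ext z (by simp [secF, inclF]) (by
    change s.1.2 z = s.1.1 • (secF lam z).1.2 z + s.1.2 z
    rw [secF_self, smul_zero, zero_add])

theorem relF_secF {Y : Fam} (h : Hom X Y) (lam : ℂ) (z : X.Coord) : h.RelF (secF lam z) (secF lam (h.crd z)) := by
  refine ⟨(map_one _).symm, fun w => ?_⟩
  change -(Y.scal (lam / 2) • dlog (jac (h.crd z) (h.crd w))) = h.om (-(X.scal (lam / 2) • dlog (jac z w)))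
  rw [map_neg, map_smulₛₗ, h.fn_scal, dlog, dlog, jac_inv, jac_inv, h.om_smul_d, h.fn_jac, h.fn_jac]

/-- The class of a section of `F_λ` in `B(λ, Q)`. -/
def clsF {lam : ℂ} (s : X.F lam) : X.BDilMod lam := (X.relF lam).mkQ (X.gen s)

theorem clsF_add {lam : ℂ} (s t : X.F lam) : clsF (s + t) = clsF s + clsF t := by
  rw [clsF, gen_add, map_add]; rfl

theorem clsF_smul {lam : ℂ} (r : X.R) (s : X.F lam) : clsF (r • s) = clsF s <• X.fn r := by
  rw [clsF, gen_smul, map_smul]; rfl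

theorem clsF_incl_act {lam : ℂ} (ω : X.Om) (P : X.DO) : clsF (X.inclF lam (ω <• P)) = clsF (X.inclF lam ω) <• P := by
  rw [clsF, clsF, ← map_smul, ← tmul_eq_gen_act, eq_comm, ← sub_eq_zero, ← map_sub]
  exact (mk_eq_zero _).2 (subset_span ⟨P, ω, rfl⟩)

theorem inclF_add (lam : ℂ) (ω η : X.Om) : X.inclF lam (ω + η) = X.inclF lam ω + X.inclF lam η :=
  Subtype.ext (Prod.ext (add_zero 0).symm rfl)

theorem projB_clsF {lam : ℂ} (s : X.F lam) : X.projB lam (clsF s) = X.fn s.1.1 := by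
  change s.1.1 • (1 : X.DO) = _
  rw [smul_DO, mul_one]

variable (X) in
theorem span_BDil (lam : ℂ) (z : X.Coord) :
    span X.DOᵐᵒᵖ (Set.range (fun ω => clsF (X.inclF lam ω)) ∪ {clsF (secF lam z)}) = ⊤ := by
  rw [eq_top_iff]
  rintro x -
  obtain ⟨x, rfl⟩ := mkQ_surjective _ x
  induction x using induction_on with
  | zero => rw [map_zero]; exact zero_mem _
  | add a b ha hb => rw [map_add]; exact add_mem ha hb
  | tmul P s =>
    rw [tmul_eq_gen_act, map_smul]
    refine smul_mem _ _ ?_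
    change clsF s ∈ _
    rw [F_eq z s, clsF_add, clsF_smul]
    exact add_mem (smul_mem _ _ (subset_span (Or.inr rfl)))
      (subset_span (Or.inl ⟨_, rfl⟩))

theorem isBilin_BDil (lam Q : ℂ) : (X.BDil lam Q).IsBilin where
  add_left (b c d : X.BDilMod lam) g := by
    change clsF (X.inclF lam (-(X.scal Q • X.d (X.actR (X.projB lam (b + c)) g)) <• X.projB lam d)) =
      clsF (X.inclF lam (-(X.scal Q • X.d (X.actR (X.projB lam b) g)) <• X.projB lam d)) +
      clsF (X.inclF lam (-(X.scal Q • X.d (X.actR (X.projB lam c) g)) <• X.projB lam d))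
    rw [← clsF_add, ← inclF_add, ← smul_add, map_add, map_add, LinearMap.add_apply, map_add, smul_add, neg_add]
  add_right (b c d : X.BDilMod lam) g := by
    change clsF (X.inclF lam (-(X.scal Q • X.d (X.actR (X.projB lam b) g)) <• X.projB lam (c + d))) =
      clsF (X.inclF lam (-(X.scal Q • X.d (X.actR (X.projB lam b) g)) <• X.projB lam c)) +
      clsF (X.inclF lam (-(X.scal Q • X.d (X.actR (X.projB lam b) g)) <• X.projB lam d))
    rw [← clsF_add, ← inclF_add, map_add, op_add, add_smul]
  act_left (b c : X.BDilMod lam) P g := by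
    change clsF (X.inclF lam (-(X.scal Q • X.d (X.actR (X.projB lam (b <• P)) g)) <• X.projB lam c)) =
      clsF (X.inclF lam (-(X.scal Q • X.d (X.actR (X.projB lam b) (X.actR P g))) <• X.projB lam c))
    rw [map_smul, op_smul_eq_mul, map_mul]; rfl
  act_right (b c : X.BDilMod lam) P g := by
    change clsF (X.inclF lam (-(X.scal Q • X.d (X.actR (X.projB lam b) g)) <• X.projB lam (c <• P))) =
      clsF (X.inclF lam (-(X.scal Q • X.d (X.actR (X.projB lam b) g)) <• X.projB lam c)) <• P
    rw [← clsF_incl_act, map_smul, op_smul_eq_mul, op_mul, mul_smul]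

theorem br_BDil (lam Q : ℂ) (s t : X.F lam) (g : X.R) :
    (X.BDil lam Q).br (clsF s) (clsF t) g = clsF (X.inclF lam (-(t.1.1 • X.scal Q • X.d (s.1.1 * g)))) := by
  change clsF (X.inclF lam (-(X.scal Q • X.d (X.actR (X.projB lam (clsF s)) g)) <• X.projB lam (clsF t))) = _
  rw [projB_clsF, projB_clsF, actR_fn, om_fn, smul_neg]

end Fam

/-- The free field of the linear dilaton. -/
abbrev dilF (Q : ℂ) : FieldData := ⟨Unit, 1, fun _ _ => -Q, fun _ _ => rfl⟩

theorem dilF_par (Q : ℂ) : (((dilF Q).ord + 1 : ℕ) : ZMod 2) = 0 := by change ((2 : ℕ) : ZMod 2) = 0; decide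

section Dil

variable {X : Fam} {A : ChirAlg X} {lam Q : ℂ} (z : X.Coord)

/-- The star map determined by a field. -/
def dilStar (lam : ℂ) (z : X.Coord) (a : A.carrier) : X.BDilMod lam →ₗ[X.DOᵐᵒᵖ] A.carrier :=
  (X.relF lam).liftQ (ChirAlg.indLift
    { toFun := fun s : X.F lam => s.1.1 • a + A.unit (s.1.2 z)
      map_add' := fun s t => by
        change (s.1.1 + t.1.1) • a + A.unit (s.1.2 z + t.1.2 z) = _
        rw [add_smul, map_add]; abel
      map_smul' := fun r s => by
        change (r * s.1.1) • a + A.unit (r • s.1.2 z) = r • _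
        rw [map_smul, mul_smul, smul_add] }) (by
    rw [relF, Submodule.span_le]
    rintro _ ⟨P, ω, rfl⟩
    change ChirAlg.indLift _ _ = 0
    rw [map_sub, ChirAlg.indLift_gen, ChirAlg.indLift_tmul]
    simp [inclF, A.unit_act])

theorem dilStar_cls (a : A.carrier) (s : X.F lam) :
    dilStar lam z a (clsF s) = s.1.1 • a + A.unit (s.1.2 z) := ChirAlg.indLift_gen _ _

theorem dilStar_incl (a : A.carrier) (ω : X.Om) : dilStar lam z a (clsF (X.inclF lam ω)) = A.unit ω := by
  rw [dilStar_cls]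
  change (0 : X.R) • a + A.unit ω = _
  rw [zero_smul, zero_add]

theorem dilStar_sec (a : A.carrier) : dilStar lam z a (clsF (secF lam z)) = a := by
  rw [dilStar_cls, secF_self, map_zero, add_zero]
  exact one_smul _ _

theorem dilStar_br {z : X.Coord} {β : Unit → A.carrier} (H : IsFields (dilF Q) A z β) (s t : X.F lam) (g : X.R) :
    A.br 1 (dilStar lam z (β ()) (clsF s)) (dilStar lam z (β ()) (clsF t)) g =
      A.unit (-(t.1.1 • X.scal Q • X.d (s.1.1 * g))) := by
  have hβ : β () ∈ A.par 0 := dilF_par Q ▸ H.par ()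
  rw [dilStar_cls, dilStar_cls, A.br_add_left, A.br_one_unit_left, add_zero, A.br_add_right,
    A.br_one_unit_right _ (ChirAlg.fsmul_mem hβ _), add_zero, A.isPre.right_smul, A.br_left, A.br_fn1,
    ChirAlg.br_one_of_mode (H.ope () ())]
  change t.1.1 • tc z 1 _ • (-Q) • A.unit (X.d z) = _
  rw [tc_one, d_eq z (s.1.1 * g), map_neg, map_smul, map_smul, map_smul, ← scal_smul,
    smul_comm (X.scal Q), scal_eq, scal_eq, map_neg, neg_smul, smul_neg, smul_neg]

theorem isStarMap_dilStar {z : X.Coord} {β : Unit → A.carrier} (H : IsFields (dilF Q) A z β) :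
    IsStarMap (X.BDil lam Q) A (dilStar lam z (β ())) where
  map_par i (b : X.BDilMod lam) hb := by
    have hβ : β () ∈ A.par 0 := dilF_par Q ▸ H.par ()
    have h0 : dilStar lam z (β ()) b ∈ A.par 0 := by
      have : b ∈ span X.DOᵐᵒᵖ (Set.range (fun ω => clsF (X.inclF lam ω)) ∪ {clsF (secF lam z)}) := by
        rw [span_BDil]; trivial
      clear hb
      induction this using span_induction with
      | zero => rw [map_zero]; exact zero_mem _
      | add b c _ _ h h' => rw [map_add]; exact add_mem h h'
      | smul P b _ h => rw [map_smul]; exact smul_mem _ _ h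
      | mem b hb =>
        rcases hb with ⟨ω, rfl⟩ | rfl
        · rw [dilStar_incl]; exact A.unit_even ω
        · rw [dilStar_sec]; exact hβ
    rcases Mdl.zmod_two i with rfl | rfl
    · exact h0
    · have e : b = 0 := hb
      have e' : dilStar lam z (β ()) b = 0 := by rw [e, map_zero]
      exact e'.symm ▸ zero_mem _
  map_br := (isBilin_BDil lam Q).map_br _ (span_BDil X lam z) (by
    have key (s t : X.F lam) (g : X.R) : A.br 1 (dilStar lam z (β ()) (clsF s)) (dilStar lam z (β ()) (clsF t)) g =
        dilStar lam z (β ()) ((X.BDil lam Q).br (clsF s) (clsF t) g) := by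
      rw [dilStar_br H, br_BDil]
      exact (dilStar_incl z _ _).symm
    rintro _ (⟨ω, rfl⟩ | rfl) _ (⟨η, rfl⟩ | rfl) g
    exacts [key _ _ g, key _ _ g, key _ _ g, key _ _ g])
  map_cent ω := dilStar_incl z _ ω

theorem isFields_of_dilStar {φ : (X.BDil lam Q).carrier →ₗ[X.DOᵐᵒᵖ] A.carrier} (h : IsStarMap (X.BDil lam Q) A φ)
    (z : X.Coord) : IsFields (dilF Q) A z fun _ => φ (clsF (secF lam z)) where
  par _ := (dilF_par Q).symm ▸ h.map_par 0 _ (mem_top (R := X.DOᵐᵒᵖ) (M := X.BDilMod lam))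
  ope _ _ n := by
    have key (g) : A.br 1 (φ (clsF (secF lam z))) (φ (clsF (secF lam z))) g = (ddz z)^[1] g • (-Q) • A.vac z := by
      refine (h.map_br _ _ g).trans ((congrArg φ (br_BDil ..)).trans ((h.map_cent _).trans ?_))
      change A.unit (-((1 : X.R) • X.scal Q • X.d (1 * g))) = ddz z g • (-Q) • A.unit (X.d z)
      rw [one_smul, one_mul, d_eq z g, map_neg, map_smul, map_smul, ← scal_smul, smul_comm, scal_eq,
        scal_eq, map_neg, neg_smul, smul_neg]
    rw [ChirAlg.mode_natCast_of_br_one key, Nat.factorial_one, one_smul]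

theorem dil_apply {φ : (X.BDil lam Q).carrier →ₗ[X.DOᵐᵒᵖ] A.carrier} (h : IsStarMap (X.BDil lam Q) A φ)
    (z : X.Coord) (s : X.F lam) : φ (clsF s) = s.1.1 • φ (clsF (secF lam z)) + A.unit (s.1.2 z) := by
  conv_lhs => rw [F_eq z s, clsF_add, clsF_smul]
  refine (map_add φ _ _).trans ?_
  rw [← A.fn_act]
  exact congrArg₂ _ (map_smul φ _ _) (h.map_cent _)

/-- The system of free fields of the linear dilaton. -/
abbrev dilSys (lam Q : ℂ) : FieldSys where
  F := dilF Q
  B X := X.BDil lam Q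
  e z _ := clsF (secF lam z)
  isFields := isFields_of_dilStar
  exists_star {X A z β} H := ⟨dilStar lam z (β ()), isStarMap_dilStar H, fun _ => dilStar_sec z _⟩
  ext {X A} z φ φ' h h' H := LinearMap.ext_on (span_BDil X lam z) (by
    rintro _ (⟨ω, rfl⟩ | rfl)
    · exact (h.map_cent ω).trans (h'.map_cent ω).symm
    · exact H ())
  natural {X Y h A A' u} hu φ φ' hφ hφ' z w H i := by
    rw [dil_apply hφ z, dil_apply hφ' (h.crd z), hu.add, hu.smul, H i, hu.unit, ← (relF_secF h lam w).1,
      (relF_secF h lam w).2 z]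

/-- The chiral algebra of the linear dilaton as an enveloping algebra of free fields. -/
def DilatonAlg.env (A : DilatonAlg lam Q) : (dilSys lam Q).Env A.alg where
  ι := A.ι
  isEnvelope := A.isEnvelope
  ι_local h z _ := A.ι_local h _ _ (relF_secF h lam z)

theorem nonempty_dilatonAlg (lam Q : ℂ) : Nonempty (DilatonAlg lam Q) := by
  let S := dilSys lam Q
  refine ⟨⟨S.alg, S.env.ι, S.env.isEnvelope, fun {X Y} h s s' hs => ?_⟩⟩
  change S.alg.map h (S.env.ι X (clsF s)) = S.env.ι Y (clsF s')
  rw [dil_apply (S.env.isEnvelope X).isStarMap X.coord₀, dil_apply (S.env.isEnvelope Y).isStarMap (h.crd X.coord₀),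
    (S.alg.isSemi h).add, (S.alg.isSemi h).smul, (S.alg.isSemi h).unit, hs.1, hs.2]
  congr 2
  exact S.env.ι_local h _ ()

end Dil

open ChirAlg (indLift indLift_gen)

/-! ### The bc-system -/

namespace Fam

variable {X : Fam} {n m m' : ℤ} (z : X.Coord)

/-- The section `dzᵐ` of `Ωᵐ`. -/
def powZ (m : ℤ) (z : X.Coord) : X.Pow m := ⟨fun w => ((jac w z ^ m : X.Rˣ) : X.R), fun v w u h => by
  beta_reduce
  rw [eq_jac h, jac_mul v w z, mul_zpow, val_mul]⟩

theorem powZ_apply (m : ℤ) (z w : X.Coord) : (powZ m z).1 w = ((jac w z ^ m : X.Rˣ) : X.R) := rfl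

theorem powZ_self (m : ℤ) (z : X.Coord) : (powZ m z).1 z = 1 := by
  rw [powZ_apply, jac_self, one_zpow, val_one]

theorem Pow_apply (α : X.Pow m) (z w : X.Coord) : α.1 w = ((jac w z ^ m : X.Rˣ) : X.R) * α.1 z := α.2 w z _ (d_jac w z)

theorem Pow_eq (α : X.Pow m) : α = α.1 z • powZ m z :=
  Subtype.ext (funext fun w => by
    change _ = α.1 z * (powZ m z).1 w
    rw [powZ_apply, mul_comm, ← Pow_apply])

theorem relPow_powZ {Y : Fam} (h : Hom X Y) (m : ℤ) (z : X.Coord) : h.RelPow (powZ m z) (powZ m (h.crd z)) := by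
  intro w
  rw [powZ_apply, powZ_apply]
  have : Units.map (h.fn : X.R →* Y.R) (jac w z) = jac (h.crd w) (h.crd z) := Units.ext (h.fn_jac w z)
  rw [← this, ← map_zpow]; rfl

theorem pair_eq (hm : m + m' = 1) (α : X.Pow m) (β : X.Pow m') (z : X.Coord) : X.pair α β = (α.1 z * β.1 z) • X.d z := by
  rw [pair, Pow_apply α z X.coord₀, Pow_apply β z X.coord₀, d_jac X.coord₀ z, smul_smul]
  congr 1
  have : ((jac X.coord₀ z ^ m : X.Rˣ) : X.R) * ((jac X.coord₀ z ^ m' : X.Rˣ) : X.R) = jac X.coord₀ z := by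
    rw [← val_mul, ← zpow_add, hm, zpow_one]
  rw [← this]; ring

theorem evPow_act (g : X.R) (x : X.Ind (X.Pow m)) (P : X.DO) : X.evPow g (x <• P) = X.evPow (X.actR P g) x := by
  induction x using induction_on with
  | zero => rw [smul_zero, map_zero, map_zero]
  | add a b ha hb => rw [smul_add, map_add, ha, hb, map_add]
  | tmul Q α =>
    change X.actR (Q * P) g • α = X.actR Q (X.actR P g) • α
    rw [map_mul]; rfl

theorem evPow_gen (g : X.R) (α : X.Pow m) : X.evPow g (X.gen α) = g • α := by
  change X.actR 1 g • α = _
  rw [map_one]; rfl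

theorem pairD_act (α : X.Pow m) (y : X.Ind (X.Pow m')) (P : X.DO) : X.pairD α (y <• P) = X.pairD α y <• P := by
  induction y using induction_on with
  | zero => rw [smul_zero, map_zero, smul_zero]
  | add a b ha hb => rw [smul_add, map_add, ha, hb, map_add, smul_add]
  | tmul Q β =>
    change X.pair α β <• (Q * P) = (X.pair α β <• Q) <• P
    rw [op_mul, mul_smul]

theorem pairD_gen (α : X.Pow m) (β : X.Pow m') : X.pairD α (X.gen β) = X.pair α β := by
  change X.pair α β <• (1 : X.DO) = _
  rw [op_one, one_smul]

theorem pairD_add_left (α α' : X.Pow m) (y : X.Ind (X.Pow m')) : X.pairD (α + α') y = X.pairD α y + X.pairD α' y := by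
  induction y using induction_on with
  | zero => rw [map_zero, map_zero, map_zero, add_zero]
  | add a b ha hb => rw [map_add, map_add, map_add, ha, hb]; abel
  | tmul Q β =>
    change X.pair (α + α') β <• Q = X.pair α β <• Q + X.pair α' β <• Q
    rw [← smul_add]
    congr 1
    simp [pair, add_mul, add_smul]

theorem pairD_zero_left (y : X.Ind (X.Pow m')) : X.pairD (0 : X.Pow m) y = 0 := by
  simpa using pairD_add_left (0 : X.Pow m) 0 y

variable (X n) in
/-- The summand `Ωⁿ ⊗ D` of `B_bc(n)`. -/
def inB : X.Ind (X.Pow n) →ₗ[X.DOᵐᵒᵖ] (X.BBC n).carrier :=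
  LinearMap.inr X.DOᵐᵒᵖ X.Om (X.Ind (X.Pow n) × X.Ind (X.Pow (1 - n))) ∘ₗ LinearMap.inl ..

variable (X n) in
/-- The summand `Ω¹⁻ⁿ ⊗ D` of `B_bc(n)`. -/
def inC : X.Ind (X.Pow (1 - n)) →ₗ[X.DOᵐᵒᵖ] (X.BBC n).carrier :=
  LinearMap.inr X.DOᵐᵒᵖ X.Om (X.Ind (X.Pow n) × X.Ind (X.Pow (1 - n))) ∘ₗ LinearMap.inr ..

/-- The fields of the bc-system with respect to the coordinate `z`. -/
def bcE (n : ℤ) (z : X.Coord) : Bool → (X.BBC n).carrier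
  | true => inB X n (X.gen (powZ n z))
  | false => inC X n (X.gen (powZ (1 - n) z))

theorem inB_gen (α : X.Pow n) : inB X n (X.gen α) = bcE n z true <• X.fn (α.1 z) := by
  conv_lhs => rw [Pow_eq z α, gen_smul, map_smul]
  rfl

theorem inC_gen (α : X.Pow (1 - n)) : inC X n (X.gen α) = bcE n z false <• X.fn (α.1 z) := by
  conv_lhs => rw [Pow_eq z α, gen_smul, map_smul]
  rfl

theorem BBC_eq (b : (X.BBC n).carrier) : b = (X.BBC n).cent b.1 + (inB X n b.2.1 + inC X n b.2.2) := by
  have (b : X.Om × X.Ind (X.Pow n) × X.Ind (X.Pow (1 - n))) : b = (b.1, 0, 0) + ((0, b.2.1, 0) + (0, 0, b.2.2)) :=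
    Prod.ext (by simp) (Prod.ext (by simp) (by simp))
  exact this b

theorem ind_mem {M : Type} [AddCommGroup M] [Module X.DOᵐᵒᵖ M] (f : X.Ind (X.Pow m) →ₗ[X.DOᵐᵒᵖ] M)
    {N : Submodule X.DOᵐᵒᵖ M} (z : X.Coord) (h : f (X.gen (powZ m z)) ∈ N) (x) : f x ∈ N := by
  induction x using induction_on with
  | zero => rw [map_zero]; exact zero_mem _
  | add a b ha hb => rw [map_add]; exact add_mem ha hb
  | tmul P α =>
    rw [tmul_eq_gen_act, map_smul, Pow_eq z α, gen_smul, map_smul]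
    exact N.smul_mem _ (N.smul_mem _ h)

variable (X) in
theorem span_BBC (n : ℤ) (z : X.Coord) :
    span X.DOᵐᵒᵖ (Set.range (X.BBC n).cent ∪ Set.range (bcE n z)) = ⊤ := by
  rw [eq_top_iff]
  rintro b -
  rw [BBC_eq b]
  exact add_mem (subset_span (Or.inl ⟨_, rfl⟩))
    (add_mem (ind_mem (inB X n) z (subset_span (Or.inr ⟨true, rfl⟩)) _)
      (ind_mem (inC X n) z (subset_span (Or.inr ⟨false, rfl⟩)) _))

theorem br_BBC (b c : (X.BBC n).carrier) (g : X.R) : (X.BBC n).br b c g =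
    (X.BBC n).cent (X.pairD (X.evPow g b.2.1) c.2.2 + X.pairD (X.evPow g b.2.2) c.2.1) := rfl

theorem BBC_cent_add (ω η : X.Om) : (X.BBC n).cent (ω + η) = (X.BBC n).cent ω + (X.BBC n).cent η :=
  Prod.ext rfl (Prod.ext (add_zero 0).symm (add_zero 0).symm)

theorem BBC_cent_act (ω : X.Om) (P : X.DO) : (X.BBC n).cent (ω <• P) = (X.BBC n).cent ω <• P :=
  Prod.ext rfl (Prod.ext (smul_zero _).symm (smul_zero _).symm)

theorem isBilin_BBC (n : ℤ) : (X.BBC n).IsBilin where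
  add_left b c d g := by
    rw [br_BBC, br_BBC, br_BBC, ← BBC_cent_add]
    congr 1
    change X.pairD (X.evPow g (b.2.1 + c.2.1)) d.2.2 + X.pairD (X.evPow g (b.2.2 + c.2.2)) d.2.1 = _
    rw [map_add, map_add, pairD_add_left, pairD_add_left]; abel
  add_right b c d g := by
    rw [br_BBC, br_BBC, br_BBC, ← BBC_cent_add]
    congr 1
    change X.pairD (X.evPow g b.2.1) (c.2.2 + d.2.2) + X.pairD (X.evPow g b.2.2) (c.2.1 + d.2.1) = _
    rw [map_add, map_add]; abel
  act_left b c P g := by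
    rw [br_BBC, br_BBC]
    congr 1
    change X.pairD (X.evPow g (b.2.1 <• P)) c.2.2 + X.pairD (X.evPow g (b.2.2 <• P)) c.2.1 = _
    rw [evPow_act, evPow_act]
  act_right b c P g := by
    rw [br_BBC, br_BBC, ← BBC_cent_act]
    congr 1
    change X.pairD (X.evPow g b.2.1) (c.2.2 <• P) + X.pairD (X.evPow g b.2.2) (c.2.1 <• P) = _
    rw [pairD_act, pairD_act, smul_add]

theorem BBC_cent_zero : (X.BBC n).cent 0 = 0 := rfl

theorem br_cent_left (ω : X.Om) (b : (X.BBC n).carrier) (g : X.R) : (X.BBC n).br ((X.BBC n).cent ω) b g = 0 := by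
  rw [br_BBC]
  change (X.BBC n).cent (X.pairD (X.evPow g 0) b.2.2 + X.pairD (X.evPow g 0) b.2.1) = 0
  rw [map_zero, map_zero, pairD_zero_left, pairD_zero_left, add_zero, BBC_cent_zero]

theorem br_cent_right (ω : X.Om) (b : (X.BBC n).carrier) (g : X.R) : (X.BBC n).br b ((X.BBC n).cent ω) g = 0 := by
  rw [br_BBC]
  change (X.BBC n).cent (X.pairD (X.evPow g b.2.1) 0 + X.pairD (X.evPow g b.2.2) 0) = 0
  rw [map_zero, map_zero, add_zero, BBC_cent_zero]

theorem br_bcE (n : ℤ) (z : X.Coord) (i j : Bool) (g : X.R) :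
    (X.BBC n).br (bcE n z i) (bcE n z j) g = (X.BBC n).cent (if i = j then 0 else g • X.d z) := by
  rw [br_BBC]
  congr 1
  cases i <;> cases j
  · change X.pairD (X.evPow g 0) (X.gen (powZ (1 - n) z)) + X.pairD (X.evPow g (X.gen (powZ (1 - n) z))) 0 = 0
    rw [map_zero, map_zero, pairD_zero_left, add_zero]
  · change X.pairD (X.evPow g 0) 0 + X.pairD (X.evPow g (X.gen (powZ (1 - n) z))) (X.gen (powZ n z)) = g • X.d z
    rw [map_zero, zero_add, evPow_gen, pairD_gen, pair_eq (by ring) _ _ z, powZ_self]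
    change ((g * (powZ (1 - n) z).1 z) * 1) • X.d z = _
    rw [powZ_self, mul_one, mul_one]
  · change X.pairD (X.evPow g (X.gen (powZ n z))) (X.gen (powZ (1 - n) z)) + X.pairD (X.evPow g 0) 0 = g • X.d z
    rw [map_zero, add_zero, evPow_gen, pairD_gen, pair_eq (by ring) _ _ z, powZ_self]
    change ((g * (powZ n z).1 z) * 1) • X.d z = _
    rw [powZ_self, mul_one, mul_one]
  · change X.pairD (X.evPow g (X.gen (powZ n z))) 0 + X.pairD (X.evPow g 0) (X.gen (powZ n z)) = 0
    rw [map_zero, map_zero, pairD_zero_left, add_zero]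

theorem bcE_mem (n : ℤ) (z : X.Coord) (i : Bool) : bcE n z i ∈ (X.BBC n).par 1 := by
  change _ ∈ Submodule.prod (⊥ : Submodule X.DOᵐᵒᵖ X.Om) (⊤ : Submodule X.DOᵐᵒᵖ (X.Ind (X.Pow n) × X.Ind (X.Pow (1 - n))))
  cases i <;> exact ⟨rfl, trivial⟩

end Fam

/-- The free fields of the bc-system. -/
abbrev bcF : FieldData := ⟨Bool, 0, fun i j => if i = j then 0 else 1, fun i j => by simp only [eq_comm]⟩

theorem bcF_par : ((bcF.ord + 1 : ℕ) : ZMod 2) = 1 := by change ((1 : ℕ) : ZMod 2) = 1; decide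

section BC

variable {X : Fam} {A : ChirAlg X} {n : ℤ} (z : X.Coord)

/-- The `𝒪`-linear map from `Ωᵐ` that sends `dzᵐ` to `a`. -/
def powMap (m : ℤ) (z : X.Coord) (a : A.carrier) : X.Pow m →ₗ[X.R] A.carrier where
  toFun α := α.1 z • a
  map_add' α β := add_smul (α.1 z) (β.1 z) a
  map_smul' r α := mul_smul r (α.1 z) a

variable (A) in
/-- The unit as a map of `D`-modules. -/
def unitD : X.Om →ₗ[X.DOᵐᵒᵖ] A.carrier where
  toFun := A.unit
  map_add' := map_add _
  map_smul' P ω := A.unit_act ω P.unop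

/-- The star map determined by two fields. -/
def bcStar (n : ℤ) (z : X.Coord) (β : Bool → A.carrier) : (X.BBC n).carrier →ₗ[X.DOᵐᵒᵖ] A.carrier :=
  coprod (unitD A)
    (coprod (indLift (powMap n z (β true))) (indLift (powMap (1 - n) z (β false))))

theorem bcStar_cent (β : Bool → A.carrier) (ω : X.Om) : bcStar n z β ((X.BBC n).cent ω) = A.unit ω := by
  change A.unit ω + (indLift (powMap n z (β true)) 0 + indLift (powMap (1 - n) z (β false)) 0) = _
  rw [map_zero, map_zero, add_zero, add_zero]

theorem bcStar_bcE (β : Bool → A.carrier) (i : Bool) : bcStar n z β (bcE n z i) = β i := by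
  cases i
  · change A.unit 0 + (indLift (powMap n z (β true)) 0 + indLift (powMap (1 - n) z (β false)) (X.gen (powZ (1 - n) z))) = _
    rw [map_zero, map_zero, indLift_gen, zero_add, zero_add]
    change (powZ (1 - n) z).1 z • β false = _
    rw [powZ_self, one_smul]
  · change A.unit 0 + (indLift (powMap n z (β true)) (X.gen (powZ n z)) + indLift (powMap (1 - n) z (β false)) 0) = _
    rw [map_zero, map_zero, indLift_gen, zero_add, add_zero]
    change (powZ n z).1 z • β true = _
    rw [powZ_self, one_smul]

theorem isStarMap_bcStar {z : X.Coord} {β : Bool → A.carrier} (H : IsFields bcF A z β) :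
    IsStarMap (X.BBC n) A (bcStar n z β) := by
  have hβ (i) : β i ∈ A.par 1 := bcF_par ▸ H.par i
  refine ⟨fun i b hb => ?_, (isBilin_BBC n).map_br _ (span_BBC X n z) ?_, bcStar_cent z β⟩
  · rcases Mdl.zmod_two i with rfl | rfl
    · have e : b.2 = 0 := hb.2
      rw [BBC_eq b, e]
      change bcStar n z β ((X.BBC n).cent b.1 + (inB X n 0 + inC X n 0)) ∈ _
      rw [map_zero, map_zero, add_zero, add_zero, bcStar_cent]
      exact A.unit_even _
    · have e : b.1 = 0 := hb.1
      rw [BBC_eq b, e, BBC_cent_zero, zero_add, map_add]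
      refine add_mem (ind_mem (bcStar n z β ∘ₗ inB X n) z ?_ _) (ind_mem (bcStar n z β ∘ₗ inC X n) z ?_ _)
      · exact (bcStar_bcE (n := n) z β true).symm ▸ hβ true
      · exact (bcStar_bcE (n := n) z β false).symm ▸ hβ false
  · rintro _ (⟨ω, rfl⟩ | ⟨i, rfl⟩) _ (⟨η, rfl⟩ | ⟨j, rfl⟩) g
    · rw [br_cent_left, bcStar_cent, A.br_one_unit_left, map_zero]
    · rw [br_cent_left, bcStar_cent, A.br_one_unit_left, map_zero]
    · rw [br_cent_right, bcStar_cent, bcStar_bcE, A.br_one_unit_right _ (hβ i), map_zero]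
    · rw [br_bcE, bcStar_cent, bcStar_bcE, bcStar_bcE, ChirAlg.br_one_of_mode (H.ope i j), tc_zero]
      change g • (if i = j then (0 : ℂ) else 1) • A.unit (X.d z) = _
      split_ifs
      · rw [zero_smul, smul_zero, map_zero]
      · rw [one_smul, map_smul]

theorem isFields_of_bcStar {φ : (X.BBC n).carrier →ₗ[X.DOᵐᵒᵖ] A.carrier} (h : IsStarMap (X.BBC n) A φ)
    (z : X.Coord) : IsFields bcF A z fun i => φ (bcE n z i) where
  par i := bcF_par.symm ▸ h.map_par 1 _ (bcE_mem n z i)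
  ope i j k := by
    have key (g) : A.br 1 (φ (bcE n z i)) (φ (bcE n z j)) g =
        (ddz z)^[0] g • (if i = j then (0 : ℂ) else 1) • A.vac z := by
      rw [h.map_br, br_bcE, h.map_cent]
      change _ = g • _
      split_ifs
      · rw [zero_smul, smul_zero, map_zero]
      · rw [one_smul, map_smul]
    rw [ChirAlg.mode_natCast_of_br_one key, Nat.factorial_zero, one_smul]

theorem bc_apply_true (φ : (X.BBC n).carrier →ₗ[X.DOᵐᵒᵖ] A.carrier) (z : X.Coord) (α : X.Pow n) :
    φ (inB X n (X.gen α)) = α.1 z • φ (bcE n z true) := by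
  rw [inB_gen z, map_smul, A.fn_act]

theorem bc_apply_false (φ : (X.BBC n).carrier →ₗ[X.DOᵐᵒᵖ] A.carrier) (z : X.Coord) (α : X.Pow (1 - n)) :
    φ (inC X n (X.gen α)) = α.1 z • φ (bcE n z false) := by
  rw [inC_gen z, map_smul, A.fn_act]

/-- The system of free fields of the bc-system. -/
abbrev bcSys (n : ℤ) : FieldSys where
  F := bcF
  B X := X.BBC n
  e := bcE n
  isFields := isFields_of_bcStar
  exists_star {X A z β} H := ⟨bcStar n z β, isStarMap_bcStar H, bcStar_bcE z β⟩
  ext {X A} z φ φ' h h' H := LinearMap.ext_on (span_BBC X n z) (by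
    rintro _ (⟨ω, rfl⟩ | ⟨i, rfl⟩)
    · exact (h.map_cent ω).trans (h'.map_cent ω).symm
    · exact H i)
  natural {X Y h A A' u} hu φ φ' hφ hφ' z w H i := by
    cases i
    · change u (φ (inC X n (X.gen _))) = φ' (inC Y n (Y.gen _))
      rw [bc_apply_false φ z, bc_apply_false φ' (h.crd z), hu.smul, H, relPow_powZ h]
    · change u (φ (inB X n (X.gen _))) = φ' (inB Y n (Y.gen _))
      rw [bc_apply_true φ z, bc_apply_true φ' (h.crd z), hu.smul, H, relPow_powZ h]

/-- The chiral algebra of the bc-system as an enveloping algebra of free fields. -/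
def BCAlg.env (C : BCAlg n) : (bcSys n).Env C.alg where
  ι := C.ι
  isEnvelope := C.isEnvelope
  ι_local h z i := by
    cases i
    · exact C.ι_local₂ h _ _ (relPow_powZ h _ z)
    · exact C.ι_local₁ h _ _ (relPow_powZ h _ z)

theorem nonempty_bcAlg (n : ℤ) : Nonempty (BCAlg n) := by
  let S := bcSys n
  refine ⟨⟨S.alg, S.env.ι, S.env.isEnvelope, fun {X Y} h α α' hα => ?_, fun {X Y} h α α' hα => ?_⟩⟩
  · change S.alg.map h (S.env.ι X (inB X n (X.gen α))) = S.env.ι Y (inB Y n (Y.gen α'))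
    rw [bc_apply_true _ X.coord₀, bc_apply_true _ (h.crd X.coord₀), (S.alg.isSemi h).smul, hα]
    congr 1
    exact S.env.ι_local h _ true
  · change S.alg.map h (S.env.ι X (inC X n (X.gen α))) = S.env.ι Y (inC Y n (Y.gen α'))
    rw [bc_apply_false _ X.coord₀, bc_apply_false _ (h.crd X.coord₀), (S.alg.isSemi h).smul, hα]
    congr 1
    exact S.env.ι_local h _ false

end BC

namespace Fam

variable {X : Fam} (z : X.Coord)

/-- The expansion of `(z(x) - z(y)) / (w(x) - w(y))` in powers of `z(x) - z(y)`. -/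
def invSer (z w : X.Coord) : PowerSeries X.R :=
  PowerSeries.invOfUnit (PowerSeries.mk fun n => tc z (n + 1) w) (jac z w)

theorem mul_invSer (z w : X.Coord) : (PowerSeries.mk fun n => tc z (n + 1) (w : X.R)) * invSer z w = 1 :=
  PowerSeries.mul_invOfUnit _ _ (by
    rw [← coeff_zero_eq_constantCoeff_apply, coeff_mk, zero_add, tc_one]; rfl)

theorem tau_dk_inv (z w : X.Coord) :
    tau z δ[w,-1] = single (-1) 1 * ofPowerSeries ℤ X.R (invSer z w) := by
  have h1 : tau z (dk w : X.Kˣ) =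
      single 1 1 * ofPowerSeries ℤ X.R (PowerSeries.mk fun n => tc z (n + 1) (w : X.R)) := by
    rw [dk_val, tau_algebraMap, ← ofPowerSeries_X, ← map_mul]
    congr 1
    ext n
    rw [diag, map_sub, tauR_tmul, tauR_tmul, map_one, mul_one, map_one, one_mul, map_sub, coeff_taylor]
    cases n with
    | zero => simp [tc_zero]
    | succ n => rw [coeff_succ_X_mul, coeff_mk, coeff_C, if_neg (by omega), sub_zero]
  have h2 : tau z δ[w,-1] * tau z (dk w : X.Kˣ) = 1 := by
    rw [← map_mul, ← val_mul, zpow_neg_one, inv_mul_cancel, val_one, map_one]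
  have h3 : tau z (dk w : X.Kˣ) * (single (-1) 1 * ofPowerSeries ℤ X.R (invSer z w)) = 1 := by
    rw [h1, mul_mul_mul_comm, ← map_mul, mul_invSer, map_one (ofPowerSeries ℤ X.R),
      mul_one, single_mul_single]
    simp
  rw [← mul_one (tau z δ[w,-1]), ← h3, ← mul_assoc, h2, one_mul]

theorem coeff_invSer_zero (z w : X.Coord) : coeff 0 (invSer z w) = ((jac z w)⁻¹ : X.Rˣ) := by
  rw [invSer, coeff_zero_eq_constantCoeff_apply, PowerSeries.constantCoeff_invOfUnit]

theorem tc_two (f : X.R) : tc z 2 f = (2⁻¹ : ℂ) • ddz z (ddz z f) := by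
  simp [tc]

theorem tc_three (f : X.R) : tc z 3 f = (6⁻¹ : ℂ) • ddz z (ddz z (ddz z f)) := by
  simp [tc, Nat.factorial]

theorem coeff_mul_invSer (z w : X.Coord) (n : ℕ) : ∑ k ∈ range (n + 1),
    tc z (k + 1) (w : X.R) * coeff (n - k) (invSer z w) = if n = 0 then 1 else 0 := by
  have h := congrArg (coeff n) (mul_invSer z w)
  rw [coeff_mul, coeff_one, Finset.Nat.sum_antidiagonal_eq_sum_range_succ
    (fun i j => coeff i (PowerSeries.mk fun n => tc z (n + 1) (w : X.R)) *
      coeff j (invSer z w))] at h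
  simpa only [coeff_mk] using h

theorem coeff_invSer_one (z w : X.Coord) : coeff 1 (invSer z w) =
    -((2⁻¹ : ℂ) • (((jac z w)⁻¹ : X.Rˣ) ^ 2 * ddz z (jac z w))) := by
  have h := coeff_mul_invSer z w 1
  simp only [sum_range_succ, Finset.sum_range_zero, zero_add, Nat.reduceAdd, Nat.reduceSub, tc_one, tc_two, coeff_invSer_zero,
    one_ne_zero, if_false] at h
  change (jac z w : X.R) * _ + (2⁻¹ : ℂ) • ddz z (jac z w) * _ = 0 at h
  have hu := (jac z w).mul_inv
  generalize ddz z (jac z w) = u' at *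
  generalize coeff 1 (invSer z w) = a at *
  generalize (((jac z w)⁻¹ : X.Rˣ) : X.R) = v at *
  generalize (jac z w : X.R) = u at *
  simp only [smul_def] at *
  linear_combination v * h - a * hu

theorem coeff_invSer_two (z w : X.Coord) : coeff 2 (invSer z w) =
    (4⁻¹ : ℂ) • (((jac z w)⁻¹ : X.Rˣ) ^ 3 * ddz z (jac z w) ^ 2) -
      (6⁻¹ : ℂ) • (((jac z w)⁻¹ : X.Rˣ) ^ 2 * ddz z (ddz z (jac z w))) := by
  have h := coeff_mul_invSer z w 2
  simp only [sum_range_succ, Finset.sum_range_zero, zero_add, Nat.reduceAdd, Nat.reduceSub, tc_one, tc_two, tc_three, coeff_invSer_zero, coeff_invSer_one,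
    two_ne_zero, if_false] at h
  change (jac z w : X.R) * _ + (2⁻¹ : ℂ) • ddz z (jac z w) * _ +
    (6⁻¹ : ℂ) • ddz z (ddz z (jac z w)) * _ = 0 at h
  have hu := (jac z w).mul_inv
  have e4 : algebraMap ℂ X.R 4⁻¹ = algebraMap ℂ X.R 2⁻¹ * algebraMap ℂ X.R 2⁻¹ := by rw [← map_mul]; norm_num
  generalize ddz z (ddz z (jac z w)) = u'' at *
  generalize ddz z (jac z w) = u' at *
  generalize coeff 2 (invSer z w) = a at *
  generalize (((jac z w)⁻¹ : X.Rˣ) : X.R) = v at *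
  generalize (jac z w : X.R) = u at *
  simp only [smul_def] at *
  linear_combination v * h - a * hu - v ^ 3 * u' ^ 2 * e4

end Fam

namespace ChirAlg

variable {X : Fam} {A : ChirAlg X}

theorem br_inv_mul (z w : X.Coord) (q : X.RR) {a b : A.carrier} {N : ℕ} (hN : ∀ n : ℕ, N ≤ n → A.mode z n a b = 0) :
    A.br (δ[w,-1] * algebraMap X.RR X.K q) a b 1 = ∑ k ∈ range (N + 1),
      coeff k (invSer z w * tauR z q) • A.br δ[z,((k : ℤ) + -1)] a b 1 := by
  rw [A.isPre.eq_lpair z, map_one, mul_one, map_mul, tau_dk_inv, tau_algebraMap, mul_assoc, ← map_mul,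
    lpair_single_mul, lpair_ofPowerSeries (N := N + 1)]
  intro n hn
  have := hN (n - 1) (by omega)
  rwa [ChirAlg.mode, show ((n - 1 : ℕ) : ℤ) = n + -1 by omega] at this

end ChirAlg

/-! ### Quadratic elements of the Fock spaces -/

theorem bsum_single {W : Type} [AddCommGroup W] {f : ℕ → W} (m : ℤ) (k : ℕ) (h : ∀ j, j ≠ k → f j = 0) :
    bsum m f = Ring.choose m k • f k :=
  finsum_eq_single _ k fun j hj => by rw [h j hj, smul_zero]

namespace FieldData

variable (F : FieldData)

theorem phi_neg_one (i) (v : F.Fock) : F.phi i (-1) v = F.cr (i, 0) * v := rfl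
theorem phi_neg_two (i) (v : F.Fock) : F.phi i (-2) v = F.cr (i, 1) * v := rfl

theorem an_field (i m) (l) : F.an i m (F.cr (l, 0)) = if m = F.ord then F.g i l • 1 else 0 := by
  rw [an_cr, contr]
  by_cases h : m = F.ord
  · rw [if_pos h, if_pos (by rw [negSucc_eq]; omega), h, choose_natCast, Nat.choose_self, Nat.cast_one,
      Int.cast_one, mul_one]
  · rw [if_neg h, if_neg (by rw [negSucc_eq]; omega), zero_smul]

theorem md_phi_field (i j l) (p : ℤ) (n : ℕ) : F.md n (F.phi i p (F.cr (j, 0))) (F.cr (l, 0)) =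
    (if n ≤ F.ord then Ring.choose p (F.ord - n) • sg (F.ord - n : ℕ) • F.g j l • F.phi i (p - (F.ord - n : ℕ)) 1 else 0) -
      sg p • Ring.choose p F.ord • sg F.ord • F.eps • F.g i l • F.phi j (p + n - F.ord) 1 := by
  rw [md_phi]
  congr 1
  · have e (k : ℕ) : sg k • F.phi i (p - k) (F.md (n + k) (F.cr (j, 0)) (F.cr (l, 0))) =
        if n + k = F.ord then sg k • F.g j l • F.phi i (p - k) 1 else 0 := by
      rw [md_cr_left, show (n : ℤ) + k = (n + k : ℕ) by push_cast; rfl, phi_natCast, an_field]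
      split_ifs <;> simp
    rw [bsum_congr _ e]
    split_ifs with h
    · rw [bsum_single _ (F.ord - n) fun k hk => if_neg (by omega), if_pos (by omega)]
    · rw [bsum_congr _ (g := fun _ => 0) fun k => if_neg (by omega), bsum_zero_fun]
  · rw [bsum_single _ F.ord fun k hk => by rw [an_field, if_neg hk, map_zero, smul_zero], an_field, if_pos rfl, theta_cr,
      map_smul, map_smul, LinearMap.smul_apply, md_cr_left, smul_comm F.eps]

end FieldData

/-- The product `:bc:` in the Fock space of the bc-system. -/
def bcJ : bcF.Fock := bcF.cr (true, 0) * bcF.cr (false, 0)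

theorem bcF_eps : bcF.eps = -1 := by norm_num [FieldData.eps]

theorem theta_bcJ : bcF.theta bcJ = bcJ := by
  rw [bcJ, bcF.theta_cr_mul, bcF.theta_cr, bcF_eps, mul_smul_comm, smul_smul]; norm_num

theorem bcJ_an (l : Bool) (m : ℕ) : bcF.an l m bcJ = if m = 0 then (if l then (-1 : ℂ) else 1) • bcF.cr (l, 0) else 0 := by
  rw [bcJ, bcF.an_cr_mul, bcF.an_field, bcF_eps, contr]
  cases m <;> cases l <;> simp [negSucc_eq, Nat.cast_add_one_ne_zero]

theorem bcJ_md_field (l : Bool) (n : ℕ) : bcF.md n bcJ (bcF.cr (l, 0)) =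
    if n = 0 then (if l then (1 : ℂ) else -1) • bcF.cr (l, 0) else 0 := by
  have h := bcF.md_phi_field true false l (-1) n
  rw [bcF.phi_neg_one] at h
  change bcF.md n bcJ _ = _ at h
  cases n with
  | zero => cases l <;> simpa [sg, bcF_eps, show bcF.ord = 0 from rfl, FieldData.phi_neg_one] using h
  | succ n => cases l <;> simpa [sg, bcF_eps, show bcF.ord = 0 from rfl, phi_natCast] using h

theorem bcJ_md_cr_mul (l : Bool) (n : ℤ) (v : bcF.Fock) : bcF.md n bcJ (bcF.cr (l, 0) * v) =
    bcF.cr (l, 0) * bcF.md n bcJ v + (if l then (1 : ℂ) else -1) • bcF.phi l (n - 1) v := by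
  rw [bcF.md_cr_mul, theta_bcJ, bsum_single _ 0 fun j hj => by rw [bcJ_an, if_neg hj, map_zero, LinearMap.zero_apply],
    bcJ_an, if_pos rfl, map_smul, LinearMap.smul_apply, bcF.md_cr_left, Ring.choose_zero_right, one_smul,
    show negSucc 0 + n - ((0 : ℕ) : ℤ) = n - 1 by rw [negSucc_eq]; push_cast; ring]
  cases l <;> simp [sub_eq_add_neg]

theorem bcJ_md_bcJ (n : ℕ) : bcF.md n bcJ bcJ = if n = 1 then 1 else 0 := by
  conv_lhs => rw [bcJ]
  change bcF.md n bcJ (bcF.cr (true, 0) * bcF.cr (false, 0)) = _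
  rw [bcJ_md_cr_mul, bcJ_md_field]
  match n with
  | 0 => simp [FieldData.phi_neg_one]
  | 1 =>
    rw [show ((1 : ℕ) : ℤ) - 1 = (0 : ℕ) by simp, bcF.phi_natCast, bcF.an_field]
    simp
  | n + 2 =>
    rw [show ((n + 2 : ℕ) : ℤ) - 1 = (n + 1 : ℕ) by push_cast; ring, bcF.phi_natCast, bcF.an_field]
    simp

theorem bcF_cr_self (p) (v : bcF.Fock) : bcF.cr p * (bcF.cr p * v) = 0 := by
  have h := congrArg (· * v) (bcF.cr_comm p p)
  beta_reduce at h
  rw [bcF_eps, smul_mul_assoc, mul_assoc] at h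
  have h2 : (2 : ℂ) • (bcF.cr p * (bcF.cr p * v)) = 0 := by linear_combination (norm := module) h
  exact (smul_eq_zero.1 h2).resolve_left two_ne_zero

theorem bcJ_md_neg_one : bcF.md (-1) bcJ bcJ =
    bcF.phi true (-2) (bcF.cr (false, 0)) + bcF.phi false (-2) (bcF.cr (true, 0)) := by
  have h1 := bcJ_md_cr_mul false (-1) 1
  have h2 : bcF.cr (false, 0) * bcJ = 0 := by
    rw [bcJ, bcF.cr_comm (true, 0), mul_smul_comm, bcF_cr_self, smul_zero]
  rw [mul_one, FieldData.md_neg_one_one, h2, zero_add, if_neg Bool.false_ne_true, show (-1 : ℤ) - 1 = -2 from rfl,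
    bcF.phi_neg_two, mul_one] at h1
  conv_lhs => arg 2; rw [bcJ]
  rw [bcJ_md_cr_mul, h1, if_pos rfl, show (-1 : ℤ) - 1 = -2 from rfl, bcF.phi_neg_two, bcF.phi_neg_two, mul_smul_comm,
    bcF.cr_comm (true, 0) (false, 1), bcF_eps]
  module

open FieldData (phi_neg_one)

/-! ### The fermion number current -/

namespace Fam

variable {X : Fam} (z : X.Coord)

theorem dlog_zpow (u : X.Rˣ) (n : ℤ) : dlog (u ^ n) = (n : ℂ) • dlog u := by
  have h := map_zpow ({ toFun := fun u => Multiplicative.ofAdd (dlog u)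
                        map_one' := congrArg _ dlog_one
                        map_mul' := fun u v => congrArg _ (dlog_mul u v) } : X.Rˣ →* Multiplicative X.Om) u n
  rw [cast_smul_eq_zsmul]
  exact h

theorem dlog_inv (u : X.Rˣ) : dlog u⁻¹ = - dlog u :=
  eq_neg_of_add_eq_zero_left (by rw [← dlog_mul, inv_mul_cancel, dlog_one])

theorem pole_eq (p : X.RR) : X.pole z p = δ[z,-1] * algebraMap X.RR X.K p := by
  rw [zpow_neg_one, Units.inv_eq_of_mul_eq_one_left (Mdl.pole_one z), pole, pole, ← Localization.mk_one_eq_algebraMap,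
    Localization.mk_mul, one_mul, mul_one]

theorem ddz_zpow (u : X.Rˣ) (n : ℤ) :
    ddz z ((u ^ n : X.Rˣ) : X.R) = (n : ℂ) • (((u ^ n : X.Rˣ) : X.R) * ((u⁻¹ : X.Rˣ) : X.R) * ddz z u) := by
  have h := dlog_zpow u n
  rw [dlog_eq z, dlog_eq z, ← algebraMap_smul X.R (n : ℂ), smul_smul] at h
  have h' := congrArg (((u ^ n : X.Rˣ) : X.R) * ·) (smul_d_inj z h)
  beta_reduce at h'
  rw [← mul_assoc, Units.mul_inv, one_mul] at h'
  rw [h', smul_def]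
  ring

theorem invSer_self : invSer z z = 1 := by
  have h : (PowerSeries.mk fun n => tc z (n + 1) (z : X.R)) = 1 := by
    ext n
    rw [coeff_mk, coeff_one]
    have := congrArg (coeff (n + 1)) (tauR_diag z)
    rw [diag, map_sub, tauR_tmul, tauR_tmul, map_one, mul_one, map_one, one_mul, map_sub, coeff_taylor,
      coeff_C, if_neg (by omega), sub_zero, coeff_X] at this
    rw [this]
    exact if_congr (by omega) rfl rfl
  rw [← mul_invSer z z, h, one_mul]

end Fam

section

variable {X : Fam} {n : ℤ} (C : BCAlg n)

namespace BCAlg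

/-- The product `:bc:` of the two fields that belong to a coordinate. -/
def cur (z : X.Coord) : (C.alg.obj X).carrier := (C.alg.obj X).mode z (-1) (C.env.field z true) (C.env.field z false)

theorem map₀_bcJ (z : X.Coord) : (C.env.isFields z).map₀ bcJ = C.cur z := by
  rw [bcJ, IsFields.map₀_cr_mul, map₀_cr]; rfl

theorem isFields_cur (z : X.Coord) : IsFields (dilF (-1)) (C.alg.obj X) z fun _ => C.cur z where
  par _ := by
    have h i := bcF_par ▸ (C.env.isFields z).par i
    rw [dilF_par]
    exact (C.alg.obj X).br_par 1 1 _ (h true) _ (h false) _ _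
  ope _ _ k := by
    rw [← C.map₀_bcJ, ← map₀_md, bcJ_md_bcJ]
    change _ = if k = 1 then (- -1 : ℂ) • _ else _
    rw [neg_neg, one_smul]
    split_ifs
    · rw [map₀_one]
    · rw [map_zero]

theorem b_eq (z : X.Coord) (α : X.Pow n) : C.b α = α.1 z • C.env.field z true := bc_apply_true (C.ι X) z α

theorem c_eq (z : X.Coord) (β : X.Pow (1 - n)) : C.c β = β.1 z • C.env.field z false := bc_apply_false (C.ι X) z β

theorem br_inv (z w : X.Coord) (q : X.RR) (α : X.Pow n) (β : X.Pow (1 - n)) :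
    (C.alg.obj X).br (δ[w,-1] * algebraMap X.RR X.K q) (C.b α) (C.c β) 1 =
      coeff 0 (invSer z w * tauR z (q * (α.1 z ⊗ₜ β.1 z))) • C.cur z +
      coeff 1 (invSer z w * tauR z (q * (α.1 z ⊗ₜ β.1 z))) • (C.alg.obj X).vac z := by
  have h := (C.env.isFields z).ope true false
  rw [C.b_eq z, C.c_eq z, ChirAlg.br_left, ChirAlg.br_right, in1_apply, in2_apply, mul_assoc, mul_assoc, ← map_mul, ← map_mul,
    tmul_mul_tmul, mul_one, one_mul, ChirAlg.br_inv_mul z w (N := 1), sum_range_succ,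
    sum_range_one]
  · congr 2
    have := h 0
    rw [if_pos rfl] at this
    refine Eq.trans ?_ (this.trans (one_smul ℂ _))
    rfl
  · intro k hk
    rw [h k, if_neg (by change ¬ k = 0; omega)]

theorem field_change_true (z w : X.Coord) : C.env.field w true = ((jac z w ^ n : X.Rˣ) : X.R) • C.env.field z true :=
  C.b_eq z (powZ n w)

theorem field_change_false (z w : X.Coord) :
    C.env.field w false = ((jac z w ^ (1 - n) : X.Rˣ) : X.R) • C.env.field z false :=
  C.c_eq z (powZ (1 - n) w)

theorem cur_change (z w : X.Coord) :
    C.cur w = C.cur z + (C.alg.obj X).unit (X.scal ((2 * n - 1) / 2) • dlog (jac z w)) := by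
  have h := C.br_inv z w 1 (powZ n w) (powZ (1 - n) w)
  rw [map_one, mul_one, one_mul, tauR_tmul, powZ_apply, powZ_apply] at h
  refine Eq.trans h ?_
  rw [dlog_eq z, smul_smul, map_smul]
  have hu := (jac z w).mul_inv
  have hn : ((jac z w ^ n : X.Rˣ) : X.R) * ((jac z w ^ (1 - n) : X.Rˣ) : X.R) = (jac z w : X.R) := by
    rw [← val_mul, ← zpow_add, add_sub_cancel, zpow_one]
  have hd := ddz_zpow z (jac z w) n
  have e : algebraMap ℂ X.R ((2 * n - 1) / 2) = algebraMap ℂ X.R n - algebraMap ℂ X.R 2⁻¹ := by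
    rw [← map_sub]; congr 1; ring
  rw [coeff_one_mul, coeff_one_mul, coeff_zero_eq_constantCoeff_apply, map_mul, map_mul,
    PowerSeries.constantCoeff_C, ← coeff_zero_eq_constantCoeff_apply,
    ← coeff_zero_eq_constantCoeff_apply, coeff_taylor, coeff_taylor, coeff_invSer_zero, coeff_invSer_one,
    tc_zero, tc_one, hd, coeff_C, if_neg one_ne_zero, scal_eq, e]
  generalize ((jac z w ^ n : X.Rˣ) : X.R) = x at *
  generalize ((jac z w ^ (1 - n) : X.Rˣ) : X.R) = y at *
  generalize ddz z (jac z w) = u' at *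
  generalize (((jac z w)⁻¹ : X.Rˣ) : X.R) = v at *
  generalize (jac z w : X.R) = u at *
  simp only [smul_def]
  congr 1
  · rw [hn, mul_comm, hu, one_smul]
  · congr 1
    linear_combination (-algebraMap ℂ X.R 2⁻¹ * v ^ 2 * u' + algebraMap ℂ X.R n * v ^ 2 * u') * hn +
      (algebraMap ℂ X.R n * v * u' - algebraMap ℂ X.R 2⁻¹ * v * u') * hu

theorem br_pole {z : X.Coord} {p : X.RR} {α : X.Pow n} {β : X.Pow (1 - n)} {s : X.F (2 * n - 1)}
    (h : IsPolarClass z p α β s) : (C.alg.obj X).br (X.pole z p) (C.b α) (C.c β) 1 =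
      s.1.1 • C.cur z + (C.alg.obj X).unit (s.1.2 z) := by
  obtain ⟨r, hr, hp⟩ := h
  have e' (k : ℕ) (hk : k < 2) : coeff k (invSer z z * tauR z (p * (α.1 z ⊗ₜ β.1 z))) =
      if k = 0 then s.1.1 else r := by
    have := PowerSeries.X_pow_dvd_iff.1 (X_pow_dvd_tauR z hp) k hk
    rw [map_sub, map_sub, map_mul (tauR z) (1 ⊗ₜ r), tauR_diag, tauR_tmul, map_sub, map_sub, tauR_tmul, map_one,
      one_mul, one_mul] at this
    rw [invSer_self, one_mul]
    interval_cases k <;> simp [coeff_C] at this ⊢ <;> linear_combination this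
  rw [pole_eq, C.br_inv z z, e' 0 (by omega), e' 1 (by omega), if_pos rfl, if_neg one_ne_zero, hr, map_smul]

end BCAlg

variable (A : DilatonAlg (2 * n - 1) (-1))

/-- The homomorphism of the linear dilaton to the bc-system that extends the fermion number current. -/
theorem exists_current : ∃ J : LocalChirHom A.alg C.alg, ∀ (X : Fam) (z : X.Coord),
    (J.app X).toFun (A.env.field z ()) = C.cur z := by
  have H (X : Fam) : ∃ Φ : ChirHom (A.alg.obj X) (C.alg.obj X), ∀ z, Φ.toFun (A.env.field z ()) = C.cur z := by
    have h1 := isStarMap_dilStar (lam := 2 * n - 1) (C.isFields_cur X.coord₀)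
    obtain ⟨Φ, hΦ, -⟩ := (A.isEnvelope X).universal _ _ h1
    refine ⟨Φ, fun z => (hΦ _).trans ((dil_apply h1 X.coord₀ _).trans ?_)⟩
    rw [C.cur_change X.coord₀ z]
    refine congrArg₂ _ ?_ (congrArg _ ?_)
    · exact (one_smul _ _).trans (dilStar_sec _ _)
    · change -(X.scal _ • dlog (jac z X.coord₀)) = _
      rw [← jac_inv, dlog_inv, smul_neg, neg_neg]
  choose Φ hΦ using H
  refine ⟨⟨Φ, fun {X Y} h a => ?_⟩, hΦ⟩
  exact A.env.semi_ext X.coord₀ ((A.alg.isSemi h).chirHom_comp (Φ Y)) ((C.alg.isSemi h).comp_chirHom (Φ X)) (fun i => by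
    rw [A.env.map_field, hΦ, hΦ]
    exact ((C.alg.isSemi h).mode X.coord₀ (-1) _ _).symm ▸ by rw [C.env.map_field, C.env.map_field]; rfl) a

theorem extendsCurrent_iff (J : LocalChirHom A.alg C.alg) :
    ExtendsCurrent A C J ↔ ∀ (X : Fam) (z : X.Coord), (J.app X).toFun (A.env.field z ()) = C.cur z := by
  constructor
  · intro h X z
    have hs : IsPolarClass z 1 (powZ n z) (powZ (1 - n) z) (secF (2 * n - 1) z) :=
      ⟨0, by rw [secF_self, zero_smul], by
        rw [powZ_self, powZ_self]
        change 1 * (1 ⊗ₜ 1) - 1 ⊗ₜ 1 - _ ∈ _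
        rw [one_mul, TensorProduct.tmul_zero, zero_mul, sub_self, sub_zero]
        exact Ideal.zero_mem _⟩
    refine (h X z 1 _ _ _ hs).trans ((C.br_pole hs).trans ?_)
    rw [secF_self, map_zero, add_zero]
    exact one_smul _ _
  · intro h X z p α β s hs
    rw [C.br_pole hs, ← h]
    refine (congrArg (J.app X).toFun (dil_apply (A.isEnvelope X).isStarMap z s)).trans ?_
    rw [map_add, (J.app X).map_unit, ← ChirAlg.fn_act, map_smul, ChirAlg.fn_act]
    rfl

theorem current_unique {J J' : LocalChirHom A.alg C.alg}
    (hJ : ∀ (X : Fam) (z : X.Coord), (J.app X).toFun (A.env.field z ()) = C.cur z)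
    (hJ' : ∀ (X : Fam) (z : X.Coord), (J'.app X).toFun (A.env.field z ()) = C.cur z) : J' = J := by
  have : J'.app = J.app := funext fun X => ChirHom.ext fun a => A.env.semi_ext X.coord₀ (of_chirHom (J'.app X))
    (of_chirHom (J.app X)) (fun i => by rw [hJ, hJ']) a
  cases J; cases J'; cases this; rfl

end

/-! ### Infinitesimal automorphisms -/

namespace Fam

variable {X : Fam}

variable (X) in
theorem exists_epsFn_eq : ∃ c : X.eps.k, X.epsFn = algebraMap X.eps.k X.eps.R c :=
  ⟨(DualNumber.eps : DualNumber X.k), rfl⟩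

theorem epsFn_mul_toEps (r : X.R) : X.epsFn * X.toEps.fn r = (DualNumber.eps : DualNumber X.k) ⊗ₜ[X.k] r :=
  (tmul_mul_tmul ..).trans (by rw [mul_one]; exact congrArg _ (one_mul r))

variable (X) in
theorem epsFn_mul_epsFn : X.epsFn * X.epsFn = 0 :=
  (tmul_mul_tmul ..).trans (by rw [DualNumber.eps_mul_eps, TensorProduct.zero_tmul]; rfl)

theorem flow_fn (ξ : X.Th) (r : X.R) : (X.flow ξ).fn (X.toEps.fn r) = X.toEps.fn r + X.epsFn * X.toEps.fn (ξ r) := by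
  rw [epsFn_mul_toEps]
  refine (flowAlg_tmul _ _ ξ 1 r).trans ?_
  rw [one_mul]; rfl

theorem ddz_epsFn_mul (z : X.eps.Coord) (r : X.eps.R) : ddz z (X.epsFn * r) = X.epsFn * ddz z r := by
  obtain ⟨c, hc⟩ := X.exists_epsFn_eq
  rw [hc, ← smul_def, ← smul_def, Derivation.map_smul]

theorem jac_flow (ξ : X.Th) (z : X.Coord) : (jac (X.toEps.crd z) ((X.flow ξ).crd (X.toEps.crd z)) : X.eps.R) =
    1 + X.epsFn * X.toEps.fn (ddz z (ξ z)) := by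
  change ddz (X.toEps.crd z) ((X.flow ξ).fn (X.toEps.fn z)) = _
  rw [flow_fn, map_add, ddz_epsFn_mul, Hom.fn_ddz]
  congr 1
  exact ddz_self _

theorem inv_of_sq_zero {R : Type} [CommRing R] {u : Rˣ} {e : R} (he : e * e = 0) (hu : (u : R) = 1 + e) :
    ((u⁻¹ : Rˣ) : R) = 1 - e := by
  have h := u.inv_mul
  rw [hu] at h
  linear_combination (1 - e) * h + ((u⁻¹ : Rˣ) : R) * he

theorem zpow_of_sq_zero {R : Type} [CommRing R] {u : Rˣ} {e : R} (he : e * e = 0) (hu : (u : R) = 1 + e) (n : ℤ) :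
    ((u ^ n : Rˣ) : R) = 1 + n * e := by
  induction n with
  | zero => simp
  | succ n ih => rw [zpow_add_one, val_mul, ih, hu]; push_cast; linear_combination (n : R) * he
  | pred n ih =>
    rw [zpow_sub_one, val_mul, ih, inv_of_sq_zero he hu]; push_cast; linear_combination (n : R) * he

theorem in1_epsFn : X.eps.in1 X.epsFn = X.eps.in2 X.epsFn := by
  obtain ⟨c, hc⟩ := X.exists_epsFn_eq
  rw [hc, commutes, commutes]

theorem kk_flow (ξ : X.Th) (f : X.K) : (X.flow ξ).kk (X.toEps.kk f) =
    X.toEps.kk f + X.eps.in2 X.epsFn * X.toEps.kk (X.vec1 ξ f + X.vec2 ξ f) := by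
  have he : X.eps.in2 X.epsFn * X.eps.in2 X.epsFn = 0 := by rw [← map_mul, epsFn_mul_epsFn, map_zero]
  let ψ : X.K →+* X.eps.K :=
    { toFun := fun f => X.toEps.kk f + X.eps.in2 X.epsFn * X.toEps.kk (X.vec1 ξ f + X.vec2 ξ f)
      map_zero' := by simp
      map_one' := by simp
      map_add' := fun f g => by simp only [map_add]; ring
      map_mul' := fun f g => by
        simp only [map_mul, map_add, leibniz, smul_eq_mul]
        linear_combination -(X.toEps.kk (X.vec1 ξ f) + X.toEps.kk (X.vec2 ξ f)) *
          (X.toEps.kk (X.vec1 ξ g) + X.toEps.kk (X.vec2 ξ g)) * he }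
  have : (X.flow ξ).kk.comp X.toEps.kk = ψ := ringHom_ext X.W (RingHom.ext fun q => by
    change (X.flow ξ).kk (X.toEps.kk (algebraMap X.RR X.K q)) = ψ (algebraMap X.RR X.K q)
    induction q using induction_on with
    | zero => simp
    | add a b ha hb => rw [map_add, map_add, map_add, ha, hb, map_add]
    | tmul a b =>
      have e : algebraMap X.RR X.K (a ⊗ₜ b) = X.in1 a * X.in2 b := by
        rw [in1_apply, in2_apply, ← map_mul, tmul_mul_tmul, mul_one, one_mul]
      have e1 : X.vec1 ξ (X.in1 a * X.in2 b) = X.in1 (ξ a) * X.in2 b := by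
        rw [← e, vec1_apply, in1_apply, in2_apply, ← map_mul, tmul_mul_tmul, mul_one, one_mul]
      have e2 : X.vec2 ξ (X.in1 a * X.in2 b) = X.in1 a * X.in2 (ξ b) := by
        rw [← e, vec2_apply, in1_apply, in2_apply, ← map_mul, tmul_mul_tmul, mul_one, one_mul]
      change _ = X.toEps.kk _ + X.eps.in2 X.epsFn * X.toEps.kk _
      rw [e, e1, e2]
      simp only [map_mul, map_add, Hom.kk_in1, Hom.kk_in2, flow_fn, in1_epsFn]
      linear_combination X.eps.in1 (X.toEps.fn (ξ a)) * X.eps.in2 (X.toEps.fn (ξ b)) * he)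
  exact congrArg (fun φ : X.K →+* X.eps.K => φ f) this

end Fam

namespace FieldSys.Env

variable {S : FieldSys} {L : LocalChirAlg} (E : S.Env L) {X : Fam} (z : X.Coord)

theorem induction {P : (L.obj X).carrier → Prop} (vac : P ((L.obj X).vac z))
    (add : ∀ a b, P a → P b → P (a + b)) (smul : ∀ (r : X.R) a, P a → P (r • a))
    (mode : ∀ i (m : ℤ) a, P a → P ((L.obj X).mode z m (E.field z i) a)) (a : (L.obj X).carrier) : P a := by
  obtain ⟨a, rfl⟩ := (E.frame_bijective z).2 a
  have hr (r : X.R) (a) : (E.frame z).toFun (r • a) = r • (E.frame z).toFun a := (of_chirHom (E.frame z)).smul r a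
  induction a using Mdl.induction_smul with
  | add a b ha hb => exact (map_add (E.frame z).toFun a b).symm ▸ add _ _ ha hb
  | smul r a ha => exact (hr r a).symm ▸ smul r _ ha
  | ten v =>
    induction v using FieldData.Fock.induction with
    | one =>
      have e : (ten 1 1 : Mdl S.F z) = (chir S.F z).unit (X.d z) := by
        rw [← one_smul X.R (X.d z)]; exact (Mdl.unit_smul_d 1).symm
      rw [e, (E.frame z).map_unit]
      exact vac
    | add v w hv hw =>
      rw [Mdl.ten_add_right]
      exact (map_add (E.frame z).toFun _ _).symm ▸ add _ _ hv hw
    | smul c v hv =>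
      rw [Mdl.ten_smul, ← algebraMap_smul X.R c]
      exact (hr _ _).symm ▸ smul _ _ hv
    | cr p v hv =>
      have e : (ten 1 (S.F.cr p * v) : Mdl S.F z) = (chir S.F z).br δ[z,negSucc p.2]
          (ten 1 (S.F.cr (p.1, 0)) : Mdl S.F z) (ten 1 v : Mdl S.F z) 1 := by
        refine Eq.trans ?_ (Mdl.mode_ten ..).symm
        rw [S.F.md_cr_left, S.F.phi_negSucc]
      rw [e, ← (E.frame z).map_br, E.frame_field]
      exact mode _ _ _ hv

/-- The formula for the Lie derivative in terms of an energy-momentum tensor holds if it holds for the fields. -/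
theorem isLie_of_fields (ξ : X.Th) {t : (L.obj X).carrier} (ht : t ∈ (L.obj X).par 0)
    (H : ∀ i, L.IsLie ξ (E.field z i) (-((L.obj X).br 1 t (E.field z i) 1) - E.field z i <• X.vec ξ))
    (l : (L.obj X).carrier) : L.IsLie ξ l (-((L.obj X).br 1 t l 1) - l <• X.vec ξ) := by
  have he (a : (L.obj X.eps).carrier) : X.epsFn • X.epsFn • a = 0 := by rw [smul_smul, epsFn_mul_epsFn, zero_smul]
  unfold LocalChirAlg.IsLie at *
  induction l using E.induction z with
  | vac =>
    have e : -((L.obj X).br 1 t ((L.obj X).vac z) 1) - (L.obj X).vac z <• X.vec ξ = ddz z (ξ z) • (L.obj X).vac z := by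
      rw [ChirAlg.br_one_unit_right _ _ ht, (L.obj X).act_vec_eq z, smul_act, ChirAlg.vac_act]; module
    rw [e, (L.isSemi _).vac, (L.isSemi _).vac, ChirAlg.vac, d_jac (X.toEps.crd z), jac_flow, map_smul, (L.isSemi _).smul,
      (L.isSemi _).vac]
    module
  | add a b ha hb =>
    rw [(L.isSemi _).add, (L.isSemi _).add, ha, hb, ChirAlg.br_add_right, smul_add]
    simp only [(L.isSemi _).add, (L.isSemi _).sub, (L.isSemi _).neg]
    module
  | smul r a ha =>
    rw [(L.isSemi _).smul, (L.isSemi _).smul, ha, ChirAlg.br_right, ChirAlg.br_fn2, smul_act, flow_fn]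
    simp only [(L.isSemi _).sub, (L.isSemi _).neg, (L.isSemi _).smul]
    generalize L.map X.toEps (a <• X.vec ξ) = x, L.map X.toEps ((L.obj X).br 1 t a 1) = y, L.map X.toEps a = a' at *
    linear_combination (norm := module) X.toEps.fn (ξ r) • he (-y - x)
  | mode i m a ha =>
    have h1 := (L.obj X).borcherds z ht ((E.isFields z).par i) a 0 0 m
    rw [bsum_zero, bsum_zero, bsum_zero] at h1
    simp only [cast_zero, add_zero, sub_zero, zero_add, sg_zero, one_smul, Mdl.sgn_zero, zpow_zero, val_one] at h1
    have h2 := (L.obj X).br_vec1 δ[z,m] ξ (E.field z i) a 1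
    have h3 := (L.obj X).br_vec2 δ[z,m] ξ (E.field z i) a 1
    have h4 := H i
    have h0 := (L.obj X).br_fn1 δ[z,m] 0 (E.field z i) a 1
    rw [map_zero, mul_zero, (L.obj X).isPre.zero, zero_mul] at h0
    rw [Derivation.map_one_eq_zero, ← h0] at h2
    have h5 : -((L.obj X).br 1 t ((L.obj X).mode z m (E.field z i) a) 1) - (L.obj X).mode z m (E.field z i) a <• X.vec ξ =
        (L.obj X).br δ[z,m] (-((L.obj X).br 1 t (E.field z i) 1) - E.field z i <• X.vec ξ) a 1 +
        (L.obj X).br δ[z,m] (E.field z i) (-((L.obj X).br 1 t a 1) - a <• X.vec ξ) 1 +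
        (L.obj X).br (X.vec1 ξ δ[z,m] + X.vec2 ξ δ[z,m]) (E.field z i) a 1 := by
      simp only [sub_eq_add_neg, ChirAlg.br_add_left, ChirAlg.br_add_right, (L.obj X).isPre.neg_left, (L.obj X).isPre.neg_right,
        ChirAlg.br_add, ← h3]
      linear_combination (norm := abel) h1 + h2
    rw [h5]
    generalize -((L.obj X).br 1 t (E.field z i) 1) - E.field z i <• X.vec ξ = b', -((L.obj X).br 1 t a 1) - a <• X.vec ξ = a' at *
    have e3 (f x y) : (L.obj X.eps).br f (X.epsFn • x) y 1 = X.epsFn • (L.obj X.eps).br f x y 1 := by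
      rw [ChirAlg.br_left, in1_epsFn, ChirAlg.br_fn2]
    have e4 (f x y) : (L.obj X.eps).br f x (X.epsFn • y) 1 = X.epsFn • (L.obj X.eps).br f x y 1 := by
      rw [ChirAlg.br_right, ChirAlg.br_fn2]
    have e5 (f x y) : (L.obj X.eps).br (X.eps.in2 X.epsFn * f) x y 1 = X.epsFn • (L.obj X.eps).br f x y 1 := by
      rw [mul_comm, ChirAlg.br_fn2]
    rw [ChirAlg.mode, (L.isSemi _).br, (L.isSemi _).br, kk_flow, h4, ha, map_one, map_one]
    simp only [(L.isSemi _).add, (L.isSemi _).br, ChirAlg.br_add, ChirAlg.br_add_left, ChirAlg.br_add_right, e3, e4, e5,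
      smul_add, he, add_zero, map_one, map_add X.toEps.kk]
    abel

end FieldSys.Env

/-! ### Uniqueness of energy-momentum tensors -/

namespace Mdl

variable {F : FieldData} {X : Fam} {z : X.Coord}

theorem ten_one_injective : Injective fun r : X.R => (ten r 1 : Mdl F z) := fun r s h => by
  have := congrArg (TensorProduct.rid ℂ X.R) (congrArg (F.vac.toLinearMap.lTensor X.R) h)
  change TensorProduct.rid ℂ X.R (r ⊗ₜ F.vac 1) = TensorProduct.rid ℂ X.R (s ⊗ₜ F.vac 1) at this
  simpa using this

theorem epsFn_smul_map_injective : Injective fun a : Mdl F z => X.epsFn • map F X.toEps z a := by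
  let κ : X.R →ₗ[ℂ] X.eps.R :=
    { toFun := fun r => X.epsFn * X.toEps.fn r
      map_add' := fun r s => by rw [map_add, mul_add]
      map_smul' := fun c r => by rw [Hom.fn_csmul, mul_smul_comm]; rfl }
  have hκ : Injective κ := fun r s h => by
    have h' : (DualNumber.eps : DualNumber X.k) ⊗ₜ[X.k] r = (DualNumber.eps : DualNumber X.k) ⊗ₜ[X.k] s :=
      (epsFn_mul_toEps r).symm.trans (h.trans (epsFn_mul_toEps s))
    have := congrArg (TensorProduct.lid X.k X.R) (congrArg ((TrivSqZeroExt.sndHom X.k X.k).rTensor X.R) h')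
    simpa using this
  have e (a : Mdl F z) : X.epsFn • map F X.toEps z a = κ.rTensor F.Fock a := by
    induction a using induction with
    | ten r v => rfl
    | add a b ha hb => rw [map_add, smul_add, ha, hb]; exact (map_add (κ.rTensor F.Fock) a b).symm
  intro a b h
  exact Module.Flat.rTensor_preserves_injective_linearMap κ hκ ((e a).symm.trans (h.trans (e b)))

/-- A section with trivial bracket with all sections is a multiple of the vacuum. -/
theorem eq_ten_one (N : F.Nondeg) [Fintype F.I] {a : Mdl F z} (h : ∀ (r : X.R) l, br z 1 (r • a) l 1 = 0) :
    ∃ r : X.R, a = ten r 1 := by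
  have h1 (p : X.RR) (l : Mdl F z) (g : X.R) : br z (algebraMap X.RR X.K p) a l g = 0 := by
    induction p using induction_on with
    | zero => rw [map_zero]; exact isPre.zero ..
    | add p q hp hq => rw [map_add, isPre.add, hp, hq, add_zero]
    | tmul r s =>
      have e : algebraMap X.RR X.K (r ⊗ₜ s) * X.in1 g = 1 * X.in1 (r * g) * X.in2 s := by
        rw [in1_apply, in1_apply, in2_apply, one_mul, ← map_mul, ← map_mul]; simp
      have := isPre.fn1 (algebraMap X.RR X.K (r ⊗ₜ s)) g a l 1
      rw [mul_one, e, isPre.fn2, ← isPre.left, h, smul_zero] at this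
      exact this.symm
  have h2 (x : Mdl F z) (hx : ∀ p l g, br z (algebraMap X.RR X.K p) x l g = 0) (y : Mdl F z) (m : ℕ) :
      isPre.tr z x y (X.swap δ[z,m]) 1 = 0 := by
    rw [isPre.tr_eq z (l := [])]
    · rfl
    · intro g
      rw [swap_dk, zpow_natCast, val_pow_eq_pow_val, dk_val, ← map_pow, ← map_zsmul]
      exact hx ..
  refine N.eq_vac_tensor fun i m => ?_
  have h3 : br z δ[z,m] (ten 1 (F.cr (i, 0))) a 1 = 0 := by
    rw [br_eq_tr, h2 a h1, h2 (par F z a) fun p l g => by rw [← par_par l, ← par_br, h1, map_zero], add_zero, neg_zero]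
  have h4 (a : Mdl F z) : br z δ[z,m] (ten 1 (F.cr (i, 0))) a 1 = (F.an i m).lTensor X.R a := by
    induction a using induction with
    | ten r v =>
      change _ = ten r (F.an i m v)
      rw [ten_eq r v, isPre.right, isPre.fn2, mode_ten, F.md_cr_left, smul_ten, mul_one]; rfl
    | add a b ha hb => rw [isPre.add_right, ha, hb]; exact (map_add ((F.an i m).lTensor X.R) a b).symm
  exact (h4 a).symm.trans h3

end Mdl

theorem ChirHom.map_fsmul {X : Fam} {A B : ChirAlg X} (Φ : ChirHom A B) (r : X.R) (a : A.carrier) :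
    Φ.toFun (r • a) = r • Φ.toFun a := (of_chirHom Φ).smul r a

namespace FieldSys.Env

variable {S : FieldSys} {L : LocalChirAlg} (E : S.Env L) {X : Fam}

include E

theorem frame_ten_one (z : X.Coord) (r : X.R) : (E.frame z).toFun (ten r 1 : Mdl S.F z) = (L.obj X).unit (r • X.d z) := by
  rw [← (E.frame z).map_unit]
  exact congrArg (E.frame z).toFun (Mdl.unit_smul_d r).symm

theorem epsFn_smul_injective : Injective fun a : (L.obj X).carrier => X.epsFn • L.map X.toEps a := by
  intro a b h
  obtain ⟨a, rfl⟩ := (E.frame_bijective X.coord₀).2 a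
  obtain ⟨b, rfl⟩ := (E.frame_bijective X.coord₀).2 b
  beta_reduce at h
  rw [E.map_frame, E.map_frame] at h
  have e := (E.frame (X.toEps.crd X.coord₀)).map_fsmul X.epsFn
  exact congrArg _ (Mdl.epsFn_smul_map_injective
    ((E.frame_bijective (X.toEps.crd X.coord₀)).1 ((e _).trans (h.trans (e _).symm))))

theorem unit_injective : Injective (L.obj X).unit := by
  intro ω η h
  obtain ⟨r, rfl⟩ := exists_om X.coord₀ ω
  obtain ⟨s, rfl⟩ := exists_om X.coord₀ η
  rw [← E.frame_ten_one, ← E.frame_ten_one] at h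
  rw [Mdl.ten_one_injective ((E.frame_bijective X.coord₀).1 h)]

theorem mem_range_unit (N : S.F.Nondeg) [Fintype S.F.I] {a : (L.obj X).carrier}
    (h : ∀ (r : X.R) l, (L.obj X).br 1 (r • a) l 1 = 0) : a ∈ LinearMap.range (L.obj X).unit := by
  obtain ⟨a, rfl⟩ := (E.frame_bijective X.coord₀).2 a
  obtain ⟨r, rfl⟩ : ∃ r : X.R, a = (ten r 1 : Mdl S.F X.coord₀) := Mdl.eq_ten_one N fun r l => by
    apply (E.frame_bijective X.coord₀).1
    have := h r ((E.frame X.coord₀).toFun l)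
    rw [← ChirHom.map_fsmul] at this
    exact ((E.frame X.coord₀).map_br 1 ..).symm.trans (this.trans (map_zero (E.frame X.coord₀).toFun).symm)
  exact ⟨_, (E.frame_ten_one _ r).symm⟩

/-- There is at most one energy-momentum tensor modulo the unit. -/
theorem preTensor_unique (N : S.F.Nondeg) [Fintype S.F.I] {T T' : PreTensor L} (hT : IsPreTensor L T) (hT' : IsPreTensor L T') :
    T' = T := by
  funext X
  ext ξ : 1
  obtain ⟨a, ha⟩ := mkQ_surjective _ (T X ξ)
  obtain ⟨a', ha'⟩ := mkQ_surjective _ (T' X ξ)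
  rw [← ha, ← ha', ← sub_eq_zero, ← map_sub]
  refine (mk_eq_zero _).2 (E.mem_range_unit N fun r l => ?_)
  have h := hT X (r • ξ) (r • a) l (by rw [map_smul, map_smul, ha])
  have h' := hT' X (r • ξ) (r • a') l (by rw [map_smul, map_smul, ha'])
  have := E.epsFn_smul_injective (add_left_cancel (h.symm.trans h'))
  rw [sub_left_inj, neg_inj] at this
  rw [smul_sub, sub_eq_add_neg, ChirAlg.br_add_left, (L.obj X).isPre.neg_left, this, add_neg_cancel]

end FieldSys.Env

open ChirHom (map_fsmul)

/-! ### The extensions `Θ'_c` -/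

namespace Fam

variable {X : Fam}

/-- The Schwarzian derivative `{w, z}`. -/
def schw (z w : X.Coord) : X.R := (((jac z w)⁻¹ : X.Rˣ) : X.R) * ddz z (ddz z (jac z w)) -
  X.scal (3 / 2) * ((((jac z w)⁻¹ : X.Rˣ) : X.R) * ddz z (jac z w)) ^ 2

theorem fn_schw {Y : Fam} (h : Hom X Y) (z w : X.Coord) : h.fn (schw z w) = schw (h.crd z) (h.crd w) := by
  rw [schw, schw, jac_inv, jac_inv]
  simp only [map_sub, map_mul, map_pow, Hom.fn_jac, Hom.fn_ddz, Hom.fn_scal]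

theorem Theta_apply {c : ℂ} (s : X.Theta c) (z w : X.Coord) :
    s.1.2 w = s.1.2 z + (X.scal (c / 12) * schw z w * s.1.1 z) • X.d z :=
  s.2 z w _ _ _ (d_jac z w) (d_eq z _) (d_eq z _)

theorem mem_Theta {c : ℂ} {s : X.Th × (X.Coord → X.Om)}
    (h : ∀ z w, s.2 w = s.2 z + (X.scal (c / 12) * schw z w * s.1 z) • X.d z) : s ∈ X.Theta c := by
  intro z w u u₁ u₂ hu h₁ h₂
  obtain rfl := eq_jac hu
  obtain rfl : u₁ = ddz z (jac z w) := smul_d_inj z (by rw [← h₁, ← d_eq])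
  obtain rfl : u₂ = ddz z (ddz z (jac z w)) := smul_d_inj z (by rw [← h₂, ← d_eq])
  exact h z w

theorem Theta_ext {c : ℂ} (z : X.Coord) {s t : X.Theta c} (h : s.1.1 = t.1.1) (h' : s.1.2 z = t.1.2 z) : s = t :=
  Subtype.ext (Prod.ext h (funext fun w => by rw [Theta_apply s z w, Theta_apply t z w, h, h']))

theorem relTheta_of {Y : Fam} {h : Hom X Y} {c : ℂ} {s : X.Theta c} {t : Y.Theta c} (hv : h.RelVec s.1.1 t.1.1) (z : X.Coord)
    (hz : t.1.2 (h.crd z) = h.om (s.1.2 z)) : h.RelTheta s t := by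
  refine ⟨hv, fun w => ?_⟩
  rw [Theta_apply t (h.crd z), Theta_apply s z, hz, map_add, Hom.om_smul_d, map_mul, map_mul, Hom.fn_scal, fn_schw,
    hv.apply_crd]
  rfl

end Fam

/-- A system of even sections `t(z)`, one for every coordinate `z`, which transforms like an energy-momentum tensor of central
charge `c`, and whose bracket with the fields gives their Lie derivatives. -/
structure FieldSys.Env.Stress {S : FieldSys} {L : LocalChirAlg} (E : S.Env L) (c : ℂ) where
  t : ∀ {X : Fam}, X.Coord → (L.obj X).carrier
  even : ∀ {X : Fam} (z : X.Coord), t z ∈ (L.obj X).par 0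
  map_t : ∀ {X Y : Fam} (h : Hom X Y) (z : X.Coord), L.map h (t z) = t (h.crd z)
  change : ∀ {X : Fam} (z w : X.Coord), (jac z w : X.R) • t w = t z - (X.scal (c / 12) * schw z w) • (L.obj X).vac z
  lie : ∀ {X : Fam} (z : X.Coord) (ξ : X.Th) i,
    L.IsLie ξ (E.field z i) (-((L.obj X).br 1 (ξ z • t z) (E.field z i) 1) - E.field z i <• X.vec ξ)

namespace FieldSys.Env.Stress

variable {S : FieldSys} {L : LocalChirAlg} {E : S.Env L} {c : ℂ} (τ : E.Stress c)

theorem smul_change {X : Fam} (ξ : X.Th) (z w : X.Coord) :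
    ξ w • τ.t w = ξ z • τ.t z - (L.obj X).unit ((X.scal (c / 12) * schw z w * ξ z) • X.d z) := by
  have h := congrArg (ξ z • ·) (τ.change z w)
  beta_reduce at h
  rw [smul_smul, show ξ z * (jac z w : X.R) = ξ w from (vec_apply_eq z ξ w).symm] at h
  rw [h, map_smul]
  module

/-- The map `Θ → A / Ω`. -/
def pre : PreTensor L := fun X => (LinearMap.range (L.obj X).unit).mkQ ∘ₗ
  { toFun := fun ξ => ξ X.coord₀ • τ.t X.coord₀
    map_add' := fun _ _ => add_smul ..
    map_smul' := fun _ _ => mul_smul _ _ _ }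

theorem pre_apply {X : Fam} (ξ : X.Th) (z : X.Coord) : τ.pre X ξ = (LinearMap.range (L.obj X).unit).mkQ (ξ z • τ.t z) := by
  change (LinearMap.range (L.obj X).unit).mkQ (ξ X.coord₀ • τ.t X.coord₀) = _
  rw [τ.smul_change ξ z X.coord₀, map_sub, sub_eq_self]
  exact (mk_eq_zero _).2 ⟨_, rfl⟩

theorem exists_eq {X : Fam} {ξ : X.Th} (z : X.Coord) {a : (L.obj X).carrier}
    (h : (LinearMap.range (L.obj X).unit).mkQ a = τ.pre X ξ) : ∃ ω, a = ξ z • τ.t z + (L.obj X).unit ω := by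
  rw [τ.pre_apply ξ z, ← sub_eq_zero, ← map_sub] at h
  obtain ⟨ω, hω⟩ := (mk_eq_zero _).1 h
  exact ⟨ω, by rw [hω]; abel⟩

theorem isPreTensor : IsPreTensor L τ.pre := by
  intro X ξ a l h
  obtain ⟨ω, rfl⟩ := τ.exists_eq X.coord₀ h
  rw [ChirAlg.br_add_left, ChirAlg.br_one_unit_left, add_zero]
  exact E.isLie_of_fields X.coord₀ ξ (ChirAlg.fsmul_mem (τ.even _) _) (τ.lie _ ξ) l

theorem isLocal : τ.pre.IsLocal := by
  intro X Y h ξ ξ' a hξ ha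
  obtain ⟨ω, rfl⟩ := τ.exists_eq X.coord₀ ha
  rw [τ.pre_apply ξ' (h.crd X.coord₀), hξ.apply_crd, ← sub_eq_zero, ← map_sub, map_add, map_smulₛₗ, τ.map_t, add_sub_cancel_left,
    L.map_unit]
  exact (mk_eq_zero _).2 ⟨_, rfl⟩

/-- The second component of the map `Θ'_c → Θ × A`. -/
theorem val_eq {X : Fam} (s : X.Theta c) (z w : X.Coord) : s.1.1 w • τ.t w + (L.obj X).unit (s.1.2 w) =
    s.1.1 z • τ.t z + (L.obj X).unit (s.1.2 z) := by
  rw [τ.smul_change _ z w, Theta_apply s z w, map_add]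
  abel

/-- The map from `Θ'_c` to the extension defined by the energy-momentum tensor. -/
def toExt (X : Fam) : X.Theta c →ₗ[X.R] τ.pre.ext X where
  toFun s := ⟨(s.1.1, s.1.1 X.coord₀ • τ.t X.coord₀ + (L.obj X).unit (s.1.2 X.coord₀)), by
    change (LinearMap.range (L.obj X).unit).mkQ (_ + _) = τ.pre X s.1.1
    rw [τ.pre_apply _ X.coord₀, map_add, add_eq_left]
    exact (mk_eq_zero _).2 ⟨_, rfl⟩⟩
  map_add' s s' := Subtype.ext (Prod.ext rfl (by
    change (s.1.1 _ + s'.1.1 _) • _ + (L.obj X).unit (_ + _) = (_ + _) + (_ + _)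
    rw [add_smul, map_add]; abel))
  map_smul' r s := Subtype.ext (Prod.ext rfl (by
    change (r * s.1.1 _) • _ + (L.obj X).unit (r • _) = r • (_ + _)
    rw [mul_smul, map_smul, smul_add]))

theorem toExt_snd {X : Fam} (s : X.Theta c) (z : X.Coord) :
    (τ.toExt X s).1.2 = s.1.1 z • τ.t z + (L.obj X).unit (s.1.2 z) := τ.val_eq s z X.coord₀

theorem toExt_bijective (X : Fam) : Function.Bijective (τ.toExt X) := by
  constructor
  · intro s s' h
    have h1 : s.1.1 = s'.1.1 := congrArg (fun x => x.1.1) h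
    have h2 : (τ.toExt X s).1.2 = (τ.toExt X s').1.2 := congrArg (fun x => x.1.2) h
    rw [τ.toExt_snd s X.coord₀, τ.toExt_snd s' X.coord₀, h1] at h2
    exact Theta_ext X.coord₀ h1 (E.unit_injective (add_left_cancel h2))
  · rintro ⟨⟨ξ, a⟩, ha⟩
    choose ω hω using fun z => τ.exists_eq z ha
    refine ⟨⟨(ξ, ω), mem_Theta fun z w => E.unit_injective ?_⟩, Subtype.ext (Prod.ext rfl (hω X.coord₀).symm)⟩
    have := (hω z).symm.trans (hω w)
    change ξ z • _ + _ = ξ w • _ + _ at this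
    rw [τ.smul_change ξ z w] at this
    rw [map_add]
    linear_combination (norm := abel) -this

/-- The isomorphism of `Θ'_c` with the extension defined by the energy-momentum tensor. -/
def iso (X : Fam) : X.Theta c ≃ₗ[X.R] τ.pre.ext X := ofBijective (τ.toExt X) (τ.toExt_bijective X)

theorem isExtIso : IsExtIso τ.pre c τ.iso where
  proj X s := rfl
  incl X ω := Prod.ext rfl (by
    change (0 : X.R) • _ + _ = _
    rw [zero_smul, zero_add]; rfl)
  isLocal {X Y} h s s' hs := by
    refine (τ.toExt_snd s' (h.crd X.coord₀)).trans ?_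
    change _ = L.map h (_ + _)
    rw [map_add, map_smulₛₗ, τ.map_t, L.map_unit, hs.1.apply_crd, hs.2]

end FieldSys.Env.Stress

/-! ### The affine line -/

namespace Fam

variable {X : Fam} (z : X.Coord)

theorem isCoord_of_d_eq {w : X.R} (u : X.Rˣ) (h : X.d w = (u : X.R) • X.d z) : IsCoord X.k X.R w := by
  have e : (fun f : X.R => f • D X.k X.R w) = (fun f : X.R => f • X.d z) ∘ fun f => f * (u : X.R) := by
    funext f
    change f • X.d w = (f * (u : X.R)) • X.d z
    rw [h, smul_smul]
  rw [IsCoord, e]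
  exact z.2.comp (Units.mulRight_bijective u)

theorem isCoord_X (k : Type) [CommRing k] : IsCoord k (Polynomial k) Polynomial.X :=
  (polynomialEquiv k).symm.bijective

/-- The affine line over a base. -/
def line (k : Type) [CommRing k] [Algebra ℂ k] : Fam where
  k := k
  R := Polynomial k
  smooth := ⟨inferInstance, inferInstance⟩
  exists_coord := ⟨Polynomial.X, isCoord_X k⟩

/-- The coordinate of the affine line. -/
def lineCrd (k : Type) [CommRing k] [Algebra ℂ k] : (line k).Coord := ⟨(Polynomial.X : Polynomial k), isCoord_X k⟩

theorem isCoord_aeval {q : Polynomial X.k} (hq : IsCoord X.k (Polynomial X.k) q) :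
    IsCoord X.k X.R (aeval (z : X.R) q) := by
  obtain ⟨g, hg⟩ := hq.2 (D X.k (Polynomial X.k) Polynomial.X)
  have h := congrArg (polynomialEquiv X.k) hg
  beta_reduce at h
  rw [map_smul, polynomialEquiv_D, polynomialEquiv_D, derivative_X,
    smul_eq_mul, mul_comm] at h
  have h' := congrArg (aeval (z : X.R)) h
  rw [map_mul, map_one] at h'
  exact isCoord_of_d_eq z (Units.mkOfMulEqOne _ _ h') (X.d.map_aeval _ _)

/-- A coordinate as a morphism of families to the affine line. -/
def lineHom : Hom (line X.k) X where
  base := AlgHom.id ℂ X.k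
  fn := (aeval (z : X.R) : Polynomial X.k →ₐ[X.k] X.R).toRingHom
  comm := (aeval (z : X.R) : Polynomial X.k →ₐ[X.k] X.R).commutes
  coord _ hq := isCoord_aeval z hq

theorem lineHom_crd : (lineHom z).crd (lineCrd X.k) = z :=
  Subtype.ext (Polynomial.aeval_X (z : X.R))

variable (X) in
theorem two_mul_half : (2 : X.R) * algebraMap ℂ X.R 2⁻¹ = 1 := by
  rw [show (2 : X.R) = algebraMap ℂ X.R 2 by rw [map_ofNat], ← map_mul, mul_inv_cancel₀ two_ne_zero, map_one]

theorem d_two_mul (z : X.R) : X.d (2 * z) = (2 : X.R) • X.d z := by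
  rw [two_mul, map_add, two_smul]

/-- Twice a coordinate. -/
def dbl : X.Coord := ⟨2 * z, isCoord_of_d_eq z (Units.mkOfMulEqOne _ _ X.two_mul_half) (d_two_mul (z : X.R))⟩

theorem jac_dbl : (jac z (dbl z) : X.R) = 2 := smul_d_inj z (by rw [← d_jac]; exact d_two_mul (z : X.R))

theorem schw_dbl : schw z (dbl z) = 0 := by
  have : ddz z (2 : X.R) = 0 := by
    rw [← one_add_one_eq_two, map_add, Derivation.map_one_eq_zero, add_zero]
  rw [schw, jac_dbl, this, map_zero]
  ring

theorem polynomial_eq_zero {k : Type} [CommRing k] [Algebra ℂ k] {p : Polynomial k}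
    (h : p = Polynomial.C 4 * p.comp (Polynomial.C 2 * Polynomial.X)) : p = 0 := by
  ext n
  have h1 := congrArg (fun q : Polynomial k => q.coeff n) h
  beta_reduce at h1
  rw [Polynomial.coeff_C_mul, Polynomial.comp_C_mul_X_coeff] at h1
  have h3 : (4 * 2 ^ n - 1 : ℂ) ≠ 0 := by
    have : (1 : ℕ) ≤ 2 ^ n := Nat.one_le_two_pow
    have h4 : ((4 * 2 ^ n : ℕ) : ℂ) ≠ (1 : ℕ) := by rw [Ne, Nat.cast_inj]; omega
    rw [sub_ne_zero]; simpa using h4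
  have h4 : (4 * 2 ^ n - 1 : ℂ) • p.coeff n = 0 := by
    rw [smul_def]
    simp only [map_sub, map_mul, map_pow, map_ofNat, map_one]
    linear_combination -h1
  have h5 := congrArg ((4 * 2 ^ n - 1 : ℂ)⁻¹ • ·) h4
  beta_reduce at h5
  rwa [smul_smul, inv_mul_cancel₀ h3, one_smul, smul_zero] at h5

/-- The doubling map of the affine line. -/
def lineDbl (k : Type) [CommRing k] [Algebra ℂ k] : Hom (line k) (line k) := lineHom (dbl (lineCrd k))

theorem lineDbl_crd (k : Type) [CommRing k] [Algebra ℂ k] : (lineDbl k).crd (lineCrd k) = dbl (lineCrd k) :=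
  lineHom_crd (dbl (lineCrd k))

theorem line_eq_zero {k : Type} [CommRing k] [Algebra ℂ k] {p : (line k).R}
    (h : p = 4 * (lineDbl k).fn p) : p = 0 :=
  polynomial_eq_zero (k := k) (p := p) (h.trans rfl)

end Fam

namespace FieldSys.Env.Stress

variable {S : FieldSys} {L : LocalChirAlg} {E : S.Env L} {c : ℂ} (τ : E.Stress c)

theorem exists_sec (τ : E.Stress c) {X : Fam} (z : X.Coord) : ∃ s : X.Theta c, s.1.1 = ddz z ∧ s.1.2 z = 0 := by
  obtain ⟨s, hs⟩ := (τ.toExt_bijective X).2 ⟨(ddz z, τ.t z), by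
    change (LinearMap.range (L.obj X).unit).mkQ _ = τ.pre X (ddz z)
    rw [τ.pre_apply _ z, ddz_self, one_smul]
    rfl⟩
  have h1 : s.1.1 = ddz z := congrArg (fun x => x.1.1) hs
  have h2 : (τ.toExt X s).1.2 = τ.t z := congrArg (fun x => x.1.2) hs
  rw [τ.toExt_snd s z, h1, ddz_self, one_smul, add_eq_left] at h2
  exact ⟨s, h1, E.unit_injective (h2.trans (map_zero _).symm)⟩

theorem iso_unique {e : ∀ X : Fam, X.Theta c ≃ₗ[X.R] τ.pre.ext X} (he : IsExtIso τ.pre c e) : e = τ.iso := by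
  choose σ hσ hσ' using fun (X : Fam) (z : X.Coord) => τ.exists_sec z
  have h1 (X : Fam) (z : X.Coord) : ∃ ω, (e X (σ X z)).1.2 = τ.t z + (L.obj X).unit ω := by
    obtain ⟨ω, hω⟩ := τ.exists_eq (ξ := ddz z) z (a := (e X (σ X z)).1.2)
      ((e X (σ X z)).2.trans (congrArg (τ.pre X) ((he.proj X _).trans (hσ X z))))
    exact ⟨ω, by rw [hω, ddz_self, one_smul]⟩
  choose δ hδ using h1
  have h2 {X Y : Fam} (h : Hom X Y) (z : X.Coord) : δ Y (h.crd z) = h.om (δ X z) := by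
    have hr : h.RelTheta (σ X z) (σ Y (h.crd z)) :=
      relTheta_of (by rw [hσ, hσ]; exact h.relVec_ddz z) z (by rw [hσ', hσ', map_zero])
    have := he.isLocal h _ _ hr
    rw [hδ, hδ, map_add, τ.map_t, L.map_unit] at this
    exact E.unit_injective (add_left_cancel this)
  have h3 (X : Fam) (z : X.Coord) : δ X z = (2 : X.R) • δ X (dbl z) := by
    have e1 : σ X z = (2 : X.R) • σ X (dbl z) := Theta_ext (dbl z) (by
      change _ = (2 : X.R) • (σ X (dbl z)).1.1
      rw [hσ, hσ, vec_eq (dbl z) (ddz z)]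
      exact congrArg (· • ddz (dbl z)) (jac_dbl z)) (by
      change _ = (2 : X.R) • (σ X (dbl z)).1.2 (dbl z)
      rw [Theta_apply _ z, schw_dbl, hσ', hσ', mul_zero, zero_mul, zero_smul, add_zero, smul_zero])
    have e2 := hδ X z
    rw [e1, map_smul] at e2
    have e3 := τ.change z (dbl z)
    rw [jac_dbl, schw_dbl, mul_zero, zero_smul, sub_zero] at e3
    have e4 : (2 : X.R) • (e X (σ X (dbl z))).1.2 = τ.t z + (L.obj X).unit (δ X z) := e2
    rw [hδ, smul_add, e3, ← map_smul] at e4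
    exact (E.unit_injective (add_left_cancel e4)).symm
  have h4 (X : Fam) (z : X.Coord) : δ X z = 0 := by
    have e1 := h2 (lineHom z) (lineCrd X.k)
    rw [lineHom_crd] at e1
    obtain ⟨p, hp⟩ := exists_om (lineCrd X.k) (δ _ (lineCrd X.k))
    have e2 := h3 _ (lineCrd X.k)
    have e3 := h2 (lineDbl X.k) (lineCrd X.k)
    rw [lineDbl_crd, hp, Hom.om_smul_d] at e3
    have e5 : (line X.k).d ((lineDbl X.k).fn (lineCrd X.k)) = (2 : (line X.k).R) • (line X.k).d (lineCrd X.k) :=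
      (congrArg (fun w : (line X.k).Coord => (line X.k).d w) (lineDbl_crd X.k)).trans (d_two_mul _)
    rw [e3, e5, hp, smul_smul, smul_smul] at e2
    have := line_eq_zero (p := p) (by
      refine (smul_d_inj _ e2).trans ?_
      ring)
    rw [e1, hp, this, zero_smul, map_zero]
  funext X
  ext s : 1
  let z := X.coord₀
  have e1 : s = s.1.1 z • σ X z + X.inclTheta c (s.1.2 z) := Theta_ext z (by
      change _ = s.1.1 z • (σ X z).1.1 + 0
      rw [hσ, ← vec_eq, add_zero]) (by
      change _ = s.1.1 z • (σ X z).1.2 z + s.1.2 z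
      rw [hσ', smul_zero, zero_add])
  refine Subtype.ext (Prod.ext (he.proj X s) ?_)
  have e2 : (e X s).1 = s.1.1 z • (e X (σ X z)).1 + (e X (X.inclTheta c (s.1.2 z))).1 := by
    conv_lhs => rw [e1, map_add, map_smul]
    rfl
  rw [e2, he.incl]
  change s.1.1 z • (e X (σ X z)).1.2 + (L.obj X).unit (s.1.2 z) = _
  rw [hδ, h4, map_zero, add_zero]
  rfl

end FieldSys.Env.Stress

/-! ### Quadratic energy-momentum tensors -/

namespace ChirAlg

variable {X : Fam} (A : ChirAlg X) {lam : ℂ} {z w : X.Coord}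

/-- The section `½ :aa: + ½ λ ∂a`. -/
def quad (lam : ℂ) (z : X.Coord) (a : A.carrier) : A.carrier :=
  (2⁻¹ : ℂ) • A.br δ[z,-1] a a 1 - (lam / 2) • (a <• X.vec (ddz z))

variable {A}

theorem quad_mem {a : A.carrier} (ha : a ∈ A.par 0) : A.quad lam z a ∈ A.par 0 :=
  Submodule.sub_mem _ (csmul_mem (A.br_par 0 0 _ ha _ ha _ _) _) (csmul_mem (smul_mem _ _ ha) _)

local notation "ρ" => Units.val (jac z w)⁻¹

theorem quad_change {a b : A.carrier} (H : IsFields (dilF (-1)) A z fun _ => a)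
    (hb : b = a + A.unit (X.scal (lam / 2) • dlog (jac z w))) :
    (jac z w : X.R) • A.quad lam w b = A.quad lam z a - (X.scal ((1 - 3 * lam ^ 2) / 12) * schw z w) • A.vac z := by
  have ha : a ∈ A.par 0 := dilF_par (-1) ▸ H.par ()
  have ho (n : ℕ) : A.br δ[z,n] a a 1 = if n = 1 then A.vac z else 0 := by
    rw [show A.br δ[z,n] a a 1 = _ from H.ope () () n]
    change (if n = 1 then (- -1 : ℂ) • A.vac z else 0) = _
    rw [neg_neg, one_smul]
  have hv : ddz z ρ = -(ρ ^ 2 * ddz z (jac z w)) := by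
    have := ddz_zpow z (jac z w) (-1)
    rw [zpow_neg_one, Int.cast_neg, Int.cast_one, neg_one_smul] at this
    rw [this, sq]
  have hz : ddz w (z : X.R) = ρ := by rw [jac_inv]; rfl
  set e : X.R := X.scal (lam / 2) * (ρ * ddz z (jac z w)) with he
  have hb' : b = a + e • A.vac z := by rw [hb, dlog_eq z, smul_smul, map_smul]
  have he' : ddz z e = X.scal (lam / 2) * (ρ * ddz z (ddz z (jac z w)) -
      (ρ * ddz z (jac z w)) ^ 2) := by
    rw [he, scal_eq, ← smul_def, Derivation.map_smul_of_tower, leibniz, hv, smul_eq_mul, smul_eq_mul, smul_def]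
    ring
  have h1 : A.br δ[w,-1] a a 1 = ρ • A.br δ[z,-1] a a 1 +
      coeff 2 (invSer z w) • A.vac z := by
    have := br_inv_mul z w 1 (a := a) (b := a) (N := 2) fun n hn => by
      rw [mode, ho, if_neg (by omega)]
    rw [map_one, mul_one, map_one, mul_one, sum_range_succ, sum_range_succ, sum_range_one, coeff_invSer_zero] at this
    rw [this]
    have o0 := ho 0
    have o1 := ho 1
    rw [if_neg (by omega)] at o0
    rw [if_pos rfl] at o1
    rw [show (((1 : ℕ) : ℤ) + -1) = ((0 : ℕ) : ℤ) by simp, show (((2 : ℕ) : ℤ) + -1) = ((1 : ℕ) : ℤ) by simp, o0, o1, smul_zero,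
      add_zero]
    rfl
  have h2 : A.br δ[w,-1] a (A.vac z) 1 = ρ • a := by
    have := br_inv_mul z w 1 (a := a) (b := A.vac z) (N := 0) fun n _ => mode_vac_right_of_nonneg (by omega) ha
    rw [map_one, mul_one, map_one, mul_one, sum_range_one, coeff_invSer_zero] at this
    rw [this]
    exact congrArg _ (mode_neg_one_vac z ha)
  have h3 (b : A.carrier) : A.br δ[w,-1] (e • A.vac z) b 1 = (ρ * e) • b := by
    have := br_inv_mul z w (e ⊗ₜ 1) (a := A.vac z) (b := b) (N := 0) fun n _ => by
      rw [mode_vac, if_neg (by omega)]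
    rw [sum_range_one, tauR_tmul, map_one, mul_one, coeff_zero_eq_constantCoeff_apply, map_mul,
      ← coeff_zero_eq_constantCoeff_apply, ← coeff_zero_eq_constantCoeff_apply, coeff_invSer_zero,
      coeff_taylor, tc_zero] at this
    rw [br_left, in1_apply, this]
    refine congrArg _ ((mode_vac z (-1) b).trans (if_pos rfl))
  have h4 : b <• X.vec (ddz w) = ρ • (a <• X.vec (ddz z)) -
      (ρ * ddz z e) • A.vac z +
      (ρ ^ 2 * ddz z (jac z w)) • (a + e • A.vac z) := by
    rw [A.act_vec_eq z, hz, smul_act, hv, hb', smul_add _ a, smul_act, vac_act]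
    generalize a <• X.vec (ddz z) = x
    module
  have hu := (jac z w).mul_inv
  rw [quad, quad, h4, hb', A.br_add_left, A.br_add_right, h3, br_right, br_fn2, h1, h2, coeff_invSer_two, he', schw]
  simp only [scal_eq] at he ⊢
  clear_value e
  subst he
  generalize a <• X.vec (ddz z) = x
  generalize A.br δ[z,-1] a a 1 = y
  generalize A.vac z = o
  generalize ddz z (ddz z (jac z w)) = u'' at *
  generalize ddz z (jac z w) = u' at *
  generalize ρ = v at *
  generalize (jac z w : X.R) = u at *
  have hs (c : ℂ) (m : A.carrier) : c • m = algebraMap ℂ X.R c • m := (algebraMap_smul X.R c m).symm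
  have hk (c : ℂ) (n : ℕ) (hc : c = n * 24⁻¹) : algebraMap ℂ X.R c = n * algebraMap ℂ X.R 24⁻¹ := by
    rw [hc, map_mul, map_natCast]
  have hk1 := hk 1 24 (by norm_num)
  have hl : algebraMap ℂ X.R ((1 - 3 * lam ^ 2) / 12) = 2 * algebraMap ℂ X.R 24⁻¹ - algebraMap ℂ X.R (lam / 2) ^ 2 := by
    rw [← map_pow, ← map_ofNat (algebraMap ℂ X.R) 2, ← map_mul, ← map_sub]
    congr 1; ring
  simp only [hs, smul_def, hl, hk 2⁻¹ 12 (by norm_num), hk 4⁻¹ 6 (by norm_num), hk 6⁻¹ 4 (by norm_num),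
    hk (3 / 2) 36 (by norm_num)]
  rw [map_one] at hk1
  generalize algebraMap ℂ X.R 24⁻¹ = k at *
  generalize algebraMap ℂ X.R (lam / 2) = l at *
  push_cast at *
  match_scalars
  · linear_combination 12 * k * hu
  · linear_combination (72 * k ^ 2 * v ^ 2 * u' ^ 2 - 48 * k ^ 2 * v * u'' + 12 * k * l ^ 2 * v ^ 2 * u' ^ 2 + l ^ 2 * v * u'' -
      2 * l ^ 2 * v ^ 2 * u' ^ 2) * hu - (2 * l ^ 2 * v ^ 2 * u' ^ 2 - 2 * k * v * u'') * hk1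
  · linear_combination -l * u * v ^ 2 * u' * hk1
  · linear_combination -l * hu

theorem br_one_smul {a b : A.carrier} {N : ℕ} (hN : ∀ n : ℕ, N ≤ n → A.mode z n a b = 0) (f : X.R) :
    A.br 1 (f • a) b 1 = ∑ k ∈ range N, tc z k f • A.br δ[z,k] a b 1 := by
  rw [A.br_left, A.isPre.eq_lpair z, map_one, one_mul, mul_one, tau_in1, lpair_ofPowerSeries (N := N) _ hN]
  simp only [coeff_taylor]

end ChirAlg

theorem IsSemi.quad {X Y : Fam} {h : Hom X Y} {A : ChirAlg X} {B : ChirAlg Y} {u : A.carrier → B.carrier} (hu : IsSemi h A B u)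
    (lam : ℂ) (z : X.Coord) (a : A.carrier) : u (A.quad lam z a) = B.quad lam (h.crd z) (u a) := by
  rw [ChirAlg.quad, ChirAlg.quad, hu.sub, hu.csmul, hu.csmul, hu.vec _ _ (h.relVec_ddz z)]
  congr 2
  exact hu.mode z (-1) a a

theorem FieldSys.Env.isLie_of_modes {S : FieldSys} {L : LocalChirAlg} (E : S.Env L) {X : Fam} {z : X.Coord} {ξ : X.Th} {i : S.F.I}
    {t : (L.obj X).carrier} {p q : ℂ} (h0 : (L.obj X).br δ[z,((0 : ℕ) : ℤ)] t (E.field z i) 1 = -(E.field z i <• X.vec (ddz z)))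
    (h1 : (L.obj X).br δ[z,((1 : ℕ) : ℤ)] t (E.field z i) 1 = p • E.field z i)
    (h2 : (L.obj X).br δ[z,((2 : ℕ) : ℤ)] t (E.field z i) 1 = q • (L.obj X).vac z)
    (h3 : ∀ n : ℕ, 3 ≤ n → (L.obj X).mode z n t (E.field z i) = 0)
    (hf : E.field ((X.flow ξ).crd (X.toEps.crd z)) i = E.field (X.toEps.crd z) i +
      X.epsFn • X.toEps.fn (ddz z (ξ z)) • (1 - p) • E.field (X.toEps.crd z) i -
      X.epsFn • X.toEps.fn (ddz z (ddz z (ξ z))) • (q / 2) • (L.obj X.eps).vac (X.toEps.crd z)) :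
    L.IsLie ξ (E.field z i) (-((L.obj X).br 1 (ξ z • t) (E.field z i) 1) - E.field z i <• X.vec ξ) := by
  have e : -((L.obj X).br 1 (ξ z • t) (E.field z i) 1) - E.field z i <• X.vec ξ =
      ddz z (ξ z) • (1 - p) • E.field z i - ddz z (ddz z (ξ z)) • (q / 2) • (L.obj X).vac z := by
    rw [ChirAlg.br_one_smul h3, sum_range_succ, sum_range_succ, sum_range_one, h0, h1, h2, tc_zero, tc_one,
      tc_two, (L.obj X).act_vec_eq z ξ, smul_act, smul_assoc (2⁻¹ : ℂ), smul_comm (2⁻¹ : ℂ), smul_smul (2⁻¹ : ℂ), inv_mul_eq_div]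
    generalize E.field z i <• X.vec (ddz z) = x
    module
  rw [e, LocalChirAlg.IsLie, E.map_field, E.map_field, hf, (L.isSemi _).sub, (L.isSemi _).smul, (L.isSemi _).smul, (L.isSemi _).csmul,
    (L.isSemi _).csmul, E.map_field, (L.isSemi _).vac]
  module

/-! ### The energy-momentum tensors of the linear dilaton and of the bc-system -/

/-- The energy-momentum tensor of the linear dilaton in the Fock space. -/
def dilT (lam : ℂ) : (dilF (-1)).Fock :=
  (2⁻¹ : ℂ) • ((dilF (-1)).phi () (-1) ((dilF (-1)).cr ((), 0))) + (lam / 2) • (dilF (-1)).trans ((dilF (-1)).cr ((), 0))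

theorem md_dilT (lam : ℂ) (n : ℕ) : (dilF (-1)).md n (dilT lam) ((dilF (-1)).cr ((), 0)) =
    if n = 0 then (dilF (-1)).trans ((dilF (-1)).cr ((), 0)) else if n = 1 then (1 : ℂ) • (dilF (-1)).cr ((), 0) else
      if n = 2 then (-lam) • 1 else 0 := by
  have h := (dilF (-1)).md_phi_field () () () (-1) n
  have e : (dilF (-1)).eps = 1 := by norm_num [FieldData.eps]
  have p (m : ℕ) (x : ℤ) (hx : x = m) : (dilF (-1)).phi () x 1 = 0 := by rw [hx, phi_natCast, FieldData.an_one]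
  have p' (m : ℕ) (x : ℤ) (hx : x = m) : (dilF (-1)).phi () x ((dilF (-1)).cr ((), 0)) = if m = 1 then (1 : ℂ) • 1 else 0 := by
    rw [hx, phi_natCast, FieldData.an_field]
    change (if m = 1 then (- -1 : ℂ) • 1 else 0) = _
    rw [neg_neg]
  rw [dilT, map_add, map_smul, map_smul, LinearMap.add_apply, LinearMap.smul_apply, LinearMap.smul_apply, h, FieldData.md_trans,
    FieldData.md_cr_left, FieldData.trans_cr, e]
  match n with
  | 0 =>
    simp [sg, ← add_smul]
    norm_num
    exact ((dilF (-1)).phi_neg_two _ _).trans (mul_one _)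
  | 1 =>
    simp [sg, p' 0 0, ← add_smul]
    norm_num
    exact ((dilF (-1)).phi_neg_one _ _).trans (mul_one _)
  | 2 =>
    rw [p' 1 _ (by simp), p 0 (-1 + (2 : ℕ) - (dilF (-1)).ord) rfl, if_pos rfl, ← cast_smul_eq_zsmul ℂ]
    simp [sg]
    rw [← one_add_one_eq_two (R := (dilF (-1)).Fock), smul_add, ← add_smul, add_halves]
  | n + 3 =>
    rw [p' (n + 2) _ (by push_cast; ring), p (n + 1) (-1 + (n + 3 : ℕ) - (dilF (-1)).ord) (by
      change -1 + ((n + 3 : ℕ) : ℤ) - 1 = _; push_cast; ring)]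
    simp [sg]

/-- The energy-momentum tensor of the bc-system in the Fock space. -/
def bcT (lam : ℂ) : bcF.Fock := (2⁻¹ : ℂ) • bcF.md (-1) bcJ bcJ + (lam / 2) • bcF.trans bcJ

theorem md_bcT (lam : ℂ) (l : Bool) (n : ℕ) : bcF.md n (bcT lam) (bcF.cr (l, 0)) =
    if n = 0 then bcF.trans (bcF.cr (l, 0)) else if n = 1 then ((1 - if l then lam else -lam) / 2) • bcF.cr (l, 0) else 0 := by
  have h i j := bcF.md_phi_field i j l (-2) n
  have p (i) (m : ℕ) : bcF.phi i m 1 = 0 := by rw [phi_natCast, FieldData.an_one]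
  have p' (m : ℕ) (x : ℤ) (hx : x = m) := hx ▸ bcJ_md_field l m
  rw [bcT, map_add, map_smul, map_smul, LinearMap.add_apply, LinearMap.smul_apply, LinearMap.smul_apply, bcJ_md_neg_one, map_add,
    LinearMap.add_apply, h, h, FieldData.md_trans, FieldData.trans_cr, bcF_eps]
  match n with
  | 0 => cases l <;> simp [sg, FieldData.phi_neg_two] <;> module
  | 1 =>
    rw [p' 0 _ (by simp)]
    cases l <;> simp [sg, phi_neg_one] <;> module
  | n + 2 =>
    rw [p' (n + 1) _ (by push_cast; ring)]
    cases l <;> simp [sg, p]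

namespace DilatonAlg

variable {X : Fam} {lam Q : ℂ}

theorem field_change (A : DilatonAlg lam Q) (z w : X.Coord) :
    A.env.field w () = A.env.field z () + (A.alg.obj X).unit (X.scal (lam / 2) • dlog (jac z w)) := by
  refine (dil_apply (A.isEnvelope X).isStarMap z (secF lam w)).trans (congrArg₂ _ (one_smul _ _) (congrArg _ ?_))
  change -(X.scal _ • dlog (jac w z)) = _
  rw [← jac_inv, dlog_inv, smul_neg, neg_neg]

variable (A : DilatonAlg lam (-1))

theorem map₀_dilT (z : X.Coord) : (A.env.isFields z).map₀ (dilT lam) = (A.alg.obj X).quad lam z (A.env.field z ()) := by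
  rw [dilT, map_add, map_smul, map_smul, IsFields.map₀_phi, map₀_trans, map₀_cr, ChirAlg.quad, smul_neg,
    ← sub_eq_add_neg]

/-- The energy-momentum tensor of the linear dilaton. -/
def stress {c : ℂ} (hc : c = 1 - 3 * lam ^ 2) : A.env.Stress c where
  t z := (A.alg.obj _).quad lam z (A.env.field z ())
  even z := ChirAlg.quad_mem (dilF_par (-1) ▸ (A.env.isFields z).par ())
  map_t h z := by rw [(A.alg.isSemi h).quad, A.env.map_field]
  change z w := by rw [hc]; exact ChirAlg.quad_change (A.env.isFields z) (A.field_change z w)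
  lie {X} z ξ i := by
    have h (n : ℕ) : (A.alg.obj X).br δ[z,n] ((A.alg.obj X).quad lam z (A.env.field z ())) (A.env.field z ()) 1 = _ :=
      ((congrArg₂ (fun a b => (A.alg.obj X).mode z n a b) (A.map₀_dilT z) ((A.env.isFields z).map₀_cr ())).symm.trans
        ((A.env.isFields z).map₀_md n _ _).symm).trans (congrArg _ (md_dilT lam n))
    refine A.env.isLie_of_modes (p := 1) (q := -lam) ((h 0).trans ?_) ((h 1).trans ?_) ((h 2).trans ?_) (fun n hn => (h n).trans ?_) ?_
    · rw [if_pos rfl, map₀_trans, map₀_cr]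
    · rw [if_neg one_ne_zero, if_pos rfl, map_smul, map₀_cr]
    · rw [if_neg two_ne_zero, if_neg (by omega), if_pos rfl, map_smul, map₀_one]
    · rw [if_neg (by omega), if_neg (by omega), if_neg (by omega), map_zero]
    · have he : X.epsFn * X.toEps.fn (ddz z (ξ z)) * (X.epsFn * X.toEps.fn (ddz z (ξ z))) = 0 := by
        rw [mul_mul_mul_comm, epsFn_mul_epsFn, zero_mul]
      have h1 := jac_flow ξ z
      have h2 := inv_of_sq_zero he h1
      rw [A.field_change (X.toEps.crd z), dlog_eq (X.toEps.crd z), h1, h2, map_add, Derivation.map_one_eq_zero, zero_add, ddz_epsFn_mul,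
        ← Hom.fn_ddz, smul_smul, map_smul, sub_mul, one_mul, mul_mul_mul_comm, epsFn_mul_epsFn, zero_mul, sub_zero, scal_eq, neg_div, sub_self]
      module

end DilatonAlg

namespace BCAlg

variable {n : ℤ} (C : BCAlg n)

theorem map_cur {X Y : Fam} (h : Hom X Y) (z : X.Coord) : C.alg.map h (C.cur z) = C.cur (h.crd z) := by
  refine ((C.alg.isSemi h).mode z (-1) _ _).trans ?_
  rw [C.env.map_field, C.env.map_field]; rfl

theorem map₀_bcT {X : Fam} (z : X.Coord) (lam : ℂ) :
    (C.env.isFields z).map₀ (bcT lam) = (C.alg.obj X).quad lam z (C.cur z) := by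
  rw [bcT, map_add, map_smul, map_smul, map₀_md, map₀_trans, map₀_bcJ, ChirAlg.quad, smul_neg, ← sub_eq_add_neg]

/-- The energy-momentum tensor of the bc-system. -/
def stress {c : ℂ} (hc : c = 1 - 3 * (2 * n - 1) ^ 2) : C.env.Stress c where
  t z := (C.alg.obj _).quad (2 * n - 1) z (C.cur z)
  even z := ChirAlg.quad_mem (dilF_par (-1) ▸ (C.isFields_cur z).par ())
  map_t h z := by rw [(C.alg.isSemi h).quad, C.map_cur]
  change z w := by rw [hc]; exact ChirAlg.quad_change (C.isFields_cur z) (C.cur_change z w)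
  lie {X} z ξ i := by
    have h (m : ℕ) : (C.alg.obj X).br δ[z,m] ((C.alg.obj X).quad (2 * n - 1) z (C.cur z)) (C.env.field z i) 1 = _ :=
      ((congrArg₂ (fun a b => (C.alg.obj X).mode z m a b) (C.map₀_bcT z _) ((C.env.isFields z).map₀_cr i)).symm.trans
        ((C.env.isFields z).map₀_md m _ _).symm).trans (congrArg _ (md_bcT (2 * n - 1) i m))
    refine C.env.isLie_of_modes (p := (1 - if i then (2 * n - 1 : ℂ) else -(2 * n - 1)) / 2) (q := 0) ((h 0).trans ?_) ((h 1).trans ?_) ((h 2).trans ?_) (fun n hn => (h n).trans ?_) ?_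
    · rw [if_pos rfl, map₀_trans, map₀_cr]
    · rw [if_neg one_ne_zero, if_pos rfl, map_smul, map₀_cr]
    · rw [if_neg two_ne_zero, if_neg (by omega), map_zero, zero_smul]
    · rw [if_neg (by omega), if_neg (by omega), map_zero]
    · have he : X.epsFn * X.toEps.fn (ddz z (ξ z)) * (X.epsFn * X.toEps.fn (ddz z (ξ z))) = 0 := by
        rw [mul_mul_mul_comm, epsFn_mul_epsFn, zero_mul]
      have h1 := zpow_of_sq_zero he (jac_flow ξ z)
      cases i
      · rw [C.field_change_false (X.toEps.crd z), h1, zero_div, zero_smul, smul_zero, smul_zero, sub_zero,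
          show (1 - (1 - if false = true then (2 * n - 1 : ℂ) else -(2 * n - 1)) / 2) = ((1 - n : ℤ) : ℂ) by
            rw [if_neg Bool.false_ne_true]; push_cast; ring, cast_smul_eq_zsmul]
        module
      · rw [C.field_change_true (X.toEps.crd z), h1, zero_div, zero_smul, smul_zero, smul_zero, sub_zero,
          show (1 - (1 - if true = true then (2 * n - 1 : ℂ) else -(2 * n - 1)) / 2) = ((n : ℤ) : ℂ) by
            rw [if_pos rfl]; ring, cast_smul_eq_zsmul]
        module

end BCAlg

theorem map_stress {n : ℤ} {A : DilatonAlg (2 * n - 1) (-1)} {C : BCAlg n} {J : LocalChirHom A.alg C.alg}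
    (hJ : ∀ (X : Fam) (z : X.Coord), (J.app X).toFun (A.env.field z ()) = C.cur z) {c : ℂ} (hc : c = 1 - 3 * (2 * n - 1) ^ 2)
    {X : Fam} (s : X.Theta c) : (J.app X).toFun ((A.stress hc).iso X s).1.2 = ((C.stress hc).iso X s).1.2 := by
  change (J.app X).toFun (s.1.1 X.coord₀ • (A.alg.obj X).quad _ _ _ + (A.alg.obj X).unit _) = s.1.1 X.coord₀ • (C.alg.obj X).quad _ _ _ + _
  rw [map_add, map_fsmul, (J.app X).map_unit, (of_chirHom (J.app X)).quad, hJ]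
  rfl

/-- The pairing of the field of the linear dilaton is nondegenerate. -/
def dilF_nondeg : (dilF (-1)).Nondeg := ⟨id, 1, one_ne_zero, fun _ => neg_neg 1, fun _ _ h => (h rfl).elim⟩

/-- The pairing of the fields of the bc-system is nondegenerate. -/
def bcF_nondeg : bcF.Nondeg := ⟨not, 1, one_ne_zero, fun i => by cases i <;> rfl, fun i j h => by cases i <;> cases j <;> first | rfl | exact (h rfl).elim⟩

end Chiral

end

theorem mainTheorem6 (n : ℤ) :
    Nonempty (Chiral.DilatonAlg (2 * n - 1) (-1)) ∧ Nonempty (Chiral.BCAlg n) ∧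
    ∀ (A : Chiral.DilatonAlg (2 * n - 1) (-1)) (C : Chiral.BCAlg n),
      ∃ J : Chiral.LocalChirHom A.alg C.alg,
        (Chiral.ExtendsCurrent A C J ∧ ∀ J', Chiral.ExtendsCurrent A C J' → J' = J) ∧
        ∃ (T : Chiral.PreTensor A.alg) (Tbc : Chiral.PreTensor C.alg),
          (Chiral.IsPreTensor A.alg T ∧ ∀ T', Chiral.IsPreTensor A.alg T' → T' = T) ∧
          (Chiral.IsPreTensor C.alg Tbc ∧ ∀ T', Chiral.IsPreTensor C.alg T' → T' = Tbc) ∧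
          T.IsLocal ∧ Tbc.IsLocal ∧
          ∃ (e : ∀ X : Chiral.Fam, X.Theta (-2 * (6 * n ^ 2 - 6 * n + 1)) ≃ₗ[X.R] T.ext X)
            (ebc : ∀ X : Chiral.Fam, X.Theta (-2 * (6 * n ^ 2 - 6 * n + 1)) ≃ₗ[X.R] Tbc.ext X),
            (Chiral.IsExtIso T _ e ∧ ∀ e', Chiral.IsExtIso T _ e' → e' = e) ∧
            (Chiral.IsExtIso Tbc _ ebc ∧ ∀ e', Chiral.IsExtIso Tbc _ e' → e' = ebc) ∧
            ∀ (X : Chiral.Fam) (s : X.Theta (-2 * (6 * n ^ 2 - 6 * n + 1))),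
              (J.app X).toFun (e X s).1.2 = (ebc X s).1.2 := by
  have hc : (-2 * (6 * n ^ 2 - 6 * n + 1) : ℂ) = 1 - 3 * (2 * n - 1) ^ 2 := by ring
  refine ⟨Chiral.nonempty_dilatonAlg _ _, Chiral.nonempty_bcAlg n, fun A C => ?_⟩
  obtain ⟨J, hJ⟩ := Chiral.exists_current C A
  have _ : Fintype (Chiral.dilSys (2 * n - 1) (-1)).F.I := inferInstanceAs (Fintype Unit)
  have _ : Fintype (Chiral.bcSys n).F.I := inferInstanceAs (Fintype Bool)
  exact ⟨J, ⟨(Chiral.extendsCurrent_iff C A J).2 hJ, fun J' h =>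
      Chiral.current_unique C A hJ ((Chiral.extendsCurrent_iff C A J').1 h)⟩,
    (A.stress hc).pre, (C.stress hc).pre,
    ⟨(A.stress hc).isPreTensor, fun T' h => A.env.preTensor_unique Chiral.dilF_nondeg (A.stress hc).isPreTensor h⟩,
    ⟨(C.stress hc).isPreTensor, fun T' h => C.env.preTensor_unique Chiral.bcF_nondeg (C.stress hc).isPreTensor h⟩,
    (A.stress hc).isLocal, (C.stress hc).isLocal, (A.stress hc).iso, (C.stress hc).iso,
    ⟨(A.stress hc).isExtIso, fun e' h => (A.stress hc).iso_unique h⟩,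
    ⟨(C.stress hc).isExtIso, fun e' h => (C.stress hc).iso_unique h⟩, fun X s => Chiral.map_stress hJ hc s⟩
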